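/- **Theorem 27 (ESP to Bisection).** There is a single algorithm which, given the dictionary $D$ produced by edit-sensitive parsing (ESP) of a string $S$ of length $N\ge 2$, computes the straight line program (SLP) that the Bisection algorithm generates from $S$, in $O(m\log^2 N)$ time, where $m$ is the size (number of assignments) of that SLP. Precisely: letters are integers in $\{0,\dots,\sigma-1\}$ with $\sigma\le N^{\kappa}$ for a constant $\kappa$, and the constant in the $O$ depends only on $\kappa$. The machine is a unit-cost RAM, with all memory initially zero except for the input, with words of $w$ bits for any $w\ge c\log_2 N$ ($c$ depends only on $\kappa$). The input consists of $\sigma$, the number $n$ of rules, the start variable, and for each variable its rule together with the length of the string that the variable derives. *ESP.* One parsing step partitions a string into metablocks, each metablock into blocks of two or three symbols, and replaces each block $\beta$ by the variable $X$ with rule $X\to\beta$ (equal blocks get the same variable). Writing the string as $w_1a_1^+w_2a_2^+\cdots w_{k+1}$ with maximal repetitions $a_i^+$ (length at least 2), the metablocks are the $a_i^+$ (Type 1), the $w_i$ with $|w_i|\ge\log^*N$ (Type 2) and the shorter nonempty $w_i$ (Type 3), where a $w_i$ of length 1 is attached to an adjacent repetition, the one on its left if there is one. Type 1 and Type 3 metablocks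 are parsed left aligned, i.e. into pairs, with a last triple if the length is odd. Type 2 metablocks are parsed by the alphabet reduction of Cormode and Muthukrishnan, with $\log^*(\sigma+N)$ rounds: a block is formed around each landmark, and the ends of the metablock are parsed left aligned. The step is iterated until the string has length one; $D$ is the set of all rules made. The $n$ variables are numbered $\sigma,\dots,\sigma+n-1$ in an arbitrary order, and the alphabet reduction is applied to these numbers. *Bisection.* The variable for a string $u$ with $|u|\ge2$ has the rule $X\to YZ$, where $Y$ derives the prefix of $u$ of length $2^k$, $k$ being the largest integer with $2^k<|u|$, and $Z$ derives the rest; the variable for a letter $a$ has the rule $X\to a$. Starting from $S$ this is applied recursively, and equal strings that appear in this construction get the same variable. -/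

import Mathlib

namespace ESPBisection

/-! ### The iterated logarithm -/

/-- `tower i` is `2 ^ 2 ^ ⋯ ^ 2` with `i` twos. -/
def tower : ℕ → ℕ
  | 0 => 1
  | i + 1 => 2 ^ tower i

theorem exists_le_tower (n : ℕ) : ∃ i, n ≤ tower i := by
  refine ⟨n, ?_⟩
  induction n with
  | zero => exact Nat.zero_le _
  | succ k ih =>
    show k + 1 ≤ 2 ^ tower k
    have h : tower k < 2 ^ tower k := Nat.lt_two_pow_self
    omega

/-- `log* n`, the least `i` such that the `i`-fold iterated binary logarithm of `n` is at most `1`,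
i.e. such that `n ≤ tower i`. -/
def logStar (n : ℕ) : ℕ := Nat.find (exists_le_tower n)

/-! ### Edit-sensitive parsing

Symbols (letters and variables) are natural numbers. -/

/-- Left aligned parsing: blocks of length two, the last one of length three if the length is
odd. -/
def leftAligned : List ℕ → List (List ℕ)
  | [] => []
  | [a] => [[a]]
  | [a, b, c] => [[a, b, c]]
  | a :: b :: t => [a, b] :: leftAligned t

/-- The segments of the factorization `w₁ a₁⁺ w₂ a₂⁺ ⋯ w_{k+1}` by maximal repetitions (empty `wᵢ`
are left out). The tag is `true` for a maximal repetition `aᵢ⁺` and `false` for a `wᵢ`. -/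
def segments (S : List ℕ) : List (Bool × List ℕ) :=
  ((S.splitBy (fun a b => a == b)).splitBy
      (fun u v => u.length == 1 && v.length == 1)).map
    (fun g => (decide (2 ≤ (g.headD []).length), g.flatten))

/-- A first segment `w₁` of length one is attached to the repetition on its right. -/
def attachFirst : List (Bool × List ℕ) → List (Bool × List ℕ)
  | (false, [x]) :: (true, u) :: rest => (true, x :: u) :: rest
  | segs => segs

/-- Every other segment `wᵢ` of length one is attached to the repetition on its left. -/
def attachLeft : List (Bool × List ℕ) → List (Bool × List ℕ)
  | (true, u) :: (false, [x]) :: rest => (true, u ++ [x]) :: attachLeft rest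
  | s :: rest => s :: attachLeft rest
  | [] => []

/-- The metablocks of a string, tagged `true` if they contain a repetition (Type 1). -/
def metablocks (S : List ℕ) : List (Bool × List ℕ) := attachLeft (attachFirst (segments S))

/-- The label of the symbol `y` with left neighbour `x ≠ y`: `2 l + bit_l(y)`, where `l` is the
lowest bit position at which `x` and `y` differ. -/
def label (x y : ℕ) : ℕ :=
  let l := padicValNat 2 (x ^^^ y)
  2 * l + (y.testBit l).toNat

/-- One round of alphabet reduction; the first position gets no label. -/
def reduceRound (w : List ℕ) : List ℕ := List.zipWith label w w.tail

/-- The least element of `{0, 1, 2}` which is neither `a` nor `b`. -/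
def leastFree (a b : Option ℕ) : ℕ :=
  if a ≠ some 0 ∧ b ≠ some 0 then 0
  else if a ≠ some 1 ∧ b ≠ some 1 then 1
  else 2

/-- Replace each `c` by the least element of `{0, 1, 2}` not occurring next to it. -/
def recolor (c : ℕ) (l : List ℕ) : List ℕ :=
  l.mapIdx fun i x =>
    if x = c then leastFree (if i = 0 then none else l[i - 1]?) l[i + 1]? else x

/-- Final labels in `{0, 1, 2}` of the positions `R, R + 1, …` of `w`, after `R` rounds of alphabet
reduction followed by the elimination of the labels `3`, `4`, `5` in this order. -/
def finalLabels (R : ℕ) (w : List ℕ) : List ℕ :=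
  recolor 5 (recolor 4 (recolor 3 (reduceRound^[R] w)))

/-- Position `i` of `l` has two neighbours and carries a local maximum. -/
def isLocalMax (l : List ℕ) (i : ℕ) : Bool :=
  decide (1 ≤ i ∧ i + 1 < l.length ∧
    l.getD (i - 1) 0 < l.getD i 0 ∧ l.getD (i + 1) 0 < l.getD i 0)

/-- Position `i` of `l` has two neighbours and carries a local minimum. -/
def isLocalMin (l : List ℕ) (i : ℕ) : Bool :=
  decide (1 ≤ i ∧ i + 1 < l.length ∧
    l.getD i 0 < l.getD (i - 1) 0 ∧ l.getD i 0 < l.getD (i + 1) 0)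

/-- Landmarks: local maxima, and local minima which are not next to a local maximum. -/
def isLandmark (l : List ℕ) (i : ℕ) : Bool :=
  isLocalMax l i || (isLocalMin l i && !isLocalMax l (i - 1) && !isLocalMax l (i + 1))

/-- The positions of the landmarks of `w`, in increasing order. -/
def landmarks (R : ℕ) (w : List ℕ) : List ℕ :=
  ((List.range (finalLabels R w).length).filter (isLandmark (finalLabels R w))).map (R + ·)

/-- Positions at which a new block starts: at the first landmark `p₁`, and between two successive
landmarks so that each position goes with its nearest landmark, ties being broken to the left. -/
def cuts : List ℕ → List ℕ
  | [] => []
  | p :: ps => p :: List.zipWith (fun q q' => (q + q') / 2 + 1) (p :: ps) ps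

/-- Cut `w`, whose first symbol has position `o`, in front of the given increasing positions. -/
def cutAt : List ℕ → ℕ → List ℕ → List (List ℕ)
  | w, _, [] => [w]
  | w, o, c :: cs => w.take (c - o) :: cutAt (w.drop (c - o)) c cs

/-- Parsing of a Type 2 metablock by alphabet reduction. Successive landmarks have distance two or
three, so the inner pieces have length two or three and left aligned parsing leaves them as they
are; it splits the part in front of the first landmark, which starts with the `R` symbols without
a label, and the last piece. -/
def type2Blocks (R : ℕ) (w : List ℕ) : List (List ℕ) :=
  (cutAt w 0 (cuts (landmarks R w))).flatMap leftAligned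

/-- The partition of a string into blocks by one edit-sensitive parsing: metablocks without
repetition of length at least `L` (Type 2) are parsed by alphabet reduction with `R` rounds, those
with a repetition (Type 1) and the short ones (Type 3) by left aligned parsing. -/
def espBlocks (L R : ℕ) (S : List ℕ) : List (List ℕ) :=
  (metablocks S).flatMap fun b =>
    if b.1 = false ∧ L ≤ b.2.length then type2Blocks R b.2 else leftAligned b.2

/-- The blocks of a string `T` arising in the edit-sensitive parsing of a string of length `N` over
the alphabet `{0, …, σ - 1}`. Less than `N` variables are ever made, so all symbols can be, and
are, numbered below `σ + N`, and `log* (σ + N)` rounds bring all labels below `6`. -/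
def blocks (σ N : ℕ) (T : List ℕ) : List (List ℕ) :=
  espBlocks (logStar N) (logStar (σ + N)) T

/-- A dictionary is the list `D` of the right-hand sides of its rules: over the alphabet
`{0, …, σ - 1}` the variables are `σ, σ + 1, …`, and the rule of the variable `σ + i` is
`σ + i → D[i]`. This is the string obtained from `T` by replacing each block by its variable. -/
def espStep (σ N : ℕ) (D : List (List ℕ)) (T : List ℕ) : List ℕ :=
  (blocks σ N T).map fun b => σ + D.idxOf b

/-- The string obtained from `S` by `i` iterations of edit-sensitive parsing. -/
def espLevel (σ : ℕ) (D : List (List ℕ)) (S : List ℕ) (i : ℕ) : List ℕ :=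
  (espStep σ S.length D)^[i] S

/-- `D` is the final dictionary, with start variable `root`, of the edit-sensitive parsing of `S`,
iterated until the string has length one. Different variables have different right-hand
sides, and the right-hand sides are the blocks that occur. The numbering of the variables is
arbitrary. -/
def IsESP (σ : ℕ) (S : List ℕ) (D : List (List ℕ)) (root : ℕ) : Prop :=
  D.Nodup ∧ ∃ h : ℕ, espLevel σ D S h = [root] ∧
    (∀ i < h, 2 ≤ (espLevel σ D S i).length) ∧
    ∀ b, b ∈ D ↔ ∃ i < h, b ∈ blocks σ S.length (espLevel σ D S i)

/-- Apply the rules of `D` once to every variable of `T`. -/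
def expandOnce (σ : ℕ) (D : List (List ℕ)) (T : List ℕ) : List ℕ :=
  T.flatMap fun X => if X < σ then [X] else D.getD (X - σ) []

/-- The string over the alphabet derived from `T` by an acyclic dictionary `D`; the height of a
derivation tree is at most the number of variables. -/
def derive (σ : ℕ) (D : List (List ℕ)) (T : List ℕ) : List ℕ := (expandOnce σ D)^[D.length] T

/-! ### Straight line programs and Bisection -/

/-- The right-hand side of an assignment of a straight line program. -/
inductive SLPExpr where
  | letter (a : ℕ)
  | pair (l r : ℕ)

/-- `Val G i u`: the variable with index `i` of `G` derives the string `u`. -/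
inductive Val (G : List SLPExpr) : ℕ → List ℕ → Prop
  | letter {i a : ℕ} : G[i]? = some (SLPExpr.letter a) → Val G i [a]
  | pair {i l r : ℕ} {u v : List ℕ} :
      G[i]? = some (SLPExpr.pair l r) → Val G l u → Val G r v → Val G i (u ++ v)

/-- A straight line program is a list of assignments (counted from `0`) in which only variables
with smaller index are used. Its size is the length of the list. -/
def IsSLP (G : List SLPExpr) : Prop := ∀ i l r : ℕ, G[i]? = some (SLPExpr.pair l r) → l < i ∧ r < i

/-- The largest power of two which is smaller than `q`, for `q ≥ 2`. -/
def halfLen (q : ℕ) : ℕ := 2 ^ Nat.log 2 (q - 1)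

/-- The substrings that appear in the recursive bisection of `S`. -/
inductive BisectionSubstring (S : List ℕ) : List ℕ → Prop
  | self : BisectionSubstring S S
  | left {u : List ℕ} : BisectionSubstring S u → 2 ≤ u.length →
      BisectionSubstring S (u.take (halfLen u.length))
  | right {u : List ℕ} : BisectionSubstring S u → 2 ≤ u.length →
      BisectionSubstring S (u.drop (halfLen u.length))

/-- `G` is the straight line program that Bisection generates from `S` (it is unique up to the
order of its assignments): the last variable derives `S`, each rule splits the string of its
variable as Bisection does, equal strings have the same variable, and there are only variables for
strings that appear in the construction. -/
structure IsBisectionSLP (G : List SLPExpr) (S : List ℕ) : Prop where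
  isSLP : IsSLP G
  represents : Val G (G.length - 1) S
  splits : ∀ (i l r : ℕ) (u v : List ℕ), G[i]? = some (SLPExpr.pair l r) → Val G l u → Val G r v →
    u.length = halfLen (u ++ v).length
  shared : ∀ (i j : ℕ) (u : List ℕ), Val G i u → Val G j u → i = j
  needed : ∀ (i : ℕ) (u : List ℕ), Val G i u → BisectionSubstring S u

/-! ### The machine model: structured programs on a unit-cost RAM with words of `w` bits -/

/-- Binary machine operations. -/
inductive Op where
  | add | sub | mul | div | mod | lt | eq

/-- Operations on words of `w` bits: addition and multiplication modulo `2 ^ w`, truncated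
subtraction, division with remainder, comparisons with value `0` or `1`. -/
def Op.eval (w : ℕ) : Op → ℕ → ℕ → ℕ
  | .add, x, y => (x + y) % 2 ^ w
  | .sub, x, y => x - y
  | .mul, x, y => (x * y) % 2 ^ w
  | .div, x, y => x / y
  | .mod, x, y => x % y
  | .lt, x, y => if x < y then 1 else 0
  | .eq, x, y => if x = y then 1 else 0

/-- Expressions: constants, registers, memory cells, operations. -/
inductive Expr where
  | const (k : ℕ)
  | reg (i : ℕ)
  | load (addr : Expr)
  | bin (op : Op) (e f : Expr)

/-- A machine state: the contents of the registers and of the memory cells. -/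
structure State where
  reg : ℕ → ℕ
  mem : ℕ → ℕ

def Expr.eval (w : ℕ) (s : State) : Expr → ℕ
  | .const k => k % 2 ^ w
  | .reg i => s.reg i
  | .load a => s.mem (a.eval w s)
  | .bin op e f => op.eval w (e.eval w s) (f.eval w s)

/-- The evaluation of an expression takes one step for each of its nodes. -/
def Expr.cost : Expr → ℕ
  | .const _ => 1
  | .reg _ => 1
  | .load a => a.cost + 1
  | .bin _ e f => e.cost + f.cost + 1

/-- Programs. -/
inductive Prog where
  | skip
  | assign (i : ℕ) (e : Expr)
  | store (addr e : Expr)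
  | seq (p q : Prog)
  | ite (e : Expr) (p q : Prog)
  | loop (e : Expr) (p : Prog)

/-- `Exec w p s t s'`: with words of `w` bits, the program `p` started in the state `s` halts after
exactly `t` steps in the state `s'`. -/
inductive Exec (w : ℕ) : Prog → State → ℕ → State → Prop
  | skip (s : State) : Exec w .skip s 1 s
  | assign (s : State) (i : ℕ) (e : Expr) :
      Exec w (.assign i e) s (e.cost + 1) { s with reg := Function.update s.reg i (e.eval w s) }
  | store (s : State) (a e : Expr) :
      Exec w (.store a e) s (a.cost + e.cost + 1)
        { s with mem := Function.update s.mem (a.eval w s) (e.eval w s) }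
  | seq {p q : Prog} {s s₁ s₂ : State} {t₁ t₂ : ℕ} :
      Exec w p s t₁ s₁ → Exec w q s₁ t₂ s₂ → Exec w (.seq p q) s (t₁ + t₂) s₂
  | ite_true {e : Expr} {p q : Prog} {s s₁ : State} {t : ℕ} :
      e.eval w s ≠ 0 → Exec w p s t s₁ → Exec w (.ite e p q) s (e.cost + 1 + t) s₁
  | ite_false {e : Expr} {p q : Prog} {s s₁ : State} {t : ℕ} :
      e.eval w s = 0 → Exec w q s t s₁ → Exec w (.ite e p q) s (e.cost + 1 + t) s₁
  | loop_true {e : Expr} {p : Prog} {s s₁ s₂ : State} {t₁ t₂ : ℕ} :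
      e.eval w s ≠ 0 → Exec w p s t₁ s₁ → Exec w (.loop e p) s₁ t₂ s₂ →
      Exec w (.loop e p) s (e.cost + 1 + t₁ + t₂) s₂
  | loop_false {e : Expr} {p : Prog} {s : State} :
      e.eval w s = 0 → Exec w (.loop e p) s (e.cost + 1) s

/-! ### Input and output -/

/-- The five words for the rule with right-hand side `b`: the length of `b`, its two or three
symbols (padded by `0`), and the length of the string that its variable derives. -/
def ruleWords (σ : ℕ) (D : List (List ℕ)) (b : List ℕ) : List ℕ :=
  [b.length, b.getD 0 0, b.getD 1 0, b.getD 2 0, (derive σ D b).length]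

/-- The start state: registers `0`, `1`, `2` hold the alphabet size, the number of rules and the
start variable, the memory holds the rules one after the other from address `0` on, and everything
else is `0`. -/
def inputState (σ : ℕ) (D : List (List ℕ)) (root : ℕ) : State where
  reg i := [σ, D.length, root].getD i 0
  mem a := (D.flatMap (ruleWords σ D)).getD a 0

/-- The three words for an assignment of a straight line program. -/
def SLPExpr.words : SLPExpr → List ℕ
  | .letter a => [0, a, 0]
  | .pair l r => [1, l, r]

/-- In the state `s` the straight line program `G` is written in memory: register `0` holds its
size, register `1` its address. -/
def IsOutput (s : State) (G : List SLPExpr) : Prop :=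
  s.reg 0 = G.length ∧
    ∀ k < 3 * G.length, s.mem (s.reg 1 + k) = (G.flatMap SLPExpr.words).getD k 0

end ESPBisection

namespace ESPBisection

/-! ### Cut positions of a list of blocks -/

/-! The SLP of Bisection has one variable for each distinct string in the recursion tree of `S`. The
algorithm descends this tree and computes for every interval that it meets a canonical key. A table
indexed by keys tells whether the same string has been met before. If so, the known variable is
returned and nothing below is visited; otherwise the two halves are treated and one assignment is
written. Each of the `m` assignments causes at most two further visits, so it suffices to compute
one key in time `O(log² N)`.

Keys come from the local consistency of ESP. Whether a block starts at a position depends only on a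
window of `O(log* N)` symbols around it, except inside a long repetition, which is cut into pairs
from its start, so that the parity of a cut may be inherited from far away on the left. On each
level of the parse, the key step therefore removes from the interval `M` symbols on the right, `M`
symbols on the left, and the run that continues the last symbol removed on the left. The change of
symbol behind that run is the anchor that `espBlocks_isCut_congr` requires, so the boundaries of the
next level inside the remaining part are functions of the interval alone. The symbols in front of
the first and behind the last such boundary are removed as well, and the rest is lifted by one
level. The removed symbols, with the run coded by its symbol and length, form two words. They spell
the string (`Parse.eq_of_keyOf`), and equal strings have equal words (`Parse.keyOf_unique`).

For the time, the height `h` is at most `log₂ N`, and `M` is a multiple of the logarithm, which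
exceeds the required `O(log*)`. An interval is held as a covering by maximal nodes of the parse
tree, which has at most `6 h + 1` members (`Parse.dq_size`). Only the run needs care, since it may
be long: the nodes over a run of `a` are, up to two per level at its end, the symbols with rules `X₁
→ a a`, `X₂ → X₁ X₁`, and so on (`Parse.run_nodes`). These symbols are recognised as they appear,
and `O(h)` expansions suffice to pass the run (`Parse.exists_skip`). So one level costs `O(M + h)`
and a key costs `O(log² N)`.

A word is turned into a number by a trie. An edge is stored at the address given by an injective
quadratic code of a node number and a letter, so neither hashing nor initialisation is needed,
because the memory starts with zeros. Numbers are bounded by the elapsed time, which is polynomial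
in `N`, so words of `c log N` bits suffice.

The time and the correctness of the program are derived together by weakest preconditions which may
speak about the time. The induction over the recursion tree is `wp_mainLoop_call`. -/

/-- The position `x` is a boundary between two blocks (or an end) of `Bs`. -/
def IsCut (Bs : List (List ℕ)) (x : ℕ) : Prop :=
  ∃ l₁ l₂, Bs = l₁ ++ l₂ ∧ l₁.flatten.length = x

theorem isCut_zero (Bs : List (List ℕ)) : IsCut Bs 0 := ⟨[], Bs, rfl, rfl⟩

theorem isCut_length (Bs : List (List ℕ)) : IsCut Bs Bs.flatten.length := ⟨Bs, [], by simp, rfl⟩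

theorem IsCut.le {Bs : List (List ℕ)} {x : ℕ} (h : IsCut Bs x) : x ≤ Bs.flatten.length := by
  obtain ⟨l₁, l₂, rfl, rfl⟩ := h
  simp only [List.flatten_append, List.length_append]
  omega

theorem isCut_nil {x : ℕ} : IsCut [] x ↔ x = 0 := by
  constructor
  · intro h; simpa using h.le
  · rintro rfl; exact isCut_zero _

theorem isCut_append {A B : List (List ℕ)} {x : ℕ} :
    IsCut (A ++ B) x ↔ IsCut A x ∨ ∃ y, IsCut B y ∧ x = A.flatten.length + y := by
  constructor
  · rintro ⟨l₁, l₂, h, rfl⟩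
    rcases List.append_eq_append_iff.1 h with ⟨c, rfl, rfl⟩ | ⟨c, rfl, rfl⟩
    · exact Or.inr ⟨c.flatten.length, ⟨c, l₂, rfl, rfl⟩, by simp⟩
    · exact Or.inl ⟨l₁, c, rfl, rfl⟩
  · rintro (⟨l₁, l₂, rfl, rfl⟩ | ⟨y, ⟨l₁, l₂, rfl, rfl⟩, rfl⟩)
    · exact ⟨l₁, l₂ ++ B, by simp, rfl⟩
    · exact ⟨A ++ l₁, l₂, by simp, by simp⟩

theorem isCut_append_of_le {A B : List (List ℕ)} {x : ℕ} (hx : x ≤ A.flatten.length) :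
    IsCut (A ++ B) x ↔ IsCut A x := by
  rw [isCut_append]
  constructor
  · rintro (h | ⟨y, _, rfl⟩)
    · exact h
    · have : y = 0 := by omega
      subst this
      exact isCut_length A
  · exact Or.inl

theorem isCut_append_of_ge {A B : List (List ℕ)} {x : ℕ} (hx : A.flatten.length ≤ x) :
    IsCut (A ++ B) x ↔ IsCut B (x - A.flatten.length) := by
  rw [isCut_append]
  constructor
  · rintro (h | ⟨y, h, rfl⟩)
    · have : x - A.flatten.length = 0 := by have := h.le; omega
      rw [this]; exact isCut_zero B
    · simpa using h
  · intro h
    exact Or.inr ⟨_, h, by omega⟩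

theorem isCut_cons {b : List ℕ} {B : List (List ℕ)} {x : ℕ} :
    IsCut (b :: B) x ↔ x = 0 ∨ ∃ y, IsCut B y ∧ x = b.length + y := by
  have h := isCut_append (A := [b]) (B := B) (x := x)
  rw [List.singleton_append] at h
  rw [h]
  constructor
  · clear h
    rintro (⟨l₁, l₂, h, rfl⟩ | ⟨y, hy, rfl⟩)
    · rcases l₁ with _ | ⟨c, l₁⟩
      · exact Or.inl rfl
      · rw [List.cons_append, List.cons.injEq, eq_comm (a := []), List.append_eq_nil_iff] at h
        obtain ⟨rfl, rfl, rfl⟩ := h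
        exact Or.inr ⟨0, isCut_zero _, by simp⟩
    · exact Or.inr ⟨y, hy, by simp⟩
  · rintro (rfl | ⟨y, hy, rfl⟩)
    · exact Or.inl (isCut_zero _)
    · exact Or.inr ⟨y, hy, by simp⟩

/-- Blocks are determined by their concatenation and their cut positions. -/
theorem eq_of_isCut_iff : ∀ {A B : List (List ℕ)}, (∀ b ∈ A, b ≠ []) → (∀ b ∈ B, b ≠ []) →
    A.flatten = B.flatten → (∀ x, IsCut A x ↔ IsCut B x) → A = B
  | [], [], _, _, _, _ => rfl
  | [], b :: B, _, hB, h, _ => by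
    have := hB b (by simp)
    simp only [List.flatten_nil, List.flatten_cons, List.nil_eq, List.append_eq_nil_iff] at h
    exact absurd h.1 this
  | a :: A, [], hA, _, h, _ => by
    have := hA a (by simp)
    simp only [List.flatten_nil, List.flatten_cons, List.append_eq_nil_iff] at h
    exact absurd h.1 this
  | a :: A, b :: B, hA, hB, h, hx => by
    have ha : 0 < a.length := List.length_pos_iff.2 (hA a (by simp))
    have hb : 0 < b.length := List.length_pos_iff.2 (hB b (by simp))
    -- The end of each first block is a cut of the other list, and the first positive cut of a list
    -- is the end of its first block. So both first blocks have the same length.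
    have h1 := (hx a.length).1 (isCut_cons.2 (Or.inr ⟨0, isCut_zero _, by simp⟩))
    have h2 := (hx b.length).2 (isCut_cons.2 (Or.inr ⟨0, isCut_zero _, by simp⟩))
    have hl : a.length = b.length := by
      rw [isCut_cons] at h1 h2
      rcases h1 with h1 | ⟨y, -, h1⟩
      · omega
      · rcases h2 with h2 | ⟨z, -, h2⟩ <;> omega
    simp only [List.flatten_cons] at h
    obtain ⟨rfl, h'⟩ := List.append_inj h hl
    congr 1
    refine eq_of_isCut_iff (fun c hc => hA c (by simp [hc])) (fun c hc => hB c (by simp [hc])) h' ?_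
    intro x
    have := hx (a.length + x)
    simp only [isCut_cons] at this
    constructor
    · intro h
      rcases this.1 (Or.inr ⟨x, h, rfl⟩) with h | ⟨y, hy, h⟩
      · omega
      · obtain rfl : x = y := by omega
        exact hy
    · intro h
      rcases this.2 (Or.inr ⟨x, h, rfl⟩) with h | ⟨y, hy, h⟩
      · omega
      · obtain rfl : x = y := by omega
        exact hy

/-! ### Left aligned parsing -/

/-- The cut positions of the left aligned parsing of a string of length `l`. -/
def LACut (l x : ℕ) : Prop := x = 0 ∨ x = l ∨ (x % 2 = 0 ∧ x + 2 ≤ l)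

theorem flatten_leftAligned (u : List ℕ) : (leftAligned u).flatten = u := by
  induction u using leftAligned.induct with
  | case1 => rfl
  | case2 a => rfl
  | case3 a b c => rfl
  | case4 a b t h ih =>
    rw [leftAligned, List.flatten_cons, ih]
    · rfl
    · exact h

theorem isCut_leftAligned (u : List ℕ) (x : ℕ) : IsCut (leftAligned u) x ↔ LACut u.length x := by
  induction u using leftAligned.induct generalizing x with
  | case1 => simp [leftAligned, isCut_nil, LACut]
  | case2 a => simp [leftAligned, isCut_cons, isCut_nil, LACut]
  | case3 a b c =>
    simp only [leftAligned, isCut_cons, isCut_nil, LACut, List.length_cons, List.length_nil,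
      exists_eq_left]
    omega
  | case4 a b t h ih =>
    have ht : t.length ≠ 1 := by
      intro h1
      obtain ⟨c, rfl⟩ := List.length_eq_one_iff.1 h1
      exact h c rfl
    rw [leftAligned]
    · simp only [isCut_cons, ih, LACut, List.length_cons, List.length_nil]
      constructor
      · rintro (h | ⟨y, h, rfl⟩) <;> omega
      · intro h
        by_cases h0 : x = 0
        · exact Or.inl h0
        · exact Or.inr ⟨x - 2, by omega, by omega⟩
    · exact h

theorem length_of_mem_leftAligned {u b : List ℕ} (hu : 2 ≤ u.length) (hb : b ∈ leftAligned u) :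
    b.length = 2 ∨ b.length = 3 := by
  induction u using leftAligned.induct with
  | case1 => simp at hu
  | case2 a => simp at hu
  | case3 a c d => simp [leftAligned] at hb; simp [hb]
  | case4 a c t h ih =>
    rw [leftAligned] at hb
    · rcases List.mem_cons.1 hb with rfl | hb
      · simp
      · rcases t with _ | ⟨x, _ | ⟨y, t⟩⟩
        · simp [leftAligned] at hb
        · exact absurd rfl (h x)
        · exact ih (by simp) hb
    · exact h

/-! ### Segments and metablocks -/

/-- No two adjacent symbols are equal. -/
abbrev RunFree (w : List ℕ) : Prop := w.IsChain (· ≠ ·)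

theorem flatten_map_singletons (w : List ℕ) : (w.map fun a => [a]).flatten = w := by
  induction w with
  | nil => rfl
  | cons a w ih => rw [List.map_cons, List.flatten_cons, ih]; rfl

theorem splitBy_eq_singletons {w : List ℕ} (h : RunFree w) :
    w.splitBy (fun a b => a == b) = w.map fun a => [a] := by
  rw [List.splitBy_eq_iff]
  refine ⟨(flatten_map_singletons w).symm, by simp, by simp, ?_⟩
  rw [List.isChain_map]
  exact h.imp (by simp)

theorem segments_runFree {w : List ℕ} (h : RunFree w) (hw : w ≠ []) :
    segments w = [(false, w)] := by
  unfold segments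
  rw [splitBy_eq_singletons h, List.splitBy_of_isChain]
  · have := flatten_map_singletons w
    rcases w with _ | ⟨a, w⟩
    · exact absurd rfl hw
    · rw [List.map_singleton, this]
      simp
  · simpa using hw
  · rw [List.isChain_map]
    exact h.imp (by simp)

theorem exists_run_prefix (b : ℕ) (B : List ℕ) :
    ∃ k B', b :: B = List.replicate (k + 1) b ++ B' ∧ ∀ x ∈ B'.head?, b ≠ x := by
  induction B with
  | nil => exact ⟨0, [], by simp, by simp⟩
  | cons c B ih =>
    by_cases h : b = c
    · subst h
      obtain ⟨k, B', h1, h2⟩ := ih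
      exact ⟨k + 1, B', by rw [h1, List.replicate_succ (n := k + 1)]; rfl, h2⟩
    · exact ⟨0, c :: B, by simp, by simpa using h⟩

theorem splitBy_replicate (k a : ℕ) :
    (List.replicate (k + 1) a).splitBy (fun a b => a == b) = [List.replicate (k + 1) a] := by
  apply List.splitBy_of_isChain
  · simp
  · exact List.isChain_replicate_of_rel _ (by simp)

theorem splitBy_run_prefix {k b : ℕ} {B' : List ℕ} (h : ∀ x ∈ B'.head?, b ≠ x) :
    (List.replicate (k + 1) b ++ B').splitBy (fun a b => a == b) =
      List.replicate (k + 1) b :: B'.splitBy (fun a b => a == b) := by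
  rw [List.splitBy_append, splitBy_replicate]
  · rfl
  · intro x hx y hy
    simp only [List.getLast?_replicate] at hx
    simp at hx
    subst hx
    simpa using h y hy

theorem segments_run_prefix {k b : ℕ} {B' : List ℕ} (hk : 1 ≤ k) (h : ∀ x ∈ B'.head?, b ≠ x) :
    segments (List.replicate (k + 1) b ++ B') =
      (true, List.replicate (k + 1) b) :: segments B' := by
  unfold segments
  rw [splitBy_run_prefix h, ← List.singleton_append, List.splitBy_append]
  · rw [List.splitBy_of_isChain (by simp) (by simp)]
    simp only [List.singleton_append, List.map_cons, List.headD_cons, List.length_replicate,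
      List.flatten_singleton, List.cons.injEq, Prod.mk.injEq, and_true, decide_eq_true_eq]
    omega
  · intro x hx y hy
    simp at hx
    subst hx
    simp
    omega

theorem head_splitBy_length {b : ℕ} {B : List ℕ} :
    ∀ v ∈ ((b :: b :: B).splitBy (fun a b => a == b)).head?, 2 ≤ v.length := by
  obtain ⟨k, B', h1, h2⟩ := exists_run_prefix b B
  have : b :: b :: B = List.replicate (k + 1 + 1) b ++ B' := by
    rw [h1, List.replicate_succ (n := k + 1)]; rfl
  rw [this, splitBy_run_prefix h2]
  simp

theorem getLast_splitBy_length {a : ℕ} {A : List ℕ} :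
    ∀ v ∈ ((A ++ [a, a]).splitBy (fun a b => a == b)).getLast?, 2 ≤ v.length := by
  obtain ⟨k, B', h1, h2⟩ := exists_run_prefix a A.reverse
  have : A ++ [a, a] = B'.reverse ++ List.replicate (k + 1 + 1) a := by
    have h3 : (a :: a :: A.reverse).reverse = (List.replicate (k + 1 + 1) a ++ B').reverse := by
      rw [h1, List.replicate_succ (n := k + 1)]; rfl
    simpa using h3
  rw [this, List.splitBy_append, splitBy_replicate]
  · simp
  · intro x hx y hy
    rw [List.getLast?_reverse] at hx
    simp [List.head?_replicate] at hy
    subst hy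
    simpa using (h2 x hx).symm

/-- Different symbols at the seam separate the runs. The second grouping joins only adjacent runs of
length one, and by `h` one of the two runs at the seam is longer, so no segment crosses it. -/
theorem segments_append {A B : List ℕ} (hAB : ∀ x ∈ A.getLast?, ∀ y ∈ B.head?, x ≠ y)
    (h : (∃ b B', B = b :: b :: B') ∨ ∃ a A', A = A' ++ [a, a]) :
    segments (A ++ B) = segments A ++ segments B := by
  unfold segments
  rw [List.splitBy_append (by simpa using hAB), List.splitBy_append, List.map_append]
  intro u hu v hv
  rcases h with ⟨b, B', rfl⟩ | ⟨a, A', rfl⟩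
  · have := head_splitBy_length v hv
    simp; omega
  · have := getLast_splitBy_length u hu
    simp; omega

theorem flatten_segments (S : List ℕ) : ((segments S).map Prod.snd).flatten = S := by
  unfold segments
  rw [List.map_map]
  have : (Prod.snd ∘ fun g : List (List ℕ) => (decide (2 ≤ (g.headD []).length), g.flatten)) =
      List.flatten := rfl
  rw [this, ← List.flatten_flatten, List.flatten_splitBy, List.flatten_splitBy]

/-- The only interaction across the seam is that a leading lone symbol of `t` is absorbed by a
repetition at the end of `s`. -/
theorem attachLeft_append (s t : List (Bool × List ℕ)) (ht : ∀ x r, t ≠ (false, [x]) :: r) :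
    attachLeft (s ++ t) = attachLeft s ++ attachLeft t := by
  induction s using attachLeft.induct with
  | case1 u x rest ih => simp [attachLeft, ih]
  | case2 s rest h ih =>
    rw [List.cons_append, attachLeft, attachLeft, ih, List.cons_append]
    · intro u x r h1 h2
      exact h u x r h1 h2
    · intro u x r h1 h2
      rcases rest with _ | ⟨c, rest⟩
      · exact ht x r (by simpa using h2)
      · simp only [List.cons_append, List.cons.injEq] at h2
        exact h u x rest h1 (by rw [h2.1])
  | case3 => simp [attachLeft]

/-- Only a lone symbol that makes up all of `s` could be attached to something behind the seam. -/
theorem attachFirst_append {s t : List (Bool × List ℕ)} (hs : s ≠ []) (h : ∀ x, s ≠ [(false, [x])]) :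
    attachFirst (s ++ t) = attachFirst s ++ t := by
  match s, hs, h with
  | [(false, [x])], _, h => exact absurd rfl (h x)
  | (false, [x]) :: (true, u) :: rest, _, _ => rfl
  | (false, [x]) :: (false, u) :: rest, _, _ => rfl
  | (true, u) :: rest, _, _ => rfl
  | (false, []) :: rest, _, _ => rfl
  | (false, x :: y :: u) :: rest, _, _ => rfl

theorem attachFirst_eq {s : List (Bool × List ℕ)} (h : ∀ x r, s ≠ (false, [x]) :: r) :
    attachFirst s = s := by
  match s, h with
  | [], _ => rfl
  | (false, [x]) :: r, h => exact absurd rfl (h x r)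
  | (true, u) :: rest, _ => rfl
  | (false, []) :: rest, _ => rfl
  | (false, x :: y :: u) :: rest, _ => rfl

/-- Two symbols in `A` exclude that its segments are empty or a single lone symbol. Hence
`attachFirst` does not look across the seam, and `hB` keeps `attachLeft` from doing so. -/
theorem metablocks_append_aux {A B : List ℕ} (hA : 2 ≤ A.length)
    (hs : segments (A ++ B) = segments A ++ segments B)
    (hB : ∀ x r, segments B ≠ (false, [x]) :: r) :
    metablocks (A ++ B) = metablocks A ++ metablocks B := by
  unfold metablocks
  rw [hs, attachFirst_append, attachLeft_append _ _ hB, attachFirst_eq hB]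
  · intro h
    have := flatten_segments A
    rw [h] at this
    simp at this
    subst this
    simp at hA
  · intro x h
    have := flatten_segments A
    rw [h] at this
    simp at this
    subst this
    simp at hA

/-- `T = A ++ B` may be parsed separately because `B` starts with a repetition. -/
theorem metablocks_append_run {A : List ℕ} {b : ℕ} {B : List ℕ} (hA : 2 ≤ A.length)
    (hAB : ∀ x ∈ A.getLast?, x ≠ b) :
    metablocks (A ++ b :: b :: B) = metablocks A ++ metablocks (b :: b :: B) := by
  apply metablocks_append_aux hA
  · exact segments_append (by simpa using hAB) (Or.inl ⟨b, B, rfl⟩)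
  · obtain ⟨k, B', h1, h2⟩ := exists_run_prefix b B
    have : b :: b :: B = List.replicate (k + 1 + 1) b ++ B' := by
      rw [h1, List.replicate_succ (n := k + 1)]; rfl
    rw [this, segments_run_prefix (by omega) h2]
    simp

/-- Every nonempty string is a run-free string followed by nothing or a repetition. -/
theorem exists_runFree_prefix (B : List ℕ) :
    ∃ w B', B = w ++ B' ∧ RunFree w ∧
      (B' = [] ∨ ∃ b B'', B' = b :: b :: B'' ∧ ∀ x ∈ w.getLast?, x ≠ b) := by
  induction B with
  | nil => exact ⟨[], [], rfl, by simp, Or.inl rfl⟩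
  | cons c B ih =>
    obtain ⟨w, B', rfl, hw, hB⟩ := ih
    rcases w with _ | ⟨d, w⟩
    · rcases hB with rfl | ⟨b, B'', rfl, -⟩
      · exact ⟨[c], [], rfl, by simp, Or.inl rfl⟩
      · by_cases h : c = b
        · subst h
          exact ⟨[], c :: c :: c :: B'', rfl, by simp, Or.inr ⟨c, c :: B'', rfl, by simp⟩⟩
        · exact ⟨[c], b :: b :: B'', rfl, by simp, Or.inr ⟨b, B'', rfl, by simpa using h⟩⟩
    · by_cases h : c = d
      · subst h
        exact ⟨[], c :: c :: (w ++ B'), rfl, by simp, Or.inr ⟨c, _, rfl, by simp⟩⟩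
      · refine ⟨c :: d :: w, B', rfl, ?_, ?_⟩
        · exact List.isChain_cons_cons.2 ⟨h, hw⟩
        · rcases hB with rfl | ⟨b, B'', rfl, hb⟩
          · exact Or.inl rfl
          · refine Or.inr ⟨b, B'', rfl, ?_⟩
            simpa [List.getLast?_cons_cons] using hb

/-- `T = A ++ B` may be parsed separately because `A` ends with a repetition and `B` starts with a
run-free segment of length at least two. -/
theorem metablocks_append_segment {A : List ℕ} {a b c : ℕ} {B : List ℕ}
    (hab : a ≠ b) (hbc : b ≠ c) (hc : ∀ x ∈ B.head?, c ≠ x) :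
    metablocks ((A ++ [a, a]) ++ b :: c :: B) = metablocks (A ++ [a, a]) ++ metablocks (b :: c :: B) := by
  apply metablocks_append_aux (by simp)
  · refine segments_append (by simpa using hab) (Or.inr ⟨a, A, rfl⟩)
  · obtain ⟨w, B', h1, hw, hB'⟩ := exists_runFree_prefix (b :: c :: B)
    -- The run-free prefix has at least two symbols: it is not empty because `b ≠ c`, and not a
    -- single symbol because otherwise `c` would start a repetition, against `hc`. So nothing is
    -- attached to the left.
    rcases w with _ | ⟨d, _ | ⟨e, w⟩⟩
    · rcases hB' with rfl | ⟨f, B'', rfl, -⟩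
      · simp at h1
      · simp at h1
        exact absurd (h1.1.trans h1.2.1.symm) hbc
    · rcases hB' with rfl | ⟨f, B'', rfl, -⟩
      · simp at h1
      · simp at h1
        obtain ⟨-, rfl, rfl⟩ := h1
        simp at hc
    · rw [h1]
      rcases hB' with rfl | ⟨f, B'', rfl, hf⟩
      · rw [List.append_nil, segments_runFree hw (by simp)]
        simp
      · rw [segments_append (by simpa using hf) (Or.inl ⟨f, B'', rfl⟩),
          segments_runFree hw (by simp)]
        simp

/-! ### Alphabet reduction -/

theorem testBit_padicValNat {n : ℕ} (hn : n ≠ 0) : n.testBit (padicValNat 2 n) = true := by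
  have h1 : 2 ^ padicValNat 2 n ∣ n := pow_padicValNat_dvd
  have h2 : ¬ 2 ^ (padicValNat 2 n + 1) ∣ n := pow_succ_padicValNat_not_dvd hn
  obtain ⟨m, hm⟩ := h1
  rw [Nat.testBit_eq_decide_div_mod_eq, decide_eq_true_eq]
  have h3 : n / 2 ^ padicValNat 2 n = m := by
    exact Nat.div_eq_of_eq_mul_right (by positivity) hm
  rw [h3]
  by_contra h4
  apply h2
  obtain ⟨r, hr⟩ : 2 ∣ m := by omega
  exact ⟨r, by rw [pow_succ, mul_assoc, ← hr, ← hm]⟩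

theorem testBit_ne_of_label {x y : ℕ} (h : x ≠ y) :
    x.testBit (padicValNat 2 (x ^^^ y)) ≠ y.testBit (padicValNat 2 (x ^^^ y)) := by
  have := testBit_padicValNat (n := x ^^^ y) (by simpa [Nat.xor_eq_zero_iff] using h)
  rw [Nat.testBit_xor] at this
  intro h2
  rw [h2] at this
  simp at this

/-- Equal labels would give the same position `l` and the same bit. But for the second label `l` is
a position at which `y` and `z` differ, while the two labels contain exactly these bits of `y` and
`z`. -/
theorem label_ne {x y z : ℕ} (hyz : y ≠ z) : label x y ≠ label y z := by
  intro h
  unfold label at h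
  simp only at h
  have h1 := Bool.toNat_lt (y.testBit (padicValNat 2 (x ^^^ y)))
  have h2 := Bool.toNat_lt (z.testBit (padicValNat 2 (y ^^^ z)))
  have h3 : padicValNat 2 (x ^^^ y) = padicValNat 2 (y ^^^ z) := by omega
  have h4 := testBit_ne_of_label hyz
  rw [h3] at h
  have h5 : (y.testBit (padicValNat 2 (y ^^^ z))).toNat =
    (z.testBit (padicValNat 2 (y ^^^ z))).toNat := by omega
  revert h4 h5
  cases y.testBit (padicValNat 2 (y ^^^ z)) <;> cases z.testBit (padicValNat 2 (y ^^^ z)) <;> simp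

theorem label_lt {x y b : ℕ} (h : x ≠ y) (hx : x < 2 ^ b) (hy : y < 2 ^ b) :
    label x y < 2 * b := by
  have h1 := testBit_padicValNat (n := x ^^^ y) (by simpa [Nat.xor_eq_zero_iff] using h)
  have h2 : x ^^^ y < 2 ^ b := Nat.xor_lt_two_pow hx hy
  have h3 : padicValNat 2 (x ^^^ y) < b := by
    by_contra h3
    have h5 := Nat.testBit_lt_two_pow (lt_of_lt_of_le h2 (Nat.pow_le_pow_right (by norm_num) (not_lt.1 h3)))
    rw [h5] at h1
    cases h1
  unfold label
  have := Bool.toNat_lt (y.testBit (padicValNat 2 (x ^^^ y)))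
  simp only
  omega

theorem runFree_iff {l : List ℕ} :
    RunFree l ↔ ∀ i a b, l[i]? = some a → l[i + 1]? = some b → a ≠ b := by
  rw [RunFree, List.isChain_iff_getElem]
  constructor
  · intro h i a b ha hb
    obtain ⟨h1, rfl⟩ := List.getElem?_eq_some_iff.1 ha
    obtain ⟨h2, rfl⟩ := List.getElem?_eq_some_iff.1 hb
    exact h i h2
  · intro h i hi
    exact h i _ _ (List.getElem?_eq_getElem (by omega)) (List.getElem?_eq_getElem hi)

theorem getElem?_reduceRound (w : List ℕ) (i : ℕ) :
    (reduceRound w)[i]? = (w[i]?).bind fun x => (w[i + 1]?).map fun y => label x y := by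
  unfold reduceRound
  rw [List.getElem?_zipWith, List.getElem?_tail]
  cases w[i]? <;> cases w[i + 1]? <;> rfl

theorem length_reduceRound (w : List ℕ) : (reduceRound w).length = w.length - 1 := by
  simp [reduceRound]

theorem length_reduceRound_iterate (R : ℕ) (w : List ℕ) :
    (reduceRound^[R] w).length = w.length - R := by
  induction R generalizing w with
  | zero => rfl
  | succ R ih => rw [Function.iterate_succ_apply, ih, length_reduceRound]; omega

theorem runFree_reduceRound {w : List ℕ} (h : RunFree w) : RunFree (reduceRound w) := by
  rw [runFree_iff] at h ⊢
  intro i a b ha hb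
  rw [getElem?_reduceRound] at ha hb
  simp only [Option.bind_eq_some_iff, Option.map_eq_some_iff] at ha hb
  obtain ⟨x, hx, y, hy, rfl⟩ := ha
  obtain ⟨y', hy', z, hz, rfl⟩ := hb
  rw [hy] at hy'
  cases hy'
  exact label_ne (h _ _ _ hy hz)

/-- The bounds for the labels, in terms of the number of remaining rounds. -/
def labelBound : ℕ → ℕ
  | 0 => 6
  | j + 1 => 2 ^ (labelBound j / 2)

/-- One round turns `b` bits into labels below `2 b`, which costs a factor two in the exponent
compared with `tower`. The stronger bound with `2 * tower j + 4` absorbs it: half of it is `tower j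
+ 2`, and the factor `4` in `2 ^ (tower j + 2)` restores the claim. -/
theorem tower_le_labelBound (j : ℕ) : 2 * tower j + 4 ≤ labelBound j := by
  induction j with
  | zero => simp [tower, labelBound]
  | succ j ih =>
    have h1 : 2 ^ (tower j + 2) ≤ labelBound (j + 1) :=
      Nat.pow_le_pow_right (by norm_num) (by omega)
    have h2 : tower j + 1 ≤ 2 ^ tower j := Nat.lt_two_pow_self
    have h3 : 1 ≤ tower j := by
      cases j with
      | zero => exact le_rfl
      | succ j => exact Nat.one_le_two_pow
    have h4 : tower (j + 1) = 2 ^ tower j := rfl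
    rw [pow_add] at h1
    omega

/-- Evenness makes twice the exponent `labelBound j / 2` equal to `labelBound j`, so the bound of
`label_lt` loses nothing to rounding. -/
theorem labelBound_even (j : ℕ) : labelBound j % 2 = 0 := by
  cases j with
  | zero => rfl
  | succ j =>
    have := tower_le_labelBound j
    have h : labelBound (j + 1) = 2 * 2 ^ (labelBound j / 2 - 1) := by
      rw [← pow_succ']
      show 2 ^ _ = _
      congr 1
      omega
    omega

theorem reduceRound_lt {w : List ℕ} {j : ℕ} (h : RunFree w) (hw : ∀ a ∈ w, a < labelBound (j + 1)) :
    ∀ a ∈ reduceRound w, a < labelBound j := by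
  intro a ha
  obtain ⟨i, hi⟩ := List.mem_iff_getElem?.1 ha
  rw [getElem?_reduceRound] at hi
  simp only [Option.bind_eq_some_iff, Option.map_eq_some_iff] at hi
  obtain ⟨x, hx, y, hy, rfl⟩ := hi
  have := label_lt (runFree_iff.1 h _ _ _ hx hy) (hw x (List.mem_of_getElem? hx))
    (hw y (List.mem_of_getElem? hy))
  have := labelBound_even j
  omega

theorem reduceRound_iterate {R : ℕ} {w : List ℕ} (h : RunFree w) (hw : ∀ a ∈ w, a < labelBound R) :
    RunFree (reduceRound^[R] w) ∧ ∀ a ∈ reduceRound^[R] w, a < 6 := by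
  induction R generalizing w with
  | zero => exact ⟨h, hw⟩
  | succ R ih => exact ih (runFree_reduceRound h) (reduceRound_lt h hw)

/-- Each round looks one symbol further to the right in the indexing by `reduceRound`, where the
label of a position is stored one place earlier than the position. -/
theorem reduceRound_iterate_congr {R : ℕ} {w w' : List ℕ} {i i' : ℕ}
    (h : ∀ k ≤ R, w[i + k]? = w'[i' + k]?) :
    (reduceRound^[R] w)[i]? = (reduceRound^[R] w')[i']? := by
  induction R generalizing w w' with
  | zero => exact h 0 le_rfl
  | succ R ih =>
    rw [Function.iterate_succ_apply, Function.iterate_succ_apply]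
    apply ih
    intro k hk
    rw [getElem?_reduceRound, getElem?_reduceRound, h k (by omega)]
    have := h (k + 1) (by omega)
    rw [← add_assoc, ← add_assoc] at this
    rw [this]

theorem getElem?_recolor (c : ℕ) (l : List ℕ) (i : ℕ) :
    (recolor c l)[i]? = (l[i]?).map fun x =>
      if x = c then leastFree (if i = 0 then none else l[i - 1]?) l[i + 1]? else x := by
  unfold recolor
  rw [List.getElem?_mapIdx]

theorem length_recolor (c : ℕ) (l : List ℕ) : (recolor c l).length = l.length := by
  simp [recolor]

theorem leastFree_spec (a b : Option ℕ) :
    leastFree a b < 3 ∧ a ≠ some (leastFree a b) ∧ b ≠ some (leastFree a b) := by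
  unfold leastFree
  split_ifs with h1 h2
  · exact ⟨by norm_num, h1⟩
  · exact ⟨by norm_num, h2⟩
  · refine ⟨by norm_num, ?_, ?_⟩
    · rintro rfl
      simp at h1 h2
      rw [h1] at h2
      simp at h2
    · rintro rfl
      simp at h1 h2
      rw [h1] at h2
      simp at h2

/-- Adjacent labels differ, so at most one of two neighbours equals `c` and is changed. Its new
value avoids the old value of the other one, which stays. -/
theorem runFree_recolor {c : ℕ} {l : List ℕ} (h : RunFree l) : RunFree (recolor c l) := by
  rw [runFree_iff] at h ⊢
  intro i a b ha hb
  rw [getElem?_recolor] at ha hb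
  simp only [Option.map_eq_some_iff, Nat.add_eq_zero_iff, one_ne_zero, and_false, if_false,
    Nat.add_sub_cancel] at ha hb
  obtain ⟨x, hx, rfl⟩ := ha
  obtain ⟨y, hy, rfl⟩ := hb
  have hxy := h _ _ _ hx hy
  rw [hx, hy]
  by_cases h1 : x = c
  · rw [if_pos h1, if_neg (show y ≠ c by rintro rfl; exact hxy h1)]
    have := (leastFree_spec (if i = 0 then none else l[i - 1]?) (some y)).2.2
    intro h2
    exact this (congrArg some h2.symm)
  · rw [if_neg h1]
    by_cases h2 : y = c
    · rw [if_pos h2]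
      have := (leastFree_spec (some x) l[i + 1 + 1]?).2.1
      intro h3
      exact this (by rw [← h3])
    · rw [if_neg h2]
      exact hxy

theorem mem_recolor {c : ℕ} {l : List ℕ} {a : ℕ} (h : a ∈ recolor c l) :
    a < 3 ∨ (a ∈ l ∧ a ≠ c) := by
  obtain ⟨i, hi⟩ := List.mem_iff_getElem?.1 h
  rw [getElem?_recolor] at hi
  simp only [Option.map_eq_some_iff] at hi
  obtain ⟨x, hx, rfl⟩ := hi
  by_cases h1 : x = c
  · rw [if_pos h1]
    exact Or.inl (leastFree_spec _ _).1
  · rw [if_neg h1]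
    exact Or.inr ⟨List.mem_of_getElem? hx, h1⟩

theorem recolor_congr_shift {c : ℕ} {l l' : List ℕ} {i i' : ℕ}
    (h : ∀ k ≤ 2, l[i + k]? = l'[i' + k]?) :
    (recolor c l)[i + 1]? = (recolor c l')[i' + 1]? := by
  rw [getElem?_recolor, getElem?_recolor, h 1 (by omega)]
  simp only [Nat.add_eq_zero_iff, one_ne_zero, and_false, if_false, Nat.add_sub_cancel]
  rw [show l[i]? = l'[i']? from h 0 (by omega),
    show l[i + 1 + 1]? = l'[i' + 1 + 1]? from h 2 (by omega)]

theorem recolor_congr_prefix {c : ℕ} {l l' : List ℕ} {i : ℕ}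
    (h : ∀ k ≤ i + 1, l[k]? = l'[k]?) : (recolor c l)[i]? = (recolor c l')[i]? := by
  rw [getElem?_recolor, getElem?_recolor, h i (by omega), h (i + 1) le_rfl, h (i - 1) (by omega)]

theorem length_finalLabels (R : ℕ) (w : List ℕ) : (finalLabels R w).length = w.length - R := by
  simp only [finalLabels, length_recolor, length_reduceRound_iterate]

theorem finalLabels_spec {R : ℕ} {w : List ℕ} (h : RunFree w) (hw : ∀ a ∈ w, a < tower R) :
    RunFree (finalLabels R w) ∧ ∀ a ∈ finalLabels R w, a < 3 := by
  obtain ⟨h1, h2⟩ := reduceRound_iterate (R := R) h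
    (fun a ha => by have := tower_le_labelBound R; have := hw a ha; omega)
  refine ⟨runFree_recolor (runFree_recolor (runFree_recolor h1)), fun a ha => ?_⟩
  rcases mem_recolor ha with h | ⟨ha, h5⟩
  · exact h
  · rcases mem_recolor ha with h | ⟨ha, h4⟩
    · exact h
    · rcases mem_recolor ha with h | ⟨ha, h3⟩
      · exact h
      · have := h2 a ha
        omega

/-- Each of the three recolourings widens the window by one place on both sides, and the `R` rounds
add `R` symbols. The offset `3` keeps away from the first label, which `recolor` treats specially.
-/
theorem finalLabels_congr_shift {R : ℕ} {w w' : List ℕ} {i i' : ℕ}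
    (h : ∀ k ≤ R + 6, w[i + k]? = w'[i' + k]?) :
    (finalLabels R w)[i + 3]? = (finalLabels R w')[i' + 3]? := by
  unfold finalLabels
  apply recolor_congr_shift (i := i + 2) (i' := i' + 2)
  intro k hk
  rw [show i + 2 + k = (i + 1 + k) + 1 by ring, show i' + 2 + k = (i' + 1 + k) + 1 by ring]
  apply recolor_congr_shift
  intro k' hk'
  rw [show i + 1 + k + k' = (i + k + k') + 1 by ring, show i' + 1 + k + k' = (i' + k + k') + 1 by ring]
  apply recolor_congr_shift
  intro k'' hk''
  apply reduceRound_iterate_congr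
  intro j hj
  have := h (k + k' + k'' + j) (by omega)
  simpa only [add_assoc] using this

/-- For strings with the same beginning no margin on the left is needed, since the special treatment
of the first label agrees. -/
theorem finalLabels_congr_prefix {R : ℕ} {w w' : List ℕ} {i : ℕ}
    (h : ∀ k ≤ i + R + 3, w[k]? = w'[k]?) :
    (finalLabels R w)[i]? = (finalLabels R w')[i]? := by
  unfold finalLabels
  apply recolor_congr_prefix
  intro k hk
  apply recolor_congr_prefix
  intro k' hk'
  apply recolor_congr_prefix
  intro k'' hk''
  apply reduceRound_iterate_congr
  intro j hj
  exact h _ (by omega)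

/-! ### Landmarks -/

theorem isLocalMax_iff {l : List ℕ} {i : ℕ} :
    isLocalMax l i = true ↔ 1 ≤ i ∧ ∃ a b c, l[i - 1]? = some a ∧ l[i]? = some b ∧
      l[i + 1]? = some c ∧ a < b ∧ c < b := by
  unfold isLocalMax
  rw [decide_eq_true_eq]
  constructor
  · rintro ⟨h1, h2, h3, h4⟩
    refine ⟨h1, l[i - 1], l[i], l[i + 1], List.getElem?_eq_getElem _, List.getElem?_eq_getElem _,
      List.getElem?_eq_getElem _, ?_⟩
    rw [List.getD_eq_getElem _ _ (by omega), List.getD_eq_getElem _ _ (by omega)] at h3 h4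
    exact ⟨h3, h4⟩
  · rintro ⟨h1, a, b, c, ha, hb, hc, h2, h3⟩
    have := (List.getElem?_eq_some_iff.1 hc).1
    simp only [List.getD_eq_getElem?_getD, ha, hb, hc, Option.getD_some]
    exact ⟨h1, this, h2, h3⟩

theorem isLocalMin_iff {l : List ℕ} {i : ℕ} :
    isLocalMin l i = true ↔ 1 ≤ i ∧ ∃ a b c, l[i - 1]? = some a ∧ l[i]? = some b ∧
      l[i + 1]? = some c ∧ b < a ∧ b < c := by
  unfold isLocalMin
  rw [decide_eq_true_eq]
  constructor
  · rintro ⟨h1, h2, h3, h4⟩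
    refine ⟨h1, l[i - 1], l[i], l[i + 1], List.getElem?_eq_getElem _, List.getElem?_eq_getElem _,
      List.getElem?_eq_getElem _, ?_⟩
    rw [List.getD_eq_getElem _ _ (by omega), List.getD_eq_getElem _ _ (by omega)] at h3 h4
    exact ⟨h3, h4⟩
  · rintro ⟨h1, a, b, c, ha, hb, hc, h2, h3⟩
    have := (List.getElem?_eq_some_iff.1 hc).1
    simp only [List.getD_eq_getElem?_getD, ha, hb, hc, Option.getD_some]
    exact ⟨h1, this, h2, h3⟩

theorem isLandmark_iff {l : List ℕ} {i : ℕ} :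
    isLandmark l i = true ↔ isLocalMax l i = true ∨ (isLocalMin l i = true ∧
      ¬ isLocalMax l (i - 1) = true ∧ ¬ isLocalMax l (i + 1) = true) := by
  simp [isLandmark, and_assoc]

/-- The definition asks for local maxima at a position and at both neighbours, hence involves five
labels. -/
theorem isLandmark_congr_shift {l l' : List ℕ} {i i' : ℕ}
    (h : ∀ k ≤ 4, l[i + k]? = l'[i' + k]?) :
    (isLandmark l (i + 2) = true ↔ isLandmark l' (i' + 2) = true) := by
  have hM : ∀ k ≤ 2, isLocalMax l (i + k + 1) = true ↔ isLocalMax l' (i' + k + 1) = true := by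
    intro k hk
    rw [isLocalMax_iff, isLocalMax_iff, Nat.add_sub_cancel, Nat.add_sub_cancel, h k (by omega)]
    have h1 := h (k + 1) (by omega)
    have h2 := h (k + 2) (by omega)
    rw [← add_assoc, ← add_assoc] at h1
    rw [show i + k + 1 + 1 = i + (k + 2) by ring, h1, h2]
    simp only [add_assoc, show ∀ a b : ℕ, 1 ≤ a + (b + 1) ↔ True by intros; simp; omega]
  have hm : isLocalMin l (i + 2) = true ↔ isLocalMin l' (i' + 2) = true := by
    rw [isLocalMin_iff, isLocalMin_iff]
    have h0 := h 1 (by omega)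
    have h1 := h 2 (by omega)
    have h2 := h 3 (by omega)
    rw [show i + 2 - 1 = i + 1 by omega, show i' + 2 - 1 = i' + 1 by omega,
      show i + 2 + 1 = i + 3 by omega, show i' + 2 + 1 = i' + 3 by omega, h0, h1, h2]
    simp
  rw [isLandmark_iff, isLandmark_iff, hm]
  have h0 := hM 0 (by omega)
  have h1 := hM 1 (by omega)
  have h2 := hM 2 (by omega)
  rw [show i + 2 - 1 = i + 0 + 1 by omega, show i' + 2 - 1 = i' + 0 + 1 by omega, h0, h2]
  rw [show i + 2 = i + 1 + 1 by omega, h1]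

theorem isLandmark_congr_prefix {l l' : List ℕ} {i : ℕ}
    (h : ∀ k ≤ i + 2, l[k]? = l'[k]?) :
    (isLandmark l i = true ↔ isLandmark l' i = true) := by
  have hM : ∀ k ≤ i + 1, isLocalMax l k = true ↔ isLocalMax l' k = true := by
    intro k hk
    rw [isLocalMax_iff, isLocalMax_iff, h k (by omega), h (k - 1) (by omega), h (k + 1) (by omega)]
  have hm : isLocalMin l i = true ↔ isLocalMin l' i = true := by
    rw [isLocalMin_iff, isLocalMin_iff, h i (by omega), h (i - 1) (by omega), h (i + 1) (by omega)]
  rw [isLandmark_iff, isLandmark_iff, hm, hM i (by omega), hM (i - 1) (by omega),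
    hM (i + 1) le_rfl]

theorem isLandmark_range {l : List ℕ} {i : ℕ} (h : isLandmark l i = true) :
    1 ≤ i ∧ i + 1 < l.length := by
  rw [isLandmark_iff, isLocalMax_iff, isLocalMin_iff] at h
  rcases h with ⟨h, a, b, c, -, -, hc, -⟩ | ⟨⟨h, a, b, c, -, -, hc, -⟩, -⟩ <;>
    exact ⟨h, (List.getElem?_eq_some_iff.1 hc).1⟩

/-- Two adjacent maxima or two adjacent minima contradict the comparison of their labels, and a
minimum next to a maximum is no landmark by definition. -/
theorem not_isLandmark_succ {l : List ℕ} {i : ℕ} (h : isLandmark l i = true) :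
    ¬ isLandmark l (i + 1) = true := by
  intro h'
  rw [isLandmark_iff] at h h'
  rw [Nat.add_sub_cancel] at h'
  have h1 : ¬ (isLocalMax l i = true ∧ isLocalMax l (i + 1) = true) := by
    rw [isLocalMax_iff, isLocalMax_iff, Nat.add_sub_cancel]
    rintro ⟨⟨-, a, b, c, -, hb, hc, -, h1⟩, -, a', b', c', hb', hc', -, h2, -⟩
    rw [hb] at hb'; rw [hc] at hc'
    cases hb'; cases hc'
    omega
  have h2 : ¬ (isLocalMin l i = true ∧ isLocalMin l (i + 1) = true) := by
    rw [isLocalMin_iff, isLocalMin_iff, Nat.add_sub_cancel]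
    rintro ⟨⟨-, a, b, c, -, hb, hc, -, h1⟩, -, a', b', c', hb', hc', -, h2, -⟩
    rw [hb] at hb'; rw [hc] at hc'
    cases hb'; cases hc'
    omega
  tauto

/-- With three label values a strictly monotone stretch has at most three members. If none of the
three candidates is a local maximum, the labels can neither rise to the middle one nor fall behind
it, so the middle one is a local minimum without a maximum next to it. -/
theorem exists_isLandmark {l : List ℕ} (hl : RunFree l) (h3 : ∀ a ∈ l, a < 3) {i : ℕ}
    (h1 : 1 ≤ i) (hi : i + 3 < l.length) : ∃ k ≤ 2, isLandmark l (i + k) = true := by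
  obtain ⟨i, rfl⟩ : ∃ j, i = j + 1 := ⟨i - 1, by omega⟩
  have hn : ∀ k ≤ 4, ∃ a, l[i + k]? = some a ∧ a < 3 := fun k hk =>
    ⟨l[i + k], List.getElem?_eq_getElem _, h3 _ (List.getElem_mem _)⟩
  obtain ⟨a0, ha0, hb0⟩ := hn 0 (by omega)
  obtain ⟨a1, ha1, hb1⟩ := hn 1 (by omega)
  obtain ⟨a2, ha2, hb2⟩ := hn 2 (by omega)
  obtain ⟨a3, ha3, hb3⟩ := hn 3 (by omega)
  obtain ⟨a4, ha4, hb4⟩ := hn 4 (by omega)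
  have d0 := runFree_iff.1 hl (i + 0) _ _ ha0 ha1
  have d1 := runFree_iff.1 hl (i + 1) _ _ ha1 ha2
  have d2 := runFree_iff.1 hl (i + 2) _ _ ha2 ha3
  have d3 := runFree_iff.1 hl (i + 3) _ _ ha3 ha4
  have M1 : isLocalMax l (i + 1) = true ↔ a0 < a1 ∧ a2 < a1 := by
    rw [isLocalMax_iff]
    simp only [Nat.add_sub_cancel]
    rw [show l[i]? = _ from ha0, ha1, show l[i + 1 + 1]? = _ from ha2]
    simp
  have M2 : isLocalMax l (i + 2) = true ↔ a1 < a2 ∧ a3 < a2 := by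
    rw [isLocalMax_iff]
    rw [show i + 2 - 1 = i + 1 by omega, show i + 2 + 1 = i + 3 by omega, ha1, ha2, ha3]
    simp
  have M3 : isLocalMax l (i + 3) = true ↔ a2 < a3 ∧ a4 < a3 := by
    rw [isLocalMax_iff]
    rw [show i + 3 - 1 = i + 2 by omega, show i + 3 + 1 = i + 4 by omega, ha2, ha3, ha4]
    simp
  have m2 : isLocalMin l (i + 2) = true ↔ a2 < a1 ∧ a2 < a3 := by
    rw [isLocalMin_iff]
    rw [show i + 2 - 1 = i + 1 by omega, show i + 2 + 1 = i + 3 by omega, ha1, ha2, ha3]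
    simp
  by_cases c1 : isLocalMax l (i + 1) = true
  · exact ⟨0, by omega, isLandmark_iff.2 (Or.inl c1)⟩
  by_cases c2 : isLocalMax l (i + 2) = true
  · exact ⟨1, by omega, isLandmark_iff.2 (Or.inl c2)⟩
  by_cases c3 : isLocalMax l (i + 3) = true
  · exact ⟨2, by omega, isLandmark_iff.2 (Or.inl c3)⟩
  refine ⟨1, by omega, isLandmark_iff.2 (Or.inr ⟨m2.2 ?_, ?_, ?_⟩)⟩
  · rw [M1] at c1
    rw [M2] at c2
    rw [M3] at c3
    omega
  · rwa [show i + 1 + 1 - 1 = i + 1 by omega]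
  · exact c3

/-- The position `p` of `w` is a landmark. -/
def LM (R : ℕ) (w : List ℕ) (p : ℕ) : Prop :=
  R ≤ p ∧ isLandmark (finalLabels R w) (p - R) = true

theorem mem_landmarks {R : ℕ} {w : List ℕ} {p : ℕ} : p ∈ landmarks R w ↔ LM R w p := by
  unfold landmarks LM
  simp only [List.mem_map, List.mem_filter, List.mem_range]
  constructor
  · rintro ⟨i, ⟨-, hi⟩, rfl⟩
    exact ⟨by omega, by simpa using hi⟩
  · rintro ⟨h1, h2⟩
    exact ⟨p - R, ⟨by have := isLandmark_range h2; omega, h2⟩, by omega⟩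

theorem pairwise_landmarks (R : ℕ) (w : List ℕ) : (landmarks R w).Pairwise (· < ·) := by
  unfold landmarks
  rw [List.pairwise_map]
  exact (List.pairwise_lt_range.filter _).imp (by intro a b h; omega)

theorem LM.range {R : ℕ} {w : List ℕ} {p : ℕ} (h : LM R w p) : R + 1 ≤ p ∧ p + 1 < w.length := by
  have := isLandmark_range h.2
  rw [length_finalLabels] at this
  have := h.1
  omega

theorem LM.not_succ {R : ℕ} {w : List ℕ} {p : ℕ} (h : LM R w p) : ¬ LM R w (p + 1) := by
  intro h'
  have := not_isLandmark_succ h.2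
  rw [show p - R + 1 = p + 1 - R by have := h.1; omega] at this
  exact this h'.2

theorem exists_LM {R : ℕ} {w : List ℕ} (hw : RunFree w) (hR : ∀ a ∈ w, a < tower R) {p : ℕ}
    (h1 : R + 1 ≤ p) (h2 : p + 3 < w.length) : ∃ k ≤ 2, LM R w (p + k) := by
  obtain ⟨h3, h4⟩ := finalLabels_spec hw hR
  obtain ⟨k, hk, h⟩ := exists_isLandmark h3 h4 (i := p - R) (by omega)
    (by rw [length_finalLabels]; omega)
  refine ⟨k, hk, by omega, ?_⟩
  rwa [show p + k - R = p - R + k by omega]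

/-- The window of the position `p` reaches from `p - R - 5` to `p + 5`: `R` symbols on the left for
the rounds, and on both sides three for the recolourings and two for the landmark test. -/
theorem LM_congr_shift {R : ℕ} {w w' : List ℕ} {i i' : ℕ}
    (h : ∀ k ≤ R + 10, w[i + k]? = w'[i' + k]?) : LM R w (i + R + 5) ↔ LM R w' (i' + R + 5) := by
  unfold LM
  have : isLandmark (finalLabels R w) (i + 3 + 2) = true ↔
      isLandmark (finalLabels R w') (i' + 3 + 2) = true := by
    apply isLandmark_congr_shift
    intro k hk
    rw [show i + 3 + k = i + k + 3 by ring, show i' + 3 + k = i' + k + 3 by ring]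
    apply finalLabels_congr_shift
    intro k' hk'
    rw [add_assoc, add_assoc]
    exact h _ (by omega)
  rw [show i + R + 5 - R = i + 3 + 2 by omega, show i' + R + 5 - R = i' + 3 + 2 by omega, this]
  simp only [and_congr_left_iff]
  omega

theorem LM_congr_prefix {R : ℕ} {w w' : List ℕ} {p : ℕ}
    (h : ∀ k ≤ p + 5, w[k]? = w'[k]?) : LM R w p ↔ LM R w' p := by
  unfold LM
  refine and_congr_right fun hp => isLandmark_congr_prefix fun k hk =>
    finalLabels_congr_prefix fun k' hk' => h _ (by omega)

/-! ### Cut positions of a parsing by alphabet reduction -/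

theorem flatten_flatMap_leftAligned (l : List (List ℕ)) :
    (l.flatMap leftAligned).flatten = l.flatten := by
  induction l with
  | nil => rfl
  | cons u l ih => rw [List.flatMap_cons, List.flatten_append, flatten_leftAligned, ih]; rfl

theorem flatten_cutAt (w : List ℕ) (o : ℕ) (cs : List ℕ) : (cutAt w o cs).flatten = w := by
  induction cs generalizing w o with
  | nil => simp [cutAt]
  | cons c cs ih => rw [cutAt, List.flatten_cons, ih, List.take_append_drop]

theorem flatten_type2Blocks (R : ℕ) (w : List ℕ) : (type2Blocks R w).flatten = w := by
  rw [type2Blocks, flatten_flatMap_leftAligned, flatten_cutAt]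

/-- `x` is a cut position of the left aligned parsing of one of the intervals between successive
members of the list. -/
def PieceCut : List ℕ → ℕ → Prop
  | s :: e :: r, x => (s ≤ x ∧ x ≤ e ∧ LACut (e - s) (x - s)) ∨ PieceCut (e :: r) x
  | _, _ => False

theorem PieceCut.ge {c : ℕ} {l : List ℕ} {x : ℕ} (hl : (c :: l).IsChain (· ≤ ·))
    (h : PieceCut (c :: l) x) : c ≤ x := by
  induction l generalizing c with
  | nil => exact h.elim
  | cons d l ih =>
    rcases h with h | h
    · exact h.1
    · rw [List.isChain_cons_cons] at hl
      exact hl.1.trans (ih hl.2 h)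

theorem isCut_cutAt {w : List ℕ} {o : ℕ} {cs : List ℕ} {x : ℕ}
    (h : (o :: (cs ++ [o + w.length])).IsChain (· ≤ ·)) :
    IsCut ((cutAt w o cs).flatMap leftAligned) x ↔
      PieceCut (o :: (cs ++ [o + w.length])) (o + x) := by
  induction cs generalizing w o x with
  | nil =>
    simp only [cutAt, List.flatMap_singleton, isCut_leftAligned, List.nil_append, PieceCut, or_false]
    simp only [LACut]
    omega
  | cons c cs ih =>
    rw [List.cons_append, List.isChain_cons_cons] at h
    have hc : c ≤ o + w.length := by
      have := List.isChain_iff_pairwise.1 h.2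
      rw [List.pairwise_cons] at this
      exact this.1 _ (by simp)
    have hlen : c + (w.drop (c - o)).length = o + w.length := by
      rw [List.length_drop]; omega
    have h2 : (c :: (cs ++ [c + (w.drop (c - o)).length])).IsChain (· ≤ ·) := by
      rw [hlen]; exact h.2
    have ht : (w.take (c - o)).length = c - o := by
      rw [List.length_take]; omega
    rw [cutAt, List.flatMap_cons, isCut_append, List.cons_append, PieceCut, flatten_leftAligned, ht,
      isCut_leftAligned, ht]
    apply or_congr
    · simp only [LACut]
      omega
    · constructor
      · rintro ⟨y, hy, rfl⟩
        rw [ih h2, hlen] at hy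
        rwa [show o + (c - o + y) = c + y by omega]
      · intro hx
        have := hx.ge h.2
        refine ⟨o + x - c, ?_, by omega⟩
        rw [ih h2, hlen]
        rwa [show c + (o + x - c) = o + x by omega]

/-- Successive landmarks have distance two or three. -/
abbrev Gap (a b : ℕ) : Prop := b = a + 2 ∨ b = a + 3

/-- An interval of length two or three has no interior cut under left aligned parsing. So only the
endpoints of the inner pieces remain, and the last piece is the only one that is really parsed. -/
theorem pieceCut_gap {l : List ℕ} {q e x : ℕ} (h : (l ++ [q]).IsChain Gap) :
    PieceCut (l ++ [q, e]) x ↔ x ∈ l ∨ (q ≤ x ∧ x ≤ e ∧ LACut (e - q) (x - q)) ∨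
      (l ≠ [] ∧ x = q) := by
  induction l with
  | nil => simp [PieceCut]
  | cons c l ih =>
    rcases l with _ | ⟨d, l⟩
    · simp only [List.cons_append, List.nil_append, PieceCut, List.mem_singleton] at *
      rw [List.isChain_cons_cons] at h
      have := h.1
      simp only [or_false, LACut]
      constructor
      · intro h; simp; omega
      · intro h; simp at h; omega
    · rw [List.cons_append, List.cons_append, PieceCut]
      rw [List.cons_append, List.cons_append, List.isChain_cons_cons] at h
      have := h.1
      rw [List.cons_append, List.cons_append] at ih
      rw [ih h.2]
      simp only [LACut, List.mem_cons]
      constructor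
      · rintro (h | h)
        · by_cases h1 : x = c
          · exact Or.inl (Or.inl h1)
          · have : x = d := by omega
            exact Or.inl (Or.inr (Or.inl this))
        · rcases h with h | h | h
          · exact Or.inl (Or.inr h)
          · exact Or.inr (Or.inl h)
          · exact Or.inr (Or.inr ⟨by simp, h.2⟩)
      · rintro ((h | h) | h | h)
        · exact Or.inl (by omega)
        · exact Or.inr (Or.inl h)
        · exact Or.inr (Or.inr (Or.inl h))
        · exact Or.inr (Or.inr (Or.inr ⟨by simp, h.2⟩))

/-- For the distances two and three alike, the midpoint rule puts the cut two places behind the left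
landmark. Thus an inner cut at `x` is governed by the landmark at `x - 2` alone. -/
theorem cuts_eq {p : ℕ} {ps : List ℕ} (h : (p :: ps).IsChain Gap) :
    cuts (p :: ps) = p :: (p :: ps).dropLast.map (· + 2) := by
  rw [cuts]
  congr 1
  induction ps generalizing p with
  | nil => rfl
  | cons q ps ih =>
    rw [List.isChain_cons_cons] at h
    rw [List.zipWith_cons_cons, ih h.2, List.dropLast_cons_cons, List.map_cons]
    congr 1
    have := h.1
    omega

/-- Distance one is impossible by `LM.not_succ`. A distance above three would leave three
consecutive positions for which `exists_LM` provides a further landmark. -/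
theorem landmarks_gap {R : ℕ} {w : List ℕ} (hw : RunFree w) (hR : ∀ a ∈ w, a < tower R) :
    (landmarks R w).IsChain Gap := by
  rw [List.isChain_iff_getElem]
  intro i hi
  have hp := List.pairwise_iff_getElem.1 (pairwise_landmarks R w)
  have h1 := mem_landmarks.1 (List.getElem_mem (by omega : i < (landmarks R w).length))
  have h2 := mem_landmarks.1 (List.getElem_mem hi)
  have h3 := hp i (i + 1) (by omega) hi (by omega)
  have hno : ∀ z, LM R w z → (landmarks R w)[i] < z → (landmarks R w)[i + 1] ≤ z := by
    intro z hz h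
    obtain ⟨j, hj, rfl⟩ := List.getElem_of_mem (mem_landmarks.2 hz)
    by_contra h5
    rcases lt_trichotomy j i with h6 | rfl | h6
    · have := hp j i hj (by omega) h6; omega
    · omega
    · rcases Nat.lt_or_ge j (i + 1) with h7 | h7
      · omega
      · rcases Nat.eq_or_lt_of_le h7 with rfl | h7
        · omega
        · have := hp (i + 1) j hi hj h7; omega
  have h4 : (landmarks R w)[i + 1] ≠ (landmarks R w)[i] + 1 := by
    intro h
    rw [h] at h2
    exact h1.not_succ h2
  have h5 := h1.range
  have h6 := h2.range
  by_contra h7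
  obtain ⟨k, hk, h8⟩ := exists_LM hw hR (p := (landmarks R w)[i] + 1) (by omega)
    (by simp only [Gap] at h7; omega)
  have := hno _ h8 (by omega)
  simp only [Gap] at h7
  omega

/-- Here `p`, `q` and `pl` are the first, the last but one and the last landmark; the last piece
starts at `q + 2`. Landmarks exist among `R + 1, …, R + 3` and among the three positions from
`w.length - 4` on, which gives the bounds on `p` and `q`. The one found from `R + 4` on guarantees
that there are two. -/
theorem type2_isCut {R : ℕ} {w : List ℕ} (hw : RunFree w) (hR : ∀ a ∈ w, a < tower R)
    (hl : R + 12 ≤ w.length) :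
    ∃ p q pl, p ≤ R + 3 ∧ LM R w p ∧ (∀ z < p, ¬ LM R w z) ∧ LM R w q ∧ LM R w pl ∧ q < pl ∧
      (∀ z, LM R w z → z ≤ q ∨ z = pl) ∧ p ≤ q ∧ w.length ≤ q + 7 ∧
      ∀ x, IsCut (type2Blocks R w) x ↔ (x ≤ p ∧ LACut p x) ∨
        (p < x ∧ x ≤ q + 2 ∧ LM R w (x - 2)) ∨
        (q + 2 ≤ x ∧ x ≤ w.length ∧ LACut (w.length - (q + 2)) (x - (q + 2))) := by
  have hg := landmarks_gap hw hR
  have hs := pairwise_landmarks R w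
  have hm : ∀ z, z ∈ landmarks R w ↔ LM R w z := fun z => mem_landmarks
  obtain ⟨k1, hk1, hL1⟩ := exists_LM hw hR (p := R + 1) le_rfl (by omega)
  obtain ⟨k2, hk2, hL2⟩ := exists_LM hw hR (p := R + 4) (by omega) (by omega)
  obtain ⟨k3, hk3, hL3⟩ := exists_LM hw hR (p := w.length - 4) (by omega) (by omega)
  unfold type2Blocks
  revert hg hs hm
  generalize landmarks R w = ls
  intro hg hs hm
  have hne : 2 ≤ ls.length := by
    rcases ls with _ | ⟨a, _ | ⟨b, ls⟩⟩
    · simp [← hm] at hL1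
    · rw [← hm] at hL1 hL2
      simp at hL1 hL2
      omega
    · simp
  obtain ⟨pl, l', rfl⟩ : ∃ pl l', ls = l' ++ [pl] := by
    rcases List.eq_nil_or_concat ls with rfl | ⟨l, a, rfl⟩
    · simp at hne
    · exact ⟨a, l, by simp⟩
  obtain ⟨q, l, rfl⟩ : ∃ q l, l' = l ++ [q] := by
    rcases List.eq_nil_or_concat l' with rfl | ⟨l, a, rfl⟩
    · simp at hne
    · exact ⟨a, l, by simp⟩
  simp only [List.append_assoc, List.cons_append, List.nil_append] at *
  have hsp := List.pairwise_append.1 hs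
  have hqpl : q < pl := by simpa using hsp.2.1
  have hlt : ∀ z ∈ l, z < q := fun z hz => hsp.2.2 z hz q (by simp)
  have hgq : Gap q pl := by
    have := (List.isChain_append.1 hg).2.1
    simpa using this
  have hmax : ∀ z, LM R w z → z ≤ q ∨ z = pl := by
    intro z hz
    rw [← hm] at hz
    simp only [List.mem_append, List.mem_cons, List.not_mem_nil, or_false] at hz
    rcases hz with hz | hz | hz
    · have := hlt z hz; omega
    · omega
    · omega
  have hplm := (hm pl).1 (by simp)
  have hqm := (hm q).1 (by simp)
  have hqr := hplm.range
  have hql : w.length ≤ q + 7 := by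
    have := hmax _ hL3
    simp only [Gap] at hgq
    omega
  obtain ⟨p, ps, hp⟩ : ∃ p ps, l ++ [q, pl] = p :: ps := by
    rcases l with _ | ⟨a, l⟩
    · exact ⟨_, _, rfl⟩
    · exact ⟨_, _, rfl⟩
  have hpm := (hm p).1 (by rw [hp]; simp)
  have hpmin : ∀ z, LM R w z → p ≤ z := by
    intro z hz
    rw [← hm, hp] at hz
    rw [hp, List.pairwise_cons] at hs
    rcases List.mem_cons.1 hz with rfl | hz
    · rfl
    · exact (hs.1 z hz).le
  have hcuts : cuts (l ++ [q, pl]) = p :: (l.map (· + 2) ++ [q + 2]) := by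
    rw [hp, cuts_eq (hp ▸ hg), ← hp]
    rw [show l ++ [q, pl] = (l ++ [q]) ++ [pl] by simp, List.dropLast_concat]
    simp
  have hp2 : ∀ y ∈ (l.map (· + 2) ++ [q + 2]).head?, y = p + 2 := by
    rcases l with _ | ⟨a, l⟩
    · simp at hp; simp [hp.1]
    · simp at hp; simp [hp.1]
  have hchain : (p :: (l.map (· + 2) ++ [q + 2])).IsChain Gap := by
    rw [List.isChain_cons]
    refine ⟨fun y hy => Or.inl (hp2 y hy), ?_⟩
    have : (l ++ [q]).IsChain Gap := by
      have h : (l ++ [q]) ++ [pl] = l ++ [q, pl] := by simp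
      exact (List.isChain_append.1 (h ▸ hg)).1
    have h2 : l.map (· + 2) ++ [q + 2] = (l ++ [q]).map (· + 2) := by simp
    rw [h2, List.isChain_map]
    exact this.imp (fun {a b} h => by simp only [Gap] at *; omega)
  refine ⟨p, q, pl, ?_, hpm, ?_, hqm, hplm, hqpl, hmax, hpmin q hqm, hql, ?_⟩
  · have := hpmin _ hL1; omega
  · intro z hz h
    have := hpmin z h; omega
  intro x
  rw [hcuts, isCut_cutAt]
  · have he : p :: (l.map (· + 2) ++ [q + 2]) ++ [w.length] =
      (p :: l.map (· + 2)) ++ [q + 2, w.length] := by simp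
    rw [zero_add, zero_add, List.cons_append, PieceCut, ← List.cons_append, he,
      pieceCut_gap (by simpa using hchain)]
    simp only [Nat.zero_le, true_and, Nat.sub_zero, List.mem_cons, List.mem_map]
    apply or_congr_right'
    intro hx
    have hpr := hpm.range
    constructor
    · rintro ((h | ⟨z, hz, rfl⟩) | h | ⟨-, h⟩)
      · subst h
        exact absurd ⟨le_rfl, Or.inr (Or.inl rfl)⟩ hx
      · have h1 := hlt z hz
        have h2 := (hm z).1 (by simp [hz])
        have h3 := hpmin z h2
        exact Or.inl ⟨by omega, by omega, by simpa using h2⟩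
      · exact Or.inr h
      · subst h
        exact Or.inl ⟨by have := hpmin q hqm; omega, le_rfl, by simpa using hqm⟩
    · rintro (⟨h1, h2, h3⟩ | h)
      · have h4 := (hm _).2 h3
        have h5 := h3.range
        simp only [List.mem_append, List.mem_cons, List.not_mem_nil, or_false] at h4
        rcases h4 with h4 | h4 | h4
        · exact Or.inl (Or.inr ⟨_, h4, by omega⟩)
        · exact Or.inr (Or.inr ⟨by simp, by omega⟩)
        · omega
      · exact Or.inr (Or.inl h)
  · rw [zero_add, List.cons_append, List.isChain_cons_cons, ← List.cons_append]
    refine ⟨Nat.zero_le _, ?_⟩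
    rw [List.isChain_append]
    refine ⟨hchain.imp (fun {a b} h => by simp only [Gap] at h; omega), by simp, ?_⟩
    intro a ha b hb
    rw [← List.cons_append, List.getLast?_concat] at ha
    simp at ha hb
    rw [← ha, ← hb]
    omega

theorem mem_cutAt_length {w : List ℕ} {o : ℕ} {cs : List ℕ}
    (h : (o :: (cs ++ [o + w.length])).IsChain (fun a b => a + 2 ≤ b)) :
    ∀ u ∈ cutAt w o cs, 2 ≤ u.length := by
  induction cs generalizing w o with
  | nil =>
    simp only [List.nil_append, List.isChain_cons_cons] at h
    simp only [cutAt, List.mem_singleton, forall_eq]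
    omega
  | cons c cs ih =>
    rw [List.cons_append, List.isChain_cons_cons] at h
    have hc : c ≤ o + w.length := by
      have := List.isChain_iff_pairwise.1 (h.2.imp (S := (· ≤ ·)) (fun {a b} h => by omega))
      rw [List.pairwise_cons] at this
      exact this.1 _ (by simp)
    have hlen : c + (w.drop (c - o)).length = o + w.length := by
      rw [List.length_drop]; omega
    intro u hu
    rw [cutAt] at hu
    rcases List.mem_cons.1 hu with rfl | hu
    · rw [List.length_take]; omega
    · exact ih (by rw [hlen]; exact h.2) u hu

theorem cuts_chain {p c n : ℕ} {ps : List ℕ} (h : (p :: ps).IsChain (fun a b => a + 2 ≤ b))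
    (hn : ∀ a ∈ p :: ps, a + 2 ≤ n) (hc : c ≤ p) :
    (c :: (List.zipWith (fun q q' => (q + q') / 2 + 1) (p :: ps) ps ++ [n])).IsChain
      (fun a b => a + 2 ≤ b) := by
  induction ps generalizing p c with
  | nil =>
    have := hn p (by simp)
    simp
    omega
  | cons q ps ih =>
    rw [List.isChain_cons_cons] at h
    rw [List.zipWith_cons_cons, List.cons_append, List.isChain_cons_cons]
    exact ⟨by omega, ih h.2 (fun a ha => hn a (List.mem_cons_of_mem _ ha)) (by omega)⟩

theorem landmarks_chain (R : ℕ) (w : List ℕ) :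
    (landmarks R w).IsChain (fun a b => a + 2 ≤ b) := by
  rw [List.isChain_iff_getElem]
  intro i hi
  have h3 := List.pairwise_iff_getElem.1 (pairwise_landmarks R w) i (i + 1) (by omega) hi (by omega)
  have h1 := mem_landmarks.1 (List.getElem_mem (by omega : i < (landmarks R w).length))
  have h2 := mem_landmarks.1 (List.getElem_mem hi)
  have h4 : (landmarks R w)[i + 1] ≠ (landmarks R w)[i] + 1 := by
    intro h
    rw [h] at h2
    exact h1.not_succ h2
  omega

/-- This needs no bound on the symbols, only that landmarks are never adjacent. All pieces then have
length at least two; for the first one this uses that the first landmark is at `R + 1` or later,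
with `R` positive. -/
theorem length_of_mem_type2Blocks {R : ℕ} {w : List ℕ} (hR1 : 1 ≤ R) (hl : 2 ≤ w.length) :
    ∀ b ∈ type2Blocks R w, b.length = 2 ∨ b.length = 3 := by
  intro b hb
  unfold type2Blocks at hb
  rw [List.mem_flatMap] at hb
  obtain ⟨u, hu, hb⟩ := hb
  refine length_of_mem_leftAligned (mem_cutAt_length ?_ u hu) hb
  have hg := landmarks_chain R w
  have hm : ∀ z ∈ landmarks R w, LM R w z := fun z => mem_landmarks.1
  revert hg hm
  generalize landmarks R w = ls
  intro hg hm
  rcases ls with _ | ⟨p, ps⟩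
  · simpa [cuts] using hl
  · rw [cuts, zero_add, List.cons_append, List.isChain_cons_cons]
    have hpr := (hm p (by simp)).range
    refine ⟨by omega, cuts_chain hg (fun a ha => ?_) le_rfl⟩
    have := (hm a ha).range
    omega

theorem getElem?_append_middle {A V Z : List ℕ} {j : ℕ} (h : j < V.length) :
    (A ++ V ++ Z)[A.length + j]? = V[j]? := by
  rw [List.getElem?_append_left (by rw [List.length_append]; omega),
    List.getElem?_append_right (by omega), Nat.add_sub_cancel_left]

/-- The cut positions near the front only depend on the front. -/
theorem type2_isCut_congr_prefix {R : ℕ} {U V V' : List ℕ} (hw : RunFree (U ++ V))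
    (hw' : RunFree (U ++ V')) (hR : ∀ a ∈ U ++ V, a < tower R) (hR' : ∀ a ∈ U ++ V', a < tower R)
    {x : ℕ} (hU : R + 12 ≤ U.length) (hx : x + 12 ≤ U.length) :
    IsCut (type2Blocks R (U ++ V)) x ↔ IsCut (type2Blocks R (U ++ V')) x := by
  obtain ⟨p, q, pl, h1, h2, h3, h4, -, -, -, -, h5, h6⟩ :=
    type2_isCut hw hR (by rw [List.length_append]; omega)
  obtain ⟨p', q', pl', h1', h2', h3', h4', -, -, -, -, h5', h6'⟩ :=
    type2_isCut hw' hR' (by rw [List.length_append]; omega)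
  have hLM : ∀ z, z + 5 < U.length → (LM R (U ++ V) z ↔ LM R (U ++ V') z) := by
    intro z hz
    apply LM_congr_prefix
    intro k hk
    rw [List.getElem?_append_left (by omega), List.getElem?_append_left (by omega)]
  -- The first landmark is at most `R + 3`, so its window lies inside `U`, and the landmarks in
  -- front of it are compared in the same range.
  have hp : p = p' := by
    rcases lt_trichotomy p p' with h | h | h
    · exact absurd ((hLM p (by omega)).1 h2) (h3' p h)
    · exact h
    · exact absurd ((hLM p' (by omega)).2 h2') (h3 p' h)
  subst hp
  rw [h6, h6']
  rw [List.length_append] at h5 h5'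
  by_cases hxp : p < x
  · have := hLM (x - 2) (by omega)
    rw [this]
    constructor
    · rintro (h | ⟨h7, h8, h9⟩ | h)
      · omega
      · exact Or.inr (Or.inl ⟨h7, by omega, h9⟩)
      · omega
    · rintro (h | ⟨h7, h8, h9⟩ | h)
      · omega
      · exact Or.inr (Or.inl ⟨h7, by omega, h9⟩)
      · omega
  · constructor
    · rintro (h | h | h)
      · exact Or.inl h
      · omega
      · omega
    · rintro (h | h | h)
      · exact Or.inl h
      · omega
      · omega

/-- The cut positions away from the front do not depend on the front. -/
theorem type2_isCut_congr_suffix {R : ℕ} {A A' V : List ℕ} (hw : RunFree (A ++ V))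
    (hw' : RunFree (A' ++ V)) (hR : ∀ a ∈ A ++ V, a < tower R) (hR' : ∀ a ∈ A' ++ V, a < tower R)
    {x : ℕ} (hV : R + 16 ≤ V.length) (hx : R + 16 ≤ x) :
    IsCut (type2Blocks R (A ++ V)) (A.length + x) ↔
      IsCut (type2Blocks R (A' ++ V)) (A'.length + x) := by
  obtain ⟨p, q, pl, h1, h2, h3, h4, hpl, hqpl, hmax, -, h5, h6⟩ :=
    type2_isCut hw hR (by rw [List.length_append]; omega)
  obtain ⟨p', q', pl', h1', h2', h3', h4', hpl', hqpl', hmax', -, h5', h6'⟩ :=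
    type2_isCut hw' hR' (by rw [List.length_append]; omega)
  have hLM : ∀ z, R + 5 ≤ z → (LM R (A ++ V) (A.length + z) ↔ LM R (A' ++ V) (A'.length + z)) := by
    intro z hz
    have := LM_congr_shift (R := R) (w := A ++ V) (w' := A' ++ V) (i := A.length + (z - (R + 5)))
      (i' := A'.length + (z - (R + 5))) (by
        intro k hk
        rw [List.getElem?_append_right (by omega), List.getElem?_append_right (by omega)]
        congr 1
        omega)
    rwa [show A.length + (z - (R + 5)) + R + 5 = A.length + z by omega,
      show A'.length + (z - (R + 5)) + R + 5 = A'.length + z by omega] at this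
  rw [List.length_append] at h5 h5'
  obtain ⟨z, rfl⟩ : ∃ z, q = A.length + z := ⟨q - A.length, by omega⟩
  obtain ⟨z', rfl⟩ : ∃ z, q' = A'.length + z := ⟨q' - A'.length, by omega⟩
  obtain ⟨y, rfl⟩ : ∃ z, pl = A.length + z := ⟨pl - A.length, by omega⟩
  obtain ⟨y', rfl⟩ : ∃ z, pl' = A'.length + z := ⟨pl' - A'.length, by omega⟩
  -- The last two landmarks lie close to the end of `V`, where landmarks correspond under the shift.
  -- Hence the last ones correspond, and so do those before them.
  have hzz : z = z' := by
    have e1 := hmax' _ ((hLM z (by omega)).1 h4)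
    have e2 := hmax _ ((hLM z' (by omega)).2 h4')
    have e3 := hmax' _ ((hLM y (by omega)).1 hpl)
    have e4 := hmax _ ((hLM y' (by omega)).2 hpl')
    omega
  subst hzz
  rw [h6, h6', List.length_append, List.length_append]
  have hL := hLM (x - 2) (by omega)
  rw [show A.length + (x - 2) = A.length + x - 2 by omega,
    show A'.length + (x - 2) = A'.length + x - 2 by omega] at hL
  rw [hL, show A.length + x - (A.length + z + 2) = x - (z + 2) by omega,
    show A'.length + x - (A'.length + z + 2) = x - (z + 2) by omega,
    show A.length + V.length - (A.length + z + 2) = V.length - (z + 2) by omega,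
    show A'.length + V.length - (A'.length + z + 2) = V.length - (z + 2) by omega]
  constructor
  · rintro (h | ⟨h7, h8, h9⟩ | ⟨h7, h8, h9⟩)
    · omega
    · exact Or.inr (Or.inl ⟨by omega, by omega, h9⟩)
    · exact Or.inr (Or.inr ⟨by omega, by omega, h9⟩)
  · rintro (h | ⟨h7, h8, h9⟩ | ⟨h7, h8, h9⟩)
    · omega
    · exact Or.inr (Or.inl ⟨by omega, by omega, h9⟩)
    · exact Or.inr (Or.inr ⟨by omega, by omega, h9⟩)

/-- The cut positions away from the ends do not depend on the ends. -/
theorem type2_isCut_congr_middle {R : ℕ} {A A' V Z Z' : List ℕ} (hw : RunFree (A ++ V ++ Z))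
    (hw' : RunFree (A' ++ V ++ Z')) (hR : ∀ a ∈ A ++ V ++ Z, a < tower R)
    (hR' : ∀ a ∈ A' ++ V ++ Z', a < tower R) {x : ℕ} (hx : R + 16 ≤ x) (hV : x + 16 ≤ V.length) :
    IsCut (type2Blocks R (A ++ V ++ Z)) (A.length + x) ↔
      IsCut (type2Blocks R (A' ++ V ++ Z')) (A'.length + x) := by
  obtain ⟨p, q, pl, h1, h2, h3, h4, hpl, hqpl, hmax, -, h5, h6⟩ :=
    type2_isCut hw hR (by simp only [List.length_append]; omega)
  obtain ⟨p', q', pl', h1', h2', h3', h4', hpl', hqpl', hmax', -, h5', h6'⟩ :=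
    type2_isCut hw' hR' (by simp only [List.length_append]; omega)
  -- The margins put `x` behind the first landmark and in front of the last piece, so only the rule
  -- that compares `x - 2` with the landmarks applies. The window of that position lies in `V`.
  have hL : LM R (A ++ V ++ Z) (A.length + x - 2) ↔ LM R (A' ++ V ++ Z') (A'.length + x - 2) := by
    have := LM_congr_shift (R := R) (w := A ++ V ++ Z) (w' := A' ++ V ++ Z')
      (i := A.length + (x - (R + 7))) (i' := A'.length + (x - (R + 7))) (by
        intro k hk
        rw [add_assoc, add_assoc, getElem?_append_middle (by omega),
          getElem?_append_middle (by omega)])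
    rwa [show A.length + (x - (R + 7)) + R + 5 = A.length + x - 2 by omega,
      show A'.length + (x - (R + 7)) + R + 5 = A'.length + x - 2 by omega] at this
  simp only [List.length_append] at h5 h5'
  rw [h6, h6', hL]
  constructor
  · rintro (h | ⟨h7, h8, h9⟩ | ⟨h7, h8, h9⟩)
    · omega
    · exact Or.inr (Or.inl ⟨by omega, by omega, h9⟩)
    · omega
  · rintro (h | ⟨h7, h8, h9⟩ | ⟨h7, h8, h9⟩)
    · omega
    · exact Or.inr (Or.inl ⟨by omega, by omega, h9⟩)
    · omega

/-! ### The partition into metablocks -/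

theorem metablocks_runFree {w : List ℕ} (h : RunFree w) (hw : w ≠ []) :
    metablocks w = [(false, w)] := by
  unfold metablocks
  rw [segments_runFree h hw]
  rcases w with _ | ⟨a, _ | ⟨b, w⟩⟩
  · exact absurd rfl hw
  · rfl
  · rfl

theorem segments_nil : segments [] = [] := rfl

theorem segments_singleton (x : ℕ) : segments [x] = [(false, [x])] :=
  segments_runFree (by simp) (by simp)

theorem metablocks_run {e z : List ℕ} {k a : ℕ} (he : e.length ≤ 1) (hz : z.length ≤ 1)
    (he' : ∀ x ∈ e, x ≠ a) (hz' : ∀ x ∈ z, a ≠ x) :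
    metablocks (e ++ (List.replicate (k + 2) a ++ z)) =
      [(true, e ++ (List.replicate (k + 2) a ++ z))] := by
  have h1 : segments (List.replicate (k + 2) a ++ z) =
      (true, List.replicate (k + 2) a) :: segments z := by
    apply segments_run_prefix (by omega)
    intro x hx
    exact hz' x (List.mem_of_mem_head? hx)
  have h2 : segments (e ++ (List.replicate (k + 2) a ++ z)) =
      segments e ++ segments (List.replicate (k + 2) a ++ z) := by
    apply segments_append
    · intro x hx y hy
      have : y = a := by
        simp [List.replicate_succ] at hy
        exact hy.symm
      rw [this]
      exact he' x (List.mem_of_mem_getLast? hx)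
    · exact Or.inl ⟨a, List.replicate k a ++ z, by simp [List.replicate_succ]⟩
  unfold metablocks
  rw [h2, h1]
  rcases e with _ | ⟨x, _ | ⟨y, e⟩⟩ <;> rcases z with _ | ⟨u, _ | ⟨v, z⟩⟩ <;>
    simp [segments_nil, segments_singleton, attachFirst, attachLeft] at he hz ⊢

/-- The first metablock of a string starting with a repetition, or with a single symbol in front
of a repetition. -/
theorem exists_metablocks_run {e B : List ℕ} {k a : ℕ} (he : e.length ≤ 1)
    (he' : ∀ x ∈ e, x ≠ a) (hB : ∀ x ∈ B.head?, a ≠ x) :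
    ∃ z B', B = z ++ B' ∧ z.length ≤ 1 ∧ (B' = [] ∨ 2 ≤ B'.length) ∧
      (∀ x ∈ (e ++ (List.replicate (k + 2) a ++ z)).getLast?, ∀ y ∈ B'.head?, x ≠ y) ∧
      metablocks (e ++ (List.replicate (k + 2) a ++ B)) =
        (true, e ++ (List.replicate (k + 2) a ++ z)) :: metablocks B' := by
  have hlast : (e ++ (List.replicate (k + 2) a ++ [])).getLast? = some a := by
    simp [List.getLast?_append, List.getLast?_replicate]
  have hm0 := metablocks_run (k := k) he (z := []) (by simp) he' (by simp)
  rcases B with _ | ⟨b, _ | ⟨c, B⟩⟩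
  · exact ⟨[], [], rfl, by simp, Or.inl rfl, by simp, hm0⟩
  · refine ⟨[b], [], rfl, by simp, Or.inl rfl, by simp, ?_⟩
    exact metablocks_run he (by simp) he' (by simpa using hB)
  -- Behind the repetition there are three possibilities: `b` starts another repetition, `b` starts
  -- a segment of length at least two, or `b` is a lone symbol in front of a repetition and is
  -- attached.
  · by_cases hbc : b = c
    · subst hbc
      refine ⟨[], b :: b :: B, rfl, by simp, Or.inr (by simp), ?_, ?_⟩
      · rw [hlast]; simpa using hB
      · have := metablocks_append_run (A := e ++ (List.replicate (k + 2) a ++ [])) (b := b) (B := B)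
          (by simp; omega) (by rw [hlast]; simpa using hB)
        rw [hm0] at this
        simpa using this
    · by_cases hc : ∀ x ∈ B.head?, c ≠ x
      · refine ⟨[], b :: c :: B, rfl, by simp, Or.inr (by simp), ?_, ?_⟩
        · rw [hlast]; simpa using hB
        · have he2 : e ++ (List.replicate (k + 2) a ++ []) = (e ++ List.replicate k a) ++ [a, a] := by
            rw [List.append_nil, List.append_assoc, show [a, a] = List.replicate 2 a from rfl,
              List.replicate_append_replicate]
          have := metablocks_append_segment (A := e ++ List.replicate k a) (a := a) (b := b) (c := c)
            (B := B) (by simpa using hB) hbc hc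
          rw [← he2, hm0] at this
          simpa using this
      · push Not at hc
        obtain ⟨x, hx, rfl⟩ := hc
        obtain ⟨B, rfl⟩ : ∃ B', B = c :: B' := by
          rcases B with _ | ⟨d, B⟩
          · simp at hx
          · simp at hx; exact ⟨B, by rw [hx]⟩
        refine ⟨[b], c :: c :: B, rfl, by simp, Or.inr (by simp), ?_, ?_⟩
        · simpa [List.getLast?_append, List.getLast?_replicate] using hbc
        · have := metablocks_append_run (A := e ++ (List.replicate (k + 2) a ++ [b])) (b := c) (B := B)
            (by simp; omega) (by simpa [List.getLast?_append, List.getLast?_replicate] using hbc)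
          rw [metablocks_run he (by simp) he' (by simpa using hB)] at this
          simpa using this

/-- The recursion over metablocks: facts about all blocks follow by splitting off the first
metablock. That the symbols at the seam differ is what keeps a block `b b b` from being followed by
`b` in the next metablock. -/
theorem exists_metablocks_cons {T : List ℕ} (hT : 2 ≤ T.length) :
    ∃ t A B, T = A ++ B ∧ 2 ≤ A.length ∧ (B = [] ∨ 2 ≤ B.length) ∧
      (∀ x ∈ A.getLast?, ∀ y ∈ B.head?, x ≠ y) ∧ (t = false → RunFree A) ∧
      metablocks T = (t, A) :: metablocks B := by
  obtain ⟨w, B', rfl, hw, hB⟩ := exists_runFree_prefix T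
  rcases hB with rfl | ⟨b, B'', rfl, hb⟩
  · rw [List.append_nil] at hT ⊢
    refine ⟨false, w, [], by simp, hT, Or.inl rfl, by simp, fun _ => hw, ?_⟩
    exact metablocks_runFree hw (by rintro rfl; simp at hT)
  · by_cases h2 : 2 ≤ w.length
    · refine ⟨false, w, b :: b :: B'', rfl, h2, Or.inr (by simp), by simpa using hb, fun _ => hw, ?_⟩
      rw [metablocks_append_run h2 hb, metablocks_runFree hw (by rintro rfl; simp at h2)]
      rfl
    · obtain ⟨k, B3, h3, h4⟩ := exists_run_prefix b B''
      have h5 : b :: b :: B'' = List.replicate (k + 2) b ++ B3 := by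
        rw [h3, List.replicate_succ (n := k + 1)]; rfl
      rw [h5]
      obtain ⟨z, B', h6, h7, h8, h9, h10⟩ := exists_metablocks_run (k := k) (e := w) (B := B3)
        (by omega) (a := b) (by
          intro x hx
          rcases w with _ | ⟨y, _ | ⟨y', w⟩⟩
          · simp at hx
          · simp at hx hb; rw [hx]; exact hb
          · simp at h2) h4
      refine ⟨true, _, B', ?_, ?_, h8, h9, by simp, h10⟩
      · rw [h6]; simp
      · simp; omega

/-! ### The partition into blocks -/

variable {L R : ℕ}

theorem espBlocks_append {A B : List ℕ} (h : metablocks (A ++ B) = metablocks A ++ metablocks B) :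
    espBlocks L R (A ++ B) = espBlocks L R A ++ espBlocks L R B := by
  unfold espBlocks
  rw [h, List.flatMap_append]

theorem espBlocks_append_run {A : List ℕ} {b : ℕ} {B : List ℕ} (hA : 2 ≤ A.length)
    (hAB : ∀ x ∈ A.getLast?, x ≠ b) :
    espBlocks L R (A ++ b :: b :: B) = espBlocks L R A ++ espBlocks L R (b :: b :: B) :=
  espBlocks_append (metablocks_append_run hA hAB)

theorem espBlocks_nil : espBlocks L R [] = [] := rfl

theorem espBlocks_runFree {w : List ℕ} (h : RunFree w) (hw : w ≠ []) :
    espBlocks L R w = if L ≤ w.length then type2Blocks R w else leftAligned w := by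
  unfold espBlocks
  rw [metablocks_runFree h hw]
  simp

theorem exists_espBlocks_append {T : List ℕ} (hT : 2 ≤ T.length) :
    ∃ X A B, T = A ++ B ∧ 2 ≤ A.length ∧ (B = [] ∨ 2 ≤ B.length) ∧
      (∀ x ∈ A.getLast?, ∀ y ∈ B.head?, x ≠ y) ∧
      (X = leftAligned A ∨ (RunFree A ∧ X = type2Blocks R A)) ∧
      espBlocks L R T = X ++ espBlocks L R B := by
  obtain ⟨t, A, B, h1, h2, h3, h4, h5, h6⟩ := exists_metablocks_cons hT
  by_cases h : t = false ∧ L ≤ A.length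
  · refine ⟨type2Blocks R A, A, B, h1, h2, h3, h4, Or.inr ⟨h5 h.1, rfl⟩, ?_⟩
    unfold espBlocks
    rw [h6, List.flatMap_cons, if_pos h]
  · refine ⟨leftAligned A, A, B, h1, h2, h3, h4, Or.inl rfl, ?_⟩
    unfold espBlocks
    rw [h6, List.flatMap_cons, if_neg h]

theorem flatten_espBlocks {T : List ℕ} (hT : T = [] ∨ 2 ≤ T.length) :
    (espBlocks L R T).flatten = T := by
  induction hn : T.length using Nat.strong_induction_on generalizing T with
  | _ n ih =>
    rcases hT with rfl | hT
    · rfl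
    · obtain ⟨X, A, B, rfl, h2, h3, -, h5, h6⟩ := exists_espBlocks_append (L := L) (R := R) hT
      rw [List.length_append] at hn
      rw [h6, List.flatten_append, ih B.length (by omega) h3 rfl]
      rcases h5 with rfl | ⟨-, rfl⟩
      · rw [flatten_leftAligned]
      · rw [flatten_type2Blocks]

theorem length_of_mem_espBlocks (hR : 1 ≤ R) {T : List ℕ} (hT : T = [] ∨ 2 ≤ T.length) :
    ∀ b ∈ espBlocks L R T, b.length = 2 ∨ b.length = 3 := by
  induction hn : T.length using Nat.strong_induction_on generalizing T with
  | _ n ih =>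
    rcases hT with rfl | hT
    · simp [espBlocks_nil]
    · obtain ⟨X, A, B, rfl, h2, h3, -, h5, h6⟩ := exists_espBlocks_append (L := L) (R := R) hT
      rw [List.length_append] at hn
      intro b hbX
      rw [h6, List.mem_append] at hbX
      rcases hbX with hbX | hbX
      · rcases h5 with rfl | ⟨-, rfl⟩
        · exact length_of_mem_leftAligned h2 hbX
        · exact length_of_mem_type2Blocks hR h2 b hbX
      · exact ih B.length (by omega) h3 rfl b hbX

/-- A triple arises only from an odd remainder, so it is the last block. -/
theorem leftAligned_chain (u : List ℕ) :
    (leftAligned u).IsChain (fun b _ => b.length ≠ 3) := by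
  induction u using leftAligned.induct with
  | case1 => simp [leftAligned]
  | case2 a => simp [leftAligned]
  | case3 a b c => simp [leftAligned]
  | case4 a b t h ih =>
    rw [leftAligned]
    · rw [List.isChain_cons]
      exact ⟨by simp, ih⟩
    · exact h

theorem not_runFree_triple {X : List (List ℕ)} {b : ℕ} (hX : [b, b, b] ∈ X)
    (h : RunFree X.flatten) : False := by
  obtain ⟨s, t, rfl⟩ := List.append_of_mem hX
  rw [List.flatten_append, List.flatten_cons] at h
  have h2 := (List.isChain_append.1 (List.isChain_append.1 h).2.1).1
  simp at h2

/-- A block `b b b` is not followed by another `b`. -/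
theorem espBlocks_chain {T : List ℕ} (hT : T = [] ∨ 2 ≤ T.length) :
    (espBlocks L R T).IsChain (fun u v => ∀ b, u = [b, b, b] → v.head? ≠ some b) := by
  induction hn : T.length using Nat.strong_induction_on generalizing T with
  | _ n ih =>
    rcases hT with rfl | hT
    · simp [espBlocks_nil]
    · obtain ⟨X, A, B, rfl, h2, h3, h4, h5, h6⟩ := exists_espBlocks_append (L := L) (R := R) hT
      rw [List.length_append] at hn
      have hXA : X.flatten = A := by
        rcases h5 with rfl | ⟨-, rfl⟩
        · rw [flatten_leftAligned]
        · rw [flatten_type2Blocks]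
      rw [h6, List.isChain_append]
      refine ⟨?_, ih B.length (by omega) h3 rfl, ?_⟩
      -- Inside one metablock a triple is last if the parsing is left aligned, and a block `b b b`
      -- does not occur at all if the metablock is run-free.
      · rcases h5 with rfl | ⟨hA, -⟩
        · refine (leftAligned_chain A).imp fun {u v} h b hu => ?_
          rw [hu] at h
          simp at h
        · rw [← hXA] at hA
          have : ∀ u ∈ X, ∀ b, u ≠ [b, b, b] := by
            rintro u hu b rfl
            exact not_runFree_triple hu hA
          rw [List.isChain_iff_getElem]
          intro i hi b hb
          exact absurd hb (this _ (List.getElem_mem _) b)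
      -- Across the seam the claim holds because the last symbol of `A` differs from the first
      -- symbol of `B`.
      · rintro u hu v hv b rfl hb
        obtain ⟨X', rfl⟩ : ∃ X', X = X' ++ [[b, b, b]] := by
          obtain ⟨hne, h⟩ := List.mem_getLast?_eq_getLast hu
          exact ⟨X.dropLast, by rw [h, List.dropLast_append_getLast hne]⟩
        have hB : B.head? = some b := by
          rw [← flatten_espBlocks (L := L) (R := R) h3]
          obtain ⟨E', hE⟩ : ∃ E', espBlocks L R B = v :: E' := by
            rcases h : espBlocks L R B with _ | ⟨c, E'⟩
            · rw [h] at hv; simp at hv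
            · rw [h] at hv; simp at hv; exact ⟨E', by rw [hv]⟩
          rw [hE, List.flatten_cons, List.head?_append, hb]
          rfl
        have hA : A.getLast? = some b := by
          rw [← hXA, List.flatten_append]
          simp [List.getLast?_append]
        exact h4 b hA b hB rfl

theorem not_isCut_succ {Bs : List (List ℕ)} (h : ∀ b ∈ Bs, 2 ≤ b.length) {x : ℕ}
    (h1 : IsCut Bs x) (h2 : IsCut Bs (x + 1)) : False := by
  induction Bs generalizing x with
  | nil => rw [isCut_nil] at h2; omega
  | cons b Bs ih =>
    have hb := h b (by simp)
    rw [isCut_cons] at h1 h2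
    rcases h2 with h2 | ⟨y, hy, h2⟩
    · omega
    · rcases h1 with rfl | ⟨z, hz, rfl⟩
      · omega
      · obtain rfl : y = z + 1 := by omega
        exact ih (fun b hb => h b (by simp [hb])) hz hy

variable {L R : ℕ}

/-! ### Local consistency -/

theorem isCut_append_congr {A B B' : List (List ℕ)} {x : ℕ}
    (h : A.flatten.length ≤ x → IsCut B (x - A.flatten.length) → IsCut B' (x - A.flatten.length))
    (hx : IsCut (A ++ B) x) : IsCut (A ++ B') x := by
  rcases Nat.lt_or_ge x A.flatten.length with h1 | h1
  · rw [isCut_append_of_le h1.le] at hx ⊢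
    exact hx
  · rw [isCut_append_of_ge h1] at hx ⊢
    exact h h1 hx

theorem isCut_leftAligned_append {A : List ℕ} {B : List (List ℕ)} {x : ℕ}
    (hx : x + 4 ≤ A.length) : IsCut (leftAligned A ++ B) x ↔ x % 2 = 0 := by
  rw [isCut_append_of_le (by rw [flatten_leftAligned]; omega), isCut_leftAligned, LACut]
  omega

/-- Cut positions which are far from the end of a prefix `U` are determined by `U`. -/
theorem espBlocks_isCut_prefix {M : ℕ} (hLM : L + 4 ≤ M) (hRM : R + 20 ≤ M) {U V V' : List ℕ}
    (hb : ∀ a ∈ U ++ V, a < tower R) (hb' : ∀ a ∈ U ++ V', a < tower R) {x : ℕ}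
    (hx : x + M ≤ U.length) (h : IsCut (espBlocks L R (U ++ V)) x) :
    IsCut (espBlocks L R (U ++ V')) x := by
  induction hn : U.length using Nat.strong_induction_on generalizing U x with
  | _ n ih =>
  -- removing a common first part of the blocks
  have step : ∀ A U' : List ℕ, U = A ++ U' → 2 ≤ A.length →
      (∀ V, espBlocks L R (U ++ V) = espBlocks L R A ++ espBlocks L R (U' ++ V)) →
      IsCut (espBlocks L R (U ++ V')) x := by
    intro A U' hU hA hE
    have hAl : (espBlocks L R A).flatten.length = A.length := by
      rw [flatten_espBlocks (Or.inr hA)]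
    rw [hE] at h ⊢
    refine isCut_append_congr (fun h1 h2 => ?_) h
    rw [hAl] at h1 h2 ⊢
    have hUl : U.length = A.length + U'.length := by rw [hU, List.length_append]
    refine ih U'.length (by omega) (U := U') ?_ ?_ (by omega) h2 rfl
    · intro a ha
      refine hb a ?_
      rw [hU, List.append_assoc]
      exact List.mem_append_right _ ha
    · intro a ha
      refine hb' a ?_
      rw [hU, List.append_assoc]
      exact List.mem_append_right _ ha
  obtain ⟨w, B, hU, hw, hB⟩ := exists_runFree_prefix U
  by_cases hw2 : 2 ≤ w.length
  · rcases hB with rfl | ⟨b, B'', rfl, hbw⟩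
    · -- no repetition is visible
      rw [List.append_nil] at hU
      subst hU
      -- The last symbol of `U` may begin a repetition that continues in `V`, so only `U.dropLast`
      -- is certain to lie in the first segment. This segment is long enough to be of Type 2.
      have key : ∀ V, (∀ a ∈ U ++ V, a < tower R) → ∃ Z Y, RunFree (U.dropLast ++ Z) ∧
          (∀ a ∈ U.dropLast ++ Z, a < tower R) ∧
          espBlocks L R (U ++ V) = type2Blocks R (U.dropLast ++ Z) ++ Y := by
        intro V hV
        obtain ⟨w, B, h1, h2, h3⟩ := exists_runFree_prefix (U ++ V)
        have h4 : U.length ≤ w.length + 1 := by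
          by_contra h4
          rcases h3 with rfl | ⟨b, B'', rfl, -⟩
          · have := congrArg List.length h1
            simp at this
            omega
          · have e1 : U[w.length]? = some b := by
              rw [← List.getElem?_append_left (l₂ := V) (by omega), h1,
                List.getElem?_append_right le_rfl]
              simp
            have e2 : U[w.length + 1]? = some b := by
              rw [← List.getElem?_append_left (l₂ := V) (by omega), h1,
                List.getElem?_append_right (by omega)]
              simp
            exact runFree_iff.1 hw _ _ _ e1 e2 rfl
        have h5 : U.dropLast <+: w := by
          refine List.prefix_of_prefix_length_le (l₃ := U ++ V)
            ((List.dropLast_prefix U).trans (List.prefix_append U V)) ?_ ?_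
          · rw [h1]; exact List.prefix_append _ _
          · rw [List.length_dropLast]; omega
        obtain ⟨Z, hZ⟩ := h5
        have hwne : w ≠ [] := by rintro rfl; simp at h4; omega
        refine ⟨Z, espBlocks L R B, hZ ▸ h2, ?_, ?_⟩
        · intro a ha
          refine hV a ?_
          rw [h1, ← hZ]
          exact List.mem_append_left _ ha
        · rw [hZ, h1]
          have : espBlocks L R w = type2Blocks R w := by
            rw [espBlocks_runFree h2 hwne, if_pos (by omega)]
          rw [← this]
          rcases h3 with rfl | ⟨b, B'', rfl, h6⟩
          · simp [espBlocks_nil]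
          · exact espBlocks_append_run (by omega) h6
      obtain ⟨Z, Y, k1, k2, k3⟩ := key V hb
      obtain ⟨Z', Y', k1', k2', k3'⟩ := key V' hb'
      have hdl : U.dropLast.length = U.length - 1 := List.length_dropLast
      rw [k3, isCut_append_of_le (by rw [flatten_type2Blocks, List.length_append]; omega)] at h
      rw [k3', isCut_append_of_le (by rw [flatten_type2Blocks, List.length_append]; omega)]
      exact (type2_isCut_congr_prefix k1 k1' k2 k2' (by omega) (by omega)).1 h
    · refine step w (b :: b :: B'') hU hw2 fun V => ?_
      rw [hU, List.append_assoc]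
      exact espBlocks_append_run hw2 hbw
  · rcases hB with rfl | ⟨b, B'', rfl, hbw⟩
    · have := congrArg List.length hU
      simp at this
      have hx0 : x = 0 := by omega
      subst hx0
      exact isCut_zero _
    · obtain ⟨k, B3, h3, h4⟩ := exists_run_prefix b B''
      have h5 : b :: b :: B'' = List.replicate (k + 2) b ++ B3 := by
        rw [h3, List.replicate_succ (n := k + 1)]; rfl
      rw [h5] at hU
      have hwb : ∀ x ∈ w, x ≠ b := by
        intro x hx
        rcases w with _ | ⟨y, _ | ⟨y', w⟩⟩
        · simp at hx
        · simp at hx hbw; rw [hx]; exact hbw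
        · simp at hw2
      have hUl : U.length = w.length + (k + 2) + B3.length := by
        rw [hU]; simp; omega
      have hlast : (w ++ List.replicate (k + 2) b).getLast? = some b := by
        simp [List.getLast?_append, List.getLast?_replicate]
      rcases B3 with _ | ⟨z1, _ | ⟨z2, _ | ⟨z3, B3⟩⟩⟩
      rotate_right
      · -- the end of the repetition is visible
        -- Three visible symbols behind the repetition decide whether `z1` starts a repetition, is a
        -- lone symbol to be attached, or starts a longer segment. In each case the first metablock
        -- is known and can be split off.
        by_cases h12 : z1 = z2
        · subst h12
          refine step (w ++ List.replicate (k + 2) b) (z1 :: z1 :: z3 :: B3) (by rw [hU]; simp)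
            (by simp; omega) fun V => ?_
          rw [hU, ← List.append_assoc, List.append_assoc (w ++ _)]
          exact espBlocks_append_run (by simp; omega) (by rw [hlast]; simpa using h4)
        · by_cases h23 : z2 = z3
          · subst h23
            refine step (w ++ List.replicate (k + 2) b ++ [z1]) (z2 :: z2 :: B3) (by rw [hU]; simp)
              (by simp; omega) fun V => ?_
            rw [hU]
            have := espBlocks_append_run (L := L) (R := R) (A := w ++ List.replicate (k + 2) b ++ [z1])
              (b := z2) (B := B3 ++ V) (by simp; omega) (by simpa using h12)
            simpa using this
          · refine step (w ++ List.replicate (k + 2) b) (z1 :: z2 :: z3 :: B3) (by rw [hU]; simp)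
              (by simp; omega) fun V => ?_
            have he2 : w ++ List.replicate (k + 2) b = (w ++ List.replicate k b) ++ [b, b] := by
              rw [List.append_assoc, show [b, b] = List.replicate 2 b from rfl,
                List.replicate_append_replicate]
            have := espBlocks_append (L := L) (R := R) (metablocks_append_segment
              (A := w ++ List.replicate k b) (a := b) (b := z1) (c := z2) (B := z3 :: B3 ++ V)
              (by simpa using h4) h12 (by simpa using h23))
            rw [← he2] at this
            rw [hU]
            simpa using this
      -- Here at most two symbols behind the repetition are visible. Whatever follows, the first
      -- metablock is left aligned and covers `U` up to these two symbols, so in both strings the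
      -- cuts in question are the even positions.
      all_goals
        have key : ∀ V, ∃ A Y, U.length ≤ A.length + 2 ∧
            espBlocks L R (U ++ V) = leftAligned A ++ Y := by
          intro V
          obtain ⟨k', B4, h6, h7⟩ := exists_run_prefix b (List.replicate (k + 1) b ++ (U.drop (w.length + (k + 2)) ++ V))
          have h8 : U ++ V = w ++ (List.replicate (k' + 1) b ++ B4) := by
            rw [← h6, hU]
            simp [List.replicate_succ, List.drop_append]
          have h9 : k + 1 ≤ k' := by
            by_contra h9
            have hg := congrArg (fun l => l[k' + 1]?) h6
            rw [List.getElem?_append_right (by simp), List.length_replicate, Nat.sub_self,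
              List.getElem?_cons_succ, List.getElem?_append_left (by simp; omega),
              List.getElem?_replicate, if_pos (by omega)] at hg
            rw [← List.head?_eq_getElem?] at hg
            exact h7 b (by rw [← hg]; rfl) rfl
          obtain ⟨k', rfl⟩ : ∃ j, k' = j + 1 := ⟨k' - 1, by omega⟩
          obtain ⟨z, B', -, -, -, -, h10⟩ := exists_metablocks_run (k := k') (e := w) (B := B4)
            (by omega) hwb h7
          refine ⟨w ++ (List.replicate (k' + 2) b ++ z), espBlocks L R B', ?_, ?_⟩
          · simp only [List.length_append, List.length_replicate, List.length_cons,
              List.length_nil] at hUl ⊢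
            omega
          · unfold espBlocks
            rw [h8, h10, List.flatMap_cons, if_neg (by simp)]
        obtain ⟨A, Y, k1, k2⟩ := key V
        obtain ⟨A', Y', k1', k2'⟩ := key V'
        rw [k2, isCut_leftAligned_append (by omega)] at h
        rw [k2', isCut_leftAligned_append (by omega)]
        exact h

/-- The symbols of `P` are moved to `Q` one at a time until the run-free part ends. If a repetition
is met at once, the first symbol of `Q` belongs to it; this is the reason for the extra one in the
bound for `A`. -/
theorem exists_segment_left {Q : List ℕ} (P : List ℕ) (hQ : RunFree Q) (hl : 4 ≤ Q.length) :
    ∃ A w, P ++ Q = A ++ w ∧ RunFree w ∧ A.length ≤ P.length + 1 ∧ (A = [] ∨ 2 ≤ A.length) ∧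
      ∀ Z, espBlocks L R (P ++ Q ++ Z) = espBlocks L R A ++ espBlocks L R (w ++ Z) := by
  induction P using List.reverseRecOn generalizing Q with
  | nil => exact ⟨[], Q, rfl, hQ, by simp, Or.inl rfl, fun Z => rfl⟩
  | append_singleton P c ih =>
    rcases Q with _ | ⟨q0, _ | ⟨q1, _ | ⟨q2, _ | ⟨q3, Q⟩⟩⟩⟩
    iterate 4 simp at hl
    by_cases h : c = q0
    · subst h
      simp only [RunFree, List.isChain_cons_cons] at hQ
      refine ⟨P ++ [c, c], q1 :: q2 :: q3 :: Q, by simp, ?_, by simp, Or.inr (by simp), fun Z => ?_⟩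
      · exact List.isChain_cons_cons.2 ⟨hQ.2.1, List.isChain_cons_cons.2 hQ.2.2⟩
      · have := espBlocks_append (L := L) (R := R) (metablocks_append_segment
          (A := P) (a := c) (b := q1) (c := q2) (B := q3 :: Q ++ Z) hQ.1 hQ.2.1
          (by simpa using hQ.2.2.1))
        simpa using this
    · obtain ⟨A, w, h1, h2, h3, h4, h5⟩ := ih (Q := c :: q0 :: q1 :: q2 :: q3 :: Q)
        (List.isChain_cons_cons.2 ⟨h, hQ⟩) (by simp)
      refine ⟨A, w, by rw [← h1]; simp, h2, by simp; omega, h4, fun Z => ?_⟩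
      rw [← h5]
      simp

/-- The last symbol of `w` may belong to a repetition which continues in `Z`, so only `w.dropLast`
is sure to lie in the segment. -/
theorem exists_segment_right {w : List ℕ} (Z : List ℕ) (hw : RunFree w) (hl : 3 ≤ w.length) :
    ∃ Z₁ B, RunFree (w.dropLast ++ Z₁) ∧ w ++ Z = (w.dropLast ++ Z₁) ++ B ∧
      espBlocks L R (w ++ Z) = espBlocks L R (w.dropLast ++ Z₁) ++ espBlocks L R B := by
  rcases Z with _ | ⟨c, Z⟩
  · refine ⟨[w.getLast (by rintro rfl; simp at hl)], [], ?_, ?_, ?_⟩ <;>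
      rw [List.dropLast_append_getLast]
    · exact hw
    · simp [espBlocks_nil]
  · obtain ⟨u, B, h1, h2, h3⟩ := exists_runFree_prefix (c :: Z)
    obtain ⟨v, d, rfl⟩ : ∃ v d, w = v ++ [d] :=
      ⟨w.dropLast, w.getLast (by rintro rfl; simp at hl), (List.dropLast_append_getLast _).symm⟩
    rw [List.dropLast_concat, h1]
    simp at hl
    have hv := List.isChain_append.1 hw
    by_cases h4 : ∃ c' u', u = c' :: u'
    · obtain ⟨c', u', rfl⟩ := h4
      obtain ⟨rfl, -⟩ : c = c' ∧ Z = u' ++ B := by simpa using h1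
      by_cases h5 : d = c
      · subst h5
        refine ⟨[], d :: d :: (u' ++ B), by simpa using hv.1, by simp, ?_⟩
        have := espBlocks_append_run (L := L) (R := R) (A := v) (b := d) (B := u' ++ B) (by omega)
          (fun x hx => hv.2.2 x hx d (by simp))
        simpa using this
      · have hr : RunFree (v ++ [d] ++ (c :: u')) := by
          refine List.isChain_append.2 ⟨hw, h2, ?_⟩
          simpa using h5
        refine ⟨d :: c :: u', B, by simpa using hr, by simp, ?_⟩
        rcases h3 with rfl | ⟨b, B'', rfl, h6⟩
        · simp [espBlocks_nil]
        · have := espBlocks_append_run (L := L) (R := R) (A := v ++ d :: c :: u') (b := b) (B := B'')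
            (by simp; omega) (by
              intro x hx
              refine h6 x ?_
              simpa [List.getLast?_append, List.getLast?_cons_cons] using hx)
          simpa using this
    · obtain rfl : u = [] := by
        rcases u with _ | ⟨a, b⟩
        · rfl
        · exact absurd ⟨a, b, rfl⟩ h4
      rcases h3 with rfl | ⟨b, B'', rfl, -⟩
      · simp at h1
      · by_cases h5 : d = b
        · subst h5
          refine ⟨[], d :: d :: d :: B'', by simpa using hv.1, by simp, ?_⟩
          have := espBlocks_append_run (L := L) (R := R) (A := v) (b := d) (B := d :: B'') (by omega)
            (fun x hx => hv.2.2 x hx d (by simp))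
          simpa using this
        · refine ⟨[d], b :: b :: B'', hw, by simp, ?_⟩
          have := espBlocks_append_run (L := L) (R := R) (A := v ++ [d]) (b := b) (B := B'') (by simp; omega)
            (by simpa using h5)
          simpa using this

theorem drop_eq_getD_cons {W : List ℕ} {z : ℕ} (h : z < W.length) :
    W.drop z = W.getD z 0 :: W.drop (z + 1) := by
  rw [List.drop_eq_getElem_cons h, List.getD_eq_getElem _ _ h]

theorem take_succ_eq_getD {W : List ℕ} {z : ℕ} (h : z < W.length) :
    W.take (z + 1) = W.take z ++ [W.getD z 0] := by
  rw [List.take_succ_eq_append_getElem h, List.getD_eq_getElem _ _ h]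

/-- Local consistency: a cut position in the middle of `W` is determined by `W`, if there is a
boundary of a run between it and the front part of `W`. -/
theorem espBlocks_isCut_congr {M : ℕ} (hR : 1 ≤ R) (hLM : L + 4 ≤ M) (hRM : R + 25 ≤ M)
    {A A' W Z Z' : List ℕ}
    (hb : ∀ a ∈ A ++ W ++ Z, a < tower R) (hb' : ∀ a ∈ A' ++ W ++ Z', a < tower R) {x y : ℕ}
    (hy : M ≤ y) (hyx : y ≤ x) (hx : x + M ≤ W.length) (hne : W.getD (y - 1) 0 ≠ W.getD y 0)
    (h : IsCut (espBlocks L R (A ++ W ++ Z)) (A.length + x)) :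
    IsCut (espBlocks L R (A' ++ W ++ Z')) (A'.length + x) := by
  set g : ℕ → ℕ := fun t => W.getD t 0 with hg
  have hdrop : ∀ z < W.length, W.drop z = g z :: W.drop (z + 1) := fun z hz => drop_eq_getD_cons hz
  have htake : ∀ z < W.length, W.take (z + 1) = W.take z ++ [g z] := fun z hz => take_succ_eq_getD hz
  have hbW : ∀ z Y, (∀ a ∈ W.drop z ++ Y, a ∈ W ∨ a ∈ Y) := by
    intro z Y a ha
    rcases List.mem_append.1 ha with ha | ha
    · exact Or.inl (List.mem_of_mem_drop ha)
    · exact Or.inr ha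
  have hfl : ∀ (P : List ℕ) z, 2 ≤ z → z ≤ W.length →
      (espBlocks L R (P ++ W.take z)).flatten.length = P.length + z := by
    intro P z hz hzW
    have : (P ++ W.take z).length = P.length + z := by simp; omega
    rw [flatten_espBlocks (Or.inr (by omega)), this]
  -- A place `z ≤ x` at which the parse separates in every context reduces the claim to cuts far
  -- from the end of a common prefix. From `z ≥ 2` on, attaching a lone first symbol cannot
  -- interfere.
  have split : ∀ z, 2 ≤ z → z ≤ x → (∀ P Z, espBlocks L R (P ++ W ++ Z) =
      espBlocks L R (P ++ W.take z) ++ espBlocks L R (W.drop z ++ Z)) →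
      IsCut (espBlocks L R (A' ++ W ++ Z')) (A'.length + x) := by
    intro z hz hzx hE
    rw [hE, isCut_append_of_ge (by rw [hfl _ z hz (by omega)]; omega), hfl _ z hz (by omega)] at h ⊢
    rw [show A.length + x - (A.length + z) = x - z by omega] at h
    rw [show A'.length + x - (A'.length + z) = x - z by omega]
    refine espBlocks_isCut_prefix (M := M) hLM (by omega) ?_ ?_ (by rw [List.length_drop]; omega) h
    · intro a ha
      refine hb a ?_
      rcases hbW _ _ a ha with ha | ha <;> simp [ha]
    · intro a ha
      refine hb' a ?_
      rcases hbW _ _ a ha with ha | ha <;> simp [ha]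
  have run_split : ∀ z, 2 ≤ z → z + 1 < W.length → g (z - 1) ≠ g z → g z = g (z + 1) →
      ∀ P Z, espBlocks L R (P ++ W ++ Z) =
        espBlocks L R (P ++ W.take z) ++ espBlocks L R (W.drop z ++ Z) := by
    intro z hz hzW h1 h2 P Z
    have h3 : W.drop z = g z :: g z :: W.drop (z + 2) := by
      rw [hdrop z (by omega), hdrop (z + 1) hzW, ← h2]
    have h4 : W.take z = W.take (z - 1) ++ [g (z - 1)] := by
      rw [← htake (z - 1) (by omega), Nat.sub_add_cancel (by omega)]
    have := espBlocks_append_run (L := L) (R := R) (A := P ++ W.take z) (b := g z)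
      (B := W.drop (z + 2) ++ Z) (by simp; omega) (by rw [h4]; simpa using h1)
    rw [h3, List.cons_append, List.cons_append, ← this]
    congr 1
    conv_lhs => rw [← List.take_append_drop z W, h3]
    simp
  have seg_split : ∀ z, 2 ≤ z → z + 2 < W.length → g (z - 2) = g (z - 1) → g (z - 1) ≠ g z →
      g z ≠ g (z + 1) → g (z + 1) ≠ g (z + 2) →
      ∀ P Z, espBlocks L R (P ++ W ++ Z) =
        espBlocks L R (P ++ W.take z) ++ espBlocks L R (W.drop z ++ Z) := by
    intro z hz hzW h0 h1 h2 h3 P Z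
    have h4 : W.drop z = g z :: g (z + 1) :: g (z + 2) :: W.drop (z + 3) := by
      rw [hdrop z (by omega), hdrop (z + 1) (by omega), hdrop (z + 2) (by omega)]
    have h5 : W.take z = W.take (z - 2) ++ [g (z - 1), g (z - 1)] := by
      have e1 := htake (z - 1) (by omega)
      have e2 := htake (z - 2) (by omega)
      rw [Nat.sub_add_cancel (by omega)] at e1
      rw [show z - 2 + 1 = z - 1 by omega] at e2
      rw [e1, e2, h0]
      simp
    have := espBlocks_append (L := L) (R := R) (metablocks_append_segment
      (A := P ++ W.take (z - 2)) (a := g (z - 1)) (b := g z) (c := g (z + 1))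
      (B := g (z + 2) :: W.drop (z + 3) ++ Z) h1 h2 (by simpa using h3))
    rw [h5, h4]
    rw [← List.append_assoc]
    simp only [List.cons_append] at this ⊢
    rw [← this]
    congr 1
    conv_lhs => rw [← List.take_append_drop z W, h4, h5]
    simp
  by_cases hrep : ∃ t, 2 ≤ t ∧ t ≤ x ∧ g t = g (t + 1)
  · obtain ⟨t, ht2, htx, ht⟩ := hrep
    by_cases hi : ∃ z, 2 ≤ z ∧ z ≤ x ∧ g (z - 1) ≠ g z ∧ g z = g (z + 1)
    · obtain ⟨z, h1, h2, h3, h4⟩ := hi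
      exact split z h1 h2 (run_split z h1 (by omega) h3 h4)
    · push Not at hi
      -- the run that contains `t` starts in front of position two
      have hdown : ∀ j, j + 1 ≤ t → g (t - j) = g (t - j + 1) := by
        intro j
        induction j with
        | zero => intro _; exact ht
        | succ j ih =>
          intro hj
          have h1 := ih (by omega)
          by_contra h3
          refine hi (t - j) (by omega) (by omega) ?_ h1
          rw [show t - (j + 1) + 1 = t - j by omega] at h3
          rwa [show t - j - 1 = t - (j + 1) by omega]
      -- The end `e` of this run is visible and at most `y`: this is the use of the boundary given
      -- by `hne`.
      have hne' : ∃ e, 2 ≤ e ∧ g (e - 1) ≠ g e := ⟨y, by omega, hne⟩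
      classical
      obtain ⟨he2, hee⟩ := Nat.find_spec hne'
      have hemin : ∀ m < Nat.find hne', ¬ (2 ≤ m ∧ g (m - 1) ≠ g m) := fun m hm =>
        Nat.find_min hne' hm
      have hey : Nat.find hne' ≤ y := Nat.find_min' hne' ⟨by omega, hne⟩
      revert he2 hee hemin hey
      generalize Nat.find hne' = e
      intro he2 hee hemin hey
      have het : t + 1 < e := by
        by_contra h1
        have := hdown (t - (e - 1)) (by omega)
        rw [show t - (t - (e - 1)) = e - 1 by omega, Nat.sub_add_cancel (by omega)] at this
        exact hee this
      have h0 : g (e - 2) = g (e - 1) := by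
        by_contra h1
        exact hemin (e - 1) (by omega) ⟨by omega, h1⟩
      have h1 : g e ≠ g (e + 1) := hi e he2 (by omega) hee
      -- If a repetition starts at `e + 1`, then `e + 1 > x` by `hi`, so `e = x` is a lone symbol
      -- attached to the run on its left. A cut at `x` would then be next to the certain cut at `e +
      -- 1`. Otherwise a segment of length at least two starts at `e`.
      by_cases h2 : g (e + 1) = g (e + 2)
      · rcases Nat.eq_or_lt_of_le (hey.trans hyx) with rfl | h3
        · exfalso
          have hE := run_split (e + 1) (by omega) (by omega) h1 h2 A Z
          have hc : IsCut (espBlocks L R (A ++ W ++ Z)) (A.length + e + 1) := by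
            rw [hE, isCut_append_of_ge (by rw [hfl _ _ (by omega) (by omega)]; omega),
              hfl _ _ (by omega) (by omega), show A.length + e + 1 - (A.length + (e + 1)) = 0 by omega]
            exact isCut_zero _
          refine not_isCut_succ (fun b hbb => ?_) h hc
          have := length_of_mem_espBlocks hR (Or.inr (by simp; omega)) b hbb
          omega
        · exact absurd h2 (hi (e + 1) (by omega) h3 h1)
      · exact split e he2 (hey.trans hyx) (seg_split e he2 (by omega) h0 hee h1 h2)
  · push Not at hrep
    -- No repetition meets the positions from two to `x`, so `x` lies in a run-free stretch `Q`
    -- which is long enough for Type 2 parsing in either context.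
    obtain ⟨Q, B, hQB, hQ, hB⟩ := exists_runFree_prefix (W.drop 2)
    have hQBl : W.length = 2 + Q.length + B.length := by
      have := congrArg List.length hQB
      rw [List.length_drop, List.length_append] at this
      omega
    have hQx : x ≤ Q.length + 1 := by
      by_contra h1
      rcases hB with rfl | ⟨b, B'', rfl, -⟩
      · simp at hQBl
        omega
      · refine hrep (Q.length + 2) (by omega) (by omega) ?_
        have e1 : (W.drop 2)[Q.length]? = some b := by
          rw [hQB, List.getElem?_append_right le_rfl]; simp
        have e2 : (W.drop 2)[Q.length + 1]? = some b := by
          rw [hQB, List.getElem?_append_right (by omega)]; simp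
        rw [List.getElem?_drop] at e1 e2
        simp only [hg, List.getD_eq_getElem?_getD]
        rw [show Q.length + 2 = 2 + Q.length by omega, e1,
          show 2 + Q.length + 1 = 2 + (Q.length + 1) by omega, e2]
    have hWQ : W = W.take 2 ++ (Q ++ B) := by rw [← hQB, List.take_append_drop]
    -- the segment that contains `x`
    have key : ∀ A Z : List ℕ, (∀ a ∈ A ++ W ++ Z, a < tower R) →
        ∃ A₀ P₁ : List ℕ, A₀.length + P₁.length = A.length + 3 ∧ (A₀ = [] ∨ 2 ≤ A₀.length) ∧
          RunFree (P₁ ++ Q.tail) ∧ (∀ a ∈ P₁ ++ Q.tail, a < tower R) ∧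
          espBlocks L R (A ++ W ++ Z) =
            espBlocks L R A₀ ++ espBlocks L R (P₁ ++ Q.tail ++ (B ++ Z)) := by
      intro A Z hAZ
      obtain ⟨A₀, w, h1, h2, h3, h4, h5⟩ := exists_segment_left (L := L) (R := R) (A ++ W.take 2) hQ
        (by omega)
      have hQt : Q = Q.take 1 ++ Q.tail := by
        rw [← List.drop_one, List.take_append_drop]
      have hPl : (A ++ W.take 2).length = A.length + 2 := by simp; omega
      have hPl' : (A ++ W.take 2 ++ Q.take 1).length = A.length + 3 := by
        rw [List.length_append, hPl, List.length_take]; omega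
      have hw : w = (A ++ W.take 2 ++ Q.take 1).drop A₀.length ++ Q.tail := by
        rw [← List.drop_append_of_le_length (by omega), List.append_assoc _ (Q.take 1), ← hQt, h1,
          List.drop_left]
      refine ⟨A₀, (A ++ W.take 2 ++ Q.take 1).drop A₀.length, ?_, h4, hw ▸ h2, ?_, ?_⟩
      · rw [List.length_drop]; omega
      · rw [← hw]
        intro a ha
        refine hAZ a ?_
        have : a ∈ A ++ W.take 2 ++ Q := by rw [h1]; simp [ha]
        rw [hWQ]
        simp only [List.mem_append] at this ⊢
        tauto
      · rw [← hw, ← h5]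
        congr 1
        conv_lhs => rw [hWQ]
        simp
    obtain ⟨A₀, P₁, k1, k2, k3, k4, k5⟩ := key A Z hb
    obtain ⟨A₁, P₂, k1', k2', k3', k4', k5'⟩ := key A' Z' hb'
    have hA₀ : (espBlocks L R A₀).flatten.length = A₀.length := by rw [flatten_espBlocks k2]
    have hA₁ : (espBlocks L R A₁).flatten.length = A₁.length := by rw [flatten_espBlocks k2']
    rw [k5, isCut_append_of_ge (by omega), hA₀,
      show A.length + x - A₀.length = P₁.length + (x - 3) by omega] at h
    rw [k5', isCut_append_of_ge (by omega), hA₁,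
      show A'.length + x - A₁.length = P₂.length + (x - 3) by omega]
    have hQtl : Q.tail.length = Q.length - 1 := by simp
    have htype : ∀ w : List ℕ, RunFree w → L ≤ w.length → 0 < w.length →
        espBlocks L R w = type2Blocks R w := by
      intro w hw hL h0
      rw [espBlocks_runFree hw (by rintro rfl; simp at h0), if_pos hL]
    -- Either the segment reaches the end of `W`, and `x` is far from both ends of it, or a
    -- repetition in `W` ends the segment at the same place in both contexts, and only the front
    -- differs.
    rcases hB with rfl | ⟨b, B'', rfl, hQb⟩
    · simp only [List.length_nil] at hQBl
      have key2 : ∀ P Z : List ℕ, RunFree (P ++ Q.tail) →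
          ∃ Z₁ Y, RunFree (P ++ Q.tail.dropLast ++ Z₁) ∧
            P ++ Q.tail ++ Z = P ++ Q.tail.dropLast ++ Z₁ ++ Y ∧
            espBlocks L R (P ++ Q.tail ++ Z) =
              type2Blocks R (P ++ Q.tail.dropLast ++ Z₁) ++ espBlocks L R Y := by
        intro P Z hP
        obtain ⟨Z₁, Y, h1, h2, h3⟩ := exists_segment_right (L := L) (R := R) Z hP
          (by rw [List.length_append]; omega)
        rw [List.dropLast_append_of_ne_nil (by intro h0; rw [h0] at hQtl; simp at hQtl; omega)] at h1 h2 h3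
        refine ⟨Z₁, Y, h1, h2, ?_⟩
        rw [h3, htype _ h1] <;>
          simp only [List.length_append, List.length_dropLast] <;> omega
      obtain ⟨Z₁, Y, m1, m2, m3⟩ := key2 P₁ Z k3
      obtain ⟨Z₂, Y', m1', m2', m3'⟩ := key2 P₂ Z' k3'
      have hdl : Q.tail.dropLast.length = Q.length - 2 := by
        rw [List.length_dropLast]; omega
      rw [List.nil_append, m3, isCut_append_of_le (by
        rw [flatten_type2Blocks]; simp only [List.length_append]; omega)] at h
      rw [List.nil_append, m3', isCut_append_of_le (by
        rw [flatten_type2Blocks]; simp only [List.length_append]; omega)]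
      refine (type2_isCut_congr_middle m1 m1' ?_ ?_ (by omega) (by omega)).1 h
      · intro a ha
        have h6 : a ∈ P₁ ++ Q.tail ++ Z := by rw [m2]; exact List.mem_append_left _ ha
        rcases List.mem_append.1 h6 with h6 | h6
        · exact k4 a h6
        · exact hb a (by simp [h6])
      · intro a ha
        have h6 : a ∈ P₂ ++ Q.tail ++ Z' := by rw [m2']; exact List.mem_append_left _ ha
        rcases List.mem_append.1 h6 with h6 | h6
        · exact k4' a h6
        · exact hb' a (by simp [h6])
    · have hlast : ∀ P : List ℕ, ∀ z ∈ (P ++ Q.tail).getLast?, z ≠ b := by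
        intro P z hz
        refine hQb z ?_
        rcases Q with _ | ⟨q, _ | ⟨q', Q⟩⟩
        · simp at hQx; omega
        · simp at hQx; omega
        · rw [List.getLast?_cons_cons]
          simpa [List.getLast?_append, List.getLast?_cons] using hz
      have hsp : ∀ P Z : List ℕ, RunFree (P ++ Q.tail) →
          espBlocks L R (P ++ Q.tail ++ (b :: b :: B'' ++ Z)) =
            type2Blocks R (P ++ Q.tail) ++ espBlocks L R (b :: b :: B'' ++ Z) := by
        intro P Z hP
        rw [← htype _ hP (by rw [List.length_append]; omega) (by rw [List.length_append]; omega)]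
        exact espBlocks_append_run (by rw [List.length_append]; omega) (hlast P)
      rw [hsp _ _ k3, isCut_append_of_le (by
        rw [flatten_type2Blocks, List.length_append]; omega)] at h
      rw [hsp _ _ k3', isCut_append_of_le (by
        rw [flatten_type2Blocks, List.length_append]; omega)]
      exact (type2_isCut_congr_suffix k3 k3' k4 k4' (by omega) (by omega)).1 h

/-! ### The levels of a parse -/

/-- The data of `IsESP` with the height made explicit. -/
structure Parse (σ : ℕ) (S : List ℕ) (D : List (List ℕ)) (root h : ℕ) : Prop where
  two_le : 2 ≤ S.length
  lt : ∀ a ∈ S, a < σ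
  nodup : D.Nodup
  top : espLevel σ D S h = [root]
  len : ∀ i < h, 2 ≤ (espLevel σ D S i).length
  mem : ∀ b, b ∈ D ↔ ∃ i < h, b ∈ blocks σ S.length (espLevel σ D S i)

/-- The right-hand side of the rule of a variable. -/
def rule (σ : ℕ) (D : List (List ℕ)) (X : ℕ) : List ℕ := D.getD (X - σ) []

/-- The string derived from a symbol. -/
def str (σ : ℕ) (D : List (List ℕ)) (X : ℕ) : List ℕ := derive σ D [X]

theorem le_tower_logStar (n : ℕ) : n ≤ tower (logStar n) := Nat.find_spec (exists_le_tower n)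

theorem logStar_le {n k : ℕ} (h : n ≤ tower k) : logStar n ≤ k := Nat.find_min' _ h

theorem one_le_logStar {n : ℕ} (h : 2 ≤ n) : 1 ≤ logStar n := by
  by_contra h0
  have := le_tower_logStar n
  rw [show logStar n = 0 by omega] at this
  simp [tower] at this
  omega

theorem le_tower (k : ℕ) : k + 1 ≤ tower k := by
  induction k with
  | zero => simp [tower]
  | succ k ih =>
    have : tower k < 2 ^ tower k := Nat.lt_two_pow_self
    rw [tower]
    omega

/-- A crude logarithmic bound is enough, since `M` may be of the order of `log N`. It lets the
program compute a valid `M` without evaluating `log*`. -/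
theorem logStar_le_of_lt_two_pow {n k : ℕ} (h : n < 2 ^ k) : logStar n ≤ k + 1 := by
  apply logStar_le
  rw [tower]
  have : 2 ^ k ≤ 2 ^ tower k := Nat.pow_le_pow_right (by norm_num) (by have := le_tower k; omega)
  omega

section
variable {σ : ℕ} {S : List ℕ} {D : List (List ℕ)} {root h : ℕ}

theorem espLevel_succ (i : ℕ) : espLevel σ D S (i + 1) =
    (blocks σ S.length (espLevel σ D S i)).map fun b => σ + D.idxOf b := by
  unfold espLevel
  rw [Function.iterate_succ_apply']
  rfl

theorem espLevel_zero : espLevel σ D S 0 = S := rfl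

namespace Parse
variable (P : Parse σ S D root h)
include P

theorem flatten_blocks {i : ℕ} (hi : i < h) :
    (blocks σ S.length (espLevel σ D S i)).flatten = espLevel σ D S i :=
  flatten_espBlocks (Or.inr (P.len i hi))

theorem length_block {i : ℕ} (hi : i < h) {b : List ℕ}
    (hb : b ∈ blocks σ S.length (espLevel σ D S i)) : b.length = 2 ∨ b.length = 3 :=
  length_of_mem_espBlocks (one_le_logStar (by have := P.two_le; omega)) (Or.inr (P.len i hi)) b hb

theorem length_succ {i : ℕ} (hi : i < h) :
    2 * (espLevel σ D S (i + 1)).length ≤ (espLevel σ D S i).length := by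
  rw [espLevel_succ, List.length_map]
  conv_rhs => rw [← P.flatten_blocks hi]
  have := fun b (hb : b ∈ blocks σ S.length (espLevel σ D S i)) => P.length_block hi hb
  revert this
  generalize blocks σ S.length (espLevel σ D S i) = Bs
  intro hB
  induction Bs with
  | nil => simp
  | cons b Bs ih =>
    have h1 := hB b (by simp)
    have h2 := ih fun b hb => hB b (by simp [hb])
    simp only [List.length_cons, List.flatten_cons, List.length_append]
    omega

theorem length_mul {i : ℕ} (hi : i ≤ h) : (espLevel σ D S i).length * 2 ^ i ≤ S.length := by
  induction i with
  | zero => simp [espLevel_zero]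
  | succ i ih =>
    have := ih (by omega)
    have h2 := P.length_succ (i := i) (by omega)
    calc (espLevel σ D S (i + 1)).length * 2 ^ (i + 1)
        = 2 * (espLevel σ D S (i + 1)).length * 2 ^ i := by ring
      _ ≤ (espLevel σ D S i).length * 2 ^ i := Nat.mul_le_mul_right _ h2
      _ ≤ _ := this

theorem two_pow_le : 2 ^ h ≤ S.length := by
  have := P.length_mul le_rfl
  rw [P.top] at this
  simpa using this

theorem height_pos : 1 ≤ h := by
  by_contra h0
  have h1 := P.top
  rw [show h = 0 by omega, espLevel_zero] at h1
  have := P.two_le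
  rw [h1] at this
  simp at this

/-- Lengths at least halve from level to level, so all levels above the string together with one
more copy of the last one fit into `N`. -/
theorem sum_length {k : ℕ} (hk : k ≤ h) :
    ∑ i ∈ Finset.range k, (espLevel σ D S (i + 1)).length + (espLevel σ D S k).length
      ≤ S.length := by
  induction k with
  | zero => simp [espLevel_zero]
  | succ k ih =>
    have := ih (by omega)
    have h2 := P.length_succ (i := k) (by omega)
    rw [Finset.sum_range_succ]
    omega

/-- Every variable occurs on a level above the string, and these levels have fewer than `N` symbols
in total. -/
theorem card_lt : D.length + 1 ≤ S.length := by
  have h1 := P.sum_length le_rfl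
  rw [P.top, List.length_singleton] at h1
  refine le_trans (Nat.add_le_add_right ?_ 1) h1
  rw [← List.toFinset_card_of_nodup P.nodup]
  have h2 : D.toFinset ⊆ (Finset.range h).biUnion
      fun i => (blocks σ S.length (espLevel σ D S i)).toFinset := by
    intro b hb
    rw [List.mem_toFinset, P.mem] at hb
    obtain ⟨i, hi, hb⟩ := hb
    simp only [Finset.mem_biUnion, Finset.mem_range, List.mem_toFinset]
    exact ⟨i, hi, hb⟩
  refine (Finset.card_le_card h2).trans (Finset.card_biUnion_le.trans ?_)
  refine Finset.sum_le_sum fun i hi => ?_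
  rw [espLevel_succ, List.length_map]
  exact List.toFinset_card_le _

theorem idxOf_lt {i : ℕ} (hi : i < h) {b : List ℕ}
    (hb : b ∈ blocks σ S.length (espLevel σ D S i)) : D.idxOf b < D.length :=
  List.idxOf_lt_length_iff.2 ((P.mem b).2 ⟨i, hi, hb⟩)

theorem rule_idxOf {i : ℕ} (hi : i < h) {b : List ℕ}
    (hb : b ∈ blocks σ S.length (espLevel σ D S i)) : rule σ D (σ + D.idxOf b) = b := by
  unfold rule
  rw [Nat.add_sub_cancel_left, List.getD_eq_getElem _ _ (P.idxOf_lt hi hb), List.getElem_idxOf]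

theorem mem_succ {i : ℕ} (hi : i < h) {X : ℕ} (hX : X ∈ espLevel σ D S (i + 1)) :
    σ ≤ X ∧ X < σ + D.length ∧ rule σ D X ∈ blocks σ S.length (espLevel σ D S i) := by
  rw [espLevel_succ, List.mem_map] at hX
  obtain ⟨b, hb, rfl⟩ := hX
  rw [P.rule_idxOf hi hb]
  exact ⟨by omega, by have := P.idxOf_lt hi hb; omega, hb⟩

theorem length_rule {i : ℕ} (hi : i < h) {X : ℕ} (hX : X ∈ espLevel σ D S (i + 1)) :
    (rule σ D X).length = 2 ∨ (rule σ D X).length = 3 :=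
  P.length_block hi (P.mem_succ hi hX).2.2

theorem map_rule {i : ℕ} (hi : i < h) : (espLevel σ D S (i + 1)).map (rule σ D) =
    blocks σ S.length (espLevel σ D S i) := by
  rw [espLevel_succ, List.map_map]
  conv_rhs => rw [← List.map_id (blocks σ S.length (espLevel σ D S i))]
  exact List.map_congr_left fun b hb => P.rule_idxOf hi hb

theorem flatMap_rule {i : ℕ} (hi : i < h) :
    (espLevel σ D S (i + 1)).flatMap (rule σ D) = espLevel σ D S i := by
  rw [List.flatMap_def, P.map_rule hi, P.flatten_blocks hi]

theorem rule_inj {i : ℕ} (hi : i < h) {X Y : ℕ} (hX : X ∈ espLevel σ D S (i + 1))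
    (hY : Y ∈ espLevel σ D S (i + 1)) (he : rule σ D X = rule σ D Y) : X = Y := by
  rw [espLevel_succ, List.mem_map] at hX hY
  obtain ⟨b, hb, rfl⟩ := hX
  obtain ⟨c, hc, rfl⟩ := hY
  rw [P.rule_idxOf hi hb, P.rule_idxOf hi hc] at he
  rw [he]

theorem mem_of_mem_rule {i : ℕ} (hi : i < h) {X x : ℕ} (hX : X ∈ espLevel σ D S (i + 1))
    (hx : x ∈ rule σ D X) : x ∈ espLevel σ D S i := by
  rw [← P.flatMap_rule hi]
  exact List.mem_flatMap.2 ⟨X, hX, hx⟩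

theorem symbol_lt {i : ℕ} (hi : i ≤ h) {X : ℕ} (hX : X ∈ espLevel σ D S i) :
    X < σ + D.length := by
  rcases i with _ | i
  · have := P.lt X hX
    omega
  · exact (P.mem_succ (by omega) hX).2.1

/-- With fewer than `N` variables all symbols are below `σ + N`, and this is why `log* (σ + N)`
rounds of alphabet reduction bring the labels below `6`. -/
theorem symbol_lt_tower {i : ℕ} (hi : i ≤ h) {X : ℕ} (hX : X ∈ espLevel σ D S i) :
    X < tower (logStar (σ + S.length)) := by
  have h1 := P.symbol_lt hi hX
  have h2 := P.card_lt
  have h3 := le_tower_logStar (σ + S.length)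
  omega

/-- Following the rules downwards from both occurrences, letters are reached at the same time, since
letters are below `σ` and variables are not. -/
theorem level_unique {i j X : ℕ} (hi : i ≤ h) (hj : j ≤ h) (hX : X ∈ espLevel σ D S i)
    (hX' : X ∈ espLevel σ D S j) : i = j := by
  induction i generalizing j X with
  | zero =>
    rcases j with _ | j
    · rfl
    · have := (P.mem_succ (by omega) hX').1
      have := P.lt X hX
      omega
  | succ i ih =>
    rcases j with _ | j
    · have := (P.mem_succ (by omega) hX).1
      have := P.lt X hX'
      omega
    · obtain ⟨x, hx⟩ : ∃ x, x ∈ rule σ D X := by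
        apply List.exists_mem_of_length_pos
        have := P.length_rule (by omega) hX
        omega
      rw [ih (by omega) (by omega) (P.mem_of_mem_rule (by omega) hX hx)
        (P.mem_of_mem_rule (by omega) hX' hx)]

/-- One variable per level gives `h` different variables. This shows that the `D.length` expansions
in `derive` are enough to reach letters. -/
theorem height_le : h ≤ D.length := by
  have hne : ∀ i < h, ∃ X, X ∈ espLevel σ D S (i + 1) := by
    intro i hi
    apply List.exists_mem_of_ne_nil
    intro h0
    have h1 := P.flatMap_rule hi
    have h2 := P.len i hi
    rw [h0] at h1
    rw [← h1] at h2
    simp at h2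
  choose! f hf using hne
  have : Set.MapsTo (fun i => f i - σ) (Finset.range h : Set ℕ) (Finset.range D.length : Set ℕ) := by
    intro i hi
    simp only [Finset.coe_range, Set.mem_Iio] at *
    have := P.mem_succ hi (hf i hi)
    omega
  have h2 := Finset.card_le_card_of_injOn _ this (by
    intro i hi j hj hij
    simp only [Finset.coe_range, Set.mem_Iio] at *
    have h1 := P.mem_succ hi (hf i hi)
    have h2 := P.mem_succ hj (hf j hj)
    have : f i = f j := by omega
    have h3 := hf i hi
    rw [this] at h3
    have := P.level_unique (by omega) (by omega) h3 (hf j hj)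
    omega)
  simpa using h2

omit P in
theorem expandOnce_flatMap (T : List ℕ) (k : ℕ) :
    (expandOnce σ D)^[k] T = T.flatMap fun x => (expandOnce σ D)^[k] [x] := by
  induction k generalizing T with
  | zero => simp
  | succ k ih =>
    simp only [Function.iterate_succ_apply]
    rw [ih]
    have : ∀ x, (expandOnce σ D)^[k] (expandOnce σ D [x]) =
      (expandOnce σ D [x]).flatMap fun y => (expandOnce σ D)^[k] [y] := fun x => ih _
    simp only [this]
    unfold expandOnce
    rw [List.flatMap_assoc]
    simp

/-- After `i` expansions a symbol of level `i` has become a string of letters, which further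
expansions leave alone. -/
theorem iterate_succ_of_mem {i k X : ℕ} (hi : i ≤ h) (hk : i ≤ k) (hX : X ∈ espLevel σ D S i) :
    (expandOnce σ D)^[k + 1] [X] = (expandOnce σ D)^[k] [X] := by
  induction i generalizing X k with
  | zero =>
    rw [Function.iterate_succ_apply]
    congr 1
    simp [expandOnce, P.lt X hX]
  | succ i ih =>
    obtain ⟨k, rfl⟩ : ∃ l, k = l + 1 := ⟨k - 1, by omega⟩
    have : expandOnce σ D [X] = rule σ D X := by
      have := (P.mem_succ (by omega) hX).1
      simp [expandOnce, rule, show ¬ X < σ by omega]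
    rw [Function.iterate_succ_apply, Function.iterate_succ_apply (n := k) (x := [X]),
      expandOnce_flatMap (k := k + 1), expandOnce_flatMap (k := k), this]
    exact List.flatMap_congr fun x hx =>
      ih (by omega) (by omega) (P.mem_of_mem_rule (by omega) hX hx)

omit P in
theorem str_letter {a : ℕ} (ha : a < σ) : str σ D a = [a] := by
  unfold str derive
  have : ∀ k, (expandOnce σ D)^[k] [a] = [a] := by
    intro k
    induction k with
    | zero => rfl
    | succ k ih => rw [Function.iterate_succ_apply, ← ih]; congr 1; simp [expandOnce, ha, ih]
  exact this _

theorem str_succ {i X : ℕ} (hi : i < h) (hX : X ∈ espLevel σ D S (i + 1)) :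
    str σ D X = (rule σ D X).flatMap (str σ D) := by
  have hh := P.height_le
  have : expandOnce σ D [X] = rule σ D X := by
    have := (P.mem_succ hi hX).1
    simp [expandOnce, rule, show ¬ X < σ by omega]
  unfold str derive
  obtain ⟨k, hk⟩ : ∃ k, D.length = k + 1 := ⟨D.length - 1, by omega⟩
  rw [hk, Function.iterate_succ_apply, this, expandOnce_flatMap]
  exact List.flatMap_congr fun x hx =>
    (P.iterate_succ_of_mem hi.le (by omega) (P.mem_of_mem_rule hi hX hx)).symm

theorem str_ne_nil {i X : ℕ} (hi : i ≤ h) (hX : X ∈ espLevel σ D S i) : 1 ≤ (str σ D X).length := by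
  induction i generalizing X with
  | zero => rw [str_letter (P.lt X hX)]; simp
  | succ i ih =>
    obtain ⟨x, hx⟩ : ∃ x, x ∈ rule σ D X := by
      apply List.exists_mem_of_length_pos
      have := P.length_rule (by omega) hX
      omega
    rw [P.str_succ (by omega) hX]
    refine le_trans (ih (by omega) (P.mem_of_mem_rule (by omega) hX hx)) ?_
    obtain ⟨s, t, h⟩ := List.append_of_mem hx
    rw [h]
    simp
    omega

theorem flatMap_str {i : ℕ} (hi : i ≤ h) : (espLevel σ D S i).flatMap (str σ D) = S := by
  induction i with
  | zero =>
    rw [espLevel_zero]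
    conv_rhs => rw [← List.flatMap_singleton' S]
    exact List.flatMap_congr fun x hx => str_letter (P.lt x hx)
  | succ i ih =>
    refine Eq.trans ?_ (ih (by omega))
    rw [← P.flatMap_rule (i := i) (by omega), List.flatMap_assoc]
    exact List.flatMap_congr fun x hx => P.str_succ (i := i) (by omega) hx

end Parse
end

/-! ### Segments of the levels -/

section
variable {σ : ℕ} {S : List ℕ} {D : List (List ℕ)} {root h : ℕ}

/-- The symbols `l` of the level `j` derive the characters of `S` at the positions in `[p, q)`. -/
def Seg (σ : ℕ) (D : List (List ℕ)) (S : List ℕ) (j : ℕ) (l : List ℕ) (p q : ℕ) : Prop :=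
  ∃ A Z, espLevel σ D S j = A ++ (l ++ Z) ∧ (A.flatMap (str σ D)).length = p ∧
    q = p + (l.flatMap (str σ D)).length

/-- A symbol of the level `j`, or the end of the level, starts at the position `p` of `S`. -/
def Bd (σ : ℕ) (D : List (List ℕ)) (S : List ℕ) (j p : ℕ) : Prop := Seg σ D S j [] p p

theorem bd_iff {j p : ℕ} : Bd σ D S j p ↔
    ∃ A Z, espLevel σ D S j = A ++ Z ∧ (A.flatMap (str σ D)).length = p := by
  unfold Bd Seg
  simp

theorem Seg.eq_add {j p q : ℕ} {l : List ℕ} (hs : Seg σ D S j l p q) :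
    q = p + (l.flatMap (str σ D)).length := by
  obtain ⟨A, Z, -, -, hq⟩ := hs
  exact hq

theorem Seg.le {j p q : ℕ} {l : List ℕ} (hs : Seg σ D S j l p q) : p ≤ q := by
  have := hs.eq_add
  omega

theorem Seg.mem {j p q x : ℕ} {l : List ℕ} (hs : Seg σ D S j l p q) (hx : x ∈ l) :
    x ∈ espLevel σ D S j := by
  obtain ⟨A, Z, h1, -, -⟩ := hs
  rw [h1]
  simp [hx]

theorem Seg.split {j p q : ℕ} {l₁ l₂ : List ℕ} (hs : Seg σ D S j (l₁ ++ l₂) p q) :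
    ∃ r, Seg σ D S j l₁ p r ∧ Seg σ D S j l₂ r q := by
  obtain ⟨A, Z, h1, h2, h3⟩ := hs
  refine ⟨_, ⟨A, l₂ ++ Z, by rw [h1]; simp, h2, rfl⟩, A ++ l₁, Z, by rw [h1]; simp, ?_, ?_⟩
  · rw [List.flatMap_append, List.length_append, h2]
  · rw [h3, List.flatMap_append, List.length_append]; omega

theorem Seg.split_cons {j p q x : ℕ} {l : List ℕ} (hs : Seg σ D S j (x :: l) p q) :
    ∃ r, Seg σ D S j [x] p r ∧ Seg σ D S j l r q :=
  Seg.split (l₁ := [x]) hs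

theorem Seg.bd_left {j p q : ℕ} {l : List ℕ} (hs : Seg σ D S j l p q) : Bd σ D S j p := by
  obtain ⟨A, Z, h1, h2, h3⟩ := hs
  exact bd_iff.2 ⟨A, _, h1, h2⟩

theorem Seg.bd_right {j p q : ℕ} {l : List ℕ} (hs : Seg σ D S j l p q) : Bd σ D S j q := by
  have : Seg σ D S j (l ++ []) p q := by simpa using hs
  obtain ⟨r, -, h2⟩ := this.split
  have := h2.eq_add
  simp at this
  subst this
  exact h2

theorem bd_zero (j : ℕ) : Bd σ D S j 0 := bd_iff.2 ⟨[], _, rfl, rfl⟩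

namespace Parse
variable (P : Parse σ S D root h)
include P

theorem length_le_str {j : ℕ} (hj : j ≤ h) {l : List ℕ} (hl : ∀ x ∈ l, x ∈ espLevel σ D S j) :
    l.length ≤ (l.flatMap (str σ D)).length := by
  induction l with
  | nil => simp
  | cons x l ih =>
    have := ih fun x hx => hl x (by simp [hx])
    have := P.str_ne_nil hj (hl x (by simp))
    rw [List.length_cons, List.flatMap_cons, List.length_append]
    omega

theorem seg_length_le {j : ℕ} (hj : j ≤ h) {l : List ℕ} {p q : ℕ} (hs : Seg σ D S j l p q) :
    p + l.length ≤ q := by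
  have := P.length_le_str hj fun x hx => hs.mem hx
  have := hs.eq_add
  omega

theorem bd_le {j : ℕ} (hj : j ≤ h) {p : ℕ} (hp : Bd σ D S j p) : p ≤ S.length := by
  obtain ⟨A, Z, h1, rfl⟩ := bd_iff.1 hp
  rw [← P.flatMap_str hj, h1]
  simp

theorem bd_length {j : ℕ} (hj : j ≤ h) : Bd σ D S j S.length :=
  bd_iff.2 ⟨espLevel σ D S j, [], by simp, by rw [P.flatMap_str hj]⟩

/-- No symbol derives the empty string, so a place in a level is determined by its position in `S`.
This makes positions a common coordinate for all levels. -/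
theorem prefix_comparable {j : ℕ} (hj : j ≤ h) {A Z A' Z' : List ℕ}
    (h1 : espLevel σ D S j = A ++ Z) (h2 : espLevel σ D S j = A' ++ Z')
    (h3 : (A.flatMap (str σ D)).length ≤ (A'.flatMap (str σ D)).length) :
    ∃ c, A' = A ++ c ∧ Z = c ++ Z' := by
  rw [h1] at h2
  rcases List.append_eq_append_iff.1 h2 with ⟨c, h4, h5⟩ | ⟨c, h4, h5⟩
  · exact ⟨c, h4, h5⟩
  · rw [h4, List.flatMap_append, List.length_append] at h3
    have h6 := P.length_le_str hj (l := c) fun x hx => by rw [h1, h4]; simp [hx]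
    have h7 : c = [] := List.length_eq_zero_iff.1 (by omega)
    subst h7
    exact ⟨[], by simp_all, by simp_all⟩

theorem prefix_unique {j : ℕ} (hj : j ≤ h) {A Z A' Z' : List ℕ}
    (h1 : espLevel σ D S j = A ++ Z) (h2 : espLevel σ D S j = A' ++ Z')
    (h3 : (A.flatMap (str σ D)).length = (A'.flatMap (str σ D)).length) : A = A' ∧ Z = Z' := by
  obtain ⟨c, h4, h5⟩ := P.prefix_comparable hj h1 h2 h3.le
  have h6 := P.length_le_str hj (l := c) fun x hx => by rw [h1, h5]; simp [hx]
  rw [h4, List.flatMap_append, List.length_append] at h3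
  have h7 : c = [] := List.length_eq_zero_iff.1 (by omega)
  subst h7
  simp_all

theorem seg_append {j : ℕ} (hj : j ≤ h) {l₁ l₂ : List ℕ} {p r q : ℕ} (h1 : Seg σ D S j l₁ p r)
    (h2 : Seg σ D S j l₂ r q) : Seg σ D S j (l₁ ++ l₂) p q := by
  obtain ⟨A, Z, h1, h3, h4⟩ := h1
  obtain ⟨A', Z', h5, h6, h7⟩ := h2
  obtain ⟨rfl, rfl⟩ := P.prefix_unique hj (A := A ++ l₁) (by rw [h1, List.append_assoc]) h5
    (by rw [List.flatMap_append, List.length_append]; omega)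
  exact ⟨A, Z', by rw [h1]; simp, h3, by rw [List.flatMap_append, List.length_append]; omega⟩

theorem seg_unique {j : ℕ} (hj : j ≤ h) {l l' : List ℕ} {p q : ℕ} (h1 : Seg σ D S j l p q)
    (h2 : Seg σ D S j l' p q) : l = l' := by
  obtain ⟨A, Z, h1, h3, h4⟩ := h1
  obtain ⟨A', Z', h5, h6, h7⟩ := h2
  obtain ⟨rfl, h8⟩ := P.prefix_unique hj h1 h5 (by omega)
  exact List.append_cancel_left (P.prefix_unique hj (A := A ++ l) (Z := Z) (A' := A ++ l')
    (Z' := Z') (by rw [h1, List.append_assoc]) (by rw [h5, List.append_assoc])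
    (by simp only [List.flatMap_append, List.length_append]; omega)).1

theorem exists_seg {j : ℕ} (hj : j ≤ h) {p q : ℕ} (hp : Bd σ D S j p) (hq : Bd σ D S j q)
    (hpq : p ≤ q) : ∃ l, Seg σ D S j l p q := by
  obtain ⟨A, Z, h1, h2⟩ := bd_iff.1 hp
  obtain ⟨A', Z', h3, h4⟩ := bd_iff.1 hq
  obtain ⟨c, rfl, rfl⟩ := P.prefix_comparable hj h1 h3 (by omega)
  refine ⟨c, A, Z', by rw [h1], h2, ?_⟩
  rw [← h4, ← h2]
  simp

theorem seg_str {j : ℕ} (hj : j ≤ h) {l : List ℕ} {p q : ℕ} (hs : Seg σ D S j l p q) :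
    l.flatMap (str σ D) = (S.drop p).take (q - p) := by
  obtain ⟨A, Z, h1, h2, h3⟩ := hs
  have h4 := P.flatMap_str hj
  rw [h1, List.flatMap_append, List.flatMap_append] at h4
  rw [← h4, ← h2, List.drop_left, show q - (A.flatMap (str σ D)).length =
    (l.flatMap (str σ D)).length by omega, List.take_left]

theorem seg_right_le {j : ℕ} (hj : j ≤ h) {l : List ℕ} {p q : ℕ} (hs : Seg σ D S j l p q) :
    q ≤ S.length := P.bd_le hj hs.bd_right

/-- The bridge from parsing to positions: it turns local consistency of cuts into a statement about
the boundaries of the next level. -/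
theorem bd_iff_isCut {j : ℕ} (hj : j < h) {A Z : List ℕ} (hA : espLevel σ D S j = A ++ Z) :
    Bd σ D S (j + 1) (A.flatMap (str σ D)).length ↔
      IsCut (blocks σ S.length (espLevel σ D S j)) A.length := by
  have key : ∀ U V, espLevel σ D S (j + 1) = U ++ V →
      espLevel σ D S j = U.flatMap (rule σ D) ++ V.flatMap (rule σ D) ∧
      (U.flatMap (str σ D)).length = ((U.flatMap (rule σ D)).flatMap (str σ D)).length := by
    intro U V hU
    refine ⟨?_, ?_⟩
    · rw [← List.flatMap_append, ← hU, P.flatMap_rule hj]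
    · rw [List.flatMap_assoc]
      congr 1
      exact List.flatMap_congr fun x hx => P.str_succ hj (by rw [hU]; simp [hx])
  rw [bd_iff]
  constructor
  · rintro ⟨U, V, h1, h2⟩
    obtain ⟨h3, h4⟩ := key U V h1
    obtain ⟨h5, -⟩ := P.prefix_unique hj.le hA h3 (by omega)
    refine ⟨U.map (rule σ D), V.map (rule σ D), ?_, ?_⟩
    · rw [← P.map_rule hj, h1, List.map_append]
    · rw [h5, List.flatMap_def]
  · rintro ⟨l₁, l₂, h1, h2⟩
    rw [← P.map_rule hj, List.map_eq_append_iff] at h1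
    obtain ⟨U, V, h3, rfl, rfl⟩ := h1
    obtain ⟨h4, h5⟩ := key U V h3
    refine ⟨U, V, h3, ?_⟩
    rw [h5, ← (List.append_inj (hA.symm.trans h4) (by rw [← h2, List.flatMap_def])).1]

theorem seg_down {j : ℕ} (hj : j < h) {l : List ℕ} {p q : ℕ} (hs : Seg σ D S (j + 1) l p q) :
    Seg σ D S j (l.flatMap (rule σ D)) p q := by
  have hT := P.flatMap_rule hj
  have key : ∀ l : List ℕ, (∀ x ∈ l, x ∈ espLevel σ D S (j + 1)) →
      ((l.flatMap (rule σ D)).flatMap (str σ D)).length = (l.flatMap (str σ D)).length := by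
    intro l hl
    rw [List.flatMap_assoc]
    congr 1
    exact (List.flatMap_congr fun x hx => P.str_succ hj (hl x hx)).symm
  have hm : ∀ x ∈ l, x ∈ espLevel σ D S (j + 1) := fun x hx => hs.mem hx
  obtain ⟨A, Z, h1, h2, h3⟩ := hs
  refine ⟨A.flatMap (rule σ D), Z.flatMap (rule σ D), ?_, ?_, ?_⟩
  · rw [← hT, h1]
    simp only [List.flatMap_append]
  · rw [key _ fun x hx => by rw [h1]; simp [hx], h2]
  · rw [key _ hm, h3]

theorem seg_down_singleton {j : ℕ} (hj : j < h) {X p q : ℕ} (hs : Seg σ D S (j + 1) [X] p q) :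
    Seg σ D S j (rule σ D X) p q := by
  simpa using P.seg_down hj hs

theorem bd_of_bd_succ {j : ℕ} (hj : j < h) {p : ℕ} (hp : Bd σ D S (j + 1) p) : Bd σ D S j p := by
  exact P.seg_down hj hp

theorem bd_of_le {i j : ℕ} (hij : i ≤ j) (hj : j ≤ h) {p : ℕ} (hp : Bd σ D S j p) :
    Bd σ D S i p := by
  induction j with
  | zero => obtain rfl : i = 0 := by omega
            exact hp
  | succ j ih =>
    rcases Nat.eq_or_lt_of_le hij with rfl | hij
    · exact hp
    · exact ih (by omega) (by omega) (P.bd_of_bd_succ (by omega) hp)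

theorem seg_zero {p q : ℕ} (hpq : p ≤ q) (hq : q ≤ S.length) :
    Seg σ D S 0 ((S.drop p).take (q - p)) p q := by
  have : ∀ l : List ℕ, (∀ x ∈ l, x ∈ S) → (l.flatMap (str σ D)) = l := by
    intro l hl
    conv_rhs => rw [← List.flatMap_singleton' l]
    exact List.flatMap_congr fun x hx => str_letter (P.lt x (hl x hx))
  refine ⟨S.take p, S.drop q, ?_, ?_, ?_⟩
  · rw [espLevel_zero]
    conv_lhs => rw [← List.take_append_drop p S, ← List.take_append_drop (q - p) (S.drop p)]
    rw [List.drop_drop, show p + (q - p) = q by omega]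
  · rw [this _ fun x hx => List.mem_of_mem_take hx, List.length_take]
    omega
  · rw [this _ fun x hx => List.mem_of_mem_drop (List.mem_of_mem_take hx), List.length_take,
      List.length_drop]
    omega

theorem bd_zero_level {p : ℕ} (hp : p ≤ S.length) : Bd σ D S 0 p :=
  (P.seg_zero hp le_rfl).bd_left

theorem seg_lift {j : ℕ} (hj : j < h) {l : List ℕ} {p q : ℕ} (hs : Seg σ D S j l p q)
    (hp : Bd σ D S (j + 1) p) (hq : Bd σ D S (j + 1) q) :
    ∃ l', Seg σ D S (j + 1) l' p q ∧ l = l'.flatMap (rule σ D) := by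
  obtain ⟨l', hl⟩ := P.exists_seg hj hp hq hs.le
  exact ⟨l', hl, P.seg_unique hj.le hs (P.seg_down hj hl)⟩

/-- A node is a single symbol, and a boundary strictly inside would split it into two nonempty lists
of symbols of its level. -/
theorem bd_node {j : ℕ} (hj : j ≤ h) {X p r b : ℕ} (hs : Seg σ D S j [X] p r) (hb : Bd σ D S j b) :
    b ≤ p ∨ r ≤ b := by
  by_contra hc
  push Not at hc
  obtain ⟨l₁, h1⟩ := P.exists_seg hj hs.bd_left hb hc.1.le
  obtain ⟨l₂, h2⟩ := P.exists_seg hj hb hs.bd_right hc.2.le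
  have h3 := congrArg List.length (P.seg_unique hj hs (P.seg_append hj h1 h2))
  have h4 : l₁ ≠ [] := by
    rintro rfl
    have := h1.eq_add
    simp at this
    omega
  have h5 : l₂ ≠ [] := by
    rintro rfl
    have := h2.eq_add
    simp at this
    omega
  have h6 := List.length_pos_iff.2 h4
  have h7 := List.length_pos_iff.2 h5
  rw [List.length_append, List.length_singleton] at h3
  omega

theorem node_lt {j : ℕ} (hj : j ≤ h) {X p r : ℕ} (hs : Seg σ D S j [X] p r) : p < r := by
  have := P.seg_length_le hj hs
  simp at this
  omega

theorem exists_node {j : ℕ} (hj : j ≤ h) {p : ℕ} (hp : p < S.length) :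
    ∃ X a b, Seg σ D S j [X] a b ∧ a ≤ p ∧ p < b := by
  obtain ⟨l, hl⟩ := P.exists_seg hj (bd_zero j) (P.bd_length hj) (Nat.zero_le _)
  have : ∀ (l : List ℕ) (a b : ℕ), Seg σ D S j l a b → a ≤ p → p < b →
      ∃ X a b, Seg σ D S j [X] a b ∧ a ≤ p ∧ p < b := by
    intro l
    induction l with
    | nil =>
      intro a b hs ha hb
      have := hs.eq_add
      simp at this
      omega
    | cons x l ih =>
      intro a b hs ha hb
      obtain ⟨r, h1, h2⟩ := hs.split_cons
      by_cases hr : p < r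
      · exact ⟨x, a, r, h1, ha, hr⟩
      · exact ih r b h2 (by omega) hb
  exact this l _ _ hl (Nat.zero_le _) hp

theorem node_eq {j : ℕ} (hj : j ≤ h) {X a b Y a' b' c : ℕ} (h1 : Seg σ D S j [X] a b)
    (h2 : Seg σ D S j [Y] a' b') (ha : a ≤ c) (hb : c < b) (ha' : a' ≤ c) (hb' : c < b') :
    a = a' ∧ b = b' ∧ X = Y := by
  have e1 := P.bd_node hj h1 h2.bd_left
  have e2 := P.bd_node hj h2 h1.bd_left
  have e3 := P.bd_node hj h1 h2.bd_right
  have e4 := P.bd_node hj h2 h1.bd_right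
  obtain rfl : a = a' := by omega
  obtain rfl : b = b' := by omega
  exact ⟨rfl, rfl, by simpa using P.seg_unique hj h1 h2⟩

theorem exists_parent {j : ℕ} (hj : j < h) {X p r : ℕ} (hs : Seg σ D S j [X] p r) :
    ∃ Y a b, Seg σ D S (j + 1) [Y] a b ∧ a ≤ p ∧ r ≤ b := by
  have h1 := P.node_lt hj.le hs
  have h2 := P.seg_right_le hj.le hs
  obtain ⟨Y, a, b, h3, h4, h5⟩ := P.exists_node (j := j + 1) (by omega) (p := p) (by omega)
  refine ⟨Y, a, b, h3, h4, ?_⟩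
  have := P.bd_node hj.le hs (P.bd_of_bd_succ hj h3.bd_right)
  omega

theorem top_node : Seg σ D S h [root] 0 S.length := by
  refine ⟨[], [], by rw [P.top]; rfl, rfl, ?_⟩
  rw [← P.flatMap_str le_rfl, P.top]
  simp

end Parse
end

/-! ### Canonical keys of substrings -/

section
variable {σ : ℕ} {S : List ℕ} {D : List (List ℕ)} {root h M : ℕ}

/-- A symbol together with the length of the string that it derives. -/
def item (σ : ℕ) (D : List (List ℕ)) (X : ℕ) : ℕ × ℕ := (X, (str σ D X).length)

/-- The string of length `n` described by the pair `(X, n)`: a power of the string of `X`. -/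
def decode (σ : ℕ) (D : List (List ℕ)) (x : ℕ × ℕ) : List ℕ :=
  (List.replicate x.2 (str σ D x.1)).flatten.take x.2

/-- One level of the key of a substring: from the symbols of level `j` at `[p, q)`, the last `M`
are removed, then the first `M`, then the run which continues the last of these, then at both
ends the symbols up to the next boundaries of the level `j + 1`. -/
structure KStep (σ : ℕ) (D : List (List ℕ)) (S : List ℕ) (h M j p q p' q' : ℕ)
    (el er : List (ℕ × ℕ)) (y x e r a : ℕ) (LS AL V AR RS : List ℕ) : Prop where
  segLS : Seg σ D S j LS p y
  segRun : Seg σ D S j (List.replicate r a) y x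
  segAL : Seg σ D S j AL x p'
  segV : Seg σ D S j V p' q'
  segAR : Seg σ D S j AR q' e
  segRS : Seg σ D S j RS e q
  lenRS : RS.length ≤ M
  lenRS' : RS.length < M → e = p
  lenLS : LS.length ≤ M
  lenLS' : LS.length < M → y = e
  last : a = LS.getLastD 0
  run_max : ∀ Z z, Seg σ D S j [Z] x z → z ≤ e → Z ≠ a
  cut : (p' = e ∧ q' = e ∧ (j < h → ∀ b b', x < b → b < b' → b' ≤ e → Bd σ D S (j + 1) b →
      Bd σ D S (j + 1) b' → False)) ∨
    (j < h ∧ x < p' ∧ p' < q' ∧ Bd σ D S (j + 1) p' ∧ Bd σ D S (j + 1) q' ∧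
      ∀ b, x < b → b ≤ e → Bd σ D S (j + 1) b → p' ≤ b ∧ b ≤ q')
  left : el = LS.map (item σ D) ++ (a, x - y) :: AL.map (item σ D)
  right : er = RS.reverse.map (item σ D) ++ AR.reverse.map (item σ D)

/-- The words emitted at the first `j` levels for the substring at `[p₀, q₀)`, and the part `[p, q)`
which remains. -/
inductive KReach (σ : ℕ) (D : List (List ℕ)) (S : List ℕ) (h M p₀ q₀ : ℕ) :
    ℕ → ℕ → ℕ → List (ℕ × ℕ) → List (ℕ × ℕ) → Prop
  | zero : KReach σ D S h M p₀ q₀ 0 p₀ q₀ [] []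
  | succ {j p q p' q' y x e r a : ℕ} {wl wr el er : List (ℕ × ℕ)} {LS AL V AR RS : List ℕ} :
      KReach σ D S h M p₀ q₀ j p q wl wr → p < q →
      KStep σ D S h M j p q p' q' el er y x e r a LS AL V AR RS →
      KReach σ D S h M p₀ q₀ (j + 1) p' q' (wl ++ el) (wr ++ er)

/-- The key of the substring at `[p₀, q₀)`. -/
def KeyOf (σ : ℕ) (D : List (List ℕ)) (S : List ℕ) (h M p₀ q₀ : ℕ)
    (wl wr : List (ℕ × ℕ)) : Prop :=
  ∃ j p, KReach σ D S h M p₀ q₀ j p p wl wr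

namespace Parse
variable (P : Parse σ S D root h)
include P

theorem kreach_bd {p₀ q₀ j p q : ℕ} {wl wr : List (ℕ × ℕ)} (hq₀ : q₀ ≤ S.length)
    (hk : KReach σ D S h M p₀ q₀ j p q wl wr) (hpq : p < q) :
    j ≤ h ∧ Bd σ D S j p ∧ Bd σ D S j q := by
  cases hk with
  | zero =>
    exact ⟨Nat.zero_le _, P.bd_zero_level (by omega), P.bd_zero_level hq₀⟩
  | succ hk hpq' hs =>
    rcases hs.cut with h1 | h1
    · omega
    · exact ⟨h1.1, h1.2.2.2.1, h1.2.2.2.2.1⟩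

/-- The same decoding serves symbols and runs: a power of the derived string is cut off at the
recorded length, which for a single symbol leaves one copy. -/
theorem decode_item {j X : ℕ} (hj : j ≤ h) (hX : X ∈ espLevel σ D S j) :
    decode σ D (item σ D X) = str σ D X := by
  have := P.str_ne_nil hj hX
  obtain ⟨k, hk⟩ : ∃ k, (str σ D X).length = k + 1 := ⟨_, (Nat.sub_add_cancel this).symm⟩
  unfold decode item
  simp only
  conv_lhs => rw [hk, List.replicate_succ, List.flatten_cons, ← hk]
  exact List.take_left

theorem flatMap_decode {j : ℕ} (hj : j ≤ h) {l : List ℕ} (hl : ∀ x ∈ l, x ∈ espLevel σ D S j) :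
    (l.map (item σ D)).flatMap (decode σ D) = l.flatMap (str σ D) := by
  rw [List.flatMap_map]
  exact List.flatMap_congr fun x hx => P.decode_item hj (hl x hx)

/-- The number of copies used, the length of the run in `S`, is at least the number of symbols in
the run, since each of them derives a nonempty string. -/
theorem decode_run {j : ℕ} (hj : j ≤ h) {r a p q : ℕ} (hs : Seg σ D S j (List.replicate r a) p q) :
    decode σ D (a, q - p) = (List.replicate r a).flatMap (str σ D) := by
  have h1 := hs.eq_add
  have h2 := P.seg_length_le hj hs
  rw [List.length_replicate] at h2
  have h3 : ∀ k, (List.replicate k a).flatMap (str σ D) =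
      (List.replicate k (str σ D a)).flatten := by
    intro k
    rw [List.flatMap_def, List.map_replicate]
  unfold decode
  simp only
  obtain ⟨k, hk⟩ : ∃ k, q - p = r + k := ⟨_, (Nat.add_sub_of_le (by omega : r ≤ q - p)).symm⟩
  conv_lhs => rw [show List.replicate (q - p) (str σ D a) = List.replicate r (str σ D a) ++
    List.replicate k (str σ D a) by rw [hk, List.replicate_add], List.flatten_append,
    show q - p = ((List.replicate r a).flatMap (str σ D)).length by omega, h3]
  rw [List.take_left, h3]

omit P in
theorem take_add_drop {p r q : ℕ} (h1 : p ≤ r) (h2 : r ≤ q) :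
    (S.drop p).take (r - p) ++ (S.drop r).take (q - r) = (S.drop p).take (q - p) := by
  rw [show S.drop r = (S.drop p).drop (r - p) by rw [List.drop_drop]; congr 1; omega,
    show q - p = (r - p) + (q - r) by omega, List.take_add]

theorem kstep_decode {j p q p' q' : ℕ} {el er : List (ℕ × ℕ)} {y x e r a : ℕ}
    {LS AL V AR RS : List ℕ} (hj : j ≤ h)
    (hs : KStep σ D S h M j p q p' q' el er y x e r a LS AL V AR RS) :
    (S.drop p).take (q - p) = el.flatMap (decode σ D) ++ (S.drop p').take (q' - p') ++
      er.reverse.flatMap (decode σ D) := by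
  rw [hs.left, hs.right, List.flatMap_append, List.flatMap_cons, P.decode_run hj hs.segRun,
    P.flatMap_decode hj fun x hx => hs.segLS.mem hx,
    P.flatMap_decode hj fun x hx => hs.segAL.mem hx, ← List.map_append, ← List.reverse_append,
    ← List.map_reverse, List.reverse_reverse, P.flatMap_decode hj fun x hx =>
      (P.seg_append hj hs.segAR hs.segRS).mem hx, P.seg_str hj hs.segLS, P.seg_str hj hs.segRun,
    P.seg_str hj hs.segAL, P.seg_str hj (P.seg_append hj hs.segAR hs.segRS)]
  have h1 := hs.segLS.le
  have h2 := hs.segRun.le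
  have h3 := hs.segAL.le
  have h4 := hs.segV.le
  have h5 := hs.segAR.le
  have h6 := hs.segRS.le
  rw [take_add_drop h2 h3, take_add_drop h1 (by omega), take_add_drop (by omega) (by omega),
    take_add_drop (by omega) (by omega)]

theorem kreach_decode {p₀ q₀ j p q : ℕ} {wl wr : List (ℕ × ℕ)} (hq₀ : q₀ ≤ S.length)
    (hk : KReach σ D S h M p₀ q₀ j p q wl wr) :
    (S.drop p₀).take (q₀ - p₀) = wl.flatMap (decode σ D) ++ (S.drop p).take (q - p) ++
      wr.reverse.flatMap (decode σ D) := by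
  induction hk with
  | zero => simp
  | succ hk hpq hs ih =>
    rw [ih, P.kstep_decode (P.kreach_bd hq₀ hk hpq).1 hs]
    simp

/-- Equal keys mean equal strings. -/
theorem eq_of_keyOf {p q p' q' : ℕ} {wl wr : List (ℕ × ℕ)} (hq : q ≤ S.length)
    (hq' : q' ≤ S.length) (h1 : KeyOf σ D S h M p q wl wr) (h2 : KeyOf σ D S h M p' q' wl wr) :
    (S.drop p).take (q - p) = (S.drop p').take (q' - p') := by
  obtain ⟨j, r, h1⟩ := h1
  obtain ⟨j', r', h2⟩ := h2
  rw [P.kreach_decode hq h1, P.kreach_decode hq' h2]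
  simp

/-- Boundaries of the next level inside equal segments agree. -/
theorem bd_transfer {j : ℕ} (hj : j < h) (hL : logStar S.length + 4 ≤ M)
    (hR : logStar (σ + S.length) + 25 ≤ M) {LS U RS u v : List ℕ} {r a p q p' q' : ℕ}
    (hs : Seg σ D S j (LS ++ (List.replicate r a ++ (U ++ RS))) p q)
    (hs' : Seg σ D S j (LS ++ (List.replicate r a ++ (U ++ RS))) p' q')
    (hLS : LS.length = M) (hRS : RS.length = M) (ha : LS.getLast? = some a) (hU : U ≠ [])
    (hUa : U.head? ≠ some a) (hu : U = u ++ v)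
    (hb : Bd σ D S (j + 1) (p + ((LS ++ (List.replicate r a ++ u)).flatMap (str σ D)).length)) :
    Bd σ D S (j + 1) (p' + ((LS ++ (List.replicate r a ++ u)).flatMap (str σ D)).length) := by
  obtain ⟨A, Z, h1, h2, -⟩ := hs
  obtain ⟨A', Z', h1', h2', -⟩ := hs'
  have e1 : ∀ (A Z : List ℕ), A ++ ((LS ++ (List.replicate r a ++ (U ++ RS))) ++ Z) =
      (A ++ (LS ++ (List.replicate r a ++ u))) ++ (v ++ RS ++ Z) := by
    intro A Z; rw [hu]; simp
  have e2 : ∀ (A : List ℕ), (A.flatMap (str σ D)).length +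
      ((LS ++ (List.replicate r a ++ u)).flatMap (str σ D)).length =
      ((A ++ (LS ++ (List.replicate r a ++ u))).flatMap (str σ D)).length := by
    intro A; rw [List.flatMap_append (xs := A), List.length_append]
  rw [← h2, e2, P.bd_iff_isCut hj (h1.trans (e1 _ _))] at hb
  rw [← h2', e2, P.bd_iff_isCut hj (h1'.trans (e1 _ _))]
  obtain ⟨L₀, hL₀⟩ : ∃ L₀, LS = L₀ ++ [a] := by
    obtain ⟨hne, h3⟩ := List.mem_getLast?_eq_getLast ha
    exact ⟨LS.dropLast, by rw [h3, List.dropLast_append_getLast hne]⟩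
  obtain ⟨z, U', rfl⟩ := List.exists_cons_of_ne_nil hU
  have hza : z ≠ a := by simpa using hUa
  have hpow : ∀ k : ℕ, L₀ ++ [a] ++ List.replicate k a = L₀ ++ List.replicate k a ++ [a] := by
    intro k
    rw [List.append_assoc, List.append_assoc, ← List.replicate_succ', List.replicate_succ]
    rfl
  have hW : LS ++ (List.replicate r a ++ (z :: U' ++ RS)) =
      (L₀ ++ List.replicate r a) ++ (a :: z :: (U' ++ RS)) := by
    rw [← List.append_assoc, hL₀, hpow]; simp
  have hll : L₀.length + 1 = M := by rw [← hLS, hL₀]; simp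
  have hul : u.length ≤ U'.length + 1 := by
    have := congrArg List.length hu
    simp at this
    omega
  rw [blocks, h1, ← List.append_assoc, List.length_append] at hb
  rw [blocks, h1', ← List.append_assoc, List.length_append]
  -- The anchor is the first symbol behind the run: the symbol before it is `a` and it is `z ≠ a`.
  -- It lies at least `M = LS.length` symbols from the left end, and `RS` provides the margin on the
  -- right.
  refine espBlocks_isCut_congr (one_le_logStar (by have := P.two_le; omega)) hL hR ?_ ?_
    (y := L₀.length + r + 1) ?_ ?_ ?_ ?_ hb
  · intro x hx
    rw [List.append_assoc, ← h1] at hx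
    exact P.symbol_lt_tower hj.le hx
  · intro x hx
    rw [List.append_assoc, ← h1'] at hx
    exact P.symbol_lt_tower hj.le hx
  · omega
  · simp; omega
  · simp; omega
  · rw [hW, Nat.add_sub_cancel, List.getD_append_right _ _ _ _ (by simp),
      List.getD_append_right _ _ _ _ (by simp)]
    simpa [show L₀.length + r + 1 - (L₀.length + r) = 1 by omega] using hza.symm

theorem isCut_map_rule {j : ℕ} (hj : j < h) {l : List ℕ} {p q y : ℕ}
    (hs : Seg σ D S (j + 1) l p q) : IsCut (l.map (rule σ D)) y ↔
      ∃ u v, l.flatMap (rule σ D) = u ++ v ∧ u.length = y ∧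
        Bd σ D S (j + 1) (p + (u.flatMap (str σ D)).length) := by
  constructor
  · rintro ⟨l₁, l₂, h1, h2⟩
    obtain ⟨U, V, rfl, rfl, rfl⟩ := List.map_eq_append_iff.1 h1
    obtain ⟨r, h3, h4⟩ := hs.split
    refine ⟨U.flatMap (rule σ D), V.flatMap (rule σ D), by simp, by rw [← h2, List.flatMap_def], ?_⟩
    rw [← (P.seg_down hj h3).eq_add]
    exact h3.bd_right
  · rintro ⟨u, v, h1, h2, h3⟩
    have h4 := P.seg_down hj hs
    rw [h1] at h4
    obtain ⟨r, h5, h6⟩ := h4.split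
    have h7 := h5.eq_add
    rw [← h7] at h3
    obtain ⟨U, hU⟩ := P.exists_seg (by omega) hs.bd_left h3 h5.le
    obtain ⟨V, hV⟩ := P.exists_seg (by omega) h3 hs.bd_right h6.le
    have h8 := P.seg_unique (by omega) hs (P.seg_append (by omega) hU hV)
    have h9 := P.seg_unique hj.le h5 (P.seg_down hj hU)
    refine ⟨U.map (rule σ D), V.map (rule σ D), by rw [h8, List.map_append], ?_⟩
    rw [← List.flatMap_def, ← h9, h2]

/-- Equal symbols below with equal boundaries give equal blocks, and within one level the rule
determines the variable. -/
theorem seg_succ_unique {j : ℕ} (hj : j < h) {V l l' : List ℕ} {p q p' q' : ℕ}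
    (hl : Seg σ D S (j + 1) l p q) (hl' : Seg σ D S (j + 1) l' p' q')
    (hV : V = l.flatMap (rule σ D)) (hV' : V = l'.flatMap (rule σ D))
    (hbd : ∀ u v, V = u ++ v → (Bd σ D S (j + 1) (p + (u.flatMap (str σ D)).length) ↔
      Bd σ D S (j + 1) (p' + (u.flatMap (str σ D)).length))) : l = l' := by
  have hne : ∀ x ∈ espLevel σ D S (j + 1), rule σ D x ≠ [] := by
    intro x hx h0
    have := P.length_rule hj hx
    rw [h0] at this
    simp at this
  have h1 : l.map (rule σ D) = l'.map (rule σ D) := by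
    apply eq_of_isCut_iff
    · intro b hb
      obtain ⟨x, hx, rfl⟩ := List.mem_map.1 hb
      exact hne x (hl.mem hx)
    · intro b hb
      obtain ⟨x, hx, rfl⟩ := List.mem_map.1 hb
      exact hne x (hl'.mem hx)
    · rw [← List.flatMap_def, ← List.flatMap_def, ← hV, hV']
    · intro y
      rw [P.isCut_map_rule hj hl, P.isCut_map_rule hj hl', ← hV, ← hV']
      constructor
      · rintro ⟨u, v, h1, h2, h3⟩
        exact ⟨u, v, h1, h2, (hbd u v h1).1 h3⟩
      · rintro ⟨u, v, h1, h2, h3⟩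
        exact ⟨u, v, h1, h2, (hbd u v h1).2 h3⟩
  have hm : ∀ x ∈ l, x ∈ espLevel σ D S (j + 1) := fun x hx => hl.mem hx
  have hm' : ∀ x ∈ l', x ∈ espLevel σ D S (j + 1) := fun x hx => hl'.mem hx
  clear hl hl' hV hV' hbd
  induction l generalizing l' with
  | nil => rcases l' with _ | ⟨y, l'⟩
           · rfl
           · simp at h1
  | cons x l ih =>
    rcases l' with _ | ⟨y, l'⟩
    · simp at h1
    · rw [List.map_cons, List.map_cons, List.cons.injEq] at h1
      rw [P.rule_inj hj (hm x (by simp)) (hm' y (by simp)) h1.1,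
        ih h1.2 (fun x hx => hm x (by simp [hx])) fun x hx => hm' x (by simp [hx])]

omit P in
theorem replicate_append_inj {a r r' : ℕ} {U U' : List ℕ} (hU : U.head? ≠ some a)
    (hU' : U'.head? ≠ some a) (he : List.replicate r a ++ U = List.replicate r' a ++ U') :
    r = r' ∧ U = U' := by
  induction r generalizing r' with
  | zero =>
    rcases r' with _ | r'
    · simpa using he
    · rw [List.replicate_succ] at he
      simp at he
      rw [he] at hU
      simp at hU
  | succ r ih =>
    rcases r' with _ | r'
    · rw [List.replicate_succ] at he
      simp at he
      rw [← he] at hU'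
      simp at hU'
    · rw [List.replicate_succ, List.replicate_succ, List.cons_append, List.cons_append,
        List.cons.injEq] at he
      obtain ⟨h1, h2⟩ := ih he.2
      exact ⟨by rw [h1], h2⟩

theorem kstep_seg {j p q p' q' : ℕ} {el er : List (ℕ × ℕ)} {y x e r a : ℕ}
    {LS AL V AR RS : List ℕ} (hj : j ≤ h)
    (hs : KStep σ D S h M j p q p' q' el er y x e r a LS AL V AR RS) :
    Seg σ D S j (AL ++ (V ++ AR)) x e ∧ Seg σ D S j (List.replicate r a ++ (AL ++ (V ++ AR))) y e ∧
      Seg σ D S j (LS ++ (List.replicate r a ++ (AL ++ (V ++ AR)))) p e ∧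
      Seg σ D S j ((LS ++ (List.replicate r a ++ (AL ++ (V ++ AR)))) ++ RS) p q := by
  have h1 := P.seg_append hj hs.segAL (P.seg_append hj hs.segV hs.segAR)
  have h2 := P.seg_append hj hs.segRun h1
  have h3 := P.seg_append hj hs.segLS h2
  exact ⟨h1, h2, h3, P.seg_append hj h3 hs.segRS⟩

theorem kstep_head {j p q p' q' : ℕ} {el er : List (ℕ × ℕ)} {y x e r a : ℕ}
    {LS AL V AR RS : List ℕ} (hj : j ≤ h)
    (hs : KStep σ D S h M j p q p' q' el er y x e r a LS AL V AR RS) :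
    (AL ++ (V ++ AR)).head? ≠ some a := by
  have h1 := (P.kstep_seg hj hs).1
  rcases hU : AL ++ (V ++ AR) with _ | ⟨z, U⟩
  · simp
  · rw [hU] at h1
    obtain ⟨w, h2, h3⟩ := h1.split_cons
    simpa using hs.run_max z w h2 h3.le

/-- This is `bd_transfer` in terms of the distance from the end of the run, which is the form in
which the cuts of two key steps are compared. -/
theorem bd_shift {j : ℕ} (hj : j < h) (hL : logStar S.length + 4 ≤ M)
    (hR : logStar (σ + S.length) + 25 ≤ M) {LS U RS : List ℕ} {r a p q p' q' x e x' : ℕ}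
    (hs : Seg σ D S j (LS ++ (List.replicate r a ++ (U ++ RS))) p q)
    (hs' : Seg σ D S j (LS ++ (List.replicate r a ++ (U ++ RS))) p' q')
    (hx : Seg σ D S j (LS ++ List.replicate r a) p x)
    (hx' : Seg σ D S j (LS ++ List.replicate r a) p' x')
    (hU : Seg σ D S j U x e)
    (hLS : LS.length = M) (hRS : RS.length = M) (ha : LS.getLast? = some a) (hne : U ≠ [])
    (hUa : U.head? ≠ some a) {d : ℕ} (hd : x + d ≤ e) (hb : Bd σ D S (j + 1) (x + d)) :
    Bd σ D S (j + 1) (x' + d) := by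
  have hb0 := P.bd_of_bd_succ hj hb
  obtain ⟨u, hu⟩ := P.exists_seg hj.le hU.bd_left hb0 (by omega)
  obtain ⟨v, hv⟩ := P.exists_seg hj.le hb0 hU.bd_right hd
  have h1 := P.seg_unique hj.le hU (P.seg_append hj.le hu hv)
  have h2 := hu.eq_add
  have h3 := hx.eq_add
  have h4 := hx'.eq_add
  have h5 := P.bd_transfer hj hL hR hs hs' hLS hRS ha hne hUa h1
    (by rwa [← List.append_assoc, List.flatMap_append, List.length_append, ← add_assoc, ← h3,
      ← h2])
  rwa [← List.append_assoc, List.flatMap_append, List.length_append, ← add_assoc, ← h4,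
    show (u.flatMap (str σ D)).length = d by omega] at h5

/-- The stripped parts are determined by the symbols of the interval since their lengths and the
maximal run are. The position of the cut is determined by the boundaries of the next level, which
agree by local consistency. -/
theorem kstep_congr {j : ℕ} (hj : j ≤ h) (hL : logStar S.length + 4 ≤ M)
    (hR : logStar (σ + S.length) + 25 ≤ M) {W : List ℕ}
    {p q p' q' : ℕ} {el er : List (ℕ × ℕ)} {y x e r a : ℕ} {LS AL V AR RS : List ℕ}
    {p₁ q₁ p₁' q₁' : ℕ} {el₁ er₁ : List (ℕ × ℕ)} {y₁ x₁ e₁ r₁ a₁ : ℕ} {LS₁ AL₁ V₁ AR₁ RS₁ : List ℕ}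
    (hs : KStep σ D S h M j p q p' q' el er y x e r a LS AL V AR RS)
    (hs₁ : KStep σ D S h M j p₁ q₁ p₁' q₁' el₁ er₁ y₁ x₁ e₁ r₁ a₁ LS₁ AL₁ V₁ AR₁ RS₁)
    (hW : Seg σ D S j W p q) (hW₁ : Seg σ D S j W p₁ q₁) :
    el = el₁ ∧ er = er₁ ∧ q' - p' = q₁' - p₁' ∧
      (p' < q' → ∃ W', Seg σ D S (j + 1) W' p' q' ∧ Seg σ D S (j + 1) W' p₁' q₁') := by
  obtain ⟨g1, g2, g3, g4⟩ := P.kstep_seg hj hs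
  obtain ⟨k1, k2, k3, k4⟩ := P.kstep_seg hj hs₁
  have w := (P.seg_unique hj hW g4).symm.trans (P.seg_unique hj hW₁ k4)
  have hh := P.kstep_head hj hs
  have hh₁ := P.kstep_head hj hs₁
  obtain ⟨hwl, rfl⟩ : LS ++ (List.replicate r a ++ (AL ++ (V ++ AR))) =
      LS₁ ++ (List.replicate r₁ a₁ ++ (AL₁ ++ (V₁ ++ AR₁))) ∧ RS = RS₁ := by
    apply List.append_inj' w
    have := P.seg_length_le hj g3
    have := P.seg_length_le hj k3
    have := hs.lenRS
    have := hs.lenRS'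
    have := hs₁.lenRS
    have := hs₁.lenRS'
    have := congrArg List.length w
    rw [List.length_append (bs := RS), List.length_append (bs := RS₁)] at this
    omega
  obtain ⟨rfl, hrest⟩ := List.append_inj hwl (by
    have := P.seg_length_le hj g2
    have := P.seg_length_le hj k2
    have := hs.lenLS
    have := hs.lenLS'
    have := hs₁.lenLS
    have := hs₁.lenLS'
    have := congrArg List.length hwl
    rw [List.length_append (as := LS), List.length_append (as := LS₁)] at this
    omega)
  obtain rfl : a = a₁ := hs.last.trans hs₁.last.symm
  obtain ⟨rfl, hU⟩ := replicate_append_inj hh hh₁ hrest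
  have hxy := hs.segRun.eq_add
  have hxy₁ := hs₁.segRun.eq_add
  have he := g1.eq_add
  have he₁ := k1.eq_add
  rw [← hU] at k1 he₁ k3 k4
  have hAL := hs.segAL.eq_add
  have hAL₁ := hs₁.segAL.eq_add
  have hV := hs.segV.eq_add
  have hV₁ := hs₁.segV.eq_add
  have hARle := hs.segAR.le
  have hARle₁ := hs₁.segAR.le
  have hALle := hs.segAL.le
  have hALle₁ := hs₁.segAL.le
  have hVle := hs.segV.le
  -- it suffices to compare the positions of the boundaries
  suffices hpos : p' - x = p₁' - x₁ ∧ q' - x = q₁' - x₁ ∧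
      (p' < q' → ∃ W', Seg σ D S (j + 1) W' p' q' ∧ Seg σ D S (j + 1) W' p₁' q₁') by
    obtain ⟨d1, d2, d3⟩ := hpos
    have g1' := g1
    rw [hU] at g1'
    obtain ⟨z, z1, z2⟩ := g1'.split
    obtain ⟨z', z3, z4⟩ := z2.split
    have hz := z1.eq_add
    have hz' := z3.eq_add
    obtain rfl : z = p' := by omega
    obtain rfl : z' = q' := by omega
    obtain rfl := P.seg_unique hj hs.segAL z1
    obtain rfl := P.seg_unique hj hs.segAR z4
    refine ⟨?_, ?_, by omega, d3⟩
    · rw [hs.left, hs₁.left, show x - y = x₁ - y₁ by omega]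
    · rw [hs.right, hs₁.right]
  by_cases hne : AL ++ (V ++ AR) = []
  · rw [hne] at he he₁
    simp at he he₁
    exact ⟨by omega, by omega, fun hlt => by omega⟩
  -- A strip shorter than `M` would have exhausted the interval, but something is left behind the
  -- run.
  have hlen : LS.length = M ∧ RS.length = M := by
    have h1 := P.seg_length_le hj g1
    have h2 := P.seg_length_le hj g2
    have h3 := P.seg_length_le hj g3
    have h4 := List.length_pos_iff.2 hne
    rw [List.length_append (as := LS), List.length_append (as := List.replicate r a)] at h3
    rw [List.length_append (as := List.replicate r a)] at h2
    have := hs.lenLS'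
    have := hs.lenRS'
    have := hs.lenLS
    have := hs.lenRS
    omega
  -- The top level has a single symbol, so there is no room for the stripped symbols together with
  -- what is left.
  have hj' : j < h := by
    rcases Nat.eq_or_lt_of_le hj with rfl | h1
    · obtain ⟨A, Z, h2, -⟩ := g4
      rw [P.top] at h2
      have := congrArg List.length h2
      simp only [List.length_append, List.length_singleton] at this
      omega
    · exact h1
  have hlast : LS.getLast? = some a := by
    rw [hs.last]
    have : LS ≠ [] := by
      rintro rfl
      simp at hlen
      omega
    rw [List.getLast?_eq_some_getLast this]
    congr 1
    rw [List.getLastD_eq_getLast?, List.getLast?_eq_some_getLast this]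
    rfl
  simp only [List.append_assoc] at g4 k4
  have g4' : Seg σ D S j (LS ++ (List.replicate r a ++ ((AL ++ (V ++ AR)) ++ RS))) p q := by
    simpa only [List.append_assoc] using g4
  have k4' : Seg σ D S j (LS ++ (List.replicate r a ++ ((AL ++ (V ++ AR)) ++ RS))) p₁ q₁ := by
    simpa only [List.append_assoc] using k4
  have hx := P.seg_append hj hs.segLS hs.segRun
  have hx₁ := P.seg_append hj hs₁.segLS hs₁.segRun
  have t1 : ∀ d, x + d ≤ e → Bd σ D S (j + 1) (x + d) → Bd σ D S (j + 1) (x₁ + d) :=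
    fun d hd hb => P.bd_shift hj' hL hR g4' k4' hx hx₁ g1 hlen.1 hlen.2 hlast hne hh hd hb
  have t2 : ∀ d, x₁ + d ≤ e₁ → Bd σ D S (j + 1) (x₁ + d) → Bd σ D S (j + 1) (x + d) :=
    fun d hd hb => P.bd_shift hj' hL hR k4' g4' hx₁ hx k1 hlen.1 hlen.2 hlast hne hh hd hb
  -- If only one of the two steps finds two boundaries, transferring them contradicts the other
  -- step. If both do, transferring the first and the last boundary in both directions shows that
  -- they agree.
  rcases hs.cut with ⟨c1, c2, c3⟩ | ⟨-, c2, c3, c4, c5, c6⟩ <;>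
    rcases hs₁.cut with ⟨e1, e2, e3⟩ | ⟨-, e2, e3, e4, e5, e6⟩
  · exact ⟨by omega, by omega, fun hlt => by omega⟩
  · exfalso
    refine c3 hj' (x + (p₁' - x₁)) (x + (q₁' - x₁)) (by omega) (by omega) (by omega)
      (t2 _ (by omega) ?_) (t2 _ (by omega) ?_)
    · rwa [Nat.add_sub_cancel' (by omega)]
    · rwa [Nat.add_sub_cancel' (by omega)]
  · exfalso
    refine e3 hj' (x₁ + (p' - x)) (x₁ + (q' - x)) (by omega) (by omega) (by omega)
      (t1 _ (by omega) ?_) (t1 _ (by omega) ?_)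
    · rwa [Nat.add_sub_cancel' (by omega)]
    · rwa [Nat.add_sub_cancel' (by omega)]
  · have f1 := e6 (x₁ + (p' - x)) (by omega) (by omega) (t1 _ (by omega)
      (by rwa [Nat.add_sub_cancel' (by omega)]))
    have f2 := e6 (x₁ + (q' - x)) (by omega) (by omega) (t1 _ (by omega)
      (by rwa [Nat.add_sub_cancel' (by omega)]))
    have f3 := c6 (x + (p₁' - x₁)) (by omega) (by omega) (t2 _ (by omega)
      (by rwa [Nat.add_sub_cancel' (by omega)]))
    have f4 := c6 (x + (q₁' - x₁)) (by omega) (by omega) (t2 _ (by omega)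
      (by rwa [Nat.add_sub_cancel' (by omega)]))
    have d1 : p' - x = p₁' - x₁ := by omega
    have d2 : q' - x = q₁' - x₁ := by omega
    refine ⟨d1, d2, fun _ => ?_⟩
    obtain ⟨l, m1, m2⟩ := P.seg_lift hj' hs.segV c4 c5
    obtain ⟨l₁, m3, m4⟩ := P.seg_lift hj' hs₁.segV e4 e5
    have hVV : V = V₁ := by
      have g1' := g1
      rw [hU] at g1'
      obtain ⟨z, z1, z2⟩ := g1'.split
      obtain ⟨z', z3, z4⟩ := z2.split
      have hz := z1.eq_add
      have hz' := z3.eq_add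
      obtain rfl : z = p' := by omega
      obtain rfl : z' = q' := by omega
      exact P.seg_unique hj hs.segV z3
    have : l = l₁ := by
      refine P.seg_succ_unique hj' m1 m3 m2 (hVV.trans m4) fun u v huv => ?_
      have hu : (u.flatMap (str σ D)).length ≤ (V.flatMap (str σ D)).length := by
        rw [huv]; simp
      have a1 := t1 (p' - x + (u.flatMap (str σ D)).length) (by omega)
      have a2 := t2 (p' - x + (u.flatMap (str σ D)).length) (by omega)
      rw [← add_assoc, ← add_assoc, show x + (p' - x) = p' by omega,
        show x₁ + (p' - x) = p₁' by omega] at a1 a2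
      exact ⟨a1, a2⟩
    exact ⟨l, m1, this ▸ m3⟩

/-- Level by level the remaining parts are spelled by the same symbols, although they may lie at
different places of the parse tree. -/
theorem kreach_congr (hL : logStar S.length + 4 ≤ M) (hR : logStar (σ + S.length) + 25 ≤ M)
    {p₀ q₀ p₁ q₁ j p q p' q' : ℕ} {wl wr wl' wr' : List (ℕ × ℕ)} (hp₀ : p₀ ≤ q₀)
    (hq₀ : q₀ ≤ S.length) (hp₁ : p₁ ≤ q₁) (hq₁ : q₁ ≤ S.length)
    (he : (S.drop p₀).take (q₀ - p₀) = (S.drop p₁).take (q₁ - p₁))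
    (hk : KReach σ D S h M p₀ q₀ j p q wl wr) (hk' : KReach σ D S h M p₁ q₁ j p' q' wl' wr') :
    wl = wl' ∧ wr = wr' ∧ q - p = q' - p' ∧
      (p < q → ∃ W, Seg σ D S j W p q ∧ Seg σ D S j W p' q') := by
  induction j generalizing p q p' q' wl wr wl' wr' with
  | zero =>
    cases hk
    cases hk'
    have := congrArg List.length he
    simp only [List.length_take, List.length_drop] at this
    refine ⟨rfl, rfl, by omega, fun _ => ⟨_, P.seg_zero hp₀ hq₀, ?_⟩⟩
    rw [he]
    exact P.seg_zero hp₁ hq₁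
  | succ j ih =>
    obtain _ | ⟨hk, hlt, hs⟩ := hk
    obtain _ | ⟨hk', hlt', hs'⟩ := hk'
    obtain ⟨rfl, rfl, -, h1⟩ := ih hk hk'
    obtain ⟨W, hW, hW'⟩ := h1 hlt
    obtain ⟨rfl, rfl, h2, h3⟩ := P.kstep_congr (P.kreach_bd hq₀ hk hlt).1 hL hR hs hs' hW hW'
    exact ⟨rfl, rfl, h2, h3⟩

omit P in
theorem kreach_earlier {p₀ q₀ j p q i : ℕ} {wl wr : List (ℕ × ℕ)}
    (hk : KReach σ D S h M p₀ q₀ j p q wl wr) (hi : i < j) :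
    ∃ p' q' wl' wr', KReach σ D S h M p₀ q₀ i p' q' wl' wr' ∧ p' < q' := by
  induction hk with
  | zero => omega
  | succ hk hlt hs ih =>
    rcases Nat.eq_or_lt_of_le (Nat.lt_succ_iff.1 hi) with rfl | hi
    · exact ⟨_, _, _, _, hk, hlt⟩
    · exact ih hi

/-- Equal strings have equal keys. -/
theorem keyOf_unique (hL : logStar S.length + 4 ≤ M) (hR : logStar (σ + S.length) + 25 ≤ M)
    {p₀ q₀ p₁ q₁ : ℕ} {wl wr wl' wr' : List (ℕ × ℕ)} (hp₀ : p₀ ≤ q₀)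
    (hq₀ : q₀ ≤ S.length) (hp₁ : p₁ ≤ q₁) (hq₁ : q₁ ≤ S.length)
    (he : (S.drop p₀).take (q₀ - p₀) = (S.drop p₁).take (q₁ - p₁))
    (hk : KeyOf σ D S h M p₀ q₀ wl wr) (hk' : KeyOf σ D S h M p₁ q₁ wl' wr') :
    wl = wl' ∧ wr = wr' := by
  obtain ⟨j, p, hk⟩ := hk
  obtain ⟨j', p', hk'⟩ := hk'
  -- Both computations stop on the same level, because the lengths of the remaining parts agree as
  -- long as both are running.
  rcases lt_trichotomy j j' with hlt | rfl | hlt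
  · obtain ⟨a, b, _, _, h1, h2⟩ := kreach_earlier hk' hlt
    have := (P.kreach_congr hL hR hp₀ hq₀ hp₁ hq₁ he hk h1).2.2.1
    omega
  · have := P.kreach_congr hL hR hp₀ hq₀ hp₁ hq₁ he hk hk'
    exact ⟨this.1, this.2.1⟩
  · obtain ⟨a, b, _, _, h1, h2⟩ := kreach_earlier hk hlt
    have := (P.kreach_congr hL hR hp₀ hq₀ hp₁ hq₁ he h1 hk').2.2.1
    omega

end Parse
end

/-! ### Covering an interval by nodes of the parse tree -/

section
variable {σ : ℕ} {S : List ℕ} {D : List (List ℕ)} {root h : ℕ} {A B A' B' : ℕ}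

/-- The pairs (symbol, level) in the list are consecutive nodes of the parse tree which cover
`[p, q)`, and the parent of none of them lies between `A` and `B`. -/
def Dq (σ : ℕ) (D : List (List ℕ)) (S : List ℕ) (h A B : ℕ) : List (ℕ × ℕ) → ℕ → ℕ → Prop
  | [], p, q => p = q
  | x :: ds, p, q => ∃ r, x.2 ≤ h ∧ Seg σ D S x.2 [x.1] p r ∧
      (∀ Y a b, x.2 < h → Seg σ D S (x.2 + 1) [Y] a b → a ≤ p → r ≤ b → A ≤ a → b ≤ B → False) ∧
      Dq σ D S h A B ds r q

theorem dq_append {ds ds' : List (ℕ × ℕ)} {p q : ℕ} : Dq σ D S h A B (ds ++ ds') p q ↔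
    ∃ r, Dq σ D S h A B ds p r ∧ Dq σ D S h A B ds' r q := by
  induction ds generalizing p with
  | nil => simp [Dq]
  | cons x ds ih =>
    simp only [List.cons_append, Dq, ih]
    constructor
    · rintro ⟨r, h1, h2, h3, r', h4, h5⟩
      exact ⟨r', ⟨r, h1, h2, h3, h4⟩, h5⟩
    · rintro ⟨r', ⟨r, h1, h2, h3, h4⟩, h5⟩
      exact ⟨r, h1, h2, h3, r', h4, h5⟩

theorem Dq.mono {ds : List (ℕ × ℕ)} {p q : ℕ} (hd : Dq σ D S h A B ds p q) (hA : A ≤ A')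
    (hB : B' ≤ B) : Dq σ D S h A' B' ds p q := by
  induction ds generalizing p with
  | nil => exact hd
  | cons x ds ih =>
    obtain ⟨r, h1, h2, h3, h4⟩ := hd
    exact ⟨r, h1, h2, fun Y a b e1 e2 e3 e4 e5 e6 => h3 Y a b e1 e2 e3 e4 (by omega) (by omega),
      ih h4⟩

namespace Parse
variable (P : Parse σ S D root h)
include P

theorem dq_length_le {ds : List (ℕ × ℕ)} {p q : ℕ} (hd : Dq σ D S h A B ds p q) :
    p + ds.length ≤ q := by
  induction ds generalizing p with
  | nil => exact le_of_eq hd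
  | cons x ds ih =>
    obtain ⟨r, h1, h2, h3, h4⟩ := hd
    have := ih h4
    have := P.node_lt h1 h2
    simp only [List.length_cons]
    omega

theorem dq_le {ds : List (ℕ × ℕ)} {p q : ℕ} (hd : Dq σ D S h A B ds p q) : p ≤ q := by
  have := P.dq_length_le hd
  omega

theorem dq_children {j : ℕ} (hj : j < h) {X a b : ℕ} (hX : Seg σ D S (j + 1) [X] a b)
    (hAB : A ≤ a → b ≤ B → False) {l : List ℕ} {p q : ℕ} (hl : Seg σ D S j l p q) (hp : a ≤ p)
    (hq : q ≤ b) : Dq σ D S h A B (l.map fun x => (x, j)) p q := by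
  induction l generalizing p with
  | nil =>
    have := hl.eq_add
    simp at this
    exact this.symm
  | cons x l ih =>
    obtain ⟨r, h1, h2⟩ := hl.split_cons
    have h3 := P.node_lt hj.le h1
    have h4 := h2.le
    refine ⟨r, hj.le, h1, fun Y a' b' _ e1 e2 e3 e4 e5 => ?_, ih h2 (by omega)⟩
    obtain ⟨rfl, rfl, -⟩ := P.node_eq (c := p) (by omega) hX e1 hp (by omega) e2 (by omega)
    exact hAB e4 e5

/-- The children have a parent that starts at `p < A`, outside the range from `A` on, so they
satisfy the maximality condition. This is why coverings are expanded with `A` just behind `p`. -/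
theorem dq_expand_left {X j p q : ℕ} {ds : List (ℕ × ℕ)}
    (hd : Dq σ D S h A B ((X, j + 1) :: ds) p q) (hA : p < A) :
    Dq σ D S h A B ((rule σ D X).map (fun x => (x, j)) ++ ds) p q := by
  obtain ⟨r, h1, h2, -, h4⟩ := hd
  rw [dq_append]
  exact ⟨r, P.dq_children h1 h2 (fun _ _ => by omega) (P.seg_down_singleton h1 h2) le_rfl le_rfl,
    h4⟩

theorem dq_expand_right {X j p q : ℕ} {ds : List (ℕ × ℕ)}
    (hd : Dq σ D S h A B (ds ++ [(X, j + 1)]) p q) (hB : B < q) :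
    Dq σ D S h A B (ds ++ (rule σ D X).map (fun x => (x, j))) p q := by
  rw [dq_append] at hd ⊢
  obtain ⟨r', h0, r, h1, h2, -, h4⟩ := hd
  obtain rfl : r = q := h4
  exact ⟨r', h0, P.dq_children h1 h2 (fun _ _ => by omega) (P.seg_down_singleton h1 h2)
    le_rfl le_rfl⟩

theorem dq_length_rule {X j p q : ℕ} {ds : List (ℕ × ℕ)}
    (hd : Dq σ D S h A B ((X, j + 1) :: ds) p q) :
    (rule σ D X).length = 2 ∨ (rule σ D X).length = 3 := by
  obtain ⟨r, h1, h2, -, h4⟩ := hd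
  exact P.length_rule h1 (h2.mem (by simp))

omit P in
theorem dq_mem {x : ℕ × ℕ} {p q : ℕ} {ds : List (ℕ × ℕ)}
    (hd : Dq σ D S h A B ds p q) (hx : x ∈ ds) : x.2 ≤ h ∧ x.1 ∈ espLevel σ D S x.2 := by
  induction ds generalizing p with
  | nil => simp at hx
  | cons y ds ih =>
    obtain ⟨r, h1, h2, -, h4⟩ := hd
    rcases List.mem_cons.1 hx with rfl | hx
    · exact ⟨h1, h2.mem (by simp)⟩
    · exact ih h4 hx

/-- If both ends are boundaries of level `j + 1`, the parent of a node of level `j` in the covering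
lies inside the interval, against maximality. So the covering is ready for the next level. -/
theorem lt_level_of_dq {j p q : ℕ} {ds : List (ℕ × ℕ)} (hj : j < h)
    (hd : Dq σ D S h p q ds p q) (hp : Bd σ D S (j + 1) p) (hq : Bd σ D S (j + 1) q)
    (hl : ∀ x ∈ ds, j ≤ x.2) : ∀ x ∈ ds, j + 1 ≤ x.2 := by
  intro x hx
  by_contra hc
  have hxj : x.2 = j := by have := hl x hx; omega
  obtain ⟨d1, d2, rfl⟩ := List.append_of_mem hx
  rw [dq_append] at hd
  obtain ⟨s, h0, r, h1, h2, h3, h4⟩ := hd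
  rw [hxj] at h2 h3
  obtain ⟨Y, a, c, h5, h6, h7⟩ := P.exists_parent hj h2
  have h8 := P.node_lt hj.le h2
  have h9 := P.bd_node (by omega) h5 hp
  have h10 := P.bd_node (by omega) h5 hq
  have h11 := P.dq_le h0
  have h12 := P.dq_le h4
  exact h3 Y a c hj h5 h6 h7 (by omega) (by omega)

/-- The positions at which the nodes in a segment start. -/
theorem exists_starts {j : ℕ} (hj : j ≤ h) {l : List ℕ} {p q : ℕ} (hs : Seg σ D S j l p q) :
    ∃ F : Finset ℕ, F.card ≤ l.length ∧
      ∀ X s t, Seg σ D S j [X] s t → p ≤ s → s < q → s ∈ F ∧ X ∈ l := by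
  induction l generalizing p with
  | nil =>
    refine ⟨∅, by simp, fun X s t _ h1 h2 => ?_⟩
    have := hs.eq_add
    simp at this
    omega
  | cons x l ih =>
    obtain ⟨r, h1, h2⟩ := hs.split_cons
    obtain ⟨F, h3, h4⟩ := ih h2
    refine ⟨insert p F, ?_, fun X s t h5 h6 h7 => ?_⟩
    · rw [List.length_cons]
      exact (Finset.card_insert_le _ _).trans (by omega)
    · by_cases hr : s < r
      · obtain ⟨rfl, -, rfl⟩ := P.node_eq (c := s) hj h1 h5 h6 hr le_rfl (P.node_lt hj h5)
        simp
      · have := h4 X s t h5 (by omega) h7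
        exact ⟨Finset.mem_insert_of_mem this.1, List.mem_cons_of_mem _ this.2⟩

/-- At most one node of a level contains `p` in its interior, and it has at most three children. -/
theorem exists_children_starts {j : ℕ} (hj : j < h) (p : ℕ) :
    ∃ F : Finset ℕ, F.card ≤ 3 ∧ ∀ X s t Y a b, Seg σ D S j [X] s t → Seg σ D S (j + 1) [Y] a b →
      a ≤ s → t ≤ b → a < p → p < b → s ∈ F := by
  by_cases hex : ∃ Y a b, Seg σ D S (j + 1) [Y] a b ∧ a < p ∧ p < b
  · obtain ⟨Y, a, b, h1, h2, h3⟩ := hex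
    obtain ⟨F, h4, h5⟩ := P.exists_starts hj.le (P.seg_down_singleton hj h1)
    refine ⟨F, ?_, fun X s t Y' a' b' e1 e2 e3 e4 e5 e6 => ?_⟩
    · have := P.length_rule hj (h1.mem (List.mem_singleton_self Y))
      omega
    · obtain ⟨rfl, rfl, -⟩ := P.node_eq (c := p) (by omega) h1 e2 h2.le h3 e5.le e6
      exact (h5 X s t e1 e3 (by have := P.node_lt hj.le e1; omega)).1
  · refine ⟨∅, by simp, fun X s t Y a b e1 e2 e3 e4 e5 e6 => ?_⟩
    exact absurd ⟨Y, a, b, e2, e5, e6⟩ hex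

/-- The nodes of a covering start at different positions, so counting possible starts bounds the
length. -/
theorem dq_length_le_card {ds : List (ℕ × ℕ)} {p q : ℕ} (hd : Dq σ D S h A B ds p q)
    {F : Finset ℕ} (hF : ∀ X j s t, j ≤ h → Seg σ D S j [X] s t → p ≤ s → t ≤ q →
      (∀ Y a b, j < h → Seg σ D S (j + 1) [Y] a b → a ≤ s → t ≤ b → A ≤ a → b ≤ B → False) →
      s ∈ F) : ds.length ≤ (F.filter (p ≤ ·)).card := by
  induction ds generalizing p with
  | nil => simp
  | cons x ds ih =>
    obtain ⟨r, h1, h2, h3, h4⟩ := hd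
    have h5 := P.node_lt h1 h2
    have h6 := P.dq_le h4
    have h7 := ih h4 fun X j s t e1 e2 e3 e4 => hF X j s t e1 e2 (by omega) e4
    have h8 : p ∈ F := hF x.1 x.2 p r h1 h2 le_rfl h6 h3
    rw [List.length_cons]
    refine Nat.succ_le_of_lt (lt_of_le_of_lt h7 (Finset.card_lt_card ?_))
    rw [Finset.ssubset_iff_of_subset]
    · exact ⟨p, by simp [h8], by simp; omega⟩
    · intro s hs
      simp only [Finset.mem_filter] at hs ⊢
      exact ⟨hs.1, by omega⟩

/-- A covering by maximal nodes is short. -/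
theorem dq_size {ds : List (ℕ × ℕ)} {p q : ℕ} (hd : Dq σ D S h p q ds p q) :
    ds.length ≤ 6 * h + 1 := by
  -- A node of the covering is the root or has a parent that sticks out over `p` or over `q`. This
  -- allows three starts for each of the two ends on each level.
  choose! f hf using fun (j : ℕ) (hj : j < h) (p : ℕ) => P.exists_children_starts hj p
  have := P.dq_length_le_card hd
    (F := insert 0 ((Finset.range h).biUnion fun j => f j p ∪ f j q)) (by
      intro X j s t hj hs hps htq hno
      rcases Nat.eq_or_lt_of_le hj with rfl | hj
      · have h1 := P.node_lt le_rfl hs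
        have h2 := P.seg_right_le le_rfl hs
        obtain ⟨rfl, -⟩ := P.node_eq (c := s) le_rfl P.top_node hs (Nat.zero_le _) (by omega)
          le_rfl h1
        simp
      · obtain ⟨Y, a, b, h1, h2, h3⟩ := P.exists_parent hj hs
        have h4 := P.node_lt hj.le hs
        refine Finset.mem_insert_of_mem (Finset.mem_biUnion.2 ⟨j, Finset.mem_range.2 hj, ?_⟩)
        rw [Finset.mem_union]
        by_cases hpa : a < p
        · exact Or.inl ((hf j hj p).2 X s t Y a b hs h1 h2 h3 hpa (by omega))
        · by_cases hqb : q < b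
          · exact Or.inr ((hf j hj q).2 X s t Y a b hs h1 h2 h3 (by omega) hqb)
          · exact (hno Y a b hj h1 h2 h3 (by omega) (by omega)).elim)
  refine this.trans ((Finset.card_filter_le _ _).trans ((Finset.card_insert_le _ _).trans ?_))
  refine Nat.add_le_add_right (Finset.card_biUnion_le.trans ?_) 1
  refine (Finset.sum_le_card_nsmul _ _ 6 fun j hj => ?_).trans (by simp [mul_comm])
  have h1 := (hf j (Finset.mem_range.1 hj) p).1
  have h2 := (hf j (Finset.mem_range.1 hj) q).1
  have := Finset.card_union_le (f j p) (f j q)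
  omega

end Parse
end

/-! ### Skipping a run -/

section
variable {σ : ℕ} {S : List ℕ} {D : List (List ℕ)} {root h : ℕ}

/-- The symbols obtained from `a` by repeated doubling. -/
def chain (σ : ℕ) (D : List (List ℕ)) (a : ℕ) : ℕ → ℕ
  | 0 => a
  | d + 1 => σ + D.idxOf [chain σ D a d, chain σ D a d]

/-- One step of skipping a run of the symbols `b j`, of which those with `j ≤ J` are known: a
known symbol, or the next one, is removed from the covering, any other one is expanded. -/
inductive SStep (σ : ℕ) (D : List (List ℕ)) (lev : ℕ) (b : ℕ → ℕ) :
    ℕ → List (ℕ × ℕ) → ℕ → List (ℕ × ℕ) → ℕ → Prop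
  | pop {Z j J : ℕ} {ds : List (ℕ × ℕ)} : j ≤ J → Z = b j → SStep σ D lev b 0 ((Z, j) :: ds) J ds J
  | adv {Z J : ℕ} {ds : List (ℕ × ℕ)} : rule σ D Z = [b J, b J] → Z = b (J + 1) →
      SStep σ D lev b 0 ((Z, J + 1) :: ds) J ds (J + 1)
  | exp {Z j J : ℕ} {ds : List (ℕ × ℕ)} : lev ≤ j → (j + 1 ≤ J → Z ≠ b (j + 1)) →
      (j = J → rule σ D Z ≠ [b J, b J]) →
      SStep σ D lev b 1 ((Z, j + 1) :: ds) J ((rule σ D Z).map (fun x => (x, j)) ++ ds) J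

/-- `n` steps of skipping a run, `e` of which are expansions. -/
inductive SRun (σ : ℕ) (D : List (List ℕ)) (lev : ℕ) (b : ℕ → ℕ) :
    ℕ → ℕ → List (ℕ × ℕ) → ℕ → List (ℕ × ℕ) → ℕ → Prop
  | refl {ds : List (ℕ × ℕ)} {J : ℕ} : SRun σ D lev b 0 0 ds J ds J
  | head {i n e J J' J'' : ℕ} {ds ds' ds'' : List (ℕ × ℕ)} : SStep σ D lev b i ds J ds' J' →
      SRun σ D lev b n e ds' J' ds'' J'' → SRun σ D lev b (n + 1) (e + i) ds J ds'' J''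

theorem SRun.trans {lev n e n' e' J J' J'' : ℕ} {b : ℕ → ℕ} {ds ds' ds'' : List (ℕ × ℕ)}
    (h1 : SRun σ D lev b n e ds J ds' J') (h2 : SRun σ D lev b n' e' ds' J' ds'' J'') :
    SRun σ D lev b (n + n') (e + e') ds J ds'' J'' := by
  induction h1 with
  | refl => simpa using h2
  | @head i n e J J' J'' ds ds' ds'' h1 h3 ih =>
    rw [show n + 1 + n' = n + n' + 1 by ring, show e + i + e' = e + e' + i by ring]
    exact SRun.head h1 (ih h2)

/-- The invariant of skipping a run of `a` at the level `lev` which starts at `y`. -/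
structure SInv (σ : ℕ) (D : List (List ℕ)) (S : List ℕ) (h lev a y q : ℕ) (ds : List (ℕ × ℕ))
    (J cur : ℕ) : Prop where
  dq : Dq σ D S h (cur + 1) q ds cur q
  level : ∀ x ∈ ds, lev ≤ x.2
  run : ∃ r, Seg σ D S lev (List.replicate r a) y cur
  le_J : lev ≤ J
  J_le : J ≤ h

namespace Parse
variable (P : Parse σ S D root h)
include P

theorem rule_eq_iff {j X : ℕ} (hj : j < h) (hX : X ∈ espLevel σ D S (j + 1)) {c : List ℕ} :
    rule σ D X = c ↔ X = σ + D.idxOf c := by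
  rw [espLevel_succ, List.mem_map] at hX
  obtain ⟨b, hb, rfl⟩ := hX
  rw [P.rule_idxOf hj hb]
  constructor
  · rintro rfl
    rfl
  · intro he
    exact (List.idxOf_inj ((P.mem b).2 ⟨j, hj, hb⟩)).1 (by omega)

/-- The rules in the chain are squares, so the length of the run doubles with each level. -/
theorem seg_chain {lev d a s t : ℕ} (hd : lev + d ≤ h)
    (hs : Seg σ D S (lev + d) [chain σ D a d] s t) :
    Seg σ D S lev (List.replicate (2 ^ d) a) s t := by
  induction d generalizing s t with
  | zero => simpa [chain] using hs
  | succ d ih =>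
    have h1 := P.seg_down_singleton (j := lev + d) (by omega) hs
    rw [(P.rule_eq_iff (j := lev + d) (c := [chain σ D a d, chain σ D a d]) (by omega)
      (hs.mem (List.mem_singleton_self _))).2 rfl] at h1
    obtain ⟨r, h2, h3⟩ := h1.split_cons
    have := P.seg_append (by omega) (ih (by omega) h2) (ih (by omega) h3)
    rwa [← List.replicate_add, ← two_mul, ← pow_succ'] at this

theorem sinv_step {lev a y q i J J' cur : ℕ} {ds ds' : List (ℕ × ℕ)}
    (hi : SInv σ D S h lev a y q ds J cur)
    (hs : SStep σ D lev (fun j => chain σ D a (j - lev)) i ds J ds' J') :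
    ∃ cur', SInv σ D S h lev a y q ds' J' cur' := by
  have key : ∀ {j r}, lev ≤ j → j ≤ h → Seg σ D S j [chain σ D a (j - lev)] cur r →
      ∃ k, Seg σ D S lev (List.replicate k a) y r := by
    intro j r h1 h2 h3
    obtain ⟨k, hk⟩ := hi.run
    obtain ⟨d, rfl⟩ := Nat.exists_eq_add_of_le h1
    rw [Nat.add_sub_cancel_left] at h3
    have := P.seg_append (by omega) hk (P.seg_chain h2 h3)
    rw [← List.replicate_add] at this
    exact ⟨_, this⟩
  obtain ⟨hdq, hlev, hrun, hJ, hJh⟩ := hi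
  cases hs with
  | @pop Z j _ _ h1 h2 =>
    obtain ⟨r, e1, e2, e3, e4⟩ := hdq
    subst h2
    have := P.node_lt e1 e2
    exact ⟨r, Dq.mono e4 (by omega) le_rfl, fun x hx => hlev x (List.mem_cons_of_mem _ hx),
      key (hlev (_, j) (by simp)) e1 e2, hJ, hJh⟩
  | @adv Z _ _ h1 h2 =>
    obtain ⟨r, e1, e2, e3, e4⟩ := hdq
    subst h2
    have := P.node_lt e1 e2
    exact ⟨r, Dq.mono e4 (by omega) le_rfl, fun x hx => hlev x (List.mem_cons_of_mem _ hx),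
      key (hlev (_, J + 1) (by simp)) e1 e2, by omega, e1⟩
  | @exp Z j _ _ h1 h2 h3 =>
    refine ⟨cur, P.dq_expand_left hdq (by omega), ?_, hrun, hJ, hJh⟩
    intro x hx
    rcases List.mem_append.1 hx with hx | hx
    · obtain ⟨z, -, rfl⟩ := List.mem_map.1 hx
      exact h1
    · exact hlev x (List.mem_cons_of_mem _ hx)

/-- A removal trades one node for one step. An expansion adds at most two nodes and one step, which
explains the factor three. -/
theorem srun_length {lev a y q n e J J' cur : ℕ} {ds ds' : List (ℕ × ℕ)}
    (hi : SInv σ D S h lev a y q ds J cur)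
    (hs : SRun σ D lev (fun j => chain σ D a (j - lev)) n e ds J ds' J') :
    ds'.length + n ≤ ds.length + 3 * e := by
  induction hs generalizing cur with
  | refl => simp
  | head h1 h2 ih =>
    obtain ⟨cur', h3⟩ := P.sinv_step hi h1
    have := ih h3
    cases h1 with
    | pop => simp; omega
    | adv => simp; omega
    | @exp Z j _ _ h4 h5 h6 =>
      have := P.dq_length_rule hi.dq
      simp at *
      omega

/-- A symbol of the chain is removed at the cost of the progress in the chain. -/
theorem consume_chain {lev a d : ℕ} (hd : lev + d ≤ h)
    (hm : chain σ D a d ∈ espLevel σ D S (lev + d)) (ds : List (ℕ × ℕ)) {J : ℕ} (hJ : lev ≤ J) :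
    ∃ J' n e, SRun σ D lev (fun j => chain σ D a (j - lev)) n e ((chain σ D a d, lev + d) :: ds) J
      ds J' ∧ J + e ≤ J' ∧ (lev + d ≤ J + 1 → e = 0) ∧ (lev + d ≤ J → J' = J) ∧ (lev + d = J + 1 → J' = J + 1) ∧
      (J + 2 ≤ lev + d → J' + 1 = lev + d) := by
  induction d generalizing J ds with
  | zero =>
    refine ⟨J, 1, 0 + 0, SRun.head (SStep.pop (by omega) ?_) SRun.refl, by omega, by omega, by omega,
      by omega, by omega⟩
    simp
  | succ d ih =>
    have hr := (P.rule_eq_iff (j := lev + d) (by omega) hm).2 rfl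
    rcases lt_trichotomy (lev + (d + 1)) (J + 1) with h1 | h1 | h1
    · refine ⟨J, 1, 0 + 0, SRun.head (SStep.pop (by omega) ?_) SRun.refl, by omega, by omega,
        by omega, by omega, by omega⟩
      simp
    · obtain rfl : J = lev + d := by omega
      refine ⟨lev + d + 1, 1, 0 + 0, SRun.head (SStep.adv ?_ ?_) SRun.refl, by omega, by omega,
        by omega, by omega, by omega⟩
      · simpa using hr
      · simp [add_assoc]
    -- A chain symbol too high to be recognised is expanded into two equal halves. The first half
    -- raises `J` until the second half is recognised without expansion, and removing the second
    -- half raises `J` once more or the first has already brought it to the required level. So every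
    -- expansion is paid for by an increase of `J`.
    · have hm' : chain σ D a d ∈ espLevel σ D S (lev + d) :=
        P.mem_of_mem_rule (by omega) hm (by rw [hr]; simp)
      obtain ⟨J₁, n₁, e₁, r₁, c₁, c₀, c₂, c₃, c₄⟩ :=
        ih (by omega) hm' ((chain σ D a d, lev + d) :: ds) hJ
      obtain ⟨J₂, n₂, e₂, r₂, d₁, d₀, d₂, d₃, d₄⟩ := ih (J := J₁) (by omega) hm' ds (by omega)
      refine ⟨J₂, n₁ + n₂ + 1, e₁ + e₂ + 1, SRun.head (SStep.exp (j := lev + d) (by omega) (by omega)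
        (by omega)) ?_, by omega, by omega, by omega, by omega, by omega⟩
      rw [hr]
      exact r₁.trans r₂

/-- The expansions that are still possible. -/
theorem exists_srun {lev a y q m : ℕ} (F : ℕ → Finset ℕ)
    (hF : ∀ k s t X r, lev < k → k ≤ h → Seg σ D S lev (List.replicate r a) y s →
      Seg σ D S k [X] s t → X ≠ chain σ D a (k - lev) → s ∈ F k)
    {ds : List (ℕ × ℕ)} {J cur : ℕ} (hi : SInv σ D S h lev a y q ds J cur) {l Φ : ℕ}
    (hl : ∀ x ∈ ds.head?, x.2 = l)
    (hΦ : Φ = ∑ k ∈ Finset.Ioc lev h, ((F k).filter fun s => cur < s ∨ (s = cur ∧ k ≤ l)).card)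
    (hm : Φ + (q - cur) ≤ m) :
    ∃ n e ds' J', SRun σ D lev (fun j => chain σ D a (j - lev)) n e ds J ds' J' ∧
      (∀ x ∈ ds'.head?, x.2 = lev ∧ x.1 ≠ a) ∧ J + e ≤ J' + Φ := by
  -- Expansions of chain symbols are paid for by the growth of `J`, all others by `Φ`, which counts
  -- the nodes off the chain that may still be met. A node is identified by its start and its level;
  -- at the current start only levels up to that of the first node are still possible. Removals
  -- reduce `q - cur`.
  induction m using Nat.strong_induction_on generalizing ds J cur l Φ with
  | _ m ih =>
    rcases ds with _ | ⟨⟨Z, j⟩, ds⟩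
    · exact ⟨0, 0, [], J, SRun.refl, by simp, by omega⟩
    obtain rfl : j = l := by simpa using hl
    have hlj : lev ≤ j := hi.level _ (List.mem_cons_self)
    obtain ⟨d, rfl⟩ := Nat.exists_eq_add_of_le hlj
    have hdq := hi.dq
    obtain ⟨r, e1, e2, e3, e4⟩ := hdq
    simp only at e1 e2 e3
    have e5 := P.node_lt e1 e2
    have e6 := P.dq_le e4
    obtain ⟨k, hk⟩ := hi.run
    by_cases hZ : Z = chain σ D a d
    · subst hZ
      obtain ⟨J', n, e, r1, c1, c0, c2, c3, c4⟩ :=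
        P.consume_chain e1 (e2.mem (List.mem_singleton_self _)) ds hi.le_J
      have hJh := hi.J_le
      have hi' : SInv σ D S h lev a y q ds J' r := by
        refine ⟨Dq.mono e4 (by omega) le_rfl, fun x hx => hi.level x (List.mem_cons_of_mem _ hx), ?_,
          by have := hi.le_J; omega, by omega⟩
        have := P.seg_append (by omega) hk (P.seg_chain e1 e2)
        rw [← List.replicate_add] at this
        exact ⟨_, this⟩
      obtain ⟨l', hl'⟩ : ∃ l', ∀ x ∈ ds.head?, x.2 = l' := by
        rcases ds with _ | ⟨x, ds⟩
        · exact ⟨0, by simp⟩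
        · exact ⟨x.2, by simp⟩
      have hle : ∑ k ∈ Finset.Ioc lev h, ((F k).filter fun s => r < s ∨ (s = r ∧ k ≤ l')).card ≤ Φ := by
        rw [hΦ]
        refine Finset.sum_le_sum fun k _ => Finset.card_le_card fun s => ?_
        simp only [Finset.mem_filter]
        exact fun ⟨f1, f2⟩ => ⟨f1, by omega⟩
      obtain ⟨n', e', ds', J'', r2, s1, s2⟩ := ih _ (by omega) hi' hl' rfl le_rfl
      exact ⟨n + n', e + e', ds', J'', r1.trans r2, s1, by omega⟩
    · rcases d with _ | d
      · exact ⟨0, 0, _, J, SRun.refl, by simpa [chain] using hZ, by omega⟩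
      · have hst : SStep σ D lev (fun j => chain σ D a (j - lev)) 1 ((Z, lev + d + 1) :: ds) J
            ((rule σ D Z).map (fun x => (x, lev + d)) ++ ds) J := by
          refine SStep.exp (by omega) (fun _ => ?_) fun hJ hr => hZ ?_
          · simpa [add_assoc] using hZ
          · rw [(P.rule_eq_iff (j := lev + d) e1 (e2.mem (List.mem_singleton_self _))).1 hr, ← hJ]
            simp [chain]
        have hr := P.length_rule (i := lev + d) e1 (e2.mem (List.mem_singleton_self _))
        have hi' : SInv σ D S h lev a y q ((rule σ D Z).map (fun x => (x, lev + d)) ++ ds) J cur := by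
          refine ⟨P.dq_expand_left hi.dq (by omega), ?_, hi.run, hi.le_J, hi.J_le⟩
          intro x hx
          rcases List.mem_append.1 hx with hx | hx
          · obtain ⟨z, -, rfl⟩ := List.mem_map.1 hx
            simp
          · exact hi.level x (List.mem_cons_of_mem _ hx)
        obtain ⟨Φ', hΦ'⟩ : ∃ Φ', Φ' = ∑ k ∈ Finset.Ioc lev h,
            ((F k).filter fun s => cur < s ∨ (s = cur ∧ k ≤ lev + d)).card := ⟨_, rfl⟩
        -- The expanded node, which starts at `cur` on level `lev + d + 1`, was counted before.
        -- Afterwards only levels up to `lev + d` count at `cur`.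
        have hlt : Φ' < Φ := by
          rw [hΦ, hΦ']
          refine Finset.sum_lt_sum (fun k _ => Finset.card_le_card fun s => ?_)
            ⟨lev + d + 1, by simp; exact e1, Finset.card_lt_card ?_⟩
          · simp only [Finset.mem_filter]
            exact fun ⟨f1, f2⟩ => ⟨f1, by omega⟩
          · rw [Finset.ssubset_iff_of_subset]
            · refine ⟨cur, ?_, by simp⟩
              simp only [Finset.mem_filter]
              refine ⟨hF (lev + d + 1) cur r Z k (by omega) e1 hk e2 ?_, by simp [add_assoc]⟩
              rwa [show lev + d + 1 - lev = d + 1 by omega]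
            · intro s
              simp only [Finset.mem_filter]
              exact fun ⟨f1, f2⟩ => ⟨f1, by omega⟩
        obtain ⟨n', e', ds', J'', r2, s1, s2⟩ := ih (Φ' + (q - cur)) (by omega) hi' (l := lev + d) (by
          rcases hrr : rule σ D Z with _ | ⟨z, t⟩
          · rw [hrr] at hr; simp at hr
          · simp) hΦ' le_rfl
        exact ⟨n' + 1, e' + 1, ds', J'', SRun.head hst r2, s1, by omega⟩

end Parse
end

/-! ### Nodes over a run -/

section
variable {σ : ℕ} {S : List ℕ} {D : List (List ℕ)} {root h : ℕ}

theorem two_mul_length_le_flatten {Bs : List (List ℕ)} (h : ∀ B ∈ Bs, B.length = 2 ∨ B.length = 3) :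
    2 * Bs.length ≤ Bs.flatten.length := by
  induction Bs with
  | nil => simp
  | cons B Bs ih =>
    have h1 := h B (by simp)
    have h2 := ih fun B hB => h B (by simp [hB])
    simp only [List.length_cons, List.flatten_cons, List.length_append]
    omega

/-- All blocks but the last occupy at least two places each and end where the last one starts, which
is before `m`. -/
theorem length_le_of_starts {Bs : List (List ℕ)} {m : ℕ}
    (hlen : ∀ B ∈ Bs, B.length = 2 ∨ B.length = 3)
    (hst : ∀ l₁ l₂, Bs = l₁ ++ l₂ → l₂ ≠ [] → l₁.flatten.length < m) : 2 * Bs.length ≤ m + 1 := by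
  rcases List.eq_nil_or_concat Bs with rfl | ⟨l, B, rfl⟩
  · simp
  · rw [List.concat_eq_append] at hlen hst ⊢
    have h1 := hst l [B] rfl (by simp)
    have h2 := two_mul_length_le_flatten fun B hB => hlen B (List.mem_append_left _ hB)
    simp
    omega

/-- Blocks over a run of `b` are pairs, up to at most two blocks at the end. -/
theorem blocks_run {b n : ℕ} {Bs : List (List ℕ)} {z ex : List ℕ}
    (hlen : ∀ B ∈ Bs, B.length = 2 ∨ B.length = 3)
    (hch : Bs.IsChain (fun u v => ∀ b, u = [b, b, b] → v.head? ≠ some b))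
    (hflat : Bs.flatten = List.replicate n b ++ (z ++ ex)) (hz : z.length ≤ 2)
    (hst : ∀ l₁ l₂, Bs = l₁ ++ l₂ → l₂ ≠ [] → l₁.flatten.length < n + z.length) :
    ∃ n' z', Bs = List.replicate n' [b, b] ++ z' ∧ z'.length ≤ 2 := by
  induction n using Nat.strong_induction_on generalizing Bs with
  | _ n ih =>
    by_cases hn : n ≤ 2
    · have := length_le_of_starts hlen hst
      exact ⟨0, Bs, rfl, by omega⟩
    obtain ⟨n, rfl⟩ : ∃ k, n = k + 3 := ⟨n - 3, by omega⟩
    rcases Bs with _ | ⟨B, Bs⟩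
    · exact ⟨0, [], rfl, by simp⟩
    rw [List.isChain_cons] at hch
    have hB := hlen B (by simp)
    have hlen' : ∀ B ∈ Bs, B.length = 2 ∨ B.length = 3 := fun B hB => hlen B (by simp [hB])
    rw [List.flatten_cons] at hflat
    have hst' : ∀ l₁ l₂, Bs = l₁ ++ l₂ → l₂ ≠ [] →
        B.length + l₁.flatten.length < n + 3 + z.length := by
      intro l₁ l₂ h1 h2
      have := hst (B :: l₁) l₂ (by rw [h1]; rfl) h2
      simpa using this
    rcases hB with hB | hB
    · have hBb : B = [b, b] := by
        have := congrArg (List.take 2) hflat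
        rw [← hB, List.take_left, hB] at this
        rw [this]
        rfl
      subst hBb
      have hflat' : Bs.flatten = List.replicate (n + 1) b ++ (z ++ ex) := by
        have := congrArg (List.drop 2) hflat
        rw [show ([b, b] ++ Bs.flatten).drop 2 = Bs.flatten from rfl] at this
        rw [this]
        rfl
      obtain ⟨n', z', h1, h2⟩ := ih (n + 1) (by omega) hlen' hch.2 hflat' fun l₁ l₂ h1 h2 => by
        have := hst' l₁ l₂ h1 h2
        simp at this
        simp
        omega
      exact ⟨n' + 1, z', by rw [h1, List.replicate_succ]; rfl, h2⟩
    · have hBb : B = [b, b, b] := by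
        have := congrArg (List.take 3) hflat
        rw [← hB, List.take_left, hB] at this
        rw [this]
        rfl
      subst hBb
      have hflat' : Bs.flatten = List.replicate n b ++ (z ++ ex) := by
        have := congrArg (List.drop 3) hflat
        rw [show ([b, b, b] ++ Bs.flatten).drop 3 = Bs.flatten from rfl] at this
        rw [this]
        rfl
      -- A block `b b b` is not followed by another `b`, so it either exhausts the run or is the
      -- last block considered. Then at most one further block can start in the two exceptional
      -- symbols.
      have hn0 : n = 0 ∨ Bs = [] := by
        rcases n with _ | n
        · exact Or.inl rfl
        · right
          rcases Bs with _ | ⟨v, Bs⟩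
          · rfl
          · have h1 := hch.1 v (by simp) b rfl
            have h2 := hlen' v (by simp)
            rcases v with _ | ⟨c, v⟩
            · simp at h2
            · rw [List.flatten_cons, List.replicate_succ] at hflat'
              simp at hflat'
              simp [hflat'.1] at h1
      rcases hn0 with rfl | rfl
      · have := length_le_of_starts (m := z.length) hlen' fun l₁ l₂ h1 h2 => by
          have := hst' l₁ l₂ h1 h2
          simp at this
          simp
          omega
        exact ⟨0, _, rfl, by simp; omega⟩
      · exact ⟨0, [[b, b, b]], rfl, by simp⟩

namespace Parse
variable (P : Parse σ S D root h)
include P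

theorem exists_bd_ge {j : ℕ} (hj : j ≤ h) {s : ℕ} (hs : s ≤ S.length) :
    ∃ b, s ≤ b ∧ Bd σ D S j b ∧ ∀ b', s ≤ b' → Bd σ D S j b' → b ≤ b' := by
  classical
  have hex : ∃ b, s ≤ b ∧ Bd σ D S j b := ⟨S.length, hs, P.bd_length hj⟩
  exact ⟨Nat.find hex, (Nat.find_spec hex).1, (Nat.find_spec hex).2,
    fun b' h1 h2 => Nat.find_min' hex ⟨h1, h2⟩⟩

/-- The nodes of each level which start in a run of `a` are symbols of the chain of `a`, up to at
most two at the end. -/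
theorem run_nodes {lev a y : ℕ} (hlev : lev ≤ h) (hy : Bd σ D S lev y) (d : ℕ) (hd : lev + d ≤ h) :
    ∃ n z s t, Seg σ D S (lev + d) (List.replicate n (chain σ D a d) ++ z) s t ∧ z.length ≤ 2 ∧
      ∀ r X s₁ t₁, Seg σ D S lev (List.replicate r a) y s₁ → Seg σ D S (lev + d) [X] s₁ t₁ →
        s ≤ s₁ ∧ s₁ < t := by
  induction d with
  | zero =>
    have hmax : ∃ R x, Seg σ D S lev (List.replicate R a) y x ∧
        ∀ r s₁, Seg σ D S lev (List.replicate r a) y s₁ → r ≤ R := by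
      classical
      have hb : ∀ r, (∃ s₁, Seg σ D S lev (List.replicate r a) y s₁) → r ≤ S.length := by
        rintro r ⟨s₁, hs⟩
        have h1 := P.seg_length_le hlev hs
        have h2 := P.seg_right_le hlev hs
        rw [List.length_replicate] at h1
        omega
      have h0 : ∃ s₁, Seg σ D S lev (List.replicate 0 a) y s₁ := ⟨y, hy⟩
      obtain ⟨x, hx⟩ := Nat.findGreatest_spec (P := fun r => ∃ s₁, Seg σ D S lev (List.replicate r a) y s₁)
        (Nat.zero_le S.length) h0
      exact ⟨_, x, hx, fun r s₁ hs => Nat.le_findGreatest (hb r ⟨s₁, hs⟩) ⟨s₁, hs⟩⟩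
    obtain ⟨R, x, hx, hR⟩ := hmax
    have hle : ∀ r s₁, Seg σ D S lev (List.replicate r a) y s₁ → y ≤ s₁ ∧ s₁ ≤ x := by
      intro r s₁ hs
      have h1 := hs.eq_add
      have h2 := hx.eq_add
      have h3 := hR r s₁ hs
      obtain ⟨k, rfl⟩ := Nat.exists_eq_add_of_le h3
      rw [List.replicate_add, List.flatMap_append, List.length_append] at h2
      omega
    rcases Nat.lt_or_ge x S.length with hxN | hxN
    -- A node that starts exactly at the end of the maximal run also counts, so one symbol behind
    -- the run is included as exceptional.
    · obtain ⟨Z, c, e, h1, h2, h3⟩ := P.exists_node hlev hxN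
      have h4 := P.bd_node hlev h1 hx.bd_right
      obtain rfl : c = x := by omega
      refine ⟨R, [Z], y, e, P.seg_append hlev hx h1, by simp, fun r X s₁ t₁ h5 h6 => ?_⟩
      have := hle r s₁ h5
      omega
    · refine ⟨R, [], y, x, by simpa [chain] using hx, by simp, fun r X s₁ t₁ h5 h6 => ?_⟩
      have h7 := hle r s₁ h5
      have h8 := P.node_lt (by omega) h6
      have h9 := P.seg_right_le (by omega) h6
      omega
  | succ d ih =>
    obtain ⟨n, z, s, t, h1, h2, h3⟩ := ih (by omega)
    have hd' : lev + d < h := by omega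
    have hst := h1.le
    have htN := P.seg_right_le hd'.le h1
    -- On the next level the relevant nodes are those that start in `[s, t)`. They are delimited by
    -- the first boundaries at or behind `s` and `t`, and the last one may reach beyond `t`.
    obtain ⟨s', a1, a2, a3⟩ := P.exists_bd_ge (j := lev + d + 1) hd' (hst.trans htN)
    obtain ⟨t', b1, b2, b3⟩ := P.exists_bd_ge (j := lev + d + 1) hd' htN
    have hst' : s' ≤ t' := a3 t' (by omega) b2
    have hrun : ∀ r X s₁ t₁, Seg σ D S lev (List.replicate r a) y s₁ →
        Seg σ D S (lev + d + 1) [X] s₁ t₁ → s' ≤ s₁ ∧ s₁ < t ∧ s₁ < t' := by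
      intro r X s₁ t₁ e1 e2
      have e3 := P.node_lt hd' e2
      have e4 := P.seg_right_le hd' e2
      obtain ⟨Z, c, e, f1, f2, f3⟩ := P.exists_node hd'.le (p := s₁) (by omega)
      have f4 := P.bd_node hd'.le f1 (P.bd_of_bd_succ hd' e2.bd_left)
      obtain rfl : c = s₁ := by omega
      have f5 := h3 r Z c e e1 f1
      exact ⟨a3 _ f5.1 e2.bd_left, f5.2, by omega⟩
    obtain ⟨U, hU⟩ := P.exists_seg hd' a2 b2 hst'
    by_cases hts : t ≤ s'
    · have : s' = t' := by
        have := b3 s' hts a2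
        omega
      refine ⟨0, [], s', t', ?_, by simp, fun r X s₁ t₁ e1 e2 => ?_⟩
      · rw [← this]; exact a2
      · have := hrun r X s₁ t₁ e1 e2
        omega
    push Not at hts
    -- the symbols of the level below
    obtain ⟨u₁, hu₁⟩ := P.exists_seg hd'.le h1.bd_left (P.bd_of_bd_succ hd' a2) a1
    obtain ⟨u₂, hu₂⟩ := P.exists_seg hd'.le (P.bd_of_bd_succ hd' a2) h1.bd_right hts.le
    obtain ⟨ex, hex⟩ := P.exists_seg hd'.le h1.bd_right (P.bd_of_bd_succ hd' b2) b1
    have hu := P.seg_unique hd'.le h1 (P.seg_append hd'.le hu₁ hu₂)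
    have hflat := P.seg_unique hd'.le (P.seg_down hd' hU) (P.seg_append hd'.le hu₂ hex)
    obtain ⟨n₁, z₁, hz₁, hz₁'⟩ : ∃ n₁ z₁, u₂ = List.replicate n₁ (chain σ D a d) ++ z₁ ∧
        z₁.length ≤ 2 := by
      rcases List.append_eq_append_iff.1 hu with ⟨c, e1, e2⟩ | ⟨c, e1, e2⟩
      · exact ⟨0, u₂, rfl, by rw [e2] at h2; simp at h2; omega⟩
      · refine ⟨c.length, z, ?_, h2⟩
        rw [e2]
        congr 1
        rw [List.eq_replicate_iff]
        exact ⟨rfl, fun x hx => List.eq_of_mem_replicate (e1 ▸ List.mem_append_right _ hx)⟩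
    have hlen : ∀ B ∈ U.map (rule σ D), B.length = 2 ∨ B.length = 3 := by
      intro B hB
      obtain ⟨X, hX, rfl⟩ := List.mem_map.1 hB
      exact P.length_rule hd' (hU.mem hX)
    have hch : (U.map (rule σ D)).IsChain (fun u v => ∀ b, u = [b, b, b] → v.head? ≠ some b) := by
      have h4 := espBlocks_chain (L := logStar S.length) (R := logStar (σ + S.length))
        (Or.inr (P.len _ hd'))
      rw [show espBlocks _ _ _ = blocks σ S.length _ from rfl, ← P.map_rule hd'] at h4
      obtain ⟨A, Z, h5, -⟩ := hU
      rw [h5, List.map_append, List.map_append] at h4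
      exact (List.isChain_append.1 (List.isChain_append.1 h4).2.1).1
    obtain ⟨n', z', k1, k2⟩ := blocks_run (n := n₁) (z := z₁) (ex := ex) hlen hch
      (by rw [← List.flatMap_def, hflat, hz₁, List.append_assoc]) hz₁' (by
        intro l₁ l₂ e1 e2
        obtain ⟨U₁, U₂, rfl, rfl, rfl⟩ := List.map_eq_append_iff.1 e1
        obtain ⟨m, f1, f2⟩ := hU.split
        have f3 : m < t' := by
          have := P.seg_length_le hd' f2
          have : 0 < U₂.length := List.length_pos_iff.2 (by rintro rfl; simp at e2)
          omega
        have f4 : m < t := by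
          by_contra hc
          have := b3 m (by omega) f1.bd_right
          omega
        have g1 := P.seg_down hd' f1
        have g2 := f1.le
        obtain ⟨v, hv⟩ := P.exists_seg hd'.le g1.bd_right h1.bd_right f4.le
        have g3 := congrArg List.length (P.seg_unique hd'.le hu₂ (P.seg_append hd'.le g1 hv))
        have g4 : 0 < v.length := by
          rcases v with _ | ⟨x, v⟩
          · have := hv.eq_add
            simp at this
            omega
          · simp
        rw [hz₁] at g3
        simp only [List.length_append, List.length_replicate] at g3
        rw [← List.flatMap_def]
        omega)
    obtain ⟨U₁, U₂, rfl, k3, k4⟩ := List.map_eq_append_iff.1 k1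
    have k5 : U₁ = List.replicate n' (chain σ D a (d + 1)) := by
      rw [List.eq_replicate_iff]
      constructor
      · simpa using congrArg List.length k3
      · intro X hX
        have hr : rule σ D X = [chain σ D a d, chain σ D a d] :=
          List.eq_of_mem_replicate (k3 ▸ List.mem_map_of_mem hX)
        exact (P.rule_eq_iff hd' (hU.mem (List.mem_append_left _ hX))).1 hr
    subst k5
    refine ⟨n', U₂, s', t', hU, by rw [← k4] at k2; simpa using k2, fun r X s₁ t₁ e1 e2 => ?_⟩
    have := hrun r X s₁ t₁ e1 e2
    omega

/-- Skipping a run succeeds with few expansions. -/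
theorem exists_skip {lev a y q : ℕ} {ds : List (ℕ × ℕ)} (hlev : lev ≤ h) (hy : Bd σ D S lev y)
    (hd : Dq σ D S h (y + 1) q ds y q) (hl : ∀ x ∈ ds, lev ≤ x.2) :
    ∃ n e ds' J', SRun σ D lev (fun j => chain σ D a (j - lev)) n e ds lev ds' J' ∧
      (∀ x ∈ ds'.head?, x.2 = lev ∧ x.1 ≠ a) ∧ lev + e ≤ J' + 2 * h := by
  -- By `run_nodes` at most two nodes of each level start in the run without being chain symbols, so
  -- the potential in `exists_srun` is at most `2 * h`.
  have hex : ∀ k, ∃ F : Finset ℕ, F.card ≤ 2 ∧ ∀ s t X r, lev < k → k ≤ h →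
      Seg σ D S lev (List.replicate r a) y s → Seg σ D S k [X] s t →
      X ≠ chain σ D a (k - lev) → s ∈ F := by
    intro k
    by_cases hk : lev < k ∧ k ≤ h
    · obtain ⟨d, rfl⟩ := Nat.exists_eq_add_of_le hk.1.le
      obtain ⟨n, z, s, t, h1, h2, h3⟩ := P.run_nodes (a := a) hlev hy d hk.2
      obtain ⟨c, h4, h5⟩ := h1.split
      obtain ⟨F, h6, h7⟩ := P.exists_starts hk.2 h5
      obtain ⟨F', -, h8⟩ := P.exists_starts hk.2 h4
      refine ⟨F, by omega, fun s₁ t₁ X r _ _ e1 e2 e3 => ?_⟩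
      rw [Nat.add_sub_cancel_left] at e3
      have h9 := h3 r X s₁ t₁ e1 e2
      by_cases hc : s₁ < c
      · exact absurd (List.eq_of_mem_replicate (h8 X s₁ t₁ e2 h9.1 hc).2) e3
      · exact (h7 X s₁ t₁ e2 (by omega) h9.2).1
    · exact ⟨∅, by simp, fun s t X r e1 e2 => absurd ⟨e1, e2⟩ hk⟩
  choose F hF1 hF2 using hex
  obtain ⟨l, hl'⟩ : ∃ l, ∀ x ∈ ds.head?, x.2 = l := by
    rcases ds with _ | ⟨x, ds⟩
    · exact ⟨0, by simp⟩
    · exact ⟨x.2, by simp⟩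
  obtain ⟨n, e, ds', J', h1, h2, h3⟩ := P.exists_srun F
    (fun k s t X r e1 e2 e3 e4 e5 => hF2 k s t X r e1 e2 e3 e4 e5)
    (⟨hd, hl, ⟨0, hy⟩, le_rfl, hlev⟩ : SInv σ D S h lev a y q ds lev y) hl' rfl le_rfl
  refine ⟨n, e, ds', J', h1, h2, h3.trans (Nat.add_le_add_left ?_ _)⟩
  refine (Finset.sum_le_card_nsmul _ _ 2 fun k _ =>
    (Finset.card_filter_le _ _).trans (hF1 k)).trans ?_
  simp
  omega

end Parse
end

/-! ### Reasoning about programs -/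

/-- The value of an operation on unbounded words. -/
def Op.val : Op → ℕ → ℕ → ℕ
  | .add, x, y => x + y
  | .sub, x, y => x - y
  | .mul, x, y => x * y
  | .div, x, y => x / y
  | .mod, x, y => x % y
  | .lt, x, y => if x < y then 1 else 0
  | .eq, x, y => if x = y then 1 else 0

/-- The operation does not overflow. -/
def Op.Fits (B : ℕ) : Op → ℕ → ℕ → Prop
  | .add, x, y => x + y < B
  | .mul, x, y => x * y < B
  | _, _, _ => True

/-- The value of an expression on unbounded words. -/
def Expr.val (s : State) : Expr → ℕ
  | .const k => k
  | .reg i => s.reg i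
  | .load a => s.mem (a.val s)
  | .bin op e f => op.val (e.val s) (f.val s)

/-- No operation overflows in the evaluation of the expression. -/
def Expr.Ok (B : ℕ) (s : State) : Expr → Prop
  | .const k => k < B
  | .reg _ => True
  | .load a => a.Ok B s
  | .bin op e f => e.Ok B s ∧ f.Ok B s ∧ op.Fits B (e.val s) (f.val s)

theorem Expr.eval_eq_val {w : ℕ} {s : State} {e : Expr} (h : e.Ok (2 ^ w) s) :
    e.eval w s = e.val s := by
  induction e with
  | const k => exact Nat.mod_eq_of_lt h
  | reg i => rfl
  | load a ih => simp only [Expr.eval, Expr.val, ih h]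
  | bin op e f ihe ihf =>
    obtain ⟨h1, h2, h3⟩ := h
    simp only [Expr.eval, Expr.val, ihe h1, ihf h2]
    cases op <;> simp only [Op.eval, Op.val]
    · exact Nat.mod_eq_of_lt h3
    · exact Nat.mod_eq_of_lt h3

/-- The expression is true, that is, not zero. -/
def Expr.Holds (s : State) (e : Expr) : Prop := e.val s ≠ 0

def State.setReg (s : State) (i v : ℕ) : State := { s with reg := Function.update s.reg i v }

def State.setMem (s : State) (a v : ℕ) : State := { s with mem := Function.update s.mem a v }

/-- The entry `k` of the array number `r`; eight arrays are interleaved from the address in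
register `3` on. -/
def State.arr (s : State) (r k : ℕ) : ℕ := s.mem (s.reg 3 + 8 * k + r)

def State.setArr (s : State) (r k v : ℕ) : State := s.setMem (s.reg 3 + 8 * k + r) v

/-- The weakest precondition, up to overflow; the postcondition may speak about the time. -/
def Prog.wp (w : ℕ) : Prog → (ℕ → State → Prop) → ℕ → State → Prop
  | .skip, Q => fun t s => Q (t + 1) s
  | .assign i e, Q => fun t s => e.Ok (2 ^ w) s ∧ Q (t + (e.cost + 1)) (s.setReg i (e.val s))
  | .store a e, Q => fun t s => a.Ok (2 ^ w) s ∧ e.Ok (2 ^ w) s ∧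
      Q (t + (a.cost + e.cost + 1)) (s.setMem (a.val s) (e.val s))
  | .seq p q, Q => p.wp w (q.wp w Q)
  | .ite e p q, Q => fun t s => e.Ok (2 ^ w) s ∧ (e.Holds s → p.wp w Q (t + (e.cost + 1)) s) ∧
      (¬ e.Holds s → q.wp w Q (t + (e.cost + 1)) s)
  | .loop e p, Q => fun t s => ∃ d s', Exec w (.loop e p) s d s' ∧ Q (t + d) s'

/-- Soundness. Because no operation overflows, evaluation modulo `2 ^ w` agrees with the unbounded
values; for loops the precondition already contains an execution. -/
theorem Prog.exec_of_wp {w : ℕ} {p : Prog} {Q : ℕ → State → Prop} {t : ℕ} {s : State}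
    (h : p.wp w Q t s) : ∃ d s', Exec w p s d s' ∧ Q (t + d) s' := by
  induction p generalizing Q t s with
  | skip => exact ⟨_, _, Exec.skip s, h⟩
  | assign i e =>
    refine ⟨_, _, Exec.assign s i e, ?_⟩
    rw [Expr.eval_eq_val h.1]
    exact h.2
  | store a e =>
    refine ⟨_, _, Exec.store s a e, ?_⟩
    rw [Expr.eval_eq_val h.1, Expr.eval_eq_val h.2.1]
    exact h.2.2
  | seq p q ihp ihq =>
    obtain ⟨d, s', h1, h2⟩ := ihp h
    obtain ⟨d', s'', h3, h4⟩ := ihq h2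
    exact ⟨_, _, Exec.seq h1 h3, by rwa [← add_assoc]⟩
  | ite e p q ihp ihq =>
    obtain ⟨h1, h2, h3⟩ := h
    by_cases he : e.Holds s
    · obtain ⟨d, s', h4, h5⟩ := ihp (h2 he)
      exact ⟨_, _, Exec.ite_true (by rw [Expr.eval_eq_val h1]; exact he) h4, by rwa [← add_assoc]⟩
    · obtain ⟨d, s', h4, h5⟩ := ihq (h3 he)
      exact ⟨_, _, Exec.ite_false (by rw [Expr.eval_eq_val h1]; simpa [Expr.Holds] using he) h4,
        by rwa [← add_assoc]⟩
  | loop e p => exact h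

/-- A loop with an invariant which bounds the time. -/
theorem Prog.wp_loop {w : ℕ} {e : Expr} {p : Prog} {Q : ℕ → State → Prop} (I : ℕ → State → Prop)
    (T : ℕ) (hT : ∀ t s, I t s → t ≤ T)
    (hstep : ∀ t s, I t s → e.Ok (2 ^ w) s ∧ (e.Holds s → p.wp w I (t + (e.cost + 1)) s) ∧
      (¬ e.Holds s → Q (t + (e.cost + 1)) s))
    {t : ℕ} {s : State} (h : I t s) : (Prog.loop e p).wp w Q t s := by
  -- Every turn costs at least one step and the invariant bounds the time, so the remaining time
  -- serves as the termination measure.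
  obtain ⟨m, hm⟩ : ∃ m, T + 1 - t = m := ⟨_, rfl⟩
  induction m using Nat.strong_induction_on generalizing t s with
  | _ m ih =>
    obtain ⟨h1, h2, h3⟩ := hstep t s h
    by_cases he : e.Holds s
    · obtain ⟨d, s', h4, h5⟩ := Prog.exec_of_wp (h2 he)
      have h6 := hT _ _ h
      obtain ⟨d', s'', h7, h8⟩ := ih (T + 1 - (t + (e.cost + 1) + d)) (by omega) h5 rfl
      refine ⟨_, _, Exec.loop_true (by rw [Expr.eval_eq_val h1]; exact he) h4 h7, ?_⟩
      rwa [← add_assoc, ← add_assoc]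
    · exact ⟨_, _, Exec.loop_false (by rw [Expr.eval_eq_val h1]; simpa [Expr.Holds] using he), h3 he⟩

/-- Unfold a loop once. -/
theorem Prog.wp_loop_unfold {w : ℕ} {e : Expr} {p : Prog} {Q : ℕ → State → Prop} {t : ℕ} {s : State}
    (h1 : e.Ok (2 ^ w) s) (he : e.Holds s)
    (h2 : p.wp w ((Prog.loop e p).wp w Q) (t + (e.cost + 1)) s) : (Prog.loop e p).wp w Q t s := by
  obtain ⟨d, s', h4, d', s'', h5, h6⟩ := Prog.exec_of_wp h2
  refine ⟨_, _, Exec.loop_true (by rw [Expr.eval_eq_val h1]; exact he) h4 h5, ?_⟩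
  rwa [← add_assoc, ← add_assoc]

/-- Leave a loop. -/
theorem Prog.wp_loop_exit {w : ℕ} {e : Expr} {p : Prog} {Q : ℕ → State → Prop} {t : ℕ} {s : State}
    (h1 : e.Ok (2 ^ w) s) (he : ¬ e.Holds s) (h2 : Q (t + (e.cost + 1)) s) :
    (Prog.loop e p).wp w Q t s :=
  ⟨_, _, Exec.loop_false (by rw [Expr.eval_eq_val h1]; simpa [Expr.Holds] using he), h2⟩

/-! ### Notation for expressions and programs -/

instance : Add Expr := ⟨.bin .add⟩
instance : Sub Expr := ⟨.bin .sub⟩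
instance : Mul Expr := ⟨.bin .mul⟩

/-- Sequential composition. -/
def block : List Prog → Prog
  | [] => .skip
  | p :: ps => .seq p (block ps)

/-- Conjunction. -/
def Expr.and (e f : Expr) : Expr := .bin .lt (.bin .eq e (.const 0)) (.bin .lt (.const 0) f)

/-- The address of an array entry. -/
def Expr.addr (r : ℕ) (e : Expr) : Expr := .reg 3 + .const 8 * e + .const r

/-- An array entry. -/
def Expr.arr (r : ℕ) (e : Expr) : Expr := .load (.addr r e)

/-- Assignment of an array entry. -/
def Prog.setArr (r : ℕ) (i e : Expr) : Prog := .store (.addr r i) e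

section
variable {w : ℕ} {s : State} {e f : Expr} {Q : ℕ → State → Prop} {t : ℕ}

theorem Expr.ok_addr {B r : ℕ} : (Expr.addr r e).Ok B s ↔
    e.Ok B s ∧ 8 < B ∧ s.reg 3 + 8 * e.val s + r < B := by
  constructor
  · rintro ⟨⟨-, ⟨h2, h1, -⟩, -⟩, h5, h6⟩
    exact ⟨h1, h2, h6⟩
  · rintro ⟨h1, h2, h3⟩
    exact ⟨⟨trivial, ⟨h2, h1, show 8 * e.val s < B by omega⟩,
      show s.reg 3 + 8 * e.val s < B by omega⟩, show r < B by omega, h3⟩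

theorem Expr.ok_bin_iff {B : ℕ} {op : Op} (h : op ∈ [Op.sub, .div, .lt, .eq]) :
    (Expr.bin op e f).Ok B s ↔ e.Ok B s ∧ f.Ok B s := by
  refine ⟨fun h => ⟨h.1, h.2.1⟩, fun h' => ⟨h'.1, h'.2, ?_⟩⟩
  simp at h
  rcases h with rfl | rfl | rfl | rfl <;> trivial

theorem Expr.holds_lt : (Expr.bin .lt e f).Holds s ↔ e.val s < f.val s := by
  simp [Expr.Holds, Expr.val, Op.val]

theorem Expr.holds_eq : (Expr.bin .eq e f).Holds s ↔ e.val s = f.val s := by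
  simp [Expr.Holds, Expr.val, Op.val]

theorem Expr.holds_and : (Expr.and e f).Holds s ↔ e.Holds s ∧ f.Holds s := by
  unfold Expr.and
  rw [Expr.holds_lt]
  simp only [Expr.Holds, Expr.val, Op.val]
  rcases Nat.eq_zero_or_pos (e.val s) with h1 | h1 <;>
    rcases Nat.eq_zero_or_pos (f.val s) with h2 | h2 <;>
    simp [h1, h2, Nat.ne_of_gt]

@[simp] theorem State.reg_setReg {i j v : ℕ} :
    (s.setReg i v).reg j = if j = i then v else s.reg j := by
  simp [State.setReg, Function.update_apply]
@[simp] theorem State.mem_setReg {i v a : ℕ} : (s.setReg i v).mem a = s.mem a := rfl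
@[simp] theorem State.reg_setMem {a v j : ℕ} : (s.setMem a v).reg j = s.reg j := rfl
@[simp] theorem State.mem_setMem {a v b : ℕ} :
    (s.setMem a v).mem b = if b = a then v else s.mem b := by
  simp [State.setMem, Function.update_apply]
@[simp] theorem State.reg_setArr {r k v j : ℕ} : (s.setArr r k v).reg j = s.reg j := rfl
theorem State.mem_setArr {r k v a : ℕ} (h : a < s.reg 3) : (s.setArr r k v).mem a = s.mem a := by
  simp only [State.setArr, State.mem_setMem]
  rw [if_neg (by omega)]
theorem State.arr_setReg {i v r k : ℕ} (h : i ≠ 3) : (s.setReg i v).arr r k = s.arr r k := by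
  simp [State.arr, h.symm]
theorem State.arr_setArr {r k v r' k' : ℕ} (hr : r < 8) (hr' : r' < 8) :
    (s.setArr r k v).arr r' k' = if r' = r ∧ k' = k then v else s.arr r' k' := by
  simp only [State.arr, State.setArr, State.mem_setMem, State.reg_setMem]
  congr 1
  apply propext
  omega
theorem State.arr_setMem {a v r k : ℕ} (ha : a < s.reg 3) : (s.setMem a v).arr r k = s.arr r k := by
  simp only [State.arr, State.mem_setMem, State.reg_setMem]
  rw [if_neg (by omega)]

theorem Prog.wp_ite {p q : Prog} : (Prog.ite e p q).wp w Q t s ↔ e.Ok (2 ^ w) s ∧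
    (e.Holds s → p.wp w Q (t + (e.cost + 1)) s) ∧
      (¬ e.Holds s → q.wp w Q (t + (e.cost + 1)) s) := Iff.rfl

@[simp] theorem wp_block_nil : (block []).wp w Q t s ↔ Q (t + 1) s := Iff.rfl
@[simp] theorem wp_block_cons {p : Prog} {ps : List Prog} :
    (block (p :: ps)).wp w Q t s ↔ p.wp w ((block ps).wp w Q) t s := Iff.rfl

/-- The rules for the computation of weakest preconditions. -/
@[simp] theorem wp_simps :
    (∀ s k, (Expr.const k).val s = k) ∧ (∀ s i, (Expr.reg i).val s = s.reg i) ∧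
    (∀ s e, (Expr.load e).val s = s.mem (e.val s)) ∧
    (∀ s (e f : Expr), (e + f).val s = e.val s + f.val s) ∧
    (∀ s (e f : Expr), (e - f).val s = e.val s - f.val s) ∧
    (∀ s (e f : Expr), (e * f).val s = e.val s * f.val s) ∧
    (∀ s e f, (Expr.bin .div e f).val s = e.val s / f.val s) ∧
    (∀ s e r, (Expr.arr r e).val s = s.arr r (e.val s)) ∧
    (∀ s B k, (Expr.const k).Ok B s ↔ k < B) ∧ (∀ s B i, (Expr.reg i).Ok B s ↔ True) ∧
    (∀ s B e, (Expr.load e).Ok B s ↔ e.Ok B s) ∧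
    (∀ s B (e f : Expr), (e + f).Ok B s ↔ e.Ok B s ∧ f.Ok B s ∧ e.val s + f.val s < B) ∧
    (∀ s B (e f : Expr), (e - f).Ok B s ↔ e.Ok B s ∧ f.Ok B s) ∧
    (∀ s B (e f : Expr), (e * f).Ok B s ↔ e.Ok B s ∧ f.Ok B s ∧ e.val s * f.val s < B) ∧
    (∀ s B e f, (Expr.bin .div e f).Ok B s ↔ e.Ok B s ∧ f.Ok B s) ∧
    (∀ s B e f, (Expr.bin .lt e f).Ok B s ↔ e.Ok B s ∧ f.Ok B s) ∧
    (∀ s B e f, (Expr.bin .eq e f).Ok B s ↔ e.Ok B s ∧ f.Ok B s) ∧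
    (∀ s B e f, (Expr.and e f).Ok B s ↔ e.Ok B s ∧ f.Ok B s ∧ 0 < B) ∧
    (∀ s B r e, (Expr.arr r e).Ok B s ↔ e.Ok B s ∧ 8 < B ∧ s.reg 3 + 8 * e.val s + r < B) ∧
    (∀ s e f, (Expr.bin .lt e f).Holds s ↔ e.val s < f.val s) ∧
    (∀ s e f, (Expr.bin .eq e f).Holds s ↔ e.val s = f.val s) ∧
    (∀ s e f, (Expr.and e f).Holds s ↔ e.Holds s ∧ f.Holds s) ∧
    (∀ s i, (Expr.reg i).Holds s ↔ s.reg i ≠ 0) ∧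
    (∀ k, (Expr.const k).cost = 1) ∧ (∀ k, (Expr.reg k).cost = 1) ∧
    (∀ e, (Expr.load e).cost = e.cost + 1) ∧
    (∀ e f : Expr, (e + f).cost = e.cost + f.cost + 1) ∧
    (∀ e f : Expr, (e - f).cost = e.cost + f.cost + 1) ∧
    (∀ e f : Expr, (e * f).cost = e.cost + f.cost + 1) ∧
    (∀ op e f, (Expr.bin op e f).cost = e.cost + f.cost + 1) ∧
    (∀ e f, (Expr.and e f).cost = e.cost + f.cost + 5) ∧
    (∀ r e, (Expr.arr r e).cost = e.cost + 7) ∧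
    (∀ w Q t s, Prog.skip.wp w Q t s ↔ Q (t + 1) s) ∧
    (∀ w Q t s i e, (Prog.assign i e).wp w Q t s ↔
      e.Ok (2 ^ w) s ∧ Q (t + (e.cost + 1)) (s.setReg i (e.val s))) ∧
    (∀ w Q t s e f, (Prog.store e f).wp w Q t s ↔ e.Ok (2 ^ w) s ∧ f.Ok (2 ^ w) s ∧
      Q (t + (e.cost + f.cost + 1)) (s.setMem (e.val s) (f.val s))) ∧
    (∀ w Q t s r e f, (Prog.setArr r e f).wp w Q t s ↔
      (e.Ok (2 ^ w) s ∧ 8 < 2 ^ w ∧ s.reg 3 + 8 * e.val s + r < 2 ^ w) ∧ f.Ok (2 ^ w) s ∧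
      Q (t + (e.cost + f.cost + 7)) (s.setArr r (e.val s) (f.val s))) ∧
    (∀ w Q t s e p q, (Prog.ite e p q).wp w Q t s ↔ e.Ok (2 ^ w) s ∧
      (e.Holds s → p.wp w Q (t + (e.cost + 1)) s) ∧
      (¬ e.Holds s → q.wp w Q (t + (e.cost + 1)) s)) ∧
    (∀ w Q t s, (block []).wp w Q t s ↔ Q (t + 1) s) ∧
    (∀ w Q t s p ps, (block (p :: ps)).wp w Q t s ↔ p.wp w ((block ps).wp w Q) t s) ∧
    (∀ (s : State) i j v, (s.setReg i v).reg j = if j = i then v else s.reg j) ∧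
    (∀ (s : State) i v a, (s.setReg i v).mem a = s.mem a) ∧
    (∀ (s : State) r k v j, (s.setArr r k v).reg j = s.reg j) ∧
    (∀ p, (True ∧ p) = p) ∧ (∀ p, (p ∧ True) = p) := by
  have hc : ∀ r e, (Expr.addr r e).cost = e.cost + 6 := fun r e => by
    show 1 + (1 + e.cost + 1) + 1 + 1 + 1 = _
    omega
  refine ⟨fun _ _ => rfl, fun _ _ => rfl, fun _ _ => rfl, fun _ _ _ => rfl, fun _ _ _ => rfl,
    fun _ _ _ => rfl, fun _ _ _ => rfl, fun _ _ _ => rfl, fun _ _ _ => Iff.rfl, fun _ _ _ => Iff.rfl,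
    fun _ _ _ => Iff.rfl, fun _ _ _ _ => Iff.rfl, fun _ _ _ _ => Expr.ok_bin_iff (by simp),
    fun _ _ _ _ => Iff.rfl, fun _ _ _ _ => Expr.ok_bin_iff (by simp),
    fun _ _ _ _ => Expr.ok_bin_iff (by simp), fun _ _ _ _ => Expr.ok_bin_iff (by simp),
    fun s B e f => ?_, fun _ _ _ _ => Expr.ok_addr, fun _ _ _ => Expr.holds_lt,
    fun _ _ _ => Expr.holds_eq, fun _ _ _ => Expr.holds_and, fun _ _ => Iff.rfl, fun _ => rfl,
    fun _ => rfl, fun _ => rfl, fun _ _ => rfl, fun _ _ => rfl, fun _ _ => rfl, fun _ _ _ => rfl,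
    fun e f => ?_, fun r e => congrArg (· + 1) (hc r e), fun _ _ _ _ => Iff.rfl,
    fun _ _ _ _ _ _ => Iff.rfl, fun _ _ _ _ _ _ => Iff.rfl, fun w Q t s r e f => ?_,
    fun _ _ _ _ _ _ _ => Iff.rfl, fun _ _ _ _ => Iff.rfl, fun _ _ _ _ _ _ => Iff.rfl,
    fun _ _ _ _ => State.reg_setReg, fun _ _ _ _ => rfl, fun _ _ _ _ _ => rfl, true_and, and_true⟩
  · refine ⟨fun h => ⟨h.1.1, h.2.1.2.1, h.2.1.1⟩, fun h => ⟨⟨h.1, h.2.2, trivial⟩,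
      ⟨h.2.2, h.2.1, trivial⟩, trivial⟩⟩
  · show e.cost + 1 + 1 + (1 + f.cost + 1) + 1 = _
    omega
  · rw [← Expr.ok_addr, show e.cost + f.cost + 7 = (Expr.addr r e).cost + f.cost + 1 by
      rw [hc]; omega]
    exact Iff.rfl

end

/-- The two states differ only in the registers `rs` and the arrays `as`. -/
structure Frame (rs as : List ℕ) (s s' : State) : Prop where
  reg : ∀ i, (hi : i ∉ rs := by decide) → s'.reg i = s.reg i
  low : ∀ a < s.reg 3, s'.mem a = s.mem a
  arr : ∀ r, (hr : r < 8 := by decide) → (ha : r ∉ as := by decide) → ∀ k, s'.arr r k = s.arr r k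

theorem Frame.rfl {rs as : List ℕ} {s : State} : Frame rs as s s :=
  ⟨fun _ _ => Eq.refl _, fun _ _ => Eq.refl _, fun _ _ _ _ => Eq.refl _⟩

theorem Frame.trans {rs as rs' as' : List ℕ} {s s' s'' : State} (h1 : Frame rs as s s')
    (h2 : Frame rs' as' s' s'') (hrs : ∀ i ∈ rs', i ∈ rs := by decide)
    (has : ∀ i ∈ as', i ∈ as := by decide) (h3 : 3 ∉ rs := by decide) : Frame rs as s s'' := by
  refine ⟨fun i hi => ?_, fun a ha => ?_, fun r hr hra k => ?_⟩
  · rw [h2.reg i (fun h => hi (hrs i h)), h1.reg i hi]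
  · rw [h2.low a (by rw [h1.reg 3 h3]; exact ha), h1.low a ha]
  · rw [h2.arr r hr (fun h => hra (has r h)), h1.arr r hr hra]

/-! ### One level of the key in terms of coverings -/

section
variable {σ : ℕ} {S : List ℕ} {D : List (List ℕ)} {root h : ℕ} {A B : ℕ}

/-- The level of the node in a covering which contains the character at distance `d`. -/
def nodeLevel (σ : ℕ) (D : List (List ℕ)) : List (ℕ × ℕ) → ℕ → ℕ
  | [], _ => 0
  | x :: ds, d => if d < (str σ D x.1).length then x.2 else
      nodeLevel σ D ds (d - (str σ D x.1).length)

theorem nodeLevel_map {l : List ℕ} {ds : List (ℕ × ℕ)} {j d : ℕ}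
    (hd : d < (l.flatMap (str σ D)).length) :
    nodeLevel σ D (l.map (fun x => (x, j)) ++ ds) d = j := by
  induction l generalizing d with
  | nil => simp at hd
  | cons x l ih =>
    simp only [List.map_cons, List.cons_append, nodeLevel]
    split_ifs with h1
    · rfl
    · rw [List.flatMap_cons, List.length_append] at hd
      exact ih (by omega)

theorem nodeLevel_le {ds : List (ℕ × ℕ)} {d : ℕ} (hds : ∀ x ∈ ds, x.2 ≤ h) :
    nodeLevel σ D ds d ≤ h := by
  induction ds generalizing d with
  | nil => exact Nat.zero_le _
  | cons x ds ih =>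
    unfold nodeLevel
    split_ifs
    · exact hds x (by simp)
    · exact ih fun y hy => hds y (List.mem_cons_of_mem _ hy)

theorem dq_map {l : List ℕ} {j p q : ℕ} (P : Parse σ S D root h) (hj : j ≤ h)
    (hp : Bd σ D S j p) (hd : Dq σ D S h A B (l.map fun x => (x, j)) p q) :
    Seg σ D S j l p q := by
  induction l generalizing p with
  | nil =>
    obtain rfl : p = q := hd
    exact hp
  | cons x l ih =>
    obtain ⟨r, h1, h2, h3, h4⟩ := hd
    exact P.seg_append hj h2 (ih h2.bd_right h4)

theorem Dq.eq_add {ds : List (ℕ × ℕ)} {p q : ℕ} (hd : Dq σ D S h A B ds p q) :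
    q = p + (ds.flatMap fun x => str σ D x.1).length := by
  induction ds generalizing p with
  | nil => simpa using (show p = q from hd).symm
  | cons x ds ih =>
    obtain ⟨r, h1, h2, h3, h4⟩ := hd
    have := h2.eq_add
    have := ih h4
    simp at *
    omega

/-- The trie stores letters, not pairs. Since each pair is written as two letters, equal words of
letters still mean equal words of items. -/
theorem flatMap_pair_inj {l l' : List (ℕ × ℕ)}
    (he : l.flatMap (fun x => [x.1, x.2]) = l'.flatMap fun x => [x.1, x.2]) : l = l' := by
  induction l generalizing l' with
  | nil =>
    cases l' with
    | nil => rfl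
    | cons y l' => simp at he
  | cons x l ih =>
    cases l' with
    | nil => simp at he
    | cons y l' =>
      simp only [List.flatMap_cons, List.cons_append, List.nil_append, List.cons.injEq] at he
      rw [ih he.2.2, Prod.ext he.1 he.2.1]

namespace Parse
variable (P : Parse σ S D root h)
include P

theorem length_derive_rule {i X : ℕ} (hi : i < h) (hX : X ∈ espLevel σ D S (i + 1)) :
    (derive σ D (rule σ D X)).length = (str σ D X).length := by
  rw [P.str_succ hi hX]
  unfold derive
  rw [expandOnce_flatMap]
  rfl

/-- A node whose parent does not lie in `[A, B]` has a parent which exceeds `B` if it starts at a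
boundary of the next level after `A`. -/
theorem parent_start {j X s t : ℕ} (hj : j < h) (hs : Seg σ D S j [X] s t)
    (hno : ∀ Y a b, j < h → Seg σ D S (j + 1) [Y] a b → a ≤ s → t ≤ b → A ≤ a → b ≤ B → False)
    (hA : A ≤ s) (hb : Bd σ D S (j + 1) s) {b' : ℕ} (hb' : Bd σ D S (j + 1) b') (hs' : s < b') :
    B < b' := by
  obtain ⟨Y, a, b, h1, h2, h3⟩ := P.exists_parent hj hs
  have h4 := P.node_lt hj.le hs
  have h5 := P.bd_node (by omega) h1 hb
  have h6 := P.bd_node (by omega) h1 hb'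
  have h7 : ¬ b ≤ B := fun h7 => hno Y a b hj h1 h2 h3 (by omega) h7
  omega

theorem parent_end {j X s t : ℕ} (hj : j < h) (hs : Seg σ D S j [X] s t)
    (hno : ∀ Y a b, j < h → Seg σ D S (j + 1) [Y] a b → a ≤ s → t ≤ b → A ≤ a → b ≤ B → False)
    (hB : t ≤ B) (hb : Bd σ D S (j + 1) t) {b' : ℕ} (hb' : Bd σ D S (j + 1) b') (hs' : b' < t) :
    b' < A := by
  obtain ⟨Y, a, b, h1, h2, h3⟩ := P.exists_parent hj hs
  have h4 := P.node_lt hj.le hs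
  have h5 := P.bd_node (by omega) h1 hb
  have h6 := P.bd_node (by omega) h1 hb'
  have h7 : ¬ A ≤ a := fun h7 => hno Y a b hj h1 h2 h3 h7 (by omega)
  omega

/-- The node of a covering by nodes of one level which starts at the given boundary. -/
theorem exists_node_start {j p q b : ℕ} {l : List ℕ}
    (hd : Dq σ D S h A B (l.map fun x => (x, j)) p q) (hb : Bd σ D S j b) (hpb : p ≤ b)
    (hbq : b < q) : ∃ X t, Seg σ D S j [X] b t ∧ t ≤ q ∧
      ∀ Y a c, j < h → Seg σ D S (j + 1) [Y] a c → a ≤ b → t ≤ c → A ≤ a → c ≤ B → False := by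
  induction l generalizing p with
  | nil =>
    obtain rfl : p = q := hd
    omega
  | cons x l ih =>
    obtain ⟨r, h1, h2, h3, h4⟩ := hd
    rcases P.bd_node h1 h2 hb with h5 | h5
    · obtain rfl : b = p := by omega
      exact ⟨x, r, h2, P.dq_le h4, h3⟩
    · exact ih h4 h5

theorem exists_node_end {j p q b : ℕ} {l : List ℕ}
    (hd : Dq σ D S h A B (l.map fun x => (x, j)) p q) (hb : Bd σ D S j b) (hpb : p < b)
    (hbq : b ≤ q) : ∃ X s, Seg σ D S j [X] s b ∧ p ≤ s ∧
      ∀ Y a c, j < h → Seg σ D S (j + 1) [Y] a c → a ≤ s → b ≤ c → A ≤ a → c ≤ B → False := by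
  induction l generalizing p with
  | nil =>
    obtain rfl : p = q := hd
    omega
  | cons x l ih =>
    obtain ⟨r, h1, h2, h3, h4⟩ := hd
    by_cases h6 : r < b
    · obtain ⟨X, s, e1, e2, e3⟩ := ih h4 h6
      exact ⟨X, s, e1, by have := P.node_lt h1 h2; omega, e3⟩
    · have := P.bd_node h1 h2 hb
      obtain rfl : b = r := by omega
      exact ⟨x, p, h2, le_rfl, h3⟩

/-- The boundaries of the next level after both ends are aligned. -/
theorem align_cut {lev x p' q' e : ℕ} {AL AR : List ℕ} {ds : List (ℕ × ℕ)} (hlev : lev ≤ h)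
    (hAL : Dq σ D S h (x + 1) e (AL.map fun z => (z, lev)) x p')
    (hds : Dq σ D S h (x + 1) e ds p' q')
    (hAR : Dq σ D S h (x + 1) e (AR.map fun z => (z, lev)) q' e)
    (h1 : AL = [] → ds = []) (h2 : ds = [] → AR = [])
    (hhead : ∀ z ∈ ds.head?, z.2 ≠ lev) (hlast : ∀ z ∈ ds.getLast?, z.2 ≠ lev)
    (hl : ∀ z ∈ ds, lev ≤ z.2) :
    ((p' = e ∧ q' = e ∧ (lev < h → ∀ b b', x < b → b < b' → b' ≤ e → Bd σ D S (lev + 1) b →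
      Bd σ D S (lev + 1) b' → False)) ∨
    (lev < h ∧ x < p' ∧ p' < q' ∧ Bd σ D S (lev + 1) p' ∧ Bd σ D S (lev + 1) q' ∧
      ∀ b, x < b → b ≤ e → Bd σ D S (lev + 1) b → p' ≤ b ∧ b ≤ q')) ∧
    (p' < q' → Dq σ D S h p' q' ds p' q' ∧ ∀ z ∈ ds, lev + 1 ≤ z.2) := by
  -- If no node of higher level is left, all nodes of the covering are of level `lev`. Two
  -- boundaries of the next level would put the parent of the node starting at the first one inside
  -- the interval, against maximality.
  by_cases hn : ds = []
  · subst hn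
    obtain rfl := h2 rfl
    obtain rfl : p' = q' := hds
    obtain rfl : p' = e := hAR
    refine ⟨Or.inl ⟨rfl, rfl, fun hj b b' e1 e2 e3 e4 e5 => ?_⟩, fun h => by omega⟩
    obtain ⟨X, t, e6, e7, e8⟩ := P.exists_node_start hAL (P.bd_of_bd_succ hj e4) e1.le
      (by omega)
    have := P.parent_start hj e6 e8 e1 e4 e5 e2
    omega
  · have hlen := P.dq_length_le hds
    have hpos := List.length_pos_iff.2 hn
    have hx : x < p' := by
      have := P.dq_length_le hAL
      have := List.length_pos_iff.2 fun h => hn (h1 h)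
      rw [List.length_map] at *
      omega
    have hq := P.dq_le hAR
    obtain ⟨z, ds', rfl⟩ := List.exists_cons_of_ne_nil hn
    have hz1 := hhead z (by simp)
    have hz2 := hl z (by simp)
    have hp : lev + 1 ≤ h ∧ Bd σ D S (lev + 1) p' := by
      obtain ⟨r, e1, e2, -, -⟩ := hds
      exact ⟨by omega, P.bd_of_le (by omega) e1 e2.bd_left⟩
    have hq : Bd σ D S (lev + 1) q' := by
      obtain ⟨ds'', u, hu⟩ : ∃ ds'' u, z :: ds' = ds'' ++ [u] :=
        ⟨_, _, (List.dropLast_append_getLast (by simp)).symm⟩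
      rw [hu, dq_append] at hds
      obtain ⟨r, -, r', e1, e2, -, e4⟩ := hds
      obtain rfl : r' = q' := e4
      have e5 := hlast u (by rw [hu]; simp)
      have e6 := hl u (by rw [hu]; simp)
      exact P.bd_of_le (by omega) e1 e2.bd_right
    have hs : Dq σ D S h p' q' (z :: ds') p' q' := hds.mono (by omega) (by omega)
    refine ⟨Or.inr ⟨by omega, hx, by omega, hp.2, hq, fun b e1 e2 e3 => ⟨?_, ?_⟩⟩, fun _ =>
      ⟨hs, P.lt_level_of_dq (by omega) hs hp.2 hq hl⟩⟩
    -- An earlier boundary would be the start of a node in `AL` whose parent ends at `p'` or before,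
    -- hence lies inside the interval, against maximality. The end `q'` is treated symmetrically
    -- with `AR`.
    · by_contra hc
      obtain ⟨X, t, e6, e7, e8⟩ := P.exists_node_start hAL (P.bd_of_bd_succ (by omega) e3)
        e1.le (by omega)
      have := P.parent_start (by omega) e6 e8 e1 e3 hp.2 (by omega)
      omega
    · by_contra hc
      obtain ⟨X, t, e6, e7, e8⟩ := P.exists_node_end hAR (P.bd_of_bd_succ (by omega) e3)
        (by omega) e2
      have := P.parent_end (by omega) e6 e8 e2 e3 hq (by omega)
      omega

end Parse
end

/-! ### The state of the key computation -/

/-- The data of a run of the program: besides the parse, the word length `w`, the parameter `M` of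
the keys, the address `X` of the arrays, and a bound `T` for the time. -/
structure Env where
  σ : ℕ
  S : List ℕ
  D : List (List ℕ)
  root : ℕ
  h : ℕ
  w : ℕ
  M : ℕ
  X : ℕ
  T : ℕ
  parse : Parse σ S D root h
  logStar_le : logStar S.length + 4 ≤ M
  logStar_le' : logStar (σ + S.length) + 25 ≤ M
  le_X : 5 * D.length + 6 * S.length ≤ X
  le_T : X + 10 * (σ + S.length) + M + 100 ≤ T
  le_pow : 100 * T ^ 2 ≤ 2 ^ w

/-- The registers and the part of the memory which do not change in the main phase. -/
structure Static (E : Env) (s : State) : Prop where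
  sigma : s.reg 0 = E.σ
  root : s.reg 2 = E.root
  base : s.reg 3 = E.X
  height : s.reg 4 = E.h
  length : s.reg 5 = E.S.length
  strip : s.reg 6 = E.M
  rule : ∀ i < E.D.length, ∀ k < 5,
    s.mem (5 * i + k) = (ruleWords E.σ E.D (E.D.getD i [])).getD k 0

/-- The registers used by the key computation. -/
def keyRegs : List ℕ :=
  [12, 20, 21, 22, 23, 24, 25, 26, 27, 28, 29, 30, 31, 32, 33, 34, 35, 36, 39, 40, 41, 42]

/-- The arrays used by the key computation: the symbols and the levels of the nodes of a covering,
the chain of a run, and a dictionary of words. -/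
def keyArrs : List ℕ := [0, 1, 2, 3]

/-- An injective coding of pairs. -/
def pairCode (a x : ℕ) : ℕ := (a + x) * (a + x) + a

/-- The code lies between the square of `a + x` and the next square, so it determines the sum, and
then `a`. -/
theorem pairCode_inj {a x b y : ℕ} (he : pairCode a x = pairCode b y) : a = b ∧ x = y := by
  unfold pairCode at he
  have h1 : a + x = b + y := by
    by_contra hne
    rcases Nat.lt_or_gt_of_ne hne with h | h
    · nlinarith
    · nlinarith
  rw [h1] at he
  omega

/-- The word with the given number in the dictionary. -/
inductive Walk (s : State) : ℕ → List ℕ → Prop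
  | nil : Walk s 0 []
  | snoc {a x : ℕ} {l : List ℕ} : Walk s a l → s.arr 3 (pairCode a x) ≠ 0 →
      Walk s (s.arr 3 (pairCode a x)) (l ++ [x])

/-- The dictionary is valid: different words have different numbers. -/
structure DictOk (s : State) : Prop where
  le : ∀ k, s.arr 3 k ≤ s.reg 12
  inj : ∀ k k', s.arr 3 k = s.arr 3 k' → s.arr 3 k ≠ 0 → k = k'

theorem Walk.mono {s s' : State} (hm : ∀ k, s.arr 3 k ≠ 0 → s'.arr 3 k = s.arr 3 k) {a : ℕ}
    {l : List ℕ} (hw : Walk s a l) : Walk s' a l := by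
  induction hw with
  | nil => exact Walk.nil
  | snoc h1 h2 ih =>
    rw [← hm _ h2]
    exact Walk.snoc ih (by rwa [hm _ h2])

theorem Walk.le {s : State} (hd : DictOk s) {a : ℕ} {l : List ℕ} (hw : Walk s a l) :
    a ≤ s.reg 12 := by
  cases hw with
  | nil => exact Nat.zero_le _
  | snoc h1 h2 => exact hd.le _

/-- A nonzero entry determines its index by `DictOk.inj`, and the index determines the number of the
shorter word and the last letter. Together with `Walk.id_unique` this lets numbers stand for words.
-/
theorem Walk.word_unique {s : State} (hd : DictOk s) {a : ℕ} {l l' : List ℕ} (hw : Walk s a l)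
    (hw' : Walk s a l') : l = l' := by
  induction hw generalizing l' with
  | nil =>
    generalize he : 0 = a at hw'
    cases hw' with
    | nil => rfl
    | snoc h1 h2 => exact absurd he.symm h2
  | @snoc a x l h1 h2 ih =>
    generalize he : s.arr 3 (pairCode a x) = b at hw'
    cases hw' with
    | nil => exact absurd he h2
    | @snoc a' x' l' h3 h4 =>
      obtain ⟨rfl, rfl⟩ := pairCode_inj (hd.inj _ _ he h2)
      rw [ih h3]

theorem Walk.id_unique {s : State} {a a' : ℕ} {l : List ℕ} (hw : Walk s a l)
    (hw' : Walk s a' l) : a = a' := by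
  induction hw generalizing a' with
  | nil =>
    generalize he : [] = l at hw'
    cases hw' with
    | nil => rfl
    | snoc h1 h2 => simp at he
  | @snoc a x l h1 h2 ih =>
    generalize he : l ++ [x] = l' at hw'
    cases hw' with
    | nil => simp at he
    | @snoc a' x' l' h3 h4 =>
      obtain ⟨h5, h6⟩ := List.append_inj' he rfl
      subst h5
      rw [ih h3, List.singleton_inj.1 h6]

/-- The list of nodes is stored between the addresses in the registers `20` and `21`. -/
structure DqRep (s : State) (ds : List (ℕ × ℕ)) : Prop where
  length : s.reg 20 + ds.length = s.reg 21
  get : ∀ i (hi : i < ds.length), s.arr 0 (s.reg 20 + i) = ds[i].1 ∧ s.arr 1 (s.reg 20 + i) = ds[i].2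

/-- The word of numbers for a word of items. -/
def flat (l : List (ℕ × ℕ)) : List ℕ := l.flatMap fun x => [x.1, x.2]

/-- The state of the key computation: the nodes `ds` cover `[p, q)`, and the words `wl` and `wr`
have been emitted. -/
structure KSt (E : Env) (s₀ : State) (t : ℕ) (s : State) (A B : ℕ) (ds : List (ℕ × ℕ)) (p q : ℕ)
    (wl wr : List (ℕ × ℕ)) : Prop where
  frame : Frame keyRegs keyArrs s₀ s
  stat : Static E s
  cnt_le : s.reg 12 ≤ t
  dict : DictOk s
  mono : ∀ k, s₀.arr 3 k ≠ 0 → s.arr 3 k = s₀.arr 3 k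
  left : Walk s (s.reg 23) (flat wl)
  right : Walk s (s.reg 24) (flat wr)
  rep : DqRep s ds
  dq : Dq E.σ E.D E.S E.h A B ds p q
  q_le : q ≤ E.S.length
  lo_le : s.reg 20 ≤ p + E.S.length + 3
  le_hi : q + 4 ≤ s.reg 21

/-- The registers that hold no part of the state of the key computation. -/
def freeRegs : List ℕ := [22, 25, 26, 27, 28, 29, 30, 31, 32, 33, 34, 35, 36, 39, 40, 41, 42]

theorem Static.of_frame {E : Env} {rs as : List ℕ} {s s' : State} (hs : Static E s)
    (hf : Frame rs as s s') (h : ∀ i ∈ [0, 2, 3, 4, 5, 6], i ∉ rs := by decide) : Static E s' := by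
  refine ⟨?_, ?_, ?_, ?_, ?_, ?_, fun i hi k hk => ?_⟩
  · rw [hf.reg 0 (h 0 (by simp)), hs.sigma]
  · rw [hf.reg 2 (h 2 (by simp)), hs.root]
  · rw [hf.reg 3 (h 3 (by simp)), hs.base]
  · rw [hf.reg 4 (h 4 (by simp)), hs.height]
  · rw [hf.reg 5 (h 5 (by simp)), hs.length]
  · rw [hf.reg 6 (h 6 (by simp)), hs.strip]
  · have := E.le_X
    rw [hf.low _ (by rw [hs.base]; omega), hs.rule i hi k hk]

theorem Frame.setReg {rs as : List ℕ} {s s' : State} (hf : Frame rs as s s') {i v : ℕ}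
    (hi : i ∈ rs := by decide) (h3 : 3 ∉ rs := by decide) : Frame rs as s (s'.setReg i v) := by
  refine ⟨fun j hj => ?_, hf.low, fun r hr hra k => ?_⟩
  · rw [State.reg_setReg, if_neg (by rintro rfl; exact hj hi), hf.reg j hj]
  · rw [State.arr_setReg (by rintro rfl; exact h3 hi), hf.arr r hr hra]

theorem Frame.setArr {rs as : List ℕ} {s s' : State} (hf : Frame rs as s s') {r k v : ℕ}
    (hr : r ∈ as := by decide) (hr8 : r < 8 := by decide) (h3 : 3 ∉ rs := by decide) :
    Frame rs as s (s'.setArr r k v) := by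
  refine ⟨fun _ h => hf.reg _ h, fun a ha => ?_, fun r' hr' hra k' => ?_⟩
  · rw [State.mem_setArr (by rw [hf.reg 3 h3]; exact ha), hf.low a ha]
  · rw [State.arr_setArr hr8 hr', if_neg (by rintro ⟨rfl, -⟩; exact hra hr), hf.arr r' hr' hra]

theorem KSt.change {E : Env} {s₀ s s' : State} {t t' A B p q A' B' p' q' : ℕ}
    {ds ds' wl wr : List (ℕ × ℕ)}
    (hk : KSt E s₀ t s A B ds p q wl wr) (ht : t ≤ t') {rs as : List ℕ} (hf : Frame rs as s s')
    (hr : ∀ i ∈ rs, i ∈ 20 :: 21 :: freeRegs) (ha : ∀ r ∈ as, r ∈ [0, 1, 2]) (hrep : DqRep s' ds')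
    (hdq : Dq E.σ E.D E.S E.h A' B' ds' p' q') (hq : q' ≤ E.S.length)
    (hlo : s'.reg 20 ≤ p' + E.S.length + 3) (hhi : q' + 4 ≤ s'.reg 21) :
    KSt E s₀ t' s' A' B' ds' p' q' wl wr := by
  have h1 : ∀ i, i ∉ 20 :: 21 :: freeRegs → s'.reg i = s.reg i :=
    fun i hi => hf.reg i fun h => hi (hr i h)
  have h2 := hf.arr 3 (by omega) fun h => by simpa using ha 3 h
  have hm : ∀ k, s.arr 3 k ≠ 0 → s'.arr 3 k = s.arr 3 k := fun k _ => h2 k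
  have h3 : ∀ i ∈ 20 :: 21 :: freeRegs, i ∈ keyRegs := by decide
  have h4 : ∀ r ∈ [0, 1, 2], r ∈ keyArrs := by decide
  refine ⟨hk.frame.trans hf (fun i hi => h3 i (hr i hi)) (fun i hi => h4 i (ha i hi)) (by decide),
    hk.stat.of_frame hf ?_, ?_, ⟨?_, ?_⟩, ?_, ?_, ?_, hrep, hdq, hq, hlo, hhi⟩
  · intro i hi hc
    have : ∀ i ∈ [0, 2, 3, 4, 5, 6], i ∉ 20 :: 21 :: freeRegs := by decide
    exact this i hi (hr i hc)
  · rw [h1 12 (by decide)]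
    exact hk.cnt_le.trans ht
  · intro k
    rw [h2, h1 12 (by decide)]
    exact hk.dict.le k
  · intro k k'
    rw [h2, h2]
    exact hk.dict.inj k k'
  · intro k
    rw [h2]
    exact hk.mono k
  · rw [h1 23 (by decide)]
    exact hk.left.mono hm
  · rw [h1 24 (by decide)]
    exact hk.right.mono hm

theorem KSt.of_frame {E : Env} {s₀ s s' : State} {t t' A B p q : ℕ} {ds wl wr : List (ℕ × ℕ)}
    (hk : KSt E s₀ t s A B ds p q wl wr) (ht : t ≤ t') {rs : List ℕ} (hf : Frame rs [2] s s')
    (hr : ∀ i ∈ rs, i ∈ freeRegs) : KSt E s₀ t' s' A B ds p q wl wr := by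
  have h1 : ∀ i, i ∉ freeRegs → s'.reg i = s.reg i := fun i hi => hf.reg i fun h => hi (hr i h)
  have h2 := h1 20 (by decide)
  have h3 := h1 21 (by decide)
  refine hk.change ht hf (fun i hi => ?_) (by decide) ⟨?_, ?_⟩ hk.dq hk.q_le ?_ ?_
  · have := hr i hi
    simp [this]
  · rw [h2, h3]
    exact hk.rep.length
  · rw [h2]
    intro i hi
    rw [hf.arr 0, hf.arr 1]
    exact hk.rep.get i hi
  · rw [h2]
    exact hk.lo_le
  · rw [h3]
    exact hk.le_hi

theorem KSt.later {E : Env} {s₀ s : State} {t t' A B p q : ℕ} {ds wl wr : List (ℕ × ℕ)}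
    (hk : KSt E s₀ t s A B ds p q wl wr) (ht : t ≤ t') : KSt E s₀ t' s A B ds p q wl wr :=
  hk.of_frame ht (rs := []) Frame.rfl (by simp)

theorem KSt.weaken {E : Env} {s₀ s : State} {t A B A' B' p q : ℕ} {ds wl wr : List (ℕ × ℕ)}
    (hk : KSt E s₀ t s A B ds p q wl wr) (hA : A ≤ A') (hB : B' ≤ B) :
    KSt E s₀ t s A' B' ds p q wl wr :=
  ⟨hk.frame, hk.stat, hk.cnt_le, hk.dict, hk.mono, hk.left, hk.right, hk.rep, hk.dq.mono hA hB,
    hk.q_le, hk.lo_le, hk.le_hi⟩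

theorem Env.fits {E : Env} : 10000 * E.T ≤ 2 ^ E.w := by
  have h1 := E.le_pow
  have h2 := E.le_T
  refine le_trans ?_ h1
  have : 100 ≤ E.T := by omega
  nlinarith

/-- The word length is required to satisfy `100 * T ^ 2 ≤ 2 ^ w` because addresses in the
interleaved arrays reach eight times a code, which itself is about `4 * T ^ 2` at most. -/
theorem Env.fits_pairCode {E : Env} {a x : ℕ} (ha : a ≤ E.T) (hx : x ≤ E.T) :
    E.X + 8 * pairCode a x + 8 < 2 ^ E.w ∧ (a + x) * (a + x) < 2 ^ E.w ∧
      pairCode a x < 2 ^ E.w := by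
  have h1 := E.le_pow
  have h2 := E.le_T
  have h3 : (a + x) * (a + x) ≤ (2 * E.T) * (2 * E.T) :=
    Nat.mul_le_mul (by omega) (by omega)
  have h4 : 100 * E.T ≤ E.T ^ 2 := by
    have : 100 ≤ E.T := by omega
    nlinarith
  unfold pairCode
  have h5 : (2 * E.T) * (2 * E.T) = 4 * E.T ^ 2 := by ring
  refine ⟨?_, ?_, ?_⟩ <;> omega

/-! ### Primitive operations of the key computation -/

/-- The length of the string of the symbol in register `28`. -/
def lenProg : Prog :=
  .ite (.bin .lt (.reg 28) (.reg 0)) (.assign 34 (.const 1))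
    (.assign 34 (.load (.const 5 * (.reg 28 - .reg 0) + .const 4)))

/-- Remove the first node. -/
def popL : Prog :=
  block [.assign 28 (.arr 0 (.reg 20)), lenProg, .assign 20 (.reg 20 + .const 1)]

/-- Remove the last node. -/
def popR : Prog :=
  block [.assign 21 (.reg 21 - .const 1), .assign 28 (.arr 0 (.reg 21)), lenProg]

/-- Replace the first node by its children. -/
def expandL : Prog :=
  block [
    .assign 28 (.arr 0 (.reg 20)),
    .assign 29 (.const 5 * (.reg 28 - .reg 0)),
    .assign 30 (.load (.reg 29)),
    .assign 39 (.arr 1 (.reg 20) - .const 1),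
    .assign 40 (.load (.reg 29 + .reg 30)),
    .assign 41 (.load (.reg 29 + .reg 30 - .const 1)),
    .assign 42 (.load (.reg 29 + .reg 30 - .const 2)),
    .setArr 0 (.reg 20) (.reg 40),
    .setArr 1 (.reg 20) (.reg 39),
    .setArr 0 (.reg 20 - .const 1) (.reg 41),
    .setArr 1 (.reg 20 - .const 1) (.reg 39),
    .setArr 0 (.reg 20 - .const 2) (.reg 42),
    .setArr 1 (.reg 20 - .const 2) (.reg 39),
    .assign 20 (.reg 20 + .const 1 - .reg 30)]

/-- Replace the last node by its children. -/
def expandR : Prog :=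
  block [
    .assign 28 (.arr 0 (.reg 21 - .const 1)),
    .assign 29 (.const 5 * (.reg 28 - .reg 0)),
    .assign 30 (.load (.reg 29)),
    .assign 39 (.arr 1 (.reg 21 - .const 1) - .const 1),
    .assign 40 (.load (.reg 29 + .const 1)),
    .assign 41 (.load (.reg 29 + .const 2)),
    .assign 42 (.load (.reg 29 + .const 3)),
    .setArr 0 (.reg 21 - .const 1) (.reg 40),
    .setArr 1 (.reg 21 - .const 1) (.reg 39),
    .setArr 0 (.reg 21) (.reg 41),
    .setArr 1 (.reg 21) (.reg 39),
    .setArr 0 (.reg 21 + .const 1) (.reg 42),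
    .setArr 1 (.reg 21 + .const 1) (.reg 39),
    .assign 21 (.reg 21 - .const 1 + .reg 30)]

/-- Append the letter in the register `i` to the word with number in the register `acc`. -/
def append (acc i : ℕ) : Prog :=
  block [
    .assign 35 ((.reg acc + .reg i) * (.reg acc + .reg i) + .reg acc),
    .ite (.bin .eq (.arr 3 (.reg 35)) (.const 0))
      (block [.assign 12 (.reg 12 + .const 1), .setArr 3 (.reg 35) (.reg 12)]) .skip,
    .assign acc (.arr 3 (.reg 35))]

/-- Append the pair in the registers `i`, `j`. -/
def emit (acc i j : ℕ) : Prog := block [append acc i, append acc j]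

section
variable {E : Env} {s₀ s : State} {t A B p q : ℕ} {ds wl wr : List (ℕ × ℕ)}
  {Q : ℕ → State → Prop}

theorem Env.symbol_lt (E : Env) {j X : ℕ} (hj : j ≤ E.h) (hX : X ∈ espLevel E.σ E.D E.S j) :
    X < E.σ + E.D.length := E.parse.symbol_lt hj hX

theorem Static.mem_rule (hs : Static E s) {j X : ℕ} (hj : j < E.h)
    (hX : X ∈ espLevel E.σ E.D E.S (j + 1)) :
    s.mem (5 * (X - E.σ)) = (ESPBisection.rule E.σ E.D X).length ∧
    (∀ k < 3, s.mem (5 * (X - E.σ) + (k + 1)) = (ESPBisection.rule E.σ E.D X).getD k 0) ∧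
    s.mem (5 * (X - E.σ) + 4) = (str E.σ E.D X).length := by
  have h1 := E.parse.mem_succ hj hX
  have h2 := hs.rule (X - E.σ) (by omega)
  have h3 := E.parse.length_derive_rule hj hX
  unfold ESPBisection.rule at *
  refine ⟨?_, fun k hk => ?_, ?_⟩
  · rw [← Nat.add_zero (5 * _), h2 0 (by omega)]
    rfl
  · rw [h2 _ (by omega)]
    rcases k with _ | _ | _ | k
    · rfl
    · rfl
    · rfl
    · omega
  · rw [h2 4 (by omega), ← h3]
    rfl

theorem wp_lenProg (hs : Static E s) {j : ℕ} (hj : j ≤ E.h)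
    (hX : s.reg 28 ∈ espLevel E.σ E.D E.S j)
    (hQ : ∀ t', t ≤ t' → t' ≤ t + 15 →
      Q t' (s.setReg 34 (str E.σ E.D (s.reg 28)).length)) : lenProg.wp E.w Q t s := by
  have h1 := E.fits
  have h2 := E.le_T
  have h3 := E.symbol_lt hj hX
  have h4 := E.le_X
  have h5 := hs.sigma
  simp only [wp_simps, lenProg, h5]
  refine ⟨fun h => ⟨by omega, ?_⟩, fun h => ⟨?_, ?_⟩⟩
  · rw [Parse.str_letter h] at hQ
    exact hQ _ (by simp; omega) (by simp)
  · omega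
  · obtain ⟨j, rfl⟩ : ∃ i, j = i + 1 := by
      rcases j with _ | j
      · exact absurd (E.parse.lt _ hX) h
      · exact ⟨j, rfl⟩
    rw [(hs.mem_rule hj hX).2.2]
    exact hQ _ (by simp; omega) (by simp)

theorem KSt.hi_le (hk : KSt E s₀ t s A B ds p q wl wr) : s.reg 21 ≤ q + E.S.length + 3 := by
  have h1 := E.parse.dq_length_le hk.dq
  have h2 := hk.rep.length
  have h3 := hk.lo_le
  omega

theorem wp_popL {x : ℕ × ℕ} (hk : KSt E s₀ t s A B (x :: ds) p q wl wr)
    (hQ : ∀ t' s' r, t ≤ t' → t' ≤ t + 60 → s'.reg 28 = x.1 →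
      s'.reg 34 = (str E.σ E.D x.1).length → r = p + (str E.σ E.D x.1).length →
      Seg E.σ E.D E.S x.2 [x.1] p r → x.2 ≤ E.h → p < r →
      KSt E s₀ t' s' A B ds r q wl wr → Frame [20, 28, 34] [] s s' → Q t' s') :
    popL.wp E.w Q t s := by
  have h1 := E.fits
  have h2 := E.le_T
  have h3 := hk.lo_le
  have h4 := hk.q_le
  have h5 := E.parse.dq_le hk.dq
  have h6 := hk.stat.base
  have h7 := (hk.rep.get 0 (by simp)).1
  have h8 := Parse.dq_mem hk.dq (x := x) (by simp)
  simp only [Nat.add_zero, List.getElem_cons_zero] at h7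
  simp only [wp_simps, popL, h6, h7]
  refine ⟨by omega, ?_⟩
  refine wp_lenProg (hk.stat.of_frame (rs := [28]) (as := [])
    (Frame.rfl.setReg) (by decide)) h8.1 ?_ ?_
  · simpa using h8.2
  · intro t' e1 e2
    simp only [wp_simps, if_true]
    obtain ⟨r, e3, e4, -, e6⟩ := hk.dq
    have e5 := e4.eq_add
    simp only [List.flatMap_cons, List.flatMap_nil, List.append_nil] at e5
    have e7 := E.parse.node_lt e3 e4
    have hf : Frame [20, 28, 34] [] s
        (((s.setReg 28 x.1).setReg 34 (str E.σ E.D x.1).length).setReg 20 (s.reg 20 + 1)) :=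
      (Frame.rfl.setReg.setReg).setReg
    refine ⟨by simp [-Nat.one_lt_two_pow_iff]; omega, ?_⟩
    refine hQ _ _ r (by omega) (by omega) (by simp) (by simp) e5 e4 e3 e7 ?_ (by simpa using hf)
    simp only [if_neg (show ¬ (20 = 34) by decide), if_neg (show ¬ (20 = 28) by decide)]
    refine hk.change (by omega) hf (by decide) (by decide) ⟨?_, ?_⟩ e6 hk.q_le ?_ ?_
    · have := hk.rep.length
      simp at *
      omega
    · intro i hi
      have := hk.rep.get (i + 1) (by simpa using hi)
      simpa [State.arr_setReg, add_assoc, add_comm 1] using this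
    · simp
      omega
    · simpa using hk.le_hi

/-- Three cells are always written. For a rule of length two the third one lies outside the new
list, so its content does not matter. There is room on the left because a covering has no more nodes
than characters, while `le_hi` keeps the right end above `q + 4`; truncated subtraction is therefore
exact. -/
theorem wp_expandL {X j : ℕ} (hk : KSt E s₀ t s A B ((X, j + 1) :: ds) p q wl wr) (hA : p < A)
    (hQ : ∀ t' s', t ≤ t' → t' ≤ t + 200 →
      KSt E s₀ t' s' A B ((rule E.σ E.D X).map (fun x => (x, j)) ++ ds) p q wl wr →
      Frame [20, 28, 29, 30, 39, 40, 41, 42] [0, 1] s s' → Q t' s') :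
    expandL.wp E.w Q t s := by
  have h1 := E.fits
  have h2 := E.le_T
  have h3 := hk.lo_le
  have h4 := hk.q_le
  have h5 := E.parse.dq_le hk.dq
  have h6 := hk.stat.base
  have h7 := hk.rep.get 0 (by simp)
  have h8 := Parse.dq_mem hk.dq (x := (X, j + 1)) (by simp)
  have h9 := hk.stat.mem_rule (by have := h8.1; simp at this; omega) h8.2
  have h10 := E.parse.dq_length_rule hk.dq
  have h11 := hk.stat.sigma
  have h12 := hk.le_hi
  have h13 := E.parse.dq_expand_left hk.dq hA
  have h14 := E.parse.dq_length_le h13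
  have h15 := hk.rep.length
  have h16 := E.symbol_lt h8.1 h8.2
  have h17 := E.le_X
  simp only [Nat.add_zero, List.getElem_cons_zero] at h7
  simp only [List.length_append, List.length_map, List.length_cons] at h14 h15
  simp only [wp_simps, expandL, reduceIte, Nat.reduceEqDiff, h6, h7, h9.1, h11, State.arr_setReg,
    ne_eq, not_false_eq_true, Nat.add_sub_cancel, Nat.add_zero]
  have hb : 5 * (X - E.σ) + 5 ≤ 5 * E.D.length := by
    have := (E.parse.mem_succ (by have := h8.1; simp at this; omega) h8.2).1
    simp only at this h16
    omega
  refine ⟨by omega, by omega, by omega, by omega, by omega, by omega, by omega, by omega, by omega,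
    by omega, by omega, by omega, by omega, hQ _ _ (by omega) (by omega) ?_ ?_⟩
  swap
  · repeat first | exact Frame.rfl | refine Frame.setReg ?_ | refine Frame.setArr ?_
  · refine hk.change (rs := [20, 28, 29, 30, 39, 40, 41, 42]) (as := [0, 1]) (by omega) ?_
      (by decide) (by decide) ⟨?_, ?_⟩ h13 h4 ?_ ?_
    · repeat first | exact Frame.rfl | refine Frame.setReg ?_ | refine Frame.setArr ?_
    · simp only [State.reg_setReg, State.reg_setArr, reduceIte, Nat.reduceEqDiff,
        List.length_append, List.length_map]
      omega
    · intro i hi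
      simp only [List.length_append, List.length_map] at hi
      simp only [State.reg_setReg, State.reg_setArr, reduceIte, Nat.reduceEqDiff, State.arr_setReg,
        State.arr_setArr, Nat.reduceLT, ne_eq, not_false_eq_true, true_and, false_and,
        zero_ne_one, one_ne_zero]
      have hc := h9.2.1
      by_cases hir : i < (rule E.σ E.D X).length
      · rw [List.getElem_append_left (by simpa using hir)]
        simp only [List.getElem_map]
        have hci := hc i (by omega)
        rw [List.getD_eq_getElem _ _ hir] at hci
        rw [← hci]
        constructor
        · split_ifs <;> first | omega | (congr 1; omega)
        · split_ifs <;> omega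
      · rw [List.getElem_append_right (by simpa using hir)]
        have := hk.rep.get (i + 1 - (rule E.σ E.D X).length) (by simp; omega)
        simp only [show i + 1 - (rule E.σ E.D X).length = i - (rule E.σ E.D X).length + 1 by omega,
          List.getElem_cons_succ] at this
        rw [show s.reg 20 + 1 - (rule E.σ E.D X).length + i =
          s.reg 20 + (i - (rule E.σ E.D X).length + 1) by omega]
        simp only [List.length_map]
        rw [← this.1, ← this.2]
        constructor
        · split_ifs <;> omega
        · split_ifs <;> omega
    · simp only [State.reg_setReg, State.reg_setArr, reduceIte, Nat.reduceEqDiff]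
      omega
    · simp only [State.reg_setReg, State.reg_setArr, reduceIte, Nat.reduceEqDiff]
      omega

end

section
variable {E : Env} {s₀ s : State} {t A B p q : ℕ} {ds wl wr : List (ℕ × ℕ)}
  {Q : ℕ → State → Prop}

theorem wp_expandR {X j : ℕ} (hk : KSt E s₀ t s A B (ds ++ [(X, j + 1)]) p q wl wr) (hB : B < q)
    (hQ : ∀ t' s', t ≤ t' → t' ≤ t + 200 →
      KSt E s₀ t' s' A B (ds ++ (rule E.σ E.D X).map (fun x => (x, j))) p q wl wr →
      Frame [21, 28, 29, 30, 39, 40, 41, 42] [0, 1] s s' → Q t' s') :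
    expandR.wp E.w Q t s := by
  have h1 := E.fits
  have h2 := E.le_T
  have h3 := hk.lo_le
  have h4 := hk.q_le
  have h5 := E.parse.dq_le hk.dq
  have h6 := hk.stat.base
  have h15 := hk.rep.length
  have h7 := hk.rep.get ds.length (by simp)
  have h8 := Parse.dq_mem hk.dq (x := (X, j + 1)) (by simp)
  have h9 := hk.stat.mem_rule (by have := h8.1; simp at this; omega) h8.2
  have h10 : (rule E.σ E.D X).length = 2 ∨ (rule E.σ E.D X).length = 3 :=
    E.parse.length_rule (by have := h8.1; simp at this; omega) h8.2
  have h11 := hk.stat.sigma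
  have h12 := hk.le_hi
  have h13 := E.parse.dq_expand_right hk.dq hB
  have h14 := E.parse.dq_length_le h13
  have h16 := E.symbol_lt h8.1 h8.2
  have h17 := E.le_X
  simp only [List.getElem_concat_length] at h7
  simp only [List.length_append, List.length_map, List.length_cons, List.length_nil] at h14 h15
  rw [show s.reg 20 + ds.length = s.reg 21 - 1 by omega] at h7
  simp only [wp_simps, expandR, reduceIte, Nat.reduceEqDiff, h6, h7, h9.1, h11, State.arr_setReg,
    ne_eq, not_false_eq_true, Nat.add_sub_cancel, Nat.add_zero]
  have hb : 5 * (X - E.σ) + 5 ≤ 5 * E.D.length := by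
    have := (E.parse.mem_succ (by have := h8.1; simp at this; omega) h8.2).1
    simp only at this h16
    omega
  refine ⟨by omega, by omega, by omega, by omega, by omega, by omega, by omega, by omega, by omega,
    by omega, by omega, by omega, by omega, hQ _ _ (by omega) (by omega) ?_ ?_⟩
  swap
  · repeat first | exact Frame.rfl | refine Frame.setReg ?_ | refine Frame.setArr ?_
  · refine hk.change (rs := [21, 28, 29, 30, 39, 40, 41, 42]) (as := [0, 1]) (by omega) ?_
      (by decide) (by decide) ⟨?_, ?_⟩ h13 h4 ?_ ?_
    · repeat first | exact Frame.rfl | refine Frame.setReg ?_ | refine Frame.setArr ?_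
    · simp only [State.reg_setReg, State.reg_setArr, reduceIte, Nat.reduceEqDiff,
        List.length_append, List.length_map]
      omega
    · intro i hi
      simp only [List.length_append, List.length_map] at hi
      simp only [State.reg_setReg, State.reg_setArr, reduceIte, Nat.reduceEqDiff, State.arr_setReg,
        State.arr_setArr, Nat.reduceLT, ne_eq, not_false_eq_true, true_and, false_and,
        zero_ne_one, one_ne_zero]
      have hc := h9.2.1
      by_cases hir : i < ds.length
      · rw [List.getElem_append_left hir]
        have := hk.rep.get i (by simp; omega)
        rw [List.getElem_append_left hir] at this
        rw [← this.1, ← this.2]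
        constructor
        · rw [if_neg (by omega), if_neg (by omega), if_neg (by omega)]
        · rw [if_neg (by omega), if_neg (by omega), if_neg (by omega)]
      · rw [List.getElem_append_right (by omega)]
        simp only [List.getElem_map]
        have hci := hc (i - ds.length) (by omega)
        rw [List.getD_eq_getElem _ _ (show i - ds.length < (rule E.σ E.D X).length by omega)] at hci
        rw [← hci]
        constructor
        · split_ifs <;> first | omega | (congr 1; omega)
        · split_ifs <;> omega
    · simp only [State.reg_setReg, State.reg_setArr, reduceIte, Nat.reduceEqDiff]
      omega
    · simp only [State.reg_setReg, State.reg_setArr, reduceIte, Nat.reduceEqDiff]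
      omega

theorem wp_popR {x : ℕ × ℕ} (hk : KSt E s₀ t s A B (ds ++ [x]) p q wl wr)
    (hQ : ∀ t' s' r, t ≤ t' → t' ≤ t + 60 → s'.reg 28 = x.1 →
      s'.reg 34 = (str E.σ E.D x.1).length → q = r + (str E.σ E.D x.1).length →
      Seg E.σ E.D E.S x.2 [x.1] r q → x.2 ≤ E.h → r < q →
      KSt E s₀ t' s' A B ds p r wl wr → Frame [21, 28, 34] [] s s' → Q t' s') :
    popR.wp E.w Q t s := by
  have h1 := E.fits
  have h2 := E.le_T
  have h3 := hk.lo_le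
  have h4 := hk.q_le
  have h5 := E.parse.dq_le hk.dq
  have h6 := hk.stat.base
  have h15 := hk.rep.length
  have h9 := E.parse.dq_length_le hk.dq
  have h7 := (hk.rep.get ds.length (by simp)).1
  have h8 := Parse.dq_mem hk.dq (x := x) (by simp)
  have h10 := hk.le_hi
  simp only [List.getElem_concat_length] at h7
  simp only [List.length_append, List.length_cons, List.length_nil] at h9 h15
  rw [show s.reg 20 + ds.length = s.reg 21 - 1 by omega] at h7
  simp only [wp_simps, popR, h6, h7, reduceIte, Nat.reduceEqDiff, State.arr_setReg, ne_eq,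
    not_false_eq_true]
  refine ⟨by omega, by omega, ?_⟩
  have hf : Frame [21, 28] [] s ((s.setReg 21 (s.reg 21 - 1)).setReg 28 x.1) :=
    Frame.rfl.setReg.setReg
  refine wp_lenProg (hk.stat.of_frame hf) h8.1 ?_ ?_
  · simpa using h8.2
  · intro t' e1 e2
    simp only [wp_block_nil]
    have hdq := hk.dq
    rw [dq_append] at hdq
    obtain ⟨r, e6, q', e3, e4, -, e7⟩ := hdq
    obtain rfl : q' = q := e7
    have e5 := e4.eq_add
    simp only [List.flatMap_cons, List.flatMap_nil, List.append_nil] at e5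
    have e7 := E.parse.node_lt e3 e4
    have hf : Frame [21, 28, 34] [] s (((s.setReg 21 (s.reg 21 - 1)).setReg 28 x.1).setReg 34
        (str E.σ E.D x.1).length) :=
      (Frame.rfl.setReg.setReg).setReg
    refine hQ _ _ r (by omega) (by omega) (by simp) (by simp) e5 e4 e3 e7 ?_ (by simpa using hf)
    simp only [State.reg_setReg, reduceIte]
    refine hk.change (by omega) hf (by decide) (by decide) ⟨?_, ?_⟩ e6 (by omega) ?_ ?_
    · simp
      omega
    · intro i hi
      have := hk.rep.get i (by simp; omega)
      rw [List.getElem_append_left hi] at this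
      simpa [State.arr_setReg] using this
    · simpa using h3
    · simp
      omega

/-- Each new word takes time, so the counter in register `12` never exceeds the elapsed time. This
bounds all numbers of words by `T`, so no code overflows. -/
theorem wp_append {acc i : ℕ} (hacc : acc ∉ [3, 12, 35])
    {l : List ℕ} (hs : Static E s) (hd : DictOk s) (hc : s.reg 12 ≤ t) (ht : t < E.T)
    (hx : s.reg i ≤ E.T) (hw : Walk s (s.reg acc) l)
    (hQ : ∀ t' s', t ≤ t' → t' ≤ t + 60 → Frame [12, 35, acc] [3] s s' → DictOk s' →
      s'.reg 12 ≤ t' → (∀ k, s.arr 3 k ≠ 0 → s'.arr 3 k = s.arr 3 k) →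
      Walk s' (s'.reg acc) (l ++ [s.reg i]) → Q t' s') :
    (append acc i).wp E.w Q t s := by
  have h1 := E.fits
  have h3 := hs.base
  have h4 := hw.le hd
  have h5 := E.fits_pairCode (a := s.reg acc) (x := s.reg i) (by omega) hx
  have h6 : (s.reg acc + s.reg i) * (s.reg acc + s.reg i) + s.reg acc =
    pairCode (s.reg acc) (s.reg i) := rfl
  simp only [List.mem_cons, List.not_mem_nil, or_false, not_or] at hacc
  simp only [wp_simps, append, reduceIte, Nat.reduceEqDiff, h6, h3, State.arr_setReg, ne_eq,
    not_false_eq_true]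
  refine ⟨by omega, by omega, fun h => ⟨by omega, by omega, by omega, ?_⟩, fun h => ⟨by omega, ?_⟩⟩
  · simp only [State.arr_setArr, Nat.reduceLT, true_and, reduceIte]
    generalize hs' : (((s.setReg 35 (pairCode (s.reg acc) (s.reg i))).setReg 12
        (s.reg 12 + 1)).setArr 3 (pairCode (s.reg acc) (s.reg i)) (s.reg 12 + 1)).setReg acc
          (s.reg 12 + 1) = s'
    have ha : ∀ k, s'.arr 3 k = if k = pairCode (s.reg acc) (s.reg i) then s.reg 12 + 1 else
        s.arr 3 k := fun k => by
      rw [← hs', State.arr_setReg hacc.1, State.arr_setArr (by omega) (by omega)]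
      simp [State.arr_setReg]
    have hv : s'.arr 3 (pairCode (s.reg acc) (s.reg i)) = s.reg 12 + 1 := by rw [ha, if_pos rfl]
    have hr : s'.reg 12 = s.reg 12 + 1 := by
      simp [← hs', Ne.symm hacc.2.1]
    have hk' : ∀ k, k ≠ pairCode (s.reg acc) (s.reg i) → s'.arr 3 k = s.arr 3 k := fun k hk => by
      rw [ha, if_neg hk]
    have hm : ∀ k, s.arr 3 k ≠ 0 → s'.arr 3 k = s.arr 3 k := fun k hk =>
      hk' k (by rintro rfl; exact hk h)
    refine hQ _ _ (by omega) (by omega) ?_ ⟨?_, ?_⟩ (by rw [hr]; omega) hm ?_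
    · have h3' : 3 ∉ [12, 35, acc] := by simp [Ne.symm hacc.1]
      rw [← hs']
      exact (((Frame.rfl.setReg (by simp) h3').setReg (by simp) h3').setArr (by simp) (by decide)
        h3').setReg (by simp) h3'
    · intro k
      rw [hr]
      by_cases hk : k = pairCode (s.reg acc) (s.reg i)
      · rw [hk, hv]
      · rw [hk' k hk]
        have := hd.le k
        omega
    · intro k k'
      by_cases hk : k = pairCode (s.reg acc) (s.reg i)
      · by_cases hkk : k' = pairCode (s.reg acc) (s.reg i)
        · intro _ _
          rw [hk, hkk]
        · rw [hk, hv, hk' k' hkk]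
          have := hd.le k'
          omega
      · by_cases hkk : k' = pairCode (s.reg acc) (s.reg i)
        · rw [hkk, hv, hk' k hk]
          have := hd.le k
          omega
        · rw [hk' k hk, hk' k' hkk]
          exact hd.inj k k'
    · have := Walk.snoc (hw.mono hm) (x := s.reg i) (by rw [hv]; omega)
      rw [hv] at this
      simpa [← hs'] using this
  · have hm : ∀ k, ((s.setReg 35 (pairCode (s.reg acc) (s.reg i))).setReg acc
        (s.arr 3 (pairCode (s.reg acc) (s.reg i)))).arr 3 k = s.arr 3 k := by
      intro k
      rw [State.arr_setReg hacc.1, State.arr_setReg (by omega)]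
    have hr : ((s.setReg 35 (pairCode (s.reg acc) (s.reg i))).setReg acc
        (s.arr 3 (pairCode (s.reg acc) (s.reg i)))).reg 12 = s.reg 12 := by
      simp [Ne.symm hacc.2.1]
    refine hQ _ _ (by omega) (by omega) ?_ ⟨?_, ?_⟩ (by rw [hr]; omega) (fun k _ => hm k) ?_
    · refine Frame.setReg ?_ (by simp) (by simp [Ne.symm hacc.1])
      refine Frame.setReg ?_ (by simp) (by simp [Ne.symm hacc.1])
      exact Frame.rfl
    · intro k
      rw [hr, hm]
      exact hd.le k
    · intro k k'
      rw [hm, hm]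
      exact hd.inj k k'
    · have := Walk.snoc (hw.mono fun k _ => hm k) (x := s.reg i) (by rw [hm]; exact h)
      rw [hm] at this
      simpa using this

theorem flat_append (x : ℕ × ℕ) (l : List (ℕ × ℕ)) : flat (l ++ [x]) = flat l ++ [x.1] ++ [x.2] := by
  simp [flat]

theorem wp_emitL {i j : ℕ} (hj : j ∈ freeRegs) (hj5 : j ≠ 35)
    (hk : KSt E s₀ t s A B ds p q wl wr)
    (ht : t + 100 < E.T) (hiT : s.reg i ≤ E.T) (hjT : s.reg j ≤ E.T)
    (hQ : ∀ t' s', t ≤ t' → t' ≤ t + 130 →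
      KSt E s₀ t' s' A B ds p q (wl ++ [(s.reg i, s.reg j)]) wr →
      Frame [12, 35, 23] [3] s s' → Q t' s') :
    (emit 23 i j).wp E.w Q t s := by
  have hne : ∀ i ∈ freeRegs, i ≠ 35 → i ∉ [12, 35, 23] := by decide
  refine wp_append (by decide) hk.stat hk.dict hk.cnt_le (by omega) hiT hk.left ?_
  intro t₁ s₁ a1 a2 a3 a4 a5 a6 a7
  rw [wp_block_cons]
  refine wp_append (by decide) (hk.stat.of_frame a3) a4 a5 (by omega)
    (by rw [a3.reg j (hne j hj hj5)]; exact hjT) a7 ?_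
  intro t₂ s₂ b1 b2 b3 b4 b5 b6 b7
  rw [wp_block_nil]
  have hf := a3.trans b3
  have hm : ∀ k, s.arr 3 k ≠ 0 → s₂.arr 3 k = s.arr 3 k := fun k hk => by
    rw [b6 k (by rwa [a6 k hk]), a6 k hk]
  refine hQ _ _ (by omega) (by omega) ⟨hk.frame.trans hf,
    hk.stat.of_frame hf, by omega, b4, fun k h => ?_, ?_, ?_, ⟨?_, fun i hi => ?_⟩,
    hk.dq, hk.q_le, ?_, ?_⟩ hf
  · have h1 := hk.mono k h
    rw [hm k (by rwa [h1]), h1]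
  · rw [flat_append]
    rwa [a3.reg j (hne j hj hj5)] at b7
  · rw [hf.reg 24]
    exact hk.right.mono hm
  · rw [hf.reg 20, hf.reg 21]
    exact hk.rep.length
  · rw [hf.reg 20, hf.arr 0, hf.arr 1]
    exact hk.rep.get i hi
  · rw [hf.reg 20]
    exact hk.lo_le
  · rw [hf.reg 21]
    exact hk.le_hi

theorem wp_emitR {i j : ℕ} (hj : j ∈ freeRegs) (hj5 : j ≠ 35)
    (hk : KSt E s₀ t s A B ds p q wl wr)
    (ht : t + 100 < E.T) (hiT : s.reg i ≤ E.T) (hjT : s.reg j ≤ E.T)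
    (hQ : ∀ t' s', t ≤ t' → t' ≤ t + 130 →
      KSt E s₀ t' s' A B ds p q wl (wr ++ [(s.reg i, s.reg j)]) →
      Frame [12, 35, 24] [3] s s' → Q t' s') :
    (emit 24 i j).wp E.w Q t s := by
  have hne : ∀ i ∈ freeRegs, i ≠ 35 → i ∉ [12, 35, 24] := by decide
  refine wp_append (by decide) hk.stat hk.dict hk.cnt_le (by omega) hiT hk.right ?_
  intro t₁ s₁ a1 a2 a3 a4 a5 a6 a7
  rw [wp_block_cons]
  refine wp_append (by decide) (hk.stat.of_frame a3) a4 a5 (by omega)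
    (by rw [a3.reg j (hne j hj hj5)]; exact hjT) a7 ?_
  intro t₂ s₂ b1 b2 b3 b4 b5 b6 b7
  rw [wp_block_nil]
  have hf := a3.trans b3
  have hm : ∀ k, s.arr 3 k ≠ 0 → s₂.arr 3 k = s.arr 3 k := fun k hk => by
    rw [b6 k (by rwa [a6 k hk]), a6 k hk]
  refine hQ _ _ (by omega) (by omega) ⟨hk.frame.trans hf,
    hk.stat.of_frame hf, by omega, b4, fun k h => ?_, ?_, ?_, ⟨?_, fun i hi => ?_⟩,
    hk.dq, hk.q_le, ?_, ?_⟩ hf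
  · have h1 := hk.mono k h
    rw [hm k (by rwa [h1]), h1]
  · rw [hf.reg 23]
    exact hk.left.mono hm
  · rw [flat_append]
    rwa [a3.reg j (hne j hj hj5)] at b7
  · rw [hf.reg 20, hf.reg 21]
    exact hk.rep.length
  · rw [hf.reg 20, hf.arr 0, hf.arr 1]
    exact hk.rep.get i hi
  · rw [hf.reg 20]
    exact hk.lo_le
  · rw [hf.reg 21]
    exact hk.le_hi

end

/-! ### Removing nodes of one level -/

/-- Remove up to `M` nodes of the current level from the right. -/
def stripR : Prog :=
  block [
    .assign 31 (.const 0),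
    .loop (.and (.bin .lt (.reg 31) (.reg 6)) (.bin .lt (.reg 20) (.reg 21)))
      (.ite (.bin .lt (.reg 22) (.arr 1 (.reg 21 - .const 1))) expandR
        (block [popR, emit 24 28 34, .assign 31 (.reg 31 + .const 1)]))]

/-- Remove up to `M` nodes of the current level from the left. -/
def stripL : Prog :=
  block [
    .assign 31 (.const 0),
    .assign 25 (.const 0),
    .loop (.and (.bin .lt (.reg 31) (.reg 6)) (.bin .lt (.reg 20) (.reg 21)))
      (.ite (.bin .lt (.reg 22) (.arr 1 (.reg 20))) expandL
        (block [popL, emit 23 28 34, .assign 25 (.reg 28), .assign 31 (.reg 31 + .const 1)]))]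

section
variable {E : Env} {s₀ s : State} {t A B p q lev : ℕ} {ds wl wr : List (ℕ × ℕ)}
  {Q : ℕ → State → Prop}

theorem KSt.length_le (hk : KSt E s₀ t s A B ds p q wl wr) : ds.length ≤ E.S.length := by
  have := E.parse.dq_length_le hk.dq
  have := hk.q_le
  omega

theorem KSt.lt_iff (hk : KSt E s₀ t s A B ds p q wl wr) : s.reg 20 < s.reg 21 ↔ ds ≠ [] := by
  have := hk.rep.length
  rw [← List.length_pos_iff]
  omega

theorem Env.length_str_le (E : Env) {j X a b : ℕ} (hj : j ≤ E.h)
    (hs : Seg E.σ E.D E.S j [X] a b) : X ≤ E.T ∧ (str E.σ E.D X).length ≤ E.T := by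
  have h1 := hs.eq_add
  have h2 := E.parse.seg_right_le hj hs
  have h3 := E.le_T
  have h4 := E.parse.symbol_lt hj (hs.mem (List.mem_singleton_self X))
  have h5 := E.parse.card_lt
  simp at h1
  omega

/-- The time is amortised: an expansion adds at least one node, worth `400` steps, and a removal
pays for itself and for the lost node by the `800` steps credited to each stripped symbol. What
remains is paid for by the length of the final covering, which is `O(h)`. -/
theorem wp_stripR (hk : KSt E s₀ t s p q ds p q wl wr) (hl : ∀ x ∈ ds, lev ≤ x.2)
    (hlev : s.reg 22 = lev) (hh : lev ≤ E.h) (hb : Bd E.σ E.D E.S lev q)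
    (ht : t + 800 * E.M + 400 * E.S.length + 1000 < E.T)
    (hQ : ∀ t' s' ds' q' RS, t ≤ t' → t' + 400 * ds.length ≤ t + 50 + 800 * E.M + 400 * ds'.length →
      KSt E s₀ t' s' p q' ds' p q' wl (wr ++ RS.reverse.map (item E.σ E.D)) →
      Seg E.σ E.D E.S lev RS q' q → RS.length ≤ E.M → (RS.length < E.M → q' = p) →
      (∀ x ∈ ds', lev ≤ x.2) → s'.reg 22 = lev → Q t' s') :
    stripR.wp E.w Q t s := by
  have h1 := E.fits
  have h2 := E.le_T
  simp only [wp_simps, stripR]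
  refine ⟨by omega, ?_⟩
  -- While the last node is being expanded, maximality is only known with respect to `B = q' - 1`.
  -- The loop cannot end in this state, and after a removal `q' ≤ B` holds again.
  refine Prog.wp_loop (fun t' s' => ∃ ds' q' RS B, t ≤ t' ∧
      t' + 400 * ds.length ≤ t + 20 + 800 * RS.length + 400 * ds'.length ∧
      KSt E s₀ t' s' p B ds' p q' wl (wr ++ RS.reverse.map (item E.σ E.D)) ∧
      (q' ≤ B ∨ RS.length < E.M ∧ ds' ≠ [] ∧ B = q' - 1) ∧
      Seg E.σ E.D E.S lev RS q' q ∧ RS.length ≤ E.M ∧ s'.reg 31 = RS.length ∧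
      (∀ x ∈ ds', lev ≤ x.2) ∧ s'.reg 22 = lev)
    (t + 20 + 800 * E.M + 400 * E.S.length) ?_ ?_ ?_
  · rintro t' s' ⟨ds', q', RS, B, -, e1, e2, -, -, e3, -⟩
    have := e2.length_le
    omega
  · rintro t' s' ⟨ds', q', RS, B, e0, e1, e2, e3, e4, e5, e6, e7, e8⟩
    have hN := e2.length_le
    have h3 := e2.hi_le
    have h4 := e2.q_le
    have h5 := e2.stat.base
    simp only [wp_simps, e2.stat.strip, e6, e2.lt_iff, e8, h5]
    refine ⟨by simp, ?_, ?_⟩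
    · rintro ⟨f1, f2⟩
      obtain ⟨ds₁, x, rfl⟩ : ∃ ds₁ x, ds' = ds₁ ++ [x] :=
        ⟨_, _, (List.dropLast_append_getLast f2).symm⟩
      have h6 := e2.rep.length
      have h7 := (e2.rep.get ds₁.length (by simp)).2
      simp only [List.getElem_concat_length] at h7
      simp only [List.length_append, List.length_cons, List.length_nil] at h6
      rw [show s'.reg 20 + ds₁.length = s'.reg 21 - 1 by omega] at h7
      have h8 : KSt E s₀ t' s' p (q' - 1) (ds₁ ++ [x]) p q' wl
          (wr ++ RS.reverse.map (item E.σ E.D)) := by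
        rcases e3 with e3 | e3
        · exact e2.weaken le_rfl (by omega)
        · rw [← e3.2.2]
          exact e2
      have hpq : p < q' := by
        have := E.parse.dq_length_le e2.dq
        simp at this
        omega
      refine ⟨by omega, fun f3 => ?_, fun f3 => ?_⟩
      · rw [h7] at f3
        obtain ⟨X, j⟩ := x
        obtain ⟨j, rfl⟩ : ∃ i, j = i + 1 := ⟨j - 1, by simp at f3; omega⟩
        refine wp_expandR (h8.later (by omega)) (by omega) ?_
        intro t₁ s₁ g1 g2 g3 g4
        have h10 : (rule E.σ E.D X).length = 2 ∨ (rule E.σ E.D X).length = 3 := by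
          have := Parse.dq_mem e2.dq (x := (X, j + 1)) (by simp)
          exact E.parse.length_rule (by have := this.1; simp at this; omega) this.2
        refine ⟨_, q', RS, q' - 1, by omega, ?_, g3, Or.inr ⟨f1, ?_, rfl⟩, e4, e5, ?_, ?_, ?_⟩
        · simp only [List.length_append, List.length_map, List.length_cons, List.length_nil] at e1 ⊢
          omega
        · intro h
          simp only [List.append_eq_nil_iff, List.map_eq_nil_iff] at h
          simp [h.2] at h10
        · rw [g4.reg 31, e6]
        · intro x hx
          rcases List.mem_append.1 hx with hx | hx
          · exact e7 x (by simp [hx])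
          · obtain ⟨z, -, rfl⟩ := List.mem_map.1 hx
            simp at f3 ⊢
            omega
        · rw [g4.reg 22, e8]
      · rw [h7] at f3
        have f4 := e7 x (by simp)
        refine wp_popR (h8.later (by omega)) ?_
        intro t₁ s₁ r g1 g2 g3 g4 g5 g6 g7 g8 g9 g10
        have h9 := E.length_str_le g7 g6
        refine wp_emitR (by decide) (by decide) g9 ?_ ?_ ?_ ?_
        · simp only [List.length_append, List.length_cons, List.length_nil] at e1 hN
          omega
        · rw [g3]
          exact h9.1
        · rw [g4]
          exact h9.2
        intro t₂ s₂ k1 k2 k3 k4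
        simp only [wp_simps]
        have h11 : s₂.reg 31 = RS.length := by
          rw [k4.reg 31, g10.reg 31, e6]
        have h12 : x.2 = lev := by omega
        rw [h12] at g6
        refine ⟨⟨by omega, by omega⟩, ds₁, r, x.1 :: RS, q' - 1, by omega, ?_, ?_,
          Or.inl (by omega), E.parse.seg_append hh g6 e4, ?_, ?_, ?_, ?_⟩
        · simp only [List.length_append, List.length_cons, List.length_nil] at e1 ⊢
          omega
        · rw [List.reverse_cons, List.map_append, ← List.append_assoc]
          rw [g3, g4] at k3
          refine k3.of_frame (by omega) (rs := [31]) ?_ (by decide)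
          exact Frame.rfl.setReg
        · simp
          omega
        · simp [h11]
        · exact fun y hy => e7 y (by simp [hy])
        · simp
          rw [k4.reg 22, g10.reg 22, e8]
    · intro f1
      have f2 : q' ≤ B := by
        rcases e3 with e3 | e3
        · exact e3
        · exact absurd ⟨e3.1, e3.2.1⟩ f1
      refine hQ _ _ ds' q' RS (by omega) (by omega)
        ((e2.weaken le_rfl f2).later (by omega))
        e4 e5 ?_ e7 e8
      intro f3
      by_contra hc
      refine f1 ⟨f3, ?_⟩
      rintro rfl
      exact hc (e2.dq : p = q').symm
  · refine ⟨ds, q, [], q, by omega, by simp, ?_, Or.inl le_rfl, hb, by simp, by simp, hl, ?_⟩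
    · simp only [List.reverse_nil, List.map_nil, List.append_nil]
      refine hk.of_frame (by omega) (rs := [31]) ?_ (by decide)
      exact Frame.rfl.setReg
    · simp [hlev]

theorem wp_stripL (hk : KSt E s₀ t s p q ds p q wl wr) (hl : ∀ x ∈ ds, lev ≤ x.2)
    (hlev : s.reg 22 = lev) (hh : lev ≤ E.h) (hb : Bd E.σ E.D E.S lev p)
    (ht : t + 800 * E.M + 400 * E.S.length + 1000 < E.T)
    (hQ : ∀ t' s' ds' p' LS, t ≤ t' → t' + 400 * ds.length ≤ t + 50 + 800 * E.M + 400 * ds'.length →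
      KSt E s₀ t' s' p' q ds' p' q (wl ++ LS.map (item E.σ E.D)) wr →
      Seg E.σ E.D E.S lev LS p p' → LS.length ≤ E.M → (LS.length < E.M → p' = q) →
      (∀ x ∈ ds', lev ≤ x.2) → s'.reg 22 = lev → s'.reg 25 = LS.getLastD 0 → Q t' s') :
    stripL.wp E.w Q t s := by
  have h1 := E.fits
  have h2 := E.le_T
  simp only [wp_simps, stripL]
  refine ⟨by omega, by omega, ?_⟩
  refine Prog.wp_loop (fun t' s' => ∃ ds' p' LS A, t ≤ t' ∧
      t' + 400 * ds.length ≤ t + 20 + 800 * LS.length + 400 * ds'.length ∧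
      KSt E s₀ t' s' A q ds' p' q (wl ++ LS.map (item E.σ E.D)) wr ∧
      (A ≤ p' ∨ LS.length < E.M ∧ ds' ≠ [] ∧ A = p' + 1) ∧
      Seg E.σ E.D E.S lev LS p p' ∧ LS.length ≤ E.M ∧ s'.reg 31 = LS.length ∧
      (∀ x ∈ ds', lev ≤ x.2) ∧ s'.reg 22 = lev ∧ s'.reg 25 = LS.getLastD 0)
    (t + 20 + 800 * E.M + 400 * E.S.length) ?_ ?_ ?_
  · rintro t' s' ⟨ds', q', LS, A, -, e1, e2, -, -, e3, -⟩
    have := e2.length_le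
    omega
  · rintro t' s' ⟨ds', p', LS, A, e0, e1, e2, e3, e4, e5, e6, e7, e8, e9⟩
    have hN := e2.length_le
    have h3 := e2.hi_le
    have h4 := e2.q_le
    have h5 := e2.stat.base
    have h13 := e2.rep.length
    simp only [wp_simps, e2.stat.strip, e6, e2.lt_iff, e8, h5]
    refine ⟨by simp, ?_, ?_⟩
    · rintro ⟨f1, f2⟩
      obtain ⟨x, ds₁, rfl⟩ := List.exists_cons_of_ne_nil f2
      have h7 := (e2.rep.get 0 (by simp)).2
      simp only [List.getElem_cons_zero, Nat.add_zero] at h7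
      have h8 : KSt E s₀ t' s' (p' + 1) q (x :: ds₁) p' q
          (wl ++ LS.map (item E.σ E.D)) wr := by
        rcases e3 with e3 | e3
        · exact e2.weaken (by omega) le_rfl
        · rw [← e3.2.2]
          exact e2
      refine ⟨by omega, fun f3 => ?_, fun f3 => ?_⟩
      · rw [h7] at f3
        obtain ⟨X, j⟩ := x
        obtain ⟨j, rfl⟩ : ∃ i, j = i + 1 := ⟨j - 1, by simp at f3; omega⟩
        refine wp_expandL (h8.later (by omega)) (by omega) ?_
        intro t₁ s₁ g1 g2 g3 g4
        have h10 := E.parse.dq_length_rule e2.dq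
        refine ⟨_, p', LS, p' + 1, by omega, ?_, g3, Or.inr ⟨f1, ?_, rfl⟩, e4, e5, ?_, ?_, ?_, ?_⟩
        · simp only [List.length_append, List.length_map, List.length_cons] at e1 ⊢
          omega
        · intro h
          simp only [List.append_eq_nil_iff, List.map_eq_nil_iff] at h
          simp [h.1] at h10
        · rw [g4.reg 31, e6]
        · intro x hx
          rcases List.mem_append.1 hx with hx | hx
          · obtain ⟨z, -, rfl⟩ := List.mem_map.1 hx
            simp at f3 ⊢
            omega
          · exact e7 x (by simp [hx])
        · rw [g4.reg 22, e8]
        · rw [g4.reg 25, e9]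
      · rw [h7] at f3
        have f4 := e7 x (by simp)
        refine wp_popL (h8.later (by omega)) ?_
        intro t₁ s₁ r g1 g2 g3 g4 g5 g6 g7 g8 g9 g10
        have h9 := E.length_str_le g7 g6
        refine wp_emitL (by decide) (by decide) g9 ?_ ?_ ?_ ?_
        · simp only [List.length_cons] at e1 hN
          omega
        · rw [g3]
          exact h9.1
        · rw [g4]
          exact h9.2
        intro t₂ s₂ k1 k2 k3 k4
        simp only [wp_simps, reduceIte, Nat.reduceEqDiff]
        have h11 : s₂.reg 31 = LS.length := by
          rw [k4.reg 31, g10.reg 31, e6]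
        have h12 : x.2 = lev := by omega
        rw [h12] at g6
        refine ⟨⟨by omega, by omega⟩, ds₁, r, LS ++ [x.1], p' + 1, by omega, ?_, ?_,
          Or.inl (by omega), E.parse.seg_append hh e4 g6, ?_, ?_, ?_, ?_, ?_⟩
        · simp only [List.length_append, List.length_cons, List.length_nil] at e1 ⊢
          omega
        · rw [List.map_append, ← List.append_assoc]
          rw [g3, g4] at k3
          refine k3.of_frame (by omega) (rs := [25, 31]) ?_ (by decide)
          exact Frame.rfl.setReg.setReg
        · simp
          omega
        · simp [h11]
        · exact fun y hy => e7 y (by simp [hy])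
        · rw [k4.reg 22, g10.reg 22, e8]
        · rw [k4.reg 28, g3]
          simp
    · intro f1
      have f2 : A ≤ p' := by
        rcases e3 with e3 | e3
        · exact e3
        · exact absurd ⟨e3.1, e3.2.1⟩ f1
      refine hQ _ _ ds' p' LS (by omega) (by omega)
        ((e2.weaken f2 le_rfl).later (by omega))
        e4 e5 ?_ e7 e8 e9
      intro f3
      by_contra hc
      refine f1 ⟨f3, ?_⟩
      rintro rfl
      exact hc (e2.dq : p' = q)
  · refine ⟨ds, p, [], p, by omega, by simp, ?_, Or.inl le_rfl, hb, by simp, by simp, hl, ?_, ?_⟩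
    · simp only [List.map_nil, List.append_nil]
      refine hk.of_frame (by omega) (rs := [25, 31]) ?_ (by decide)
      exact Frame.rfl.setReg.setReg
    · simp [hlev]
    · simp

end

/-! ### Skipping a run and aligning -/

/-- The rule of the symbol in register `28` is the square of the last symbol of the chain. -/
def squareTest : Expr :=
  .and (.bin .eq (.load (.const 5 * (.reg 28 - .reg 0))) (.const 2))
    (.and (.bin .eq (.load (.const 5 * (.reg 28 - .reg 0) + .const 1)) (.arr 2 (.reg 26)))
      (.bin .eq (.load (.const 5 * (.reg 28 - .reg 0) + .const 2)) (.arr 2 (.reg 26))))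

/-- The loop which skips the run of the symbol in register `25`. -/
def skipLoop : Prog :=
  .loop (.and (.reg 36) (.bin .lt (.reg 20) (.reg 21)))
    (block [
      .assign 28 (.arr 0 (.reg 20)),
      .assign 39 (.arr 1 (.reg 20)),
      .ite (.bin .lt (.reg 26) (.reg 39))
        (.ite (.and (.bin .eq (.reg 39) (.reg 26 + .const 1)) squareTest)
          (block [popL, .assign 26 (.reg 26 + .const 1), .setArr 2 (.reg 26) (.reg 28),
            .assign 27 (.reg 27 + .reg 34)])
          expandL)
        (.ite (.bin .eq (.reg 28) (.arr 2 (.reg 39)))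
          (block [popL, .assign 27 (.reg 27 + .reg 34)])
          (.ite (.bin .eq (.reg 39) (.reg 22)) (.assign 36 (.const 0)) expandL))])

/-- Skip a run. -/
def skipRun : Prog :=
  block [.assign 36 (.const 1), .assign 26 (.reg 22), .setArr 2 (.reg 22) (.reg 25),
    .assign 27 (.const 0), skipLoop, emit 23 25 27]

/-- Remove all nodes of the current level from the left. -/
def alignL : Prog :=
  .loop (.and (.bin .lt (.reg 20) (.reg 21)) (.bin .eq (.arr 1 (.reg 20)) (.reg 22)))
    (block [popL, emit 23 28 34])

/-- Remove all nodes of the current level from the right. -/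
def alignR : Prog :=
  .loop (.and (.bin .lt (.reg 20) (.reg 21)) (.bin .eq (.arr 1 (.reg 21 - .const 1)) (.reg 22)))
    (block [popR, emit 24 28 34])

section
variable {E : Env} {s₀ s : State} {t A B p q lev a y : ℕ} {ds wl wr : List (ℕ × ℕ)}
  {Q : ℕ → State → Prop}

theorem Env.height_le (E : Env) : E.h + 1 ≤ E.S.length := by
  have h1 := E.parse.two_pow_le
  have h2 : E.h < 2 ^ E.h := Nat.lt_two_pow_self
  omega

theorem wp_alignL (hk : KSt E s₀ t s A B ds p q wl wr)
    (hlev : s.reg 22 = lev)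
    (ht : t + 400 * E.S.length + 1000 < E.T)
    (hQ : ∀ (t' : ℕ) (s' : State) (ds' : List (ℕ × ℕ)) (p' : ℕ) (AL : List ℕ), t ≤ t' → t' + 400 * ds'.length ≤ t + 50 + 400 * ds.length →
      KSt E s₀ t' s' A B ds' p' q (wl ++ AL.map (item E.σ E.D)) wr →
      ds = AL.map (fun z => (z, lev)) ++ ds' → (∀ z ∈ ds'.head?, z.2 ≠ lev) → s'.reg 22 = lev →
      Q t' s') :
    alignL.wp E.w Q t s := by
  have h1 := E.fits
  have h2 := E.le_T
  refine Prog.wp_loop (fun t' s' => ∃ (ds' : List (ℕ × ℕ)) (p' : ℕ) (AL : List ℕ), t ≤ t' ∧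
      t' + 400 * ds'.length ≤ t + 400 * ds.length ∧
      KSt E s₀ t' s' A B ds' p' q (wl ++ AL.map (item E.σ E.D)) wr ∧
      ds = AL.map (fun z => (z, lev)) ++ ds' ∧ s'.reg 22 = lev)
    (t + 400 * E.S.length) ?_ ?_ ?_
  · rintro t' s' ⟨ds', p', AL, -, e1, -⟩
    have := hk.length_le
    omega
  · rintro t' s' ⟨ds', p', AL, e0, e1, e2, e3, e4⟩
    have hN := hk.length_le
    have hN' := e2.length_le
    have h3 := e2.hi_le
    have h4 := e2.q_le
    have h5 := e2.stat.base
    have h13 := e2.rep.length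
    simp only [wp_simps, e2.lt_iff, e4, h5]
    refine ⟨by omega, ?_, ?_⟩
    · rintro ⟨f1, f2⟩
      obtain ⟨x, ds₁, rfl⟩ := List.exists_cons_of_ne_nil f1
      have h7 := (e2.rep.get 0 (by simp)).2
      simp only [List.getElem_cons_zero, Nat.add_zero] at h7
      rw [h7] at f2
      refine wp_popL (e2.later (by omega)) ?_
      intro t₁ s₁ r g1 g2 g3 g4 g5 g6 g7 g8 g9 g10
      have h9 := E.length_str_le g7 g6
      simp only [List.length_cons] at e1 hN'
      refine wp_emitL (by decide) (by decide) g9 (by omega) ?_ ?_ ?_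
      · rw [g3]
        exact h9.1
      · rw [g4]
        exact h9.2
      intro t₂ s₂ k1 k2 k3 k4
      rw [wp_block_nil]
      refine ⟨ds₁, r, AL ++ [x.1], by omega, by omega, ?_, ?_, ?_⟩
      · rw [List.map_append, ← List.append_assoc]
        rw [g3, g4] at k3
        exact k3.later (by omega)
      · rw [e3]
        simp [← f2]
      · rw [k4.reg 22, g10.reg 22, e4]
    · intro f1
      refine hQ _ _ ds' p' AL (by omega) (by omega)
        (e2.later (by omega)) e3 ?_ e4
      intro z hz hc
      obtain ⟨ds₁, rfl⟩ : ∃ ds₁, ds' = z :: ds₁ := by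
        cases ds' with
        | nil => simp at hz
        | cons x ds₁ => exact ⟨ds₁, by simp at hz; rw [hz]⟩
      have h7 := (e2.rep.get 0 (by simp)).2
      simp only [List.getElem_cons_zero, Nat.add_zero] at h7
      exact f1 ⟨by simp, by rw [h7, hc]⟩
  · exact ⟨ds, p, [], le_rfl, le_rfl, by simpa using hk, by simp, hlev⟩

theorem wp_alignR (hk : KSt E s₀ t s A B ds p q wl wr)
    (hlev : s.reg 22 = lev)
    (ht : t + 400 * E.S.length + 1000 < E.T)
    (hQ : ∀ (t' : ℕ) (s' : State) (ds' : List (ℕ × ℕ)) (q' : ℕ) (AR : List ℕ), t ≤ t' → t' + 400 * ds'.length ≤ t + 50 + 400 * ds.length →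
      KSt E s₀ t' s' A B ds' p q' wl (wr ++ AR.reverse.map (item E.σ E.D)) →
      ds = ds' ++ AR.map (fun z => (z, lev)) → (∀ z ∈ ds'.getLast?, z.2 ≠ lev) →
      s'.reg 22 = lev → Q t' s') :
    alignR.wp E.w Q t s := by
  have h1 := E.fits
  have h2 := E.le_T
  refine Prog.wp_loop (fun t' s' => ∃ (ds' : List (ℕ × ℕ)) (q' : ℕ) (AR : List ℕ), t ≤ t' ∧
      t' + 400 * ds'.length ≤ t + 400 * ds.length ∧
      KSt E s₀ t' s' A B ds' p q' wl (wr ++ AR.reverse.map (item E.σ E.D)) ∧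
      ds = ds' ++ AR.map (fun z => (z, lev)) ∧ s'.reg 22 = lev)
    (t + 400 * E.S.length) ?_ ?_ ?_
  · rintro t' s' ⟨ds', q', AR, -, e1, -⟩
    have := hk.length_le
    omega
  · rintro t' s' ⟨ds', q', AR, e0, e1, e2, e3, e4⟩
    have hN := hk.length_le
    have hN' := e2.length_le
    have h3 := e2.hi_le
    have h4 := e2.q_le
    have h5 := e2.stat.base
    have h13 := e2.rep.length
    simp only [wp_simps, e2.lt_iff, e4, h5]
    refine ⟨by omega, ?_, ?_⟩
    · rintro ⟨f1, f2⟩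
      obtain ⟨ds₁, x, rfl⟩ : ∃ ds₁ x, ds' = ds₁ ++ [x] :=
        ⟨_, _, (List.dropLast_append_getLast f1).symm⟩
      have h7 := (e2.rep.get ds₁.length (by simp)).2
      simp only [List.getElem_concat_length] at h7
      simp only [List.length_append, List.length_cons, List.length_nil] at h13 e1 hN'
      rw [show s'.reg 20 + ds₁.length = s'.reg 21 - 1 by omega] at h7
      rw [h7] at f2
      refine wp_popR (e2.later (by omega)) ?_
      intro t₁ s₁ r g1 g2 g3 g4 g5 g6 g7 g8 g9 g10
      have h9 := E.length_str_le g7 g6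
      refine wp_emitR (by decide) (by decide) g9 (by omega) ?_ ?_ ?_
      · rw [g3]
        exact h9.1
      · rw [g4]
        exact h9.2
      intro t₂ s₂ k1 k2 k3 k4
      rw [wp_block_nil]
      refine ⟨ds₁, r, x.1 :: AR, by omega, by omega, ?_, ?_, ?_⟩
      · rw [List.reverse_cons, List.map_append, ← List.append_assoc]
        rw [g3, g4] at k3
        exact k3.later (by omega)
      · rw [e3]
        simp [← f2]
      · rw [k4.reg 22, g10.reg 22, e4]
    · intro f1
      refine hQ _ _ ds' q' AR (by omega) (by omega)
        (e2.later (by omega)) e3 ?_ e4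
      intro z hz hc
      obtain ⟨ds₁, rfl⟩ : ∃ ds₁, ds' = ds₁ ++ [z] := List.getLast?_eq_some_iff.1 hz
      have h7 := (e2.rep.get ds₁.length (by simp)).2
      simp only [List.getElem_concat_length] at h7
      simp only [List.length_append, List.length_cons, List.length_nil] at h13
      rw [show s'.reg 20 + ds₁.length = s'.reg 21 - 1 by omega] at h7
      exact f1 ⟨by simp, by rw [h7, hc]⟩
  · exact ⟨ds, q, [], le_rfl, le_rfl, by simpa using hk, by simp, hlev⟩

/-- The state while a run of `a` which starts at `y` is skipped. -/
structure SkipSt (E : Env) (s₀ : State) (t : ℕ) (s : State) (lev a y q : ℕ) (ds : List (ℕ × ℕ))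
    (J cur : ℕ) (wl wr : List (ℕ × ℕ)) : Prop where
  kst : KSt E s₀ t s (cur + 1) q ds cur q wl wr
  sinv : SInv E.σ E.D E.S E.h lev a y q ds J cur
  level : s.reg 22 = lev
  symbol : s.reg 25 = a
  top : s.reg 26 = J
  total : s.reg 27 + y = cur
  chain : ∀ d, lev + d ≤ J → s.arr 2 (lev + d) = chain E.σ E.D a d

theorem cost_squareTest_le : squareTest.cost ≤ 60 := by
  simp [squareTest]

theorem holds_squareTest {Z j c : ℕ} (hs : Static E s) (hj : j < E.h)
    (hZ : Z ∈ espLevel E.σ E.D E.S (j + 1)) (h28 : s.reg 28 = Z) (hc : s.arr 2 (s.reg 26) = c) :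
    squareTest.Holds s ↔ rule E.σ E.D Z = [c, c] := by
  have h1 := hs.mem_rule hj hZ
  have h2 := h1.2.1 0 (by omega)
  have h3 := h1.2.1 1 (by omega)
  simp only [wp_simps, squareTest, h28, hs.sigma, hc, h1.1]
  simp only [Nat.zero_add, Nat.reduceAdd] at h2 h3
  rw [h2, h3]
  rcases E.parse.length_rule hj hZ with h4 | h4
  · obtain ⟨b, c', h5⟩ := List.length_eq_two.1 h4
    rw [h5]
    simp
  · rw [h4]
    constructor
    · intro h
      omega
    · intro h
      rw [h] at h4
      simp at h4

/-- The abstract step only gives some new position; it is identified by the string that the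
remaining covering derives up to `q`. -/
theorem SkipSt.pop {x : ℕ × ℕ} {J J' cur : ℕ} (hk : SkipSt E s₀ t s lev a y q (x :: ds) J cur wl wr)
    (hss : SStep E.σ E.D lev (fun j => ESPBisection.chain E.σ E.D a (j - lev)) 0 (x :: ds) J ds J')
    {t' r : ℕ} {s' : State} (hr : r = cur + (str E.σ E.D x.1).length)
    (hk' : KSt E s₀ t' s' (cur + 1) q ds r q wl wr)
    (hlt : cur < r) (h22 : s'.reg 22 = s.reg 22) (h25 : s'.reg 25 = s.reg 25) (h26 : s'.reg 26 = J')
    (h27 : s'.reg 27 = s.reg 27 + (str E.σ E.D x.1).length)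
    (hch : ∀ d, lev + d ≤ J' → s'.arr 2 (lev + d) = ESPBisection.chain E.σ E.D a d) :
    SkipSt E s₀ t' s' lev a y q ds J' r wl wr := by
  obtain ⟨cur', h1⟩ := E.parse.sinv_step hk.sinv hss
  have h2 := h1.dq.eq_add
  have h3 := hk'.dq.eq_add
  obtain rfl : cur' = r := by omega
  exact ⟨hk'.weaken (by omega) le_rfl, h1, h22.trans hk.level, h25.trans hk.symbol, h26,
    by have := hk.total; omega, hch⟩

theorem SkipSt.expand {x : ℕ × ℕ} {k J cur : ℕ} {ds' : List (ℕ × ℕ)}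
    (hk : SkipSt E s₀ t s lev a y q (x :: ds) J cur wl wr)
    (hss : SStep E.σ E.D lev (fun j => ESPBisection.chain E.σ E.D a (j - lev)) k (x :: ds) J ds' J)
    {t' : ℕ} {s' : State} {rs as : List ℕ} (hk' : KSt E s₀ t' s' (cur + 1) q ds' cur q wl wr)
    (hf : Frame rs as s s') (hr : ∀ i ∈ [22, 25, 26, 27], i ∉ rs := by decide)
    (ha : 2 ∉ as := by decide) : SkipSt E s₀ t' s' lev a y q ds' J cur wl wr := by
  obtain ⟨cur', h1⟩ := E.parse.sinv_step hk.sinv hss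
  have h2 := h1.dq.eq_add
  have h3 := hk'.dq.eq_add
  obtain rfl : cur' = cur := by omega
  refine ⟨hk', h1, ?_, ?_, ?_, ?_, fun d hd => ?_⟩
  · rw [hf.reg 22 (hr _ (by decide)), hk.level]
  · rw [hf.reg 25 (hr _ (by decide)), hk.symbol]
  · rw [hf.reg 26 (hr _ (by decide)), hk.top]
  · rw [hf.reg 27 (hr _ (by decide)), hk.total]
  · rw [hf.arr 2 (by decide) ha, hk.chain d hd]

/-- The loop simulates the given abstract run step by step: in each state the tests of the program
select the branch of that step, since the other constructors contradict them. -/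
theorem wp_skipLoop {n e J J' cur : ℕ} {ds' : List (ℕ × ℕ)}
    (hrun : SRun E.σ E.D lev (fun j => chain E.σ E.D a (j - lev)) n e ds J ds' J')
    (hhead : ∀ x ∈ ds'.head?, x.2 = lev ∧ x.1 ≠ a)
    (hk : SkipSt E s₀ t s lev a y q ds J cur wl wr) (h36 : s.reg 36 = 1)
    (hQ : ∀ t' s' x, t ≤ t' → t' ≤ t + 500 * n + 500 →
      SkipSt E s₀ t' s' lev a y q ds' J' x wl wr → Q t' s') :
    skipLoop.wp E.w Q t s := by
  have h1 := E.fits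
  have h2 := E.le_T
  have hh := E.height_le
  induction hrun generalizing t s cur with
  | @refl ds J =>
    have hlo := hk.kst.hi_le
    have hq := hk.kst.q_le
    have hlen := hk.kst.rep.length
    have h5 := hk.kst.stat.base
    by_cases hd : ds = []
    · refine Prog.wp_loop_exit ?_ ?_ ?_
      · simp
      · simp [hk.kst.lt_iff, hd]
      · simp only [wp_simps]
        refine hQ _ _ cur (by omega) (by omega) ?_
        exact ⟨hk.kst.later (by omega), hk.sinv,
          hk.level, hk.symbol, hk.top, hk.total, hk.chain⟩
    · obtain ⟨x, ds₁, rfl⟩ := List.exists_cons_of_ne_nil hd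
      have h7 := hk.kst.rep.get 0 (by simp)
      simp only [List.getElem_cons_zero, Nat.add_zero] at h7
      obtain ⟨h8, h9⟩ := hhead x (by simp)
      have h10 := hk.sinv.le_J
      have h11 := hk.chain 0 (by omega)
      have h12 := hk.sinv.J_le
      simp only [Nat.add_zero, chain] at h11
      refine Prog.wp_loop_unfold (by simp) (by simp [hk.kst.lt_iff, h36]) ?_
      simp only [wp_simps, reduceIte, Nat.reduceEqDiff, State.arr_setReg, ne_eq,
        not_false_eq_true, h5, h7, h8, hk.top, hk.level, h11, h9, show ¬ J < lev by omega,
        false_implies, forall_const, not_true_eq_false]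
      refine ⟨by omega, by omega, by omega, by omega, ?_⟩
      refine Prog.wp_loop_exit (by simp) (by simp) ?_
      simp only [wp_simps]
      refine hQ _ _ cur (by omega) (by omega) ⟨hk.kst.of_frame (by omega) (rs := [28, 39, 36]) ?_
        (by decide), hk.sinv, ?_, ?_, ?_, ?_, ?_⟩
      · repeat first | exact Frame.rfl | refine Frame.setReg ?_
      · simp [hk.level]
      · simp [hk.symbol]
      · simp [hk.top]
      · simpa using hk.total
      · simpa [State.arr_setReg] using hk.chain
  | @head i n e J J₁ J₂ ds ds₁ ds₂ hss _ ih =>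
    obtain ⟨x, ds₃, rfl⟩ : ∃ x ds₃, ds = x :: ds₃ := by
      cases hss <;> exact ⟨_, _, rfl⟩
    have hlo := hk.kst.hi_le
    have hq := hk.kst.q_le
    have hlen := hk.kst.rep.length
    have h5 := hk.kst.stat.base
    have h6 := hk.kst.stat.sigma
    have h7 := hk.kst.rep.get 0 (by simp)
    simp only [List.getElem_cons_zero, Nat.add_zero] at h7
    have h8 := Parse.dq_mem hk.kst.dq (x := x) (by simp)
    have h9 := E.symbol_lt h8.1 h8.2
    have h10 := hk.sinv.le_J
    have h12 := hk.sinv.J_le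
    have h13 := E.le_X
    have h14 : s.arr 2 J = chain E.σ E.D a (J - lev) := by
      have := hk.chain (J - lev) (by omega)
      rwa [Nat.add_sub_cancel' h10] at this
    have hf28 : Frame [20, 28, 29, 30, 39, 40, 41, 42] [0, 1] s
        ((s.setReg 28 x.1).setReg 39 x.2) := Frame.rfl.setReg.setReg
    have hk28 := fun t' (ht' : t ≤ t') => hk.kst.of_frame ht' (rs := [28, 39])
      (Frame.rfl.setReg (i := 28) (v := x.1) |>.setReg (i := 39) (v := x.2)) (by decide)
    have hc := cost_squareTest_le
    have ih' : ∀ t' s' c, t ≤ t' → t' ≤ t + 500 → SkipSt E s₀ t' s' lev a y q ds₁ J₁ c wl wr →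
        s'.reg 36 = 1 → skipLoop.wp E.w Q t' s' := fun t' s' c a1 a2 a3 a4 =>
      ih hhead a3 a4 fun t'' s'' x b1 b2 b3 => hQ t'' s'' x (by omega) (by omega) b3
    refine Prog.wp_loop_unfold (by simp) (by simp [hk.kst.lt_iff, h36]) ?_
    simp only [wp_simps, reduceIte, Nat.reduceEqDiff, State.arr_setReg, ne_eq, not_false_eq_true,
      h5, h7, hk.top, hk.level]
    refine ⟨by omega, by omega, fun hJ => ⟨⟨by omega, ?_, by omega⟩, fun hm => ?_, fun hm => ?_⟩,
      fun hJ => ⟨by omega, fun hm => ?_, fun hm => ⟨fun hl => ?_, fun hl => ?_⟩⟩⟩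
    · simp only [wp_simps, squareTest, reduceIte, Nat.reduceEqDiff, h5, h6, hk.top]
      omega
    · obtain ⟨hm1, hm2⟩ := hm
      obtain ⟨Z, j⟩ := x
      simp only at hm1 hJ h8 h7
      subst hm1
      rw [holds_squareTest (j := J) (c := chain E.σ E.D a (J - lev)) (hk28 t le_rfl).stat
        (by omega) h8.2 (by simp) (by simpa [State.arr_setReg, hk.top] using h14)] at hm2
      cases hss with
      | pop e1 e2 => omega
      | exp e1 e2 e3 => exact absurd hm2 (e3 rfl)
      | adv e1 e2 =>
        refine wp_popL (hk28 _ (by omega)) ?_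
        intro t₁ s₁ r g1 g2 g3 g4 g5 g6 g7 g8 g9 g10
        have g11 := g9.stat.base
        have g12 : s₁.reg 26 = J := by rw [g10.reg 26]; simp [hk.top]
        have g13 : s₁.reg 27 = s.reg 27 := by rw [g10.reg 27]; simp
        have g14 : ∀ k, s₁.arr 2 k = s.arr 2 k := fun k => by
          rw [g10.arr 2]; simp [State.arr_setReg]
        have g15 := hk.total
        have g16 := E.parse.dq_le hk.kst.dq
        have g17 := E.length_str_le g7 g6
        dsimp only at g3 g4 g5 g6 g7 g17
        simp only [wp_simps, reduceIte, Nat.reduceEqDiff, g11, g12, g13, g3, g4]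
        refine ⟨by omega, by omega, by omega, ?_⟩
        refine ih' _ _ r (by omega) (by omega) (hk.pop (SStep.adv e1 e2) g5
          (g9.of_frame (by omega) (rs := [26, 27]) ?_ (by decide)) (by omega) ?_ ?_ ?_ ?_ ?_) ?_
        · refine Frame.setReg ?_
          refine Frame.setArr ?_
          exact Frame.rfl.setReg
        · simp [g10.reg 22]
        · simp [g10.reg 25]
        · simp
        · simp
        · intro d hd
          rw [State.arr_setReg (by decide), State.arr_setArr (by decide) (by decide),
            State.arr_setReg (by decide)]
          split_ifs with h
          · rw [e2]
            congr 1
            omega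
          · rw [g14]
            exact hk.chain d (by omega)
        · simp [g10.reg 36, h36]
    · obtain ⟨Z, j⟩ := x
      simp only at hJ h8 h7 hm
      obtain ⟨j, rfl⟩ : ∃ i, j = i + 1 := ⟨j - 1, by omega⟩
      cases hss with
      | pop e1 e2 => omega
      | adv e1 e2 =>
        refine absurd ⟨rfl, ?_⟩ hm
        rw [holds_squareTest (j := J) (c := chain E.σ E.D a (J - lev)) (hk28 t le_rfl).stat
          (by omega) h8.2 (by simp) (by simpa [State.arr_setReg, hk.top] using h14)]
        exact e1
      | exp e1 e2 e3 =>
        refine wp_expandL (hk28 _ (by omega)) (by omega) fun t₁ s₁ g1 g2 g3 g4 => ?_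
        exact ih' _ _ cur (by omega) (by omega) (hk.expand (SStep.exp e1 e2 e3) (g3.later (by omega))
          (hf28.trans g4)) (by simp [g4.reg 36, h36])
    · obtain ⟨Z, j⟩ := x
      simp only at hJ h8 h7 hm
      have hj : lev ≤ j := hk.sinv.level (Z, j) (by simp)
      have hm' : Z = chain E.σ E.D a (j - lev) := by
        have := hk.chain (j - lev) (by omega)
        rw [Nat.add_sub_cancel' hj] at this
        rw [hm, this]
      cases hss with
      | adv e1 e2 => omega
      | exp e1 e2 e3 => exact absurd hm' (e2 (by omega))
      | pop e1 e2 =>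
        refine wp_popL (hk28 _ (by omega)) ?_
        intro t₁ s₁ r g1 g2 g3 g4 g5 g6 g7 g8 g9 g10
        have g13 : s₁.reg 27 = s.reg 27 := by rw [g10.reg 27]; simp
        have g15 := hk.total
        have g16 := E.parse.dq_le hk.kst.dq
        have g17 := E.length_str_le g7 g6
        dsimp only at g3 g4 g5 g6 g7 g17
        simp only [wp_simps, g13, g4]
        refine ⟨by omega, ?_⟩
        refine ih' _ _ r (by omega) (by omega) (hk.pop (SStep.pop e1 e2) g5
          (g9.of_frame (by omega) (rs := [27]) ?_ (by decide)) (by omega) ?_ ?_ ?_ ?_ ?_) ?_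
        · exact Frame.rfl.setReg
        · simp [g10.reg 22]
        · simp [g10.reg 25]
        · simp [g10.reg 26, hk.top]
        · simp
        · intro d hd
          rw [State.arr_setReg (by decide), g10.arr 2]
          simpa [State.arr_setReg] using hk.chain d hd
        · simp [g10.reg 36, h36]
    · obtain ⟨Z, j⟩ := x
      simp only at hJ h8 h7 hm hl
      cases hss with
      | adv e1 e2 => omega
      | exp e1 e2 e3 => omega
      | pop e1 e2 =>
        refine absurd ?_ hm
        have hj : lev ≤ j := by omega
        have := hk.chain (j - lev) (by omega)
        rw [Nat.add_sub_cancel' hj] at this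
        rw [this]
        exact e2
    · obtain ⟨Z, j⟩ := x
      simp only at hJ h8 h7 hm hl
      cases hss with
      | adv e1 e2 => omega
      | pop e1 e2 =>
        refine absurd ?_ hm
        have hj : lev ≤ j := hk.sinv.level (Z, j) (by simp)
        have := hk.chain (j - lev) (by omega)
        rw [Nat.add_sub_cancel' hj] at this
        rw [this]
        exact e2
      | exp e1 e2 e3 =>
        refine wp_expandL (hk28 _ (by omega)) (by omega) fun t₁ s₁ g1 g2 g3 g4 => ?_
        exact ih' _ _ cur (by omega) (by omega) (hk.expand (SStep.exp e1 e2 e3) (g3.later (by omega))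
          (hf28.trans g4)) (by simp [g4.reg 36, h36])

/-- `exists_skip` and `J' ≤ h` allow at most `3 * h` expansions, and by `srun_length` each of them
accounts for at most three in nodes and steps. This is the origin of `9 * E.h`. -/
theorem wp_skipRun (hk : KSt E s₀ t s y q ds y q wl wr) (hl : ∀ x ∈ ds, lev ≤ x.2)
    (hlev : s.reg 22 = lev) (ha : s.reg 25 = a) (hh : lev ≤ E.h) (hb : Bd E.σ E.D E.S lev y)
    (haT : a ≤ E.T) (ht : t + 10000 * E.S.length + 1000 < E.T)
    (hQ : ∀ t' s' ds' x, t ≤ t' →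
      t' + 500 * ds'.length ≤ t + 1000 + 500 * (ds.length + 9 * E.h) →
      ds'.length ≤ ds.length + 9 * E.h →
      KSt E s₀ t' s' (x + 1) q ds' x q (wl ++ [(a, x - y)]) wr →
      (∃ r, Seg E.σ E.D E.S lev (List.replicate r a) y x) →
      (∀ z ∈ ds'.head?, z.2 = lev ∧ z.1 ≠ a) →
      (∀ x ∈ ds', lev ≤ x.2) → s'.reg 22 = lev → Q t' s') :
    skipRun.wp E.w Q t s := by
  have h1 := E.fits
  have h2 := E.le_T
  have h3 := E.height_le
  have h4 := hk.length_le
  have h5 := hk.stat.base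
  have h6 := hk.q_le
  have hk0 := hk.weaken (Nat.le_succ y) le_rfl
  have hi : SInv E.σ E.D E.S E.h lev a y q ds lev y := ⟨hk0.dq, hl, ⟨0, hb⟩, le_rfl, hh⟩
  obtain ⟨n, e, ds', J', hrun, hhead, he⟩ := E.parse.exists_skip hh hb hk0.dq hl
  have hlen := E.parse.srun_length hi hrun
  simp only [wp_simps, skipRun, reduceIte, Nat.reduceEqDiff, hlev, h5, ha]
  refine ⟨by omega, by omega, by omega, ?_⟩
  refine wp_skipLoop hrun hhead (cur := y) (y := y) (q := q) (s₀ := s₀) (wl := wl) (wr := wr)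
    ⟨hk0.of_frame (t' := _) (rs := [36, 26, 27]) ?_ ?_ (by decide), hi, ?_, ?_, ?_, ?_, ?_⟩ ?_ ?_
  · omega
  · refine Frame.setReg ?_
    refine Frame.setArr ?_
    refine Frame.setReg ?_
    exact Frame.rfl.setReg
  · simp [hlev]
  · simp [ha]
  · simp
  · simp
  · intro d hd
    obtain rfl : d = 0 := by omega
    rw [State.arr_setReg (by decide), State.arr_setArr (by decide) (by decide), if_pos (by simp)]
    rfl
  · simp
  · intro t₁ s₁ x g1 g2 g3
    have g4 := g3.sinv.J_le
    have g5 := g3.total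
    have g6 := E.parse.dq_le g3.kst.dq
    refine wp_emitL (by decide) (by decide) g3.kst (by omega) ?_ (by omega)
      ?_
    · rw [g3.symbol]
      exact haT
    intro t₂ s₂ k1 k2 k3 k4
    rw [wp_block_nil]
    rw [g3.symbol, show s₁.reg 27 = x - y by omega] at k3
    refine hQ _ _ ds' x (by omega) (by omega) (by omega)
      (k3.later (by omega)) g3.sinv.run hhead
      g3.sinv.level ?_
    rw [k4.reg 22, g3.level]

end

/-! ### The computation of a key -/

/-- One level of the key. -/
def levelProg : Prog :=
  block [stripR, stripL, skipRun, alignL, alignR, .assign 22 (.reg 22 + .const 1)]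

/-- Cut off the nodes in front of the position in register `8`. -/
def trimL : Prog :=
  .loop (.bin .lt (.reg 32) (.reg 8))
    (block [.assign 28 (.arr 0 (.reg 20)), lenProg,
      .ite (.bin .lt (.reg 8) (.reg 32 + .reg 34)) expandL
        (block [popL, .assign 32 (.reg 32 + .reg 34)])])

/-- Cut off the nodes behind the interval given by registers `8` and `9`. -/
def trimR : Prog :=
  .loop (.bin .lt (.reg 8 + .reg 9) (.reg 33))
    (block [.assign 28 (.arr 0 (.reg 21 - .const 1)), lenProg,
      .ite (.bin .lt (.reg 33) (.reg 8 + .reg 9 + .reg 34)) expandR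
        (block [popR, .assign 33 (.reg 33 - .reg 34)])])

/-- Compute the key of the interval which starts at the position in register `8` and has the length
in register `9`. Its two components are returned in the registers `23` and `24`, and its first
letter in register `38` if the length is one. -/
def keyProg : Prog :=
  block [
    .assign 20 (.reg 5 + .const 3),
    .assign 21 (.reg 5 + .const 4),
    .assign 23 (.const 0),
    .assign 24 (.const 0),
    .assign 32 (.const 0),
    .assign 33 (.reg 5),
    .setArr 0 (.reg 20) (.reg 2),
    .setArr 1 (.reg 20) (.reg 4),
    trimL,
    trimR,
    .assign 38 (.arr 0 (.reg 20)),
    .assign 22 (.const 0),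
    .loop (.bin .lt (.reg 20) (.reg 21)) levelProg]

/-- A bound for the time of one level. -/
def Env.levelCost (E : Env) : ℕ := 1600 * E.M + 22000 * E.h + 5000

/-- A bound for the time of a key. -/
def Env.keyCost (E : Env) : ℕ := (E.h + 2) * (E.levelCost + 100) + 5000 * E.h + 5000

section
variable {E : Env} {s₀ s : State} {t A B p q lev a y : ℕ} {ds wl wr : List (ℕ × ℕ)}
  {Q : ℕ → State → Prop}

theorem Dq.right_unique {σ : ℕ} {S : List ℕ} {D : List (List ℕ)} {h A B A' B' p q q' : ℕ}
    {ds : List (ℕ × ℕ)} (h1 : Dq σ D S h A B ds p q) (h2 : Dq σ D S h A' B' ds p q') : q = q' := by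
  rw [h1.eq_add, h2.eq_add]

theorem Dq.left_unique {σ : ℕ} {S : List ℕ} {D : List (List ℕ)} {h A B A' B' p p' q : ℕ}
    {ds : List (ℕ × ℕ)} (h1 : Dq σ D S h A B ds p q) (h2 : Dq σ D S h A' B' ds p' q) : p = p' := by
  have := h1.eq_add
  have := h2.eq_add
  omega

/-- Both strips leave a covering by maximal nodes, to which `dq_size` applies anew. Thus all
amortised bounds become `O(M + h)`, whatever the length of the interval. -/
theorem wp_levelProg (hk : KSt E s₀ t s p q ds p q wl wr) (hpq : p < q) (hl : ∀ x ∈ ds, lev ≤ x.2)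
    (hlev : s.reg 22 = lev) (hh : lev ≤ E.h) (hbp : Bd E.σ E.D E.S lev p)
    (hbq : Bd E.σ E.D E.S lev q) (ht : t + 40000 * (E.S.length + E.M) + 40000 < E.T)
    (hQ : ∀ t' s' ds' p' q' el er y x e r a LS AL V AR RS, t ≤ t' → t' ≤ t + E.levelCost →
      KStep E.σ E.D E.S E.h E.M lev p q p' q' el er y x e r a LS AL V AR RS →
      KSt E s₀ t' s' p' q' ds' p' q' (wl ++ el) (wr ++ er) → s'.reg 22 = lev + 1 →
      (p' < q' → ∀ z ∈ ds', lev + 1 ≤ z.2) → Q t' s') :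
    levelProg.wp E.w Q t s := by
  have hh' := E.height_le
  have hT := E.le_T
  have hw := E.fits
  unfold Env.levelCost at hQ
  rw [levelProg, wp_block_cons]
  refine wp_stripR hk hl hlev hh hbq (by omega) ?_
  intro t₁ s₁ ds₁ e RS a1 a2 hk1 segRS lenRS lenRS' hl1 hlev1
  have hd1 := E.parse.dq_size hk1.dq
  rw [wp_block_cons]
  refine wp_stripL hk1 hl1 hlev1 hh hbp (by omega) ?_
  intro t₂ s₂ ds₂ y LS b1 b2 hk2 segLS lenLS lenLS' hl2 hlev2 hlast
  have hd2 := E.parse.dq_size hk2.dq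
  have haT : LS.getLastD 0 ≤ E.T := by
    rcases List.eq_nil_or_concat LS with rfl | ⟨l, z, rfl⟩
    · simp
    · have h1 := E.symbol_lt hh (segLS.mem (x := z) (by simp))
      have h2 := E.parse.card_lt
      simp
      omega
  rw [wp_block_cons]
  refine wp_skipRun hk2 hl2 hlev2 hlast hh segLS.bd_right haT (by omega) ?_
  intro t₃ s₃ ds₃ x c1 c2 c3 hk3 hrun hhead hl3 hlev3
  obtain ⟨r, segRun⟩ := hrun
  rw [wp_block_cons]
  refine wp_alignL hk3 hlev3 (by omega) ?_
  intro t₄ s₄ ds₄ p' AL d1 d2 hk4 hds4 hhead4 hlev4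
  have hlen4 := congrArg List.length hds4
  rw [wp_block_cons]
  refine wp_alignR hk4 hlev4 (by omega) ?_
  intro t₅ s₅ ds₅ q' AR e1 e2 hk5 hds5 hlast5 hlev5
  have hlen5 := congrArg List.length hds5
  simp only [List.length_append] at hlen4 hlen5
  -- the parts of the covering
  have hdq3 := hk3.dq
  rw [hds4, dq_append] at hdq3
  obtain ⟨p'', hAL, hdq4⟩ := hdq3
  obtain rfl : p'' = p' := hdq4.left_unique hk4.dq
  rw [hds5, dq_append] at hdq4
  obtain ⟨q'', hdq5, hAR⟩ := hdq4
  obtain rfl : q'' = q' := hdq5.right_unique hk5.dq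
  have segAL := dq_map E.parse hh segRun.bd_right hAL
  have hl5 : ∀ z ∈ ds₅, lev ≤ z.2 := fun z hz => hl3 z (by rw [hds4, hds5]; simp [hz])
  have hAL0 : AL = [] → ds₄ = [] := by
    rintro rfl
    simp only [List.map_nil, List.nil_append] at hds4
    cases ds₄ with
    | nil => rfl
    | cons z ds₄ =>
      exact absurd (hhead z (by rw [hds4]; simp)).1 (hhead4 z (by simp))
  have hds50 : ds₅ = [] → AR = [] := by
    rintro rfl
    simp only [List.nil_append] at hds5
    cases AR with
    | nil => rfl
    | cons z AR => exact absurd rfl (hhead4 (z, lev) (by rw [hds5]; simp))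
  have hhead5 : ∀ z ∈ ds₅.head?, z.2 ≠ lev := fun z hz => by
    refine hhead4 z ?_
    rw [hds5]
    cases ds₅ with
    | nil => simp at hz
    | cons z' ds₅ => simpa using hz
  obtain ⟨hcut, hnext⟩ := E.parse.align_cut hh hAL hdq5 hAR
    (fun h => (List.append_eq_nil_iff.1 (hds5 ▸ hAL0 h)).1) hds50 hhead5 hlast5 hl5
  have hbd : Bd E.σ E.D E.S lev q'' := by
    rcases hcut with h | h
    · rw [h.2.1]
      exact segRS.bd_left
    · exact E.parse.bd_of_le (Nat.le_succ _) h.1 h.2.2.2.2.1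
  have segAR := dq_map E.parse hh hbd hAR
  obtain ⟨V, segV⟩ := E.parse.exists_seg hh segAL.bd_right hbd (E.parse.dq_le hdq5)
  simp only [wp_simps, hlev5]
  refine ⟨by omega, ?_⟩
  refine hQ _ _ ds₅ p'' q'' (LS.map (item E.σ E.D) ++ (LS.getLastD 0, x - y) ::
    AL.map (item E.σ E.D)) (RS.reverse.map (item E.σ E.D) ++ AR.reverse.map (item E.σ E.D))
    y x e r (LS.getLastD 0) LS AL V AR RS (by omega) (by omega)
    ⟨segLS, segRun, segAL, segV, segAR, segRS, lenRS, lenRS', lenLS, lenLS', rfl, ?_, hcut, rfl,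
      rfl⟩ ?_ ?_ fun h => (hnext h).2
  -- Skipping stops in front of a node of level `lev` different from `a`, or when nothing is left.
  -- So the skipped run is maximal, as the uniqueness of keys requires.
  · intro Z z hZ hze hZa
    have hxz := E.parse.node_lt hh hZ
    cases hds3 : ds₃ with
    | nil =>
      have := hk3.dq
      rw [hds3] at this
      have : x = e := this
      omega
    | cons u ds =>
      have h1 := hhead u (by rw [hds3]; simp)
      have h2 := hk3.dq
      rw [hds3] at h2
      obtain ⟨r', h3, h4, -, -⟩ := h2
      rw [h1.1] at h4
      have h5 := E.parse.node_lt hh h4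
      have := (E.parse.node_eq hh hZ h4 (c := x) le_rfl hxz le_rfl h5).2.2
      exact h1.2 (by rw [← this, hZa])
  · have hk6 : KSt E s₀ (t₅ + (1 + 1 + 1 + 1) + 1) (s₅.setReg 22 (lev + 1)) (x + 1) e ds₅ p'' q''
        (wl ++ (LS.map (item E.σ E.D) ++ (LS.getLastD 0, x - y) :: AL.map (item E.σ E.D)))
        (wr ++ (RS.reverse.map (item E.σ E.D) ++ AR.reverse.map (item E.σ E.D))) := by
      have := hk5.of_frame (t' := t₅ + (1 + 1 + 1 + 1) + 1) (by omega) (rs := [22])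
        ((Frame.rfl (as := [2])).setReg (i := 22) (v := lev + 1)) (by decide)
      simpa using this
    refine ⟨hk6.frame, hk6.stat, hk6.cnt_le, hk6.dict, hk6.mono, hk6.left, hk6.right, hk6.rep, ?_,
      hk6.q_le, hk6.lo_le, hk6.le_hi⟩
    rcases hcut with h | h
    · have : ds₅ = [] := by
        have := E.parse.dq_length_le hdq5
        exact List.length_eq_zero_iff.1 (by omega)
      rw [this]
      exact h.1.trans h.2.1.symm
    · exact (hnext h.2.2.1).1
  · simp

/-- A nonempty remaining part after `lev` steps forces `lev ≤ h`, so the loop makes at most `h + 1`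
turns. -/
theorem wp_keyLoop (hk : KSt E s₀ t s p q ds p q [] []) (hpq : p < q) (hlev : s.reg 22 = 0)
    (ht : t + (E.h + 2) * (E.levelCost + 100) + 40000 * (E.S.length + E.M) + 40000 < E.T)
    (hQ : ∀ t' s' p' wl wr, t ≤ t' → t' ≤ t + (E.h + 2) * (E.levelCost + 100) →
      KSt E s₀ t' s' p' p' [] p' p' wl wr → KeyOf E.σ E.D E.S E.h E.M p q wl wr → Q t' s') :
    (Prog.loop (.bin .lt (.reg 20) (.reg 21)) levelProg).wp E.w Q t s := by
  have hq := hk.q_le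
  refine Prog.wp_loop (fun t' s' => ∃ lev ds' p' q' wl wr, t ≤ t' ∧
      t' ≤ t + lev * (E.levelCost + 100) ∧
      KSt E s₀ t' s' p' q' ds' p' q' wl wr ∧ KReach E.σ E.D E.S E.h E.M p q lev p' q' wl wr ∧
      s'.reg 22 = lev ∧ lev ≤ E.h + 1 ∧ (p' < q' → ∀ x ∈ ds', lev ≤ x.2))
    (t + (E.h + 1) * (E.levelCost + 100)) ?_ ?_ ?_
  · rintro t' s' ⟨lev, ds', p', q', wl, wr, -, e1, -, -, -, e2, -⟩
    have := Nat.mul_le_mul_right (E.levelCost + 100) e2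
    omega
  · rintro t' s' ⟨lev, ds', p', q', wl, wr, e0, e1, e2, e3, e4, e5, e6⟩
    have e7 := Nat.mul_le_mul_right (E.levelCost + 100) e5
    have e8 : (E.h + 2) * (E.levelCost + 100) = (E.h + 1) * (E.levelCost + 100) +
      (E.levelCost + 100) := by ring
    simp only [wp_simps, e2.lt_iff]
    refine ⟨fun h => ?_, fun h => ?_⟩
    · have hpq' : p' < q' := by
        have := E.parse.dq_length_le e2.dq
        have := List.length_pos_iff.2 h
        omega
      obtain ⟨f1, f2, f3⟩ := E.parse.kreach_bd hq e3 hpq'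
      refine wp_levelProg (e2.later (by omega)) hpq'
        (e6 hpq') e4 f1 f2 f3 (by omega) ?_
      intro t₁ s₁ ds₁ p₁ q₁ el er y x e r a LS AL V AR RS g1 g2 g3 g4 g5 g6
      refine ⟨lev + 1, ds₁, p₁, q₁, _, _, by omega, ?_, g4, KReach.succ e3 hpq' g3, g5, by omega, g6⟩
      have : (lev + 1) * (E.levelCost + 100) = lev * (E.levelCost + 100) +
        (E.levelCost + 100) := by ring
      omega
    · have hds : ds' = [] := not_not.1 h
      subst hds
      obtain rfl : p' = q' := e2.dq
      exact hQ _ _ p' wl wr (by omega) (by omega)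
        (e2.later (by omega)) ⟨lev, p', e3⟩
  · exact ⟨0, ds, p, q, [], [], le_rfl, by omega, hk, KReach.zero, hlev, by omega,
      fun _ _ _ => Nat.zero_le _⟩

/-- The potential is the number of nodes plus three times the level of the node over `p`: an
expansion adds at most two nodes and lowers this level by one, and a removal drops a node without
changing the level. -/
theorem wp_trimL {u : ℕ} (hk : KSt E s₀ t s p E.S.length ds u E.S.length [] [])
    (h8 : s₀.reg 8 = p) (h32 : s.reg 32 = u) (hup : u ≤ p) (hp : p < E.S.length)
    (ht : t + 400 * (ds.length + 3 * E.h) + 1000 < E.T)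
    (hQ : ∀ t' s' ds', t ≤ t' → t' ≤ t + 50 + 400 * (ds.length + 3 * E.h) →
      KSt E s₀ t' s' p E.S.length ds' p E.S.length [] [] → s'.reg 33 = s.reg 33 → Q t' s') :
    trimL.wp E.w Q t s := by
  have h1 := E.fits
  have h2 := E.le_T
  refine Prog.wp_loop (fun t' s' => ∃ ds' u', t ≤ t' ∧
      t' + 400 * (ds'.length + 3 * nodeLevel E.σ E.D ds' (p - u')) ≤
        t + 400 * (ds.length + 3 * E.h) ∧
      KSt E s₀ t' s' p E.S.length ds' u' E.S.length [] [] ∧ s'.reg 32 = u' ∧ u' ≤ p ∧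
      s'.reg 33 = s.reg 33)
    (t + 400 * (ds.length + 3 * E.h)) ?_ ?_ ?_
  · rintro t' s' ⟨ds', u', -, e1, -⟩
    omega
  · rintro t' s' ⟨ds', u', e0, e1, e2, e3, e4, e5⟩
    have h5 := e2.stat.base
    have h6 := e2.lo_le
    have h7 : s'.reg 8 = p := by rw [e2.frame.reg 8, h8]
    simp only [wp_simps, h5, e3, h7]
    refine ⟨fun f1 => ⟨by omega, ?_⟩, fun f1 => ?_⟩
    · have f2 : ds' ≠ [] := by
        rintro rfl
        have : u' = E.S.length := e2.dq
        omega
      obtain ⟨x, ds₁, rfl⟩ := List.exists_cons_of_ne_nil f2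
      have h9 := (e2.rep.get 0 (by simp)).1
      simp only [List.getElem_cons_zero, Nat.add_zero] at h9
      have h10 := Parse.dq_mem e2.dq (x := x) (by simp)
      rw [h9]
      have hf : ∀ v, Frame [28, 34] [2] s' ((s'.setReg 28 x.1).setReg 34 v) := fun v =>
        Frame.rfl.setReg.setReg
      refine wp_lenProg (e2.stat.of_frame (rs := [28]) (as := [])
        (Frame.rfl.setReg) (by decide)) h10.1
        (by simpa using h10.2) ?_
      intro t₁ g1 g2
      have g3 : (str E.σ E.D x.1).length ≤ E.S.length ∧ 1 ≤ (str E.σ E.D x.1).length := by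
        obtain ⟨r, k1, k2, -, k4⟩ := e2.dq
        have := k2.eq_add
        have := E.parse.dq_le k4
        have := E.parse.node_lt k1 k2
        simp at *
        omega
      simp only [wp_simps, reduceIte, Nat.reduceEqDiff, e3, h7]
      have hk' := e2.of_frame (t' := t₁ + (1 + (1 + 1 + 1) + 1 + 1)) (by omega)
        (hf (str E.σ E.D x.1).length) (by decide)
      refine ⟨by omega, fun k1 => ?_, fun k1 => ?_⟩
      · obtain ⟨X, j⟩ := x
        have hj : j ≠ 0 := by
          rintro rfl
          have := Parse.str_letter (D := E.D) (E.parse.lt X h10.2)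
          simp only [this, List.length_singleton] at k1
          omega
        obtain ⟨j, rfl⟩ := Nat.exists_eq_succ_of_ne_zero hj
        refine wp_expandL hk' f1 ?_
        intro t₂ s₂ m1 m2 m3 m4
        have m5 := E.parse.dq_length_rule e2.dq
        have m6 := E.parse.str_succ (by have := h10.1; simp at this; omega) h10.2
        dsimp only at m6 k1 g3
        refine ⟨_, u', by omega, ?_, m3.later (by omega),
          ?_, e4, ?_⟩
        · rw [nodeLevel, if_pos (by simp only; omega)] at e1
          rw [nodeLevel_map (by rw [← m6]; omega)]
          simp only [List.length_append, List.length_map, List.length_cons] at e1 ⊢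
          omega
        · rw [m4.reg 32]
          simp [e3]
        · rw [m4.reg 33]
          simp [e5]
      · refine wp_popL hk' ?_
        intro t₂ s₂ r m1 m2 m3 m4 m5 m6 m7 m8 m9 m10
        have m11 : s₂.reg 32 = u' := by
          rw [m10.reg 32]
          simp [e3]
        simp only [wp_simps, m4, m11]
        refine ⟨by omega, ds₁, r, by omega, ?_, m9.of_frame (by omega) (rs := [32]) ?_ (by decide),
          ?_, by omega, ?_⟩
        · rw [nodeLevel, if_neg (by omega)] at e1
          rw [show p - r = p - u' - (str E.σ E.D x.1).length by omega]
          simp only [List.length_cons] at e1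
          omega
        · exact Frame.rfl.setReg
        · simp [m5]
        · simp only [reduceIte, Nat.reduceEqDiff]
          rw [m10.reg 33]
          simp [e5]
    · obtain rfl : u' = p := by omega
      exact hQ _ _ ds' (by omega) (by omega)
        (e2.later (by omega)) e5
  · refine ⟨ds, u, le_rfl, ?_, hk, h32, hup, rfl⟩
    have := nodeLevel_le (σ := E.σ) (D := E.D) (h := E.h) (ds := ds) (d := p - u)
      fun x hx => (Parse.dq_mem hk.dq hx).1
    omega

theorem wp_trimR {u : ℕ} (hk : KSt E s₀ t s p q ds p u [] [])
    (h8 : s₀.reg 8 = p) (h9' : s₀.reg 9 + p = q) (h33 : s.reg 33 = u) (hqu : q ≤ u) (hp : p < q)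
    (ht : t + 400 * (ds.length + 3 * E.h) + 1000 < E.T)
    (hQ : ∀ t' s' ds', t ≤ t' → t' ≤ t + 50 + 400 * (ds.length + 3 * E.h) →
      KSt E s₀ t' s' p q ds' p q [] [] → Q t' s') :
    trimR.wp E.w Q t s := by
  have h1 := E.fits
  have h2 := E.le_T
  have hu := hk.q_le
  refine Prog.wp_loop (fun t' s' => ∃ ds' u', t ≤ t' ∧
      t' + 400 * (ds'.length + 3 * nodeLevel E.σ E.D ds'.reverse (u' - q)) ≤
        t + 400 * (ds.length + 3 * E.h) ∧
      KSt E s₀ t' s' p q ds' p u' [] [] ∧ s'.reg 33 = u' ∧ q ≤ u' ∧ u' ≤ u)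
    (t + 400 * (ds.length + 3 * E.h)) ?_ ?_ ?_
  · rintro t' s' ⟨ds', u', -, e1, -⟩
    omega
  · rintro t' s' ⟨ds', u', e0, e1, e2, e3, e4, e5⟩
    have h5 := e2.stat.base
    have h6 := e2.lo_le
    have h7 : s'.reg 8 = p := by rw [e2.frame.reg 8, h8]
    have h7' : p + s'.reg 9 = q := by rw [e2.frame.reg 9]; omega
    have hlen := e2.rep.length
    simp only [wp_simps, h5, e3, h7, h7']
    refine ⟨by omega, fun f1 => ⟨by omega, ?_⟩, fun f1 => ?_⟩
    · have f2 : ds' ≠ [] := by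
        rintro rfl
        have : p = u' := e2.dq
        omega
      obtain ⟨ds₁, x, rfl⟩ : ∃ ds₁ x, ds' = ds₁ ++ [x] :=
        ⟨_, _, (List.dropLast_append_getLast f2).symm⟩
      have h9 := (e2.rep.get ds₁.length (by simp)).1
      simp only [List.getElem_concat_length] at h9
      simp only [List.length_append, List.length_cons, List.length_nil] at hlen
      rw [show s'.reg 20 + ds₁.length = s'.reg 21 - 1 by omega] at h9
      have h10 := Parse.dq_mem e2.dq (x := x) (by simp)
      rw [h9]
      have hf : ∀ v, Frame [28, 34] [2] s' ((s'.setReg 28 x.1).setReg 34 v) := fun v =>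
        Frame.rfl.setReg.setReg
      refine wp_lenProg (e2.stat.of_frame (rs := [28]) (as := [])
        (Frame.rfl.setReg) (by decide)) h10.1
        (by simpa using h10.2) ?_
      intro t₁ g1 g2
      have g3 : (str E.σ E.D x.1).length ≤ E.S.length ∧ 1 ≤ (str E.σ E.D x.1).length := by
        have hdq := e2.dq
        rw [dq_append] at hdq
        obtain ⟨r', k0, r, k1, k2, -, k4⟩ := hdq
        have := k2.eq_add
        have := E.parse.seg_right_le k1 k2
        have := E.parse.node_lt k1 k2
        simp at *
        omega
      simp only [wp_simps, reduceIte, Nat.reduceEqDiff, e3, h7, h7']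
      have hk' := e2.of_frame (t' := t₁ + (1 + (1 + 1 + 1 + 1 + 1) + 1 + 1)) (by omega)
        (hf (str E.σ E.D x.1).length) (by decide)
      refine ⟨by omega, fun k1 => ?_, fun k1 => ?_⟩
      · obtain ⟨X, j⟩ := x
        have hj : j ≠ 0 := by
          rintro rfl
          have := Parse.str_letter (D := E.D) (E.parse.lt X h10.2)
          simp only [this, List.length_singleton] at k1
          omega
        obtain ⟨j, rfl⟩ := Nat.exists_eq_succ_of_ne_zero hj
        refine wp_expandR hk' f1 ?_
        intro t₂ s₂ m1 m2 m3 m4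
        have m5 : (rule E.σ E.D X).length = 2 ∨ (rule E.σ E.D X).length = 3 :=
          E.parse.length_rule (by have := h10.1; simp at this; omega) h10.2
        have m6 := E.parse.str_succ (by have := h10.1; simp at this; omega) h10.2
        dsimp only at m6 k1 g3
        refine ⟨_, u', by omega, ?_, m3.later (by omega),
          ?_, e4, e5⟩
        · rw [List.reverse_append, List.reverse_singleton, List.singleton_append, nodeLevel,
            if_pos (by simp only; omega)] at e1
          rw [List.reverse_append, ← List.map_reverse, nodeLevel_map]
          · simp only [List.length_append, List.length_map, List.length_cons, List.length_nil]
              at e1 ⊢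
            omega
          · have : ((rule E.σ E.D X).reverse.flatMap (str E.σ E.D)).length =
                (str E.σ E.D X).length := by
              rw [m6, List.length_flatMap, List.length_flatMap, List.map_reverse, List.sum_reverse]
            omega
        · rw [m4.reg 33]
          simp [e3]
      · refine wp_popR hk' ?_
        intro t₂ s₂ r m1 m2 m3 m4 m5 m6 m7 m8 m9 m10
        have m11 : s₂.reg 33 = u' := by
          rw [m10.reg 33]
          simp [e3]
        simp only [wp_simps, m4, m11]
        refine ⟨ds₁, r, by omega, ?_, m9.of_frame (by omega) (rs := [33]) ?_ (by decide),
          ?_, by omega, by omega⟩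
        · rw [List.reverse_append, List.reverse_singleton, List.singleton_append, nodeLevel,
            if_neg (by omega)] at e1
          rw [show r - q = u' - q - (str E.σ E.D x.1).length by omega]
          simp only [List.length_append, List.length_cons, List.length_nil] at e1
          omega
        · exact Frame.rfl.setReg
        · simp
          omega
    · obtain rfl : u' = q := by omega
      exact hQ _ _ ds' (by omega) (by omega)
        (e2.later (by omega))
  · refine ⟨ds, u, le_rfl, ?_, hk, h33, hqu, le_rfl⟩
    have := nodeLevel_le (σ := E.σ) (D := E.D) (h := E.h) (ds := ds.reverse) (d := u - q)
      fun x hx => (Parse.dq_mem hk.dq (List.mem_reverse.1 hx)).1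
    omega

end

section
variable {E : Env} {s : State} {t p q : ℕ} {ds wl wr : List (ℕ × ℕ)} {Q : ℕ → State → Prop}

/-- The first symbol of a covering of a single letter. -/
theorem Dq.head_eq_letter {E : Env} {A B p : ℕ} {x : ℕ × ℕ}
    (hd : Dq E.σ E.D E.S E.h A B (x :: ds) p (p + 1)) : x.1 = E.S.getD p 0 := by
  obtain ⟨r, h1, h2, -, h4⟩ := hd
  have h5 := E.parse.node_lt h1 h2
  have h6 := E.parse.dq_le h4
  obtain rfl : r = p + 1 := by omega
  obtain ⟨X, j⟩ := x
  dsimp only at *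
  rcases j with _ | j
  · have h7 := E.parse.seg_right_le h1 h2
    have h8 := E.parse.seg_zero (p := p) (q := p + 1) (by omega) h7
    have h9 := E.parse.seg_unique h1 h2 h8
    rw [Nat.add_sub_cancel_left, List.take_one_drop_eq_of_lt_length (by omega)] at h9
    rw [List.getD_eq_getElem _ _ (by omega)]
    exact (List.cons.inj h9).1
  · have h7 := E.parse.seg_length_le (by omega) (E.parse.seg_down_singleton (by omega) h2)
    have h8 := E.parse.length_rule (by omega) (h2.mem (List.mem_singleton_self X))
    omega

/-- The covering starts with the root alone, which is maximal because it has no parent, in the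
middle of an area with room on both sides. Register `38` saves the first symbol before the loop
consumes the covering; for an interval of length one it is the letter. -/
theorem wp_keyProg (hs : Static E s) (hd : DictOk s) (hc : s.reg 12 ≤ t) (h8 : s.reg 8 = p)
    (h9 : s.reg 9 + p = q) (hpq : p < q) (hq : q ≤ E.S.length)
    (ht : t + E.keyCost + 40000 * (E.S.length + E.M) + 50000 < E.T)
    (hQ : ∀ t' s' wl wr, t ≤ t' → t' ≤ t + E.keyCost → Frame (38 :: keyRegs) keyArrs s s' → DictOk s' →
      s'.reg 12 ≤ t' → (∀ k, s.arr 3 k ≠ 0 → s'.arr 3 k = s.arr 3 k) →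
      Walk s' (s'.reg 23) (flat wl) → Walk s' (s'.reg 24) (flat wr) →
      KeyOf E.σ E.D E.S E.h E.M p q wl wr → (q = p + 1 → s'.reg 38 = E.S.getD p 0) → Q t' s') :
    keyProg.wp E.w Q t s := by
  have h1 := E.fits
  have h2 := E.le_T
  have h5 := hs.base
  have h6 := hs.length
  have hlc : E.levelCost + 100 ≤ (E.h + 2) * (E.levelCost + 100) :=
    Nat.le_mul_of_pos_left _ (by omega)
  unfold Env.keyCost at ht hQ
  simp only [wp_simps, keyProg, reduceIte, Nat.reduceEqDiff, h5, h6, hs.root, hs.height]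
  refine ⟨by omega, by omega, by omega, by omega, by omega, by omega, by omega, ?_⟩
  refine wp_trimL (E := E) (s₀ := s) (p := p) (ds := [(E.root, E.h)]) (u := 0)
    ⟨?_, ?_, ?_, ⟨?_, ?_⟩, ?_, ?_, ?_, ⟨?_, ?_⟩, ?_, le_rfl, ?_, ?_⟩ h8 ?_ (Nat.zero_le _)
    (by omega) ?_ ?_
  · repeat first | exact Frame.rfl | refine Frame.setReg ?_ | refine Frame.setArr ?_
  · refine hs.of_frame (rs := keyRegs) (as := keyArrs) ?_ (by decide)
    repeat first | exact Frame.rfl | refine Frame.setReg ?_ | refine Frame.setArr ?_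
  · simp
    omega
  · intro k
    simpa [State.arr_setReg, State.arr_setArr] using hd.le k
  · intro k k'
    simpa [State.arr_setReg, State.arr_setArr] using hd.inj k k'
  · intro k _
    simp [State.arr_setReg, State.arr_setArr]
  · simpa [flat] using Walk.nil
  · simpa [flat] using Walk.nil
  · simp
  · intro i hi
    obtain rfl : i = 0 := by simpa using hi
    simp [State.arr_setArr]
  · exact ⟨E.S.length, le_rfl, E.parse.top_node, fun Y a b h _ _ _ _ _ => by simp at h, rfl⟩
  · simp
  · simp
  · simp
  · simp only [List.length_singleton]
    omega
  intro t₁ s₁ ds₁ a1 a2 hk1 h33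
  simp only [List.length_singleton] at a2
  have hd1 : ds₁.length ≤ 6 * E.h + 1 := by
    exact E.parse.dq_size hk1.dq
  refine wp_trimR (q := q) (hk1.weaken le_rfl hq) h8 h9 (by rw [h33]; simp) hq hpq (by omega) ?_
  intro t₂ s₂ ds₂ b1 b2 hk2
  have h20 := hk2.lo_le
  have h21 := hk2.stat.base
  simp only [wp_simps, h21]
  refine ⟨by omega, by omega, ?_⟩
  have hf : Frame [38, 22] [] s₂ ((s₂.setReg 38 (s₂.arr 0 (s₂.reg 20))).setReg 22 0) :=
    Frame.rfl.setReg.setReg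
  have ha : ∀ r k, ((s₂.setReg 38 (s₂.arr 0 (s₂.reg 20))).setReg 22 0).arr r k = s₂.arr r k := by
    intro r k
    simp [State.arr_setReg]
  refine wp_keyLoop (E := E) (s₀ := (s₂.setReg 38 (s₂.arr 0 (s₂.reg 20))).setReg 22 0)
    ⟨Frame.rfl, hk2.stat.of_frame hf, ?_, ⟨?_, ?_⟩, fun _ _ => rfl, ?_, ?_,
      ⟨?_, ?_⟩, hk2.dq, hk2.q_le, ?_, ?_⟩ hpq (by simp) (by omega) ?_
  · have := hk2.cnt_le
    simp
    omega
  · simpa [ha] using hk2.dict.le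
  · simpa [ha] using hk2.dict.inj
  · simpa using hk2.left.mono fun k _ => ha 3 k
  · simpa using hk2.right.mono fun k _ => ha 3 k
  · simpa using hk2.rep.length
  · simpa [ha] using hk2.rep.get
  · simpa using hk2.lo_le
  · simpa using hk2.le_hi
  intro t₃ s₃ p' wl wr c1 c2 hk3 hkey
  have hm : ∀ k, s.arr 3 k ≠ 0 → s₃.arr 3 k = s.arr 3 k := by
    intro k hk
    have e1 := hk2.mono k hk
    have e2 := hk3.mono k (by rwa [ha, e1])
    rw [e2, ha, e1]
  have hF : Frame (38 :: keyRegs) keyArrs s s₃ := by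
    have e1 : Frame (38 :: keyRegs) keyArrs s s₂ :=
      ⟨fun i hi => hk2.frame.reg i fun h => hi (List.mem_cons_of_mem _ h), hk2.frame.low,
        fun _ h h' => hk2.frame.arr _ h h'⟩
    exact (e1.trans hf).trans hk3.frame
  refine hQ _ _ wl wr (by omega) (by omega) hF hk3.dict (hk3.cnt_le.trans (Nat.le_succ _)) hm
    hk3.left hk3.right hkey ?_
  rintro rfl
  rw [hk3.frame.reg 38]
  simp only [State.reg_setReg, reduceIte, Nat.reduceEqDiff]
  cases hds : ds₂ with
  | nil =>
    have := hk2.dq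
    rw [hds] at this
    have : p = p + 1 := this
    omega
  | cons x ds =>
    have e1 := hk2.rep.get 0 (by rw [hds]; simp)
    have e2 := hk2.dq
    rw [hds] at e2
    rw [← e2.head_eq_letter, ← Nat.add_zero (s₂.reg 20), e1.1]
    simp [hds]

end

/-! ### Extending straight line programs -/

theorem Val.unique {G : List SLPExpr} {i : ℕ} {u v : List ℕ} (h1 : Val G i u) (h2 : Val G i v) :
    u = v := by
  induction h1 generalizing v with
  | @letter i a h =>
    cases h2 with
    | letter h' => rw [h] at h'; simpa using h'
    | pair h' => rw [h] at h'; simp at h'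
  | @pair i l r u₁ u₂ h _ _ ih1 ih2 =>
    cases h2 with
    | letter h' => rw [h] at h'; simp at h'
    | @pair _ l' r' v₁ v₂ h' h3 h4 =>
      rw [h] at h'
      simp only [Option.some.injEq, SLPExpr.pair.injEq] at h'
      obtain ⟨rfl, rfl⟩ := h'
      rw [ih1 h3, ih2 h4]

theorem Val.lt_length {G : List SLPExpr} {i : ℕ} {u : List ℕ} (h : Val G i u) : i < G.length := by
  cases h with
  | letter h => exact (List.getElem?_eq_some_iff.1 h).1
  | pair h => exact (List.getElem?_eq_some_iff.1 h).1

theorem Val.append {G G' : List SLPExpr} {i : ℕ} {u : List ℕ} (h : Val G i u) :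
    Val (G ++ G') i u := by
  induction h with
  | letter h =>
    refine Val.letter ?_
    rw [List.getElem?_append_left (List.getElem?_eq_some_iff.1 h).1, h]
  | pair h _ _ ih1 ih2 =>
    refine Val.pair ?_ ih1 ih2
    rw [List.getElem?_append_left (List.getElem?_eq_some_iff.1 h).1, h]

/-- In an SLP the variables used have smaller indices, so a derivation from an old variable never
reaches the appended assignments. -/
theorem Val.of_append {G G' : List SLPExpr} (hG : IsSLP G) {i : ℕ} {u : List ℕ}
    (h : Val (G ++ G') i u) (hi : i < G.length) : Val G i u := by
  induction h with
  | letter h =>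
    rw [List.getElem?_append_left hi] at h
    exact Val.letter h
  | pair h _ _ ih1 ih2 =>
    rw [List.getElem?_append_left hi] at h
    have := hG _ _ _ h
    exact Val.pair h (ih1 (by omega)) (ih2 (by omega))

/-- The part of `IsBisectionSLP` that holds during the construction. -/
structure PartialSLP (S : List ℕ) (G : List SLPExpr) : Prop where
  isSLP : IsSLP G
  splits : ∀ (i l r : ℕ) (u v : List ℕ), G[i]? = some (SLPExpr.pair l r) → Val G l u → Val G r v →
    u.length = halfLen (u ++ v).length
  needed : ∀ (i : ℕ) (u : List ℕ), Val G i u → BisectionSubstring S u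

theorem PartialSLP.nil (S : List ℕ) : PartialSLP S [] :=
  ⟨fun i l r h => by simp at h, fun i l r u v h => by simp at h,
    fun i u h => by have := h.lt_length; simp at this⟩

theorem getElem?_concat_cases {G : List SLPExpr} {x y : SLPExpr} {i : ℕ}
    (h : (G ++ [x])[i]? = some y) : i < G.length ∧ G[i]? = some y ∨ i = G.length ∧ x = y := by
  rcases lt_trichotomy i G.length with hi | hi | hi
  · rw [List.getElem?_append_left hi] at h
    exact Or.inl ⟨hi, h⟩
  · subst hi
    simp at h
    exact Or.inr ⟨rfl, h⟩
  · rw [List.getElem?_eq_none (by simp; omega)] at h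
    simp at h

theorem PartialSLP.append {S : List ℕ} {G : List SLPExpr} (hG : PartialSLP S G) {x : SLPExpr}
    {u : List ℕ} (hx : ∀ l r, x = SLPExpr.pair l r → l < G.length ∧ r < G.length)
    (hs : ∀ l r v w, x = SLPExpr.pair l r → Val G l v → Val G r w →
      v.length = halfLen (v ++ w).length)
    (hu : Val (G ++ [x]) G.length u) (hn : BisectionSubstring S u) : PartialSLP S (G ++ [x]) := by
  have hslp : IsSLP (G ++ [x]) := by
    intro i l r h
    rcases getElem?_concat_cases h with ⟨-, h'⟩ | ⟨rfl, h'⟩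
    · exact hG.isSLP i l r h'
    · exact hx l r h'
  refine ⟨hslp, fun i l r v w h h1 h2 => ?_, fun i v h => ?_⟩
  · have h3 := hslp i l r h
    rcases getElem?_concat_cases h with ⟨hi, h'⟩ | ⟨rfl, h'⟩
    · exact hG.splits i l r v w h' (h1.of_append hG.isSLP (by omega))
        (h2.of_append hG.isSLP (by omega))
    · exact hs l r v w h' (h1.of_append hG.isSLP (by omega)) (h2.of_append hG.isSLP (by omega))
  · have h3 := h.lt_length
    simp only [List.length_append, List.length_singleton] at h3
    by_cases hi : i < G.length
    · exact hG.needed i v (h.of_append hG.isSLP hi)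
    · obtain rfl : i = G.length := by omega
      rw [h.unique hu]
      exact hn

theorem PartialSLP.append_letter {S : List ℕ} {G : List SLPExpr} (hG : PartialSLP S G) {a : ℕ}
    (hn : BisectionSubstring S [a]) :
    PartialSLP S (G ++ [SLPExpr.letter a]) ∧ Val (G ++ [SLPExpr.letter a]) G.length [a] := by
  have hv : Val (G ++ [SLPExpr.letter a]) G.length [a] := Val.letter (by simp)
  exact ⟨hG.append (fun l r h => by simp at h) (fun l r v w h => by simp at h) hv hn, hv⟩

theorem PartialSLP.append_pair {S : List ℕ} {G : List SLPExpr} (hG : PartialSLP S G) {l r : ℕ}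
    {u v : List ℕ} (hl : Val G l u) (hr : Val G r v) (hh : u.length = halfLen (u ++ v).length)
    (hn : BisectionSubstring S (u ++ v)) :
    PartialSLP S (G ++ [SLPExpr.pair l r]) ∧
      Val (G ++ [SLPExpr.pair l r]) G.length (u ++ v) := by
  have hv : Val (G ++ [SLPExpr.pair l r]) G.length (u ++ v) :=
    Val.pair (by simp) hl.append hr.append
  refine ⟨hG.append (fun l' r' h => ?_) (fun l' r' v' w' h h1 h2 => ?_) hv hn, hv⟩
  · simp only [SLPExpr.pair.injEq] at h
    rw [← h.1, ← h.2]
    exact ⟨hl.lt_length, hr.lt_length⟩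
  · simp only [SLPExpr.pair.injEq] at h
    rw [← h.1] at h1
    rw [← h.2] at h2
    rw [h1.unique hl, h2.unique hr]
    exact hh

/-! ### The layout of programs in memory, and slices of the input string -/

theorem length_flatMap_words (G : List SLPExpr) : (G.flatMap SLPExpr.words).length = 3 * G.length := by
  induction G with
  | nil => rfl
  | cons x G ih =>
    rw [List.flatMap_cons, List.length_append, ih, List.length_cons]
    cases x <;> simp [SLPExpr.words] <;> omega

theorem halfLen_eq {q i : ℕ} (h1 : 2 ^ i < q) (h2 : q ≤ 2 * 2 ^ i) : halfLen q = 2 ^ i := by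
  unfold halfLen
  congr 1
  have : 0 < 2 ^ i := Nat.two_pow_pos i
  exact Nat.log_eq_of_pow_le_of_lt_pow (by omega) (by rw [pow_succ]; omega)

/-- The substring at `[p, q)`. -/
def slice (S : List ℕ) (p q : ℕ) : List ℕ := (S.drop p).take (q - p)

theorem length_slice {S : List ℕ} {p q : ℕ} (hq : q ≤ S.length) : (slice S p q).length = q - p := by
  unfold slice
  rw [List.length_take, List.length_drop]
  omega

theorem slice_append {S : List ℕ} {p r q : ℕ} (h1 : p ≤ r) (h2 : r ≤ q) :
    slice S p r ++ slice S r q = slice S p q := Parse.take_add_drop h1 h2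

theorem slice_take {S : List ℕ} {p r q : ℕ} (h1 : p ≤ r) (h2 : r ≤ q) :
    (slice S p q).take (r - p) = slice S p r := by
  unfold slice
  rw [List.take_take, min_eq_left (by omega)]

theorem slice_drop {S : List ℕ} {p r q : ℕ} (h1 : p ≤ r) (h2 : r ≤ q) :
    (slice S p q).drop (r - p) = slice S r q := by
  unfold slice
  rw [List.drop_take, List.drop_drop]
  congr 1
  · omega
  · congr 1
    omega

theorem slice_self {S : List ℕ} : slice S 0 S.length = S := by
  simp [slice]

theorem slice_succ {S : List ℕ} {p : ℕ} (hp : p < S.length) : slice S p (p + 1) = [S.getD p 0] := by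
  unfold slice
  rw [Nat.add_sub_cancel_left, List.take_one_drop_eq_of_lt_length hp, List.getD_eq_getElem _ _ hp]
  rfl

/-! ### The main loop -/

/-- Compute in register `30` the largest power of two below the number in register `9`. -/
def halfProg : Prog :=
  block [.assign 30 (.const 1),
    .loop (.bin .lt (.const 2 * .reg 30) (.reg 9)) (.assign 30 (.const 2 * .reg 30))]

/-- Add the assignment in the registers `28`, `29`, `30` to the program, and enter it in the table of
keys. -/
def emitRule : Prog :=
  block [
    .store (.reg 37 + .const 3 * .reg 11) (.reg 28),
    .store (.reg 37 + .const 3 * .reg 11 + .const 1) (.reg 29),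
    .store (.reg 37 + .const 3 * .reg 11 + .const 2) (.reg 30),
    .setArr 4 (.reg 35) (.reg 11 + .const 1),
    .assign 10 (.reg 11),
    .assign 11 (.reg 11 + .const 1),
    .assign 13 (.const 1)]

/-- Start with the interval in the registers `8`, `9`. -/
def callProg : Prog :=
  block [
    keyProg,
    .assign 35 ((.reg 23 + .reg 24) * (.reg 23 + .reg 24) + .reg 23),
    .assign 10 (.arr 4 (.reg 35)),
    .ite (.bin .eq (.reg 10) (.const 0))
      (.ite (.bin .eq (.reg 9) (.const 1))
        (block [.assign 28 (.const 0), .assign 29 (.reg 38), .assign 30 (.const 0), emitRule])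
        (block [.setArr 5 (.reg 7) (.reg 8), .setArr 6 (.reg 7) (.reg 9),
          .setArr 7 (.const 2 * .reg 7) (.reg 35),
          .setArr 7 (.const 2 * .reg 7 + .const 1) (.const 0),
          .assign 7 (.reg 7 + .const 1), halfProg, .assign 9 (.reg 30)]))
      (block [.assign 10 (.reg 10 - .const 1), .assign 13 (.const 1)])]

/-- Return the variable in register `10` to the interval on the top of the stack. -/
def retProg : Prog :=
  .ite (.bin .eq (.reg 7) (.const 0)) (.assign 13 (.const 2))
    (.ite (.bin .eq (.arr 7 (.const 2 * .reg 7 - .const 1)) (.const 0))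
      (block [.setArr 7 (.const 2 * .reg 7 - .const 1) (.reg 10 + .const 1),
        .assign 8 (.arr 5 (.reg 7 - .const 1)), .assign 9 (.arr 6 (.reg 7 - .const 1)), halfProg,
        .assign 8 (.reg 8 + .reg 30), .assign 9 (.reg 9 - .reg 30), .assign 13 (.const 0)])
      (block [.assign 35 (.arr 7 (.const 2 * .reg 7 - .const 2)), .assign 28 (.const 1),
        .assign 29 (.arr 7 (.const 2 * .reg 7 - .const 1) - .const 1), .assign 30 (.reg 10),
        emitRule, .assign 7 (.reg 7 - .const 1)]))

/-- The recursion over the intervals of the bisection. -/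
def mainLoop : Prog :=
  .loop (.bin .lt (.reg 13) (.const 2)) (.ite (.bin .eq (.reg 13) (.const 0)) callProg retProg)

/-- A bound for the time spent with one interval. -/
def Env.callCost (E : Env) : ℕ := E.keyCost + 200 * Nat.log 2 E.S.length + 2000

/-- The straight line program `G` has been written, and the table contains the keys of its
variables. -/
structure MInv (E : Env) (t : ℕ) (s : State) (G : List SLPExpr) : Prop where
  stat : Static E s
  base : s.reg 37 = 5 * E.D.length
  size : s.reg 11 = G.length
  size_le : G.length ≤ 2 * E.S.length
  out : ∀ k < 3 * G.length, s.mem (5 * E.D.length + k) = (G.flatMap SLPExpr.words).getD k 0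
  cnt_le : s.reg 12 ≤ t
  dict : DictOk s
  tab : ∀ k, s.arr 4 k ≠ 0 → ∃ p q wl wr a b, k = pairCode a b ∧ p < q ∧ q ≤ E.S.length ∧
    KeyOf E.σ E.D E.S E.h E.M p q wl wr ∧ Walk s a (flat wl) ∧ Walk s b (flat wr) ∧
    s.arr 4 k ≤ G.length ∧ Val G (s.arr 4 k - 1) (slice E.S p q)
  surj : ∀ i < G.length, ∃ k, s.arr 4 k = i + 1
  slp : PartialSLP E.S G

section
variable {E : Env} {s s' : State} {t t' p q : ℕ} {wl wr : List (ℕ × ℕ)} {G : List SLPExpr}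
  {Q : ℕ → State → Prop}

theorem MInv.change (hm : MInv E t s G) {rs as : List ℕ} (hf : Frame rs as s s')
    (hr : ∀ i ∈ [0, 2, 3, 4, 5, 6, 11, 37], i ∉ rs) (ha : 4 ∉ as) (hc : s'.reg 12 ≤ t')
    (hd : DictOk s') (hmono : ∀ k, s.arr 3 k ≠ 0 → s'.arr 3 k = s.arr 3 k) : MInv E t' s' G := by
  have h4 := hf.arr 4 (by decide) ha
  have hX := E.le_X
  refine ⟨hm.stat.of_frame hf fun i hi => hr i ?_, ?_, ?_, hm.size_le, fun k hk => ?_, hc, hd,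
    fun k hk => ?_, fun i hi => ?_, hm.slp⟩
  · simp at hi ⊢
    tauto
  · rw [hf.reg 37 (hr 37 (by simp)), hm.base]
  · rw [hf.reg 11 (hr 11 (by simp)), hm.size]
  · have := hm.size_le
    rw [hf.low _ (by rw [hm.stat.base]; omega), hm.out k hk]
  · rw [h4] at hk ⊢
    obtain ⟨p, q, wl, wr, a, b, h1, h2, h3, h5, h6, h7, h8⟩ := hm.tab k hk
    exact ⟨p, q, wl, wr, a, b, h1, h2, h3, h5, h6.mono hmono, h7.mono hmono, h8⟩
  · obtain ⟨k, hk⟩ := hm.surj i hi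
    exact ⟨k, by rw [h4, hk]⟩

theorem MInv.of_frame (hm : MInv E t s G) (ht : t ≤ t') {rs as : List ℕ} (hf : Frame rs as s s')
    (hr : ∀ i ∈ [0, 2, 3, 4, 5, 6, 11, 12, 37], i ∉ rs := by decide)
    (ha : ∀ r ∈ [3, 4], r ∉ as := by decide) :
    MInv E t' s' G := by
  have h3 := hf.arr 3 (by decide) (ha 3 (by simp))
  have h12 := hf.reg 12 (hr 12 (by simp))
  have := hm.cnt_le
  refine hm.change hf (fun i hi => hr i ?_) (ha 4 (by simp)) (by omega) ⟨fun k => ?_, fun k k' => ?_⟩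
    fun k _ => h3 k
  · simp at hi ⊢
    tauto
  · rw [h3, h12]
    exact hm.dict.le k
  · rw [h3, h3]
    exact hm.dict.inj k k'

theorem MInv.later (hm : MInv E t s G) (ht : t ≤ t') : MInv E t' s G :=
  hm.of_frame ht (rs := []) (as := []) Frame.rfl

/-- An entry of the table under the key of a substring is a variable for this substring. -/
theorem MInv.lookup (hm : MInv E t s G) {a b : ℕ} (hq : q ≤ E.S.length)
    (hk : KeyOf E.σ E.D E.S E.h E.M p q wl wr) (ha : Walk s a (flat wl)) (hb : Walk s b (flat wr))
    (hne : s.arr 4 (pairCode a b) ≠ 0) : Val G (s.arr 4 (pairCode a b) - 1) (slice E.S p q) := by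
  obtain ⟨p', q', wl', wr', a', b', h1, h2, h3, h4, h5, h6, h7, h8⟩ := hm.tab _ hne
  obtain ⟨rfl, rfl⟩ := pairCode_inj h1
  have h9 := flatMap_pair_inj (ha.word_unique hm.dict h5)
  have h10 := flatMap_pair_inj (hb.word_unique hm.dict h6)
  rw [← h9, ← h10] at h4
  have := E.parse.eq_of_keyOf hq h3 hk h4
  unfold slice at *
  rwa [this]

/-- Sharing is the point: two variables for equal strings have equal keys, hence the same numbers of
words and the same table entry, and the entry names only one variable. -/
theorem MInv.isBisectionSLP (hm : MInv E t s G) (h : Val G (G.length - 1) E.S) :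
    IsBisectionSLP G E.S := by
  refine ⟨hm.slp.isSLP, h, hm.slp.splits, fun i j u hi hj => ?_, hm.slp.needed⟩
  have key : ∀ i, Val G i u → ∃ p q wl wr a b, p < q ∧ q ≤ E.S.length ∧
      KeyOf E.σ E.D E.S E.h E.M p q wl wr ∧ Walk s a (flat wl) ∧ Walk s b (flat wr) ∧
      s.arr 4 (pairCode a b) = i + 1 ∧ u = slice E.S p q := by
    intro i hi
    obtain ⟨k, hk⟩ := hm.surj i hi.lt_length
    obtain ⟨p, q, wl, wr, a, b, rfl, h2, h3, h4, h5, h6, h7, h8⟩ := hm.tab k (by omega)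
    rw [hk, Nat.add_sub_cancel] at h8
    exact ⟨p, q, wl, wr, a, b, h2, h3, h4, h5, h6, hk, hi.unique h8⟩
  obtain ⟨p, q, wl, wr, a, b, h1, h2, h3, h4, h5, h6, h7⟩ := key i hi
  obtain ⟨p', q', wl', wr', a', b', h1', h2', h3', h4', h5', h6', h7'⟩ := key j hj
  obtain ⟨rfl, rfl⟩ := E.parse.keyOf_unique E.logStar_le E.logStar_le' h1.le h2 h1'.le h2'
    (h7.symm.trans h7') h3 h3'
  rw [h4.id_unique h4', h5.id_unique h5'] at h6
  omega

theorem wp_halfProg {len : ℕ} (h9 : s.reg 9 = len) (h2 : 2 ≤ len) (hN : len ≤ E.S.length)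
    (hQ : ∀ t' s', t ≤ t' → t' ≤ t + 50 + 50 * Nat.log 2 E.S.length → Frame [30] [] s s' →
      s'.reg 30 = halfLen len → Q t' s') : halfProg.wp E.w Q t s := by
  have h1 := E.fits
  have hT := E.le_T
  have hlog : ∀ i, 2 ^ i < len → i ≤ Nat.log 2 E.S.length := fun i hi =>
    Nat.le_log_of_pow_le (by omega) (by omega)
  simp only [wp_simps, halfProg]
  refine ⟨by omega, ?_⟩
  refine Prog.wp_loop (fun t' s' => ∃ i, t ≤ t' ∧ t' ≤ t + 20 + 50 * i ∧ Frame [30] [] s s' ∧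
    s'.reg 30 = 2 ^ i ∧ 2 ^ i < len) (t + 20 + 50 * Nat.log 2 E.S.length) ?_ ?_ ?_
  · rintro t' s' ⟨i, -, e1, -, -, e2⟩
    have := hlog i e2
    omega
  · rintro t' s' ⟨i, e0, e1, e2, e3, e4⟩
    have e5 : s'.reg 9 = len := by rw [e2.reg 9, h9]
    have e6 := hlog i e4
    simp only [wp_simps, e3, e5]
    generalize hv : 2 ^ i = v at *
    refine ⟨⟨by omega, by omega⟩, fun h => ⟨⟨by omega, by omega⟩, i + 1, by omega, by omega,
      e2.setReg, ?_, ?_⟩, fun h => hQ _ _ (by omega) (by omega) e2 ?_⟩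
    · simp [pow_succ, hv, mul_comm]
    · rw [pow_succ, hv]
      omega
    · rw [e3, ← hv, halfLen_eq (i := i) (by omega) (by omega)]
  · exact ⟨0, by omega, by omega, Frame.rfl.setReg, by simp,
      by rw [pow_zero]; omega⟩

/-- At most `2 N` assignments of three words are written behind the rules, so the output stays below
the address `X` of the arrays. -/
theorem wp_emitRule {x : SLPExpr} {a b : ℕ} (hm : MInv E t s G)
    (hx : x.words = [s.reg 28, s.reg 29, s.reg 30]) (hc : s.reg 35 = pairCode a b)
    (h0 : s.arr 4 (s.reg 35) = 0) (ha : Walk s a (flat wl)) (hb : Walk s b (flat wr))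
    (hk : KeyOf E.σ E.D E.S E.h E.M p q wl wr) (hpq : p < q) (hq : q ≤ E.S.length)
    (hG : PartialSLP E.S (G ++ [x])) (hv : Val (G ++ [x]) G.length (slice E.S p q))
    (hsz : G.length + 1 ≤ 2 * E.S.length) (ht : t < E.T)
    (hQ : ∀ t' s', t ≤ t' → t' ≤ t + 100 → MInv E t' s' (G ++ [x]) → s'.reg 10 = G.length →
      s'.reg 13 = 1 → s'.reg 7 = s.reg 7 →
      (∀ r ∈ [3, 5, 6, 7], ∀ k, s'.arr r k = s.arr r k) →
      (∀ k, k ≠ s.reg 35 → s'.arr 4 k = s.arr 4 k) → s'.arr 4 (s.reg 35) = G.length + 1 →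
      Q t' s') : emitRule.wp E.w Q t s := by
  have h1 := E.fits
  have hT := E.le_T
  have hX := E.le_X
  have h3 := hm.stat.base
  have h11 := hm.size
  have h37 := hm.base
  have hcnt := hm.cnt_le
  have hfit := E.fits_pairCode (a := a) (x := b) (by have := ha.le hm.dict; omega)
    (by have := hb.le hm.dict; omega)
  rw [← hc] at hfit
  simp only [wp_simps, emitRule, State.reg_setMem, reduceIte, Nat.reduceEqDiff, h3, h11, h37]
  refine ⟨by omega, by omega, by omega, by omega, by omega, by omega, ?_⟩
  obtain ⟨s₁, hs₁⟩ : ∃ s₁, s₁ = ((s.setMem (5 * E.D.length + 3 * G.length) (s.reg 28)).setMem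
    (5 * E.D.length + 3 * G.length + 1) (s.reg 29)).setMem
    (5 * E.D.length + 3 * G.length + 2) (s.reg 30) := ⟨_, rfl⟩
  rw [← hs₁]
  have hreg : ∀ i, s₁.reg i = s.reg i := fun i => by rw [hs₁]; rfl
  have harr : ∀ r k, s₁.arr r k = s.arr r k := by
    intro r k
    rw [hs₁, State.arr_setMem (by simp only [State.reg_setMem]; omega),
      State.arr_setMem (by simp only [State.reg_setMem]; omega), State.arr_setMem (by omega)]
  generalize hs₂ : (((s₁.setArr 4 (s.reg 35) (G.length + 1)).setReg 10 G.length).setReg 11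
      (G.length + 1)).setReg 13 1 = s₂
  have harr' : ∀ r < 8, ∀ k, s₂.arr r k = if r = 4 ∧ k = s.reg 35 then G.length + 1 else
      s.arr r k := by
    intro r hr k
    rw [← hs₂, State.arr_setReg (by decide), State.arr_setReg (by decide),
      State.arr_setReg (by decide), State.arr_setArr (by decide) hr, harr]
  have hmem : ∀ a' < E.X, s₂.mem a' = s₁.mem a' := by
    intro a' ha'
    simp only [← hs₂, State.mem_setReg]
    rw [State.mem_setArr (by rw [hreg]; omega)]
  have hreg' : ∀ i, s₂.reg i = if i = 13 then 1 else if i = 11 then G.length + 1 else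
      if i = 10 then G.length else s.reg i := by
    intro i
    simp only [← hs₂, State.reg_setReg, State.reg_setArr, hreg]
  have h3r : ∀ k, s₂.arr 3 k = s.arr 3 k := fun k => by
    rw [harr' 3 (by decide), if_neg (by omega)]
  have h4r : ∀ k, k ≠ s.reg 35 → s₂.arr 4 k = s.arr 4 k := fun k hk => by
    rw [harr' 4 (by decide), if_neg (by omega)]
  have h4c : s₂.arr 4 (s.reg 35) = G.length + 1 := by
    rw [harr' 4 (by decide), if_pos ⟨rfl, rfl⟩]
  have hw : ∀ {a l}, Walk s a l → Walk s₂ a l := fun h => h.mono fun k _ => h3r k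
  refine ⟨by omega, hQ _ s₂ ?_ ?_ ⟨⟨?_, ?_, ?_, ?_, ?_, ?_, fun i hi k hk => ?_⟩, ?_, ?_, ?_,
    fun k hk => ?_, ?_, ⟨fun k => ?_, fun k k' => ?_⟩, fun k hkn => ?_, fun i hi => ?_, hG⟩ ?_ ?_ ?_ ?_
    h4r h4c⟩
  · omega
  · omega
  · rw [hreg']; exact hm.stat.sigma
  · rw [hreg']; exact hm.stat.root
  · rw [hreg']; exact hm.stat.base
  · rw [hreg']; exact hm.stat.height
  · rw [hreg']; exact hm.stat.length
  · rw [hreg']; exact hm.stat.strip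
  · rw [hmem _ (by omega), hs₁]
    simp only [State.mem_setMem]
    rw [if_neg (by omega), if_neg (by omega), if_neg (by omega), hm.stat.rule i hi k hk]
  · rw [hreg']; exact hm.base
  · rw [hreg']; simp
  · simp
    omega
  · simp only [List.length_append, List.length_singleton] at hk
    rw [hmem _ (by omega), hs₁, List.flatMap_append, List.flatMap_singleton, hx]
    simp only [State.mem_setMem]
    have hl := length_flatMap_words G
    by_cases hk' : k < 3 * G.length
    · rw [if_neg (by omega), if_neg (by omega), if_neg (by omega), hm.out k hk',
        List.getD_append _ _ _ _ (by omega)]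
    · rw [List.getD_append_right _ _ _ _ (by omega), hl]
      obtain ⟨i, rfl⟩ := Nat.exists_eq_add_of_le (Nat.le_of_not_lt hk')
      rw [Nat.add_sub_cancel_left]
      obtain rfl | rfl | rfl : i = 0 ∨ i = 1 ∨ i = 2 := by omega
      · rw [if_neg (by omega), if_neg (by omega), if_pos (by omega)]
        rfl
      · rw [if_neg (by omega), if_pos (by omega)]
        rfl
      · rw [if_pos (by omega)]
        rfl
  · rw [hreg']
    simp
    omega
  · rw [h3r, hreg']
    exact hm.dict.le k
  · rw [h3r, h3r]
    exact hm.dict.inj k k'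
  · by_cases hkc : k = s.reg 35
    · rw [hkc, h4c]
      exact ⟨p, q, wl, wr, a, b, hc, hpq, hq, hk, hw ha, hw hb, by simp, by simpa using hv⟩
    · rw [h4r k hkc] at hkn ⊢
      obtain ⟨p', q', wl', wr', a', b', e1, e2, e3, e4, e5, e6, e7, e8⟩ := hm.tab k hkn
      exact ⟨p', q', wl', wr', a', b', e1, e2, e3, e4, hw e5, hw e6, by simp; omega, e8.append⟩
  · simp only [List.length_append, List.length_singleton] at hi
    by_cases hi' : i < G.length
    · obtain ⟨k, hk⟩ := hm.surj i hi'
      refine ⟨k, ?_⟩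
      rw [h4r k (by rintro rfl; omega), hk]
    · exact ⟨s.reg 35, by rw [h4c]; omega⟩
  · rw [hreg']; simp
  · rw [hreg']; simp
  · rw [hreg']; simp
  · intro r hr k
    have hr' : r < 8 ∧ r ≠ 4 := by
      simp at hr
      omega
    rw [harr' r hr'.1, if_neg (by omega)]

end

/-- The tables of words and keys are extended, and the lowest `sp` entries of the stack are kept. -/
structure Keeps (sp : ℕ) (s s' : State) : Prop where
  dict : ∀ k, s.arr 3 k ≠ 0 → s'.arr 3 k = s.arr 3 k
  tab : ∀ k, s.arr 4 k ≠ 0 → s'.arr 4 k = s.arr 4 k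
  stack : ∀ k < sp, s'.arr 5 k = s.arr 5 k ∧ s'.arr 6 k = s.arr 6 k ∧
    s'.arr 7 (2 * k) = s.arr 7 (2 * k) ∧ s'.arr 7 (2 * k + 1) = s.arr 7 (2 * k + 1)

/-- The interval at `p` of length `len` has been treated between the times `t` and `t'`, and the
straight line program has been extended from `G` to `G'`. -/
structure Returned (E : Env) (p len t : ℕ) (s : State) (G : List SLPExpr) (t' : ℕ) (s' : State)
    (G' : List SLPExpr) : Prop where
  inv : MInv E t' s' G'
  keeps : Keeps (s.reg 7) s s'
  sp : s'.reg 7 = s.reg 7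
  mode : s'.reg 13 = 1
  val : Val G' (s'.reg 10) (slice E.S p (p + len))
  ext : ∃ G₁, G' = G ++ G₁
  fresh : ∀ k, s.arr 4 k = 0 → s'.arr 4 k ≠ 0 → ∃ u, Val G' (s'.arr 4 k - 1) u ∧ u.length ≤ len
  last : G' = G ∨ s'.reg 10 + 1 = G'.length
  size_lt : G'.length < G.length + 2 * len
  le : t ≤ t'
  time : t' + 3 * (E.callCost * G.length) ≤ t + E.callCost + 3 * (E.callCost * G'.length)

section
variable {E : Env} {s s' s'' : State} {t t' p len sp : ℕ} {G : List SLPExpr} {Q : ℕ → State → Prop}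

theorem Keeps.trans {sp' : ℕ} (h1 : Keeps sp s s') (h2 : Keeps sp' s' s'') (h : sp ≤ sp') :
    Keeps sp s s'' := by
  refine ⟨fun k hk => ?_, fun k hk => ?_, fun k hk => ?_⟩
  · rw [h2.dict k (by rwa [h1.dict k hk]), h1.dict k hk]
  · rw [h2.tab k (by rwa [h1.tab k hk]), h1.tab k hk]
  · obtain ⟨a1, a2, a3, a4⟩ := h1.stack k hk
    obtain ⟨b1, b2, b3, b4⟩ := h2.stack k (by omega)
    exact ⟨b1.trans a1, b2.trans a2, b3.trans a3, b4.trans a4⟩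

/-- The eight steps are those of the two tests, with three nodes and one further step each. -/
theorem wp_mainLoop_of_body (h : s.reg 13 < 2) (hfit : 2 < 2 ^ E.w)
    (h0 : s.reg 13 = 0 → callProg.wp E.w (mainLoop.wp E.w Q) (t + 8) s)
    (h1 : s.reg 13 = 1 → retProg.wp E.w (mainLoop.wp E.w Q) (t + 8) s) :
    mainLoop.wp E.w Q t s := by
  refine Prog.wp_loop_unfold ⟨trivial, hfit, trivial⟩ (Expr.holds_lt.2 h) ?_
  refine Prog.wp_ite.2 ⟨⟨trivial, by show 0 < 2 ^ E.w; omega, trivial⟩, fun he => ?_, fun he => ?_⟩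
  · exact h0 (Expr.holds_eq.1 he)
  · refine h1 ?_
    have : ¬ s.reg 13 = 0 := fun hc => he (Expr.holds_eq.2 hc)
    omega

/-- There are three outcomes. A key in the table or a single letter returns a variable at once.
Otherwise the interval is pushed together with the code of its key, so that the key need not be
computed again when both halves are known. -/
theorem wp_callProg (hm : MInv E t s G) (h8 : s.reg 8 = p) (h9 : s.reg 9 = len) (hlen : 1 ≤ len)
    (hq : p + len ≤ E.S.length) (hb : BisectionSubstring E.S (slice E.S p (p + len)))
    (hsp : s.reg 7 ≤ E.S.length) (h13 : s.reg 13 = 0) (hsz : G.length + 1 ≤ 2 * E.S.length)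
    (ht : t + E.callCost + 40000 * (E.S.length + E.M) + 50000 < E.T)
    (hret : ∀ t' s' G', Returned E p len t s G t' s' G' → t' + 8 ≤ t + E.callCost →
      G'.length ≤ G.length + 1 → Q t' s')
    (hpush : ∀ t' s' a b wl wr, 2 ≤ len → t ≤ t' →
      t' ≤ t + E.keyCost + 50 * Nat.log 2 E.S.length + 600 → MInv E t' s' G →
      Keeps (s.reg 7) s s' → (∀ k, s'.arr 4 k = s.arr 4 k) → s'.reg 7 = s.reg 7 + 1 →
      s'.arr 5 (s.reg 7) = p → s'.arr 6 (s.reg 7) = len → s'.arr 7 (2 * s.reg 7) = pairCode a b →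
      s'.arr 7 (2 * s.reg 7 + 1) = 0 → Walk s' a (flat wl) → Walk s' b (flat wr) →
      KeyOf E.σ E.D E.S E.h E.M p (p + len) wl wr → s'.arr 4 (pairCode a b) = 0 →
      s'.reg 8 = p → s'.reg 9 = halfLen len → s'.reg 13 = 0 → Q t' s') :
    callProg.wp E.w Q t s := by
  have h1 := E.fits
  have h2 := E.le_T
  have h3 := E.le_X
  have hV : E.callCost = E.keyCost + 200 * Nat.log 2 E.S.length + 2000 := rfl
  simp only [callProg, wp_block_cons]
  refine wp_keyProg (q := p + len) hm.stat hm.dict hm.cnt_le h8 (by omega) (by omega) hq (by omega)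
    fun t₁ s₁ wl wr e1 e2 e3 e4 e5 e6 e7 e8 e9 e10 => ?_
  have hm₁ : MInv E t₁ s₁ G := hm.change e3 (by decide) (by decide) e5 e4 e6
  have f3 := hm₁.stat.base
  have f5 := e3.arr 5
  have f4 := e3.arr 4
  have f6 := e3.arr 6
  have f7 := e3.arr 7
  have g7 := e3.reg 7
  have g8 : s₁.reg 8 = p := by rw [e3.reg 8, h8]
  have g9 : s₁.reg 9 = len := by rw [e3.reg 9, h9]
  have g13 : s₁.reg 13 = 0 := by rw [e3.reg 13, h13]
  have l1 := e7.le e4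
  have l2 := e8.le e4
  have hfit := E.fits_pairCode (a := s₁.reg 23) (x := s₁.reg 24) (by omega) (by omega)
  have hcode : (s₁.reg 23 + s₁.reg 24) * (s₁.reg 23 + s₁.reg 24) + s₁.reg 23 =
    pairCode (s₁.reg 23) (s₁.reg 24) := rfl
  simp only [wp_simps, reduceIte, Nat.reduceEqDiff, f3, g8, g9, g7, hcode]
  rw [State.arr_setReg (by decide)]
  have hk₁ : Keeps (s.reg 7) s s₁ := ⟨e6, fun k _ => by rw [f4], fun k _ =>
    ⟨by rw [f5], by rw [f6], by rw [f7], by rw [f7]⟩⟩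
  refine ⟨⟨by omega, by omega⟩, ⟨by omega, by omega⟩, by omega, fun hz => ⟨by omega, ?_, ?_⟩, ?_⟩
  · rintro rfl
    refine ⟨by omega, by omega, ?_⟩
    have hf : Frame [35, 10, 28, 29, 30] [] s₁ (((((s₁.setReg 35 (pairCode (s₁.reg 23) (s₁.reg 24))).setReg
        10 (s₁.arr 4 (pairCode (s₁.reg 23) (s₁.reg 24)))).setReg 28 0).setReg 29 (s₁.reg 38)).setReg
        30 0) := by
      repeat first | exact Frame.rfl | refine Frame.setReg ?_
    have hsl := slice_succ (S := E.S) (p := p) (by omega)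
    obtain ⟨c1, c2⟩ := hm.slp.append_letter (hsl ▸ hb)
    refine wp_emitRule (x := .letter (E.S.getD p 0)) (a := s₁.reg 23) (b := s₁.reg 24) (p := p)
      (q := p + 1) (wl := wl) (wr := wr) (hm₁.of_frame (by omega) hf) ?_ ?_ ?_
      (e7.mono fun k _ => by rw [hf.arr 3])
      (e8.mono fun k _ => by rw [hf.arr 3]) e9 (by omega) hq c1
      (by rwa [hsl]) hsz (by omega) fun t₂ s₂ d1 d2 d3 d4 d5 d6 d7 d8 d9 => ?_
    · simp [SLPExpr.words, e10]
    · simp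
    · simp only [State.reg_setReg, Nat.reduceEqDiff, reduceIte]
      rw [hf.arr 4, hz]
    · simp only [State.reg_setReg, Nat.reduceEqDiff, reduceIte] at d6 d8 d9
      have d10 : ∀ r ∈ [3, 5, 6, 7], s₂.arr r = s₁.arr r := fun r hr => by
        funext k
        rw [d7 r hr, hf.arr r (by simp at hr; omega) (by simp)]
      simp only [wp_block_nil]
      refine hret _ _ (G ++ [.letter (E.S.getD p 0)]) ⟨d3.later (by omega), ⟨fun k hk => ?_, fun k hk => ?_, fun k hk => ?_⟩,
        by rw [d6, g7], d5, by rw [d4, hsl]; exact c2, ⟨_, rfl⟩, fun k hk0 hk => ?_,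
        Or.inr (by simp [d4]), by simp, by omega, ?_⟩ (by omega) (by simp)
      · rw [d10 3 (by simp), e6 k hk]
      · rw [d8 k, hf.arr 4, f4]
        rintro rfl
        rw [f4] at hz
        exact hk hz
      · rw [d10 5 (by simp), d10 6 (by simp), d10 7 (by simp)]
        exact hk₁.stack k hk
      · by_cases hkc : k = pairCode (s₁.reg 23) (s₁.reg 24)
        · rw [hkc, d9]
          exact ⟨_, c2, by simp⟩
        · rw [d8 k hkc, hf.arr 4, f4] at hk
          exact absurd hk0 hk
      · simp only [List.length_append, List.length_singleton, Nat.mul_succ]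
        omega
  · intro h1l
    refine ⟨by omega, by omega, by omega, by omega, by omega, by omega, ?_⟩
    generalize hs₂ : ((((((s₁.setReg 35 (pairCode (s₁.reg 23) (s₁.reg 24))).setReg 10
      (s₁.arr 4 (pairCode (s₁.reg 23) (s₁.reg 24)))).setArr 5 (s.reg 7) p).setArr
      6 (s.reg 7) len).setArr 7 (2 * s.reg 7) (pairCode (s₁.reg 23) (s₁.reg 24))).setArr
      7 (2 * s.reg 7 + 1) 0).setReg 7 (s.reg 7 + 1) = s₂
    have hf : Frame [35, 10, 7] [5, 6, 7] s₁ s₂ := by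
      rw [← hs₂]
      repeat first | exact Frame.rfl | refine Frame.setReg ?_ | refine Frame.setArr ?_
    have ha : ∀ r < 8, ∀ k, s₂.arr r k = if r = 7 ∧ k = 2 * s.reg 7 + 1 then 0 else
        if r = 7 ∧ k = 2 * s.reg 7 then pairCode (s₁.reg 23) (s₁.reg 24) else
        if r = 6 ∧ k = s.reg 7 then len else if r = 5 ∧ k = s.reg 7 then p else s₁.arr r k := by
      intro r hr k
      rw [← hs₂, State.arr_setReg (by decide), State.arr_setArr (by decide) hr,
        State.arr_setArr (by decide) hr, State.arr_setArr (by decide) hr,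
        State.arr_setArr (by decide) hr, State.arr_setReg (by decide), State.arr_setReg (by decide)]
    refine wp_halfProg (E := E) (len := len) ?_ (by omega) (by omega) fun t₃ s₃ d1 d2 d3 d4 => ?_
    · rw [hf.reg 9, g9]
    simp only [wp_simps, d4]
    have ha' : ∀ r < 8, ∀ k, (s₃.setReg 9 (halfLen len)).arr r k = s₂.arr r k := fun r hr k => by
      rw [State.arr_setReg (by decide), d3.arr r hr (by simp)]
    have ha3 : ∀ k, (s₃.setReg 9 (halfLen len)).arr 3 k = s₁.arr 3 k := fun k => by
      rw [ha' 3 (by decide), hf.arr 3]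
    have ha4 : ∀ k, (s₃.setReg 9 (halfLen len)).arr 4 k = s₁.arr 4 k := fun k => by
      rw [ha' 4 (by decide), hf.arr 4]
    have hr' : ∀ i ∉ [9, 30, 35, 10, 7], (s₃.setReg 9 (halfLen len)).reg i = s₁.reg i := fun i hi => by
      simp at hi
      rw [State.reg_setReg, if_neg (by omega), d3.reg i (by simp; omega), hf.reg i (by simp; omega)]
    refine hpush _ _ (s₁.reg 23) (s₁.reg 24) wl wr (by omega) ?_ ?_
      (((hm₁.of_frame le_rfl hf).of_frame le_rfl d3).of_frame (t' := _) ?_ (rs := [9]) (as := [])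
        (Frame.rfl.setReg))
      (hk₁.trans ⟨fun k _ => ha3 k, fun k _ => ha4 k, fun k hk => ?_⟩ le_rfl)
      (fun k => by rw [ha4, f4]) ?_ ?_ ?_ ?_ ?_ (e7.mono fun k _ => ha3 k) (e8.mono fun k _ => ha3 k)
      e9 (by rw [ha4, hz]) ?_ (by simp) ?_
    · omega
    · omega
    · omega
    · rw [ha' 5 (by decide), ha' 6 (by decide), ha' 7 (by decide), ha' 7 (by decide), ha 5 (by decide),
        ha 6 (by decide), ha 7 (by decide), ha 7 (by decide)]
      simp [hk.ne, show 2 * k ≠ 2 * s.reg 7 + 1 by omega, show 2 * k + 1 ≠ 2 * s.reg 7 by omega]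
    · rw [State.reg_setReg, if_neg (by decide), d3.reg 7 (by simp), ← hs₂]
      simp
    · rw [ha' 5 (by decide), ha 5 (by decide)]
      simp
    · rw [ha' 6 (by decide), ha 6 (by decide)]
      simp
    · rw [ha' 7 (by decide), ha 7 (by decide)]
      simp
    · rw [ha' 7 (by decide), ha 7 (by decide)]
      simp
    · rw [hr' 8 (by decide), g8]
    · rw [hr' 13 (by decide), g13]
  · intro hz
    refine ⟨by omega, by omega, hret _ _ G ⟨hm₁.of_frame (by omega) (rs := [35, 10, 13]) (as := []) ?_ (by decide)
      (by decide), hk₁.trans ⟨fun k _ => ?_, fun k _ => ?_, fun k hk => ?_⟩ le_rfl, g7, ?_, ?_,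
      ⟨[], by simp⟩, fun k hk0 hk => ?_, Or.inl rfl, by omega, by omega, by omega⟩ (by omega) (by omega)⟩
    · repeat first | exact Frame.rfl | refine Frame.setReg ?_
    · rfl
    · rfl
    · exact ⟨rfl, rfl, rfl, rfl⟩
    · simp
    · simpa using hm₁.lookup hq e9 e7 e8 hz
    · rw [State.arr_setReg (by decide), State.arr_setReg (by decide), State.arr_setReg (by decide),
        State.arr_setReg (by decide), f4] at hk
      exact absurd hk0 hk

end

section
variable {E : Env} {s s' s'' : State} {t t' p len sp : ℕ} {G : List SLPExpr} {Q : ℕ → State → Prop}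

/-- The entry `0` on the stack marks that the left half has just been treated. The variable is
therefore stored increased by one, which distinguishes the second return from the first. -/
theorem wp_retProg_left (hm : MInv E t s G) (h7 : s.reg 7 = sp + 1) (hsp : sp ≤ E.S.length)
    (h2 : 2 ≤ len) (hq : p + len ≤ E.S.length) (h10 : s.reg 10 < G.length) (a5 : s.arr 5 sp = p)
    (a6 : s.arr 6 sp = len) (a7 : s.arr 7 (2 * sp + 1) = 0)
    (hQ : ∀ t' s', t ≤ t' → t' ≤ t + 50 * Nat.log 2 E.S.length + 600 → MInv E t' s' G →
      Keeps sp s s' → (∀ k, s'.arr 3 k = s.arr 3 k) → (∀ k, s'.arr 4 k = s.arr 4 k) →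
      s'.reg 7 = sp + 1 → s'.arr 7 (2 * sp) = s.arr 7 (2 * sp) →
      s'.arr 7 (2 * sp + 1) = s.reg 10 + 1 → s'.reg 8 = p + halfLen len →
      s'.reg 9 = len - halfLen len → s'.reg 13 = 0 → Q t' s') : retProg.wp E.w Q t s := by
  have h1 := E.fits
  have hT := E.le_T
  have hX := E.le_X
  have f3 := hm.stat.base
  have hsz := hm.size_le
  have i1 : 2 * (sp + 1) - 1 = 2 * sp + 1 := by omega
  simp only [wp_simps, retProg, reduceIte, Nat.reduceEqDiff, f3, h7, i1, a7, Nat.add_sub_cancel,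
    Nat.succ_ne_zero, not_false_iff, forall_true_left, not_true, IsEmpty.forall_iff]
  rw [State.arr_setArr (by decide) (by decide), State.arr_setReg (by decide),
    State.arr_setArr (by decide) (by decide), if_neg (by simp), if_neg (by simp), a5, a6]
  refine ⟨by omega, by omega, by omega, by omega, by omega, by omega, ?_⟩
  generalize hs₂ : ((s.setArr 7 (2 * sp + 1) (s.reg 10 + 1)).setReg 8 p).setReg 9 len = s₂
  have hf : Frame [8, 9] [7] s s₂ := by
    rw [← hs₂]
    repeat first | exact Frame.rfl | refine Frame.setReg ?_ | refine Frame.setArr ?_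
  refine wp_halfProg (E := E) (len := len) (by rw [← hs₂]; simp) h2 (by omega) fun t₃ s₃ d1 d2 d3 d4 => ?_
  have b8 : s₃.reg 8 = p := by rw [d3.reg 8, ← hs₂]; simp
  have b9 : s₃.reg 9 = len := by rw [d3.reg 9, ← hs₂]; simp
  have b7 : s₃.reg 7 = sp + 1 := by rw [d3.reg 7, hf.reg 7, h7]
  have hh : halfLen len < len := by
    unfold halfLen
    exact lt_of_le_of_lt (Nat.pow_log_le_self 2 (by omega)) (by omega)
  simp only [wp_simps, reduceIte, Nat.reduceEqDiff, d4, b8, b9]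
  have ha : ∀ r < 8, ∀ k, (((s₃.setReg 8 (p + halfLen len)).setReg 9 (len - halfLen len)).setReg
      13 0).arr r k = if r = 7 ∧ k = 2 * sp + 1 then s.reg 10 + 1 else s.arr r k := by
    intro r hr k
    rw [State.arr_setReg (by decide), State.arr_setReg (by decide), State.arr_setReg (by decide),
      d3.arr r hr (by simp), ← hs₂, State.arr_setReg (by decide), State.arr_setReg (by decide),
      State.arr_setArr (by decide) hr]
  refine ⟨by omega, by omega, ?_⟩
  refine hQ _ _ ?_ ?_
    (((hm.of_frame le_rfl hf).of_frame le_rfl d3).of_frame (t' := _) ?_ (rs := [8, 9, 13]) (as := []) ?_ (by decide) (by decide))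
    ⟨fun k _ => ?_, fun k _ => ?_, fun k hk => ?_⟩ (fun k => ?_) (fun k => ?_) (by simp [b7]) ?_ ?_
    (by simp) (by simp) (by simp)
  · omega
  · omega
  · omega
  · repeat first | exact Frame.rfl | refine Frame.setReg ?_
  · simp [ha 3 (by decide)]
  · simp [ha 4 (by decide)]
  · rw [ha 5 (by decide), ha 6 (by decide), ha 7 (by decide), ha 7 (by decide)]
    simp [show 2 * k ≠ 2 * sp + 1 by omega, hk.ne]
  · simp [ha 3 (by decide)]
  · simp [ha 4 (by decide)]
  · simp [ha 7 (by decide)]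
  · simp [ha 7 (by decide)]

theorem wp_retProg_right {a b l : ℕ} {wl wr : List (ℕ × ℕ)} (hm : MInv E t s G)
    (h7 : s.reg 7 = sp + 1) (hsp : sp ≤ E.S.length)
    (h2 : 2 ≤ len) (hq : p + len ≤ E.S.length) (a7 : s.arr 7 (2 * sp) = pairCode a b)
    (a7' : s.arr 7 (2 * sp + 1) = l + 1) (ha : Walk s a (flat wl)) (hb : Walk s b (flat wr))
    (hk : KeyOf E.σ E.D E.S E.h E.M p (p + len) wl wr) (h0 : s.arr 4 (pairCode a b) = 0)
    (hl : Val G l (slice E.S p (p + halfLen len)))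
    (hr : Val G (s.reg 10) (slice E.S (p + halfLen len) (p + len)))
    (hn : BisectionSubstring E.S (slice E.S p (p + len)))
    (hsz : G.length + 1 ≤ 2 * E.S.length) (ht : t + 400 < E.T)
    (hQ : ∀ t' s', t ≤ t' → t' ≤ t + 300 → MInv E t' s' (G ++ [.pair l (s.reg 10)]) →
      s'.reg 10 = G.length → s'.reg 13 = 1 → s'.reg 7 = sp →
      (∀ r ∈ [3, 5, 6, 7], ∀ k, s'.arr r k = s.arr r k) →
      (∀ k, k ≠ pairCode a b → s'.arr 4 k = s.arr 4 k) → s'.arr 4 (pairCode a b) = G.length + 1 →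
      Val (G ++ [.pair l (s.reg 10)]) G.length (slice E.S p (p + len)) →
      Q t' s') : retProg.wp E.w Q t s := by
  have h1 := E.fits
  have hT := E.le_T
  have f3 := hm.stat.base
  have i1 : 2 * (sp + 1) - 1 = 2 * sp + 1 := by omega
  have i2 : 2 * (sp + 1) - 2 = 2 * sp := by omega
  simp only [wp_simps, retProg, reduceIte, Nat.reduceEqDiff, f3, h7, i1, i2, a7, a7',
    Nat.add_sub_cancel, Nat.succ_ne_zero, not_false_iff, forall_true_left,
    IsEmpty.forall_iff]
  rw [State.arr_setReg (by decide), State.arr_setReg (by decide), a7', Nat.add_sub_cancel]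
  have hh : halfLen len < len := by
    unfold halfLen
    exact lt_of_le_of_lt (Nat.pow_log_le_self 2 (by omega)) (by omega)
  have hsl := slice_append (S := E.S) (p := p) (r := p + halfLen len) (q := p + len) (by omega) (by omega)
  obtain ⟨c1, c2⟩ := hm.slp.append_pair hl hr
    (by rw [hsl, length_slice (by omega), length_slice (by omega)]; simp) (hsl ▸ hn)
  rw [hsl] at c2
  refine ⟨by omega, by omega, by omega, by omega, by omega, ?_⟩
  have hf : Frame [35, 28, 29, 30] [] s ((((s.setReg 35 (pairCode a b)).setReg 28 1).setReg 29
      l).setReg 30 (s.reg 10)) := by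
    repeat first | exact Frame.rfl | refine Frame.setReg ?_
  refine wp_emitRule (x := .pair l (s.reg 10)) (a := a) (b := b) (p := p)
    (q := p + len) (wl := wl) (wr := wr) (hm.of_frame (by omega) hf) ?_ ?_ ?_
    (ha.mono fun k _ => by rw [hf.arr 3])
    (hb.mono fun k _ => by rw [hf.arr 3]) hk (by omega) hq c1
    c2 hsz (by omega) fun t₂ s₂ d1 d2 d3 d4 d5 d6 d7 d8 d9 => ?_
  · simp [SLPExpr.words]
  · simp
  · simp only [State.reg_setReg, Nat.reduceEqDiff, reduceIte]
    rw [hf.arr 4, h0]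
  · simp only [State.reg_setReg, Nat.reduceEqDiff, reduceIte] at d6 d8 d9
    rw [h7] at d6
    simp only [wp_simps, d6, Nat.add_sub_cancel]
    refine ⟨by omega, hQ _ _ ?_ ?_ (d3.of_frame ?_ (rs := [7]) (as := [])
      (Frame.rfl.setReg)) (by simp [d4])
      (by simp [d5]) (by simp) (fun r hr k => ?_) (fun k hk => ?_) ?_ c2⟩
    · omega
    · omega
    · omega
    · rw [State.arr_setReg (by decide), d7 r hr, hf.arr r (by simp at hr; omega) (by simp)]
    · rw [State.arr_setReg (by decide), d8 k hk, hf.arr 4]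
    · rw [State.arr_setReg (by decide), d9]

end

section
variable {E : Env}

theorem halfLen_lt {len : ℕ} (h : 2 ≤ len) : 0 < halfLen len ∧ halfLen len < len :=
  ⟨Nat.two_pow_pos _, lt_of_le_of_lt (Nat.pow_log_le_self 2 (by omega)) (by omega)⟩

/-- The stack machine runs one flat loop, so the recursion is stated in continuation form: once the
interval has returned, the loop goes on with the stack as before. In the time balance a visit pays
`callCost` from the caller, and each new variable contributes three more: two for the visits to its
halves and one for the work after their returns. A visit that finds its key adds no variable and
ends there. -/
theorem wp_mainLoop_call {len : ℕ} : ∀ {s : State} {t p : ℕ} {G : List SLPExpr}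
    {Q : ℕ → State → Prop}, MInv E t s G → s.reg 8 = p → s.reg 9 = len → s.reg 13 = 0 → 1 ≤ len →
    p + len ≤ E.S.length → BisectionSubstring E.S (slice E.S p (p + len)) →
    s.reg 7 + len ≤ E.S.length → G.length + 2 * len ≤ 2 * E.S.length →
    t + 6 * (E.callCost * len) + 40000 * (E.S.length + E.M) + 60000 < E.T →
    (∀ t' s' G', Returned E p len t s G t' s' G' → mainLoop.wp E.w Q t' s') →
    mainLoop.wp E.w Q t s := by
  induction len using Nat.strong_induction_on with
  | _ len ih =>
  intro s t p G Q hm h8 h9 h13 hlen hq hb hsp hsz ht hQ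
  have hV : E.callCost = E.keyCost + 200 * Nat.log 2 E.S.length + 2000 := rfl
  have hVl : E.callCost ≤ E.callCost * len := Nat.le_mul_of_pos_right _ hlen
  have h1 := E.fits
  refine wp_mainLoop_of_body (by omega) (by omega) (fun _ => ?_) (by omega)
  refine wp_callProg (hm.later (Nat.le_add_right t 8)) h8 h9 hlen hq hb (by omega) h13 (by omega) (by omega)
    (fun t' s' G' hr htr hlr => hQ t' s' G' ⟨hr.inv, hr.keeps, hr.sp, hr.mode, hr.val, hr.ext,
      hr.fresh, hr.last, hr.size_lt, by have := hr.le; omega, ?_⟩) ?_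
  · obtain ⟨G₁, rfl⟩ := hr.ext
    have : E.callCost * G.length ≤ E.callCost * (G ++ G₁).length := Nat.mul_le_mul_left _ (by simp)
    omega
  intro t₁ s₁ a b wl wr hl2 e1 e2 e3 e4 e5 e6 e7 e8 e9 e10 e11 e12 e13 e14 e15 e16 e17
  obtain ⟨k1, k2⟩ := halfLen_lt hl2
  generalize hk : halfLen len = k at *
  obtain ⟨r, rfl⟩ : ∃ r, len = k + r := ⟨len - k, by omega⟩
  have hVk : E.callCost ≤ E.callCost * k := Nat.le_mul_of_pos_right _ (by omega)
  have hVr : E.callCost ≤ E.callCost * r := Nat.le_mul_of_pos_right _ (by omega)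
  rw [Nat.mul_add] at ht
  have hlsl : (slice E.S p (p + (k + r))).length = k + r := by
    rw [length_slice (by omega)]
    omega
  have hbl : BisectionSubstring E.S (slice E.S p (p + k)) := by
    have := hb.left (by omega)
    rw [hlsl, hk] at this
    have h2 := slice_take (S := E.S) (p := p) (r := p + k) (q := p + (k + r)) (by omega) (by omega)
    rw [Nat.add_sub_cancel_left] at h2
    rwa [h2] at this
  have hbr : BisectionSubstring E.S (slice E.S (p + k) (p + k + r)) := by
    have := hb.right (by omega)
    rw [hlsl, hk] at this
    have h2 := slice_drop (S := E.S) (p := p) (r := p + k) (q := p + (k + r)) (by omega) (by omega)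
    rw [Nat.add_sub_cancel_left] at h2
    rwa [h2, ← Nat.add_assoc] at this
  -- All entries made while the halves were treated belong to shorter strings, whereas an entry
  -- under this key would be a variable for the whole string. So the key is still absent when the
  -- assignment is written.
  have hzero : ∀ {t s G}, MInv E t s G → Walk s a (flat wl) → Walk s b (flat wr) →
      (s.arr 4 (pairCode a b) ≠ 0 →
        ∃ u, Val G (s.arr 4 (pairCode a b) - 1) u ∧ u.length < k + r) →
      s.arr 4 (pairCode a b) = 0 := by
    intro t s G hm' ha hb' hf
    by_contra hne
    obtain ⟨u, hu, hul⟩ := hf hne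
    rw [hu.unique (hm'.lookup hq e13 ha hb' hne), hlsl] at hul
    omega
  refine ih k k2 e3 e15 e16 e17 (by omega) (by omega) hbl (by omega) (by omega) (by omega)
    fun t₂ s₂ G₂ hr₂ => ?_
  obtain ⟨G₁, rfl⟩ := hr₂.ext
  have z₂ : s₂.arr 4 (pairCode a b) = 0 := by
    refine hzero hr₂.inv (e11.mono hr₂.keeps.dict) (e12.mono hr₂.keeps.dict) fun hne => ?_
    obtain ⟨u, hu, hul⟩ := hr₂.fresh _ e14 hne
    exact ⟨u, hu, by omega⟩
  obtain ⟨c5, c6, c7, c7'⟩ := hr₂.keeps.stack (s.reg 7) (by omega)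
  have l2 := hr₂.size_lt
  have t2 := hr₂.time
  have le2 := hr₂.le
  have hG1 : G₁.length ≤ 2 * k - 1 := by
    simp only [List.length_append] at l2
    omega
  -- The number of new variables is bounded by the length of the half, so the times at which the
  -- recursion continues stay within the bound required of `T`.
  have hVG : E.callCost * G₁.length ≤ 2 * (E.callCost * k) - E.callCost := by
    refine (Nat.mul_le_mul_left _ hG1).trans ?_
    rw [Nat.mul_sub, Nat.mul_one, Nat.mul_left_comm]
  simp only [List.length_append, Nat.mul_add] at t2 l2
  refine wp_mainLoop_of_body (by rw [hr₂.mode]; omega) (by omega) (by rw [hr₂.mode]; omega)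
    fun _ => ?_
  refine wp_retProg_left (len := k + r) (p := p) (hr₂.inv.later (Nat.le_add_right t₂ 8)) (hr₂.sp.trans e6) (by omega) hl2 hq hr₂.val.lt_length
    (by rw [c5, e7]) (by rw [c6, e8]) (by rw [c7', e10]) ?_
  intro t₃ s₃ f1 f2 f3 f4 f5 f6 f7 f8 f9 f10 f11 f12
  rw [hk] at f10 f11
  rw [Nat.add_sub_cancel_left] at f11
  refine ih r (by omega) f3 f10 f11 f12 (by omega) (by omega) hbr (by omega)
    (by simp only [List.length_append]; omega) (by omega) fun t₄ s₄ G₄ hr₄ => ?_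
  obtain ⟨G₃, rfl⟩ := hr₄.ext
  have w₃ : ∀ {a l}, Walk s₁ a l → Walk s₄ a l := fun h =>
    (((h.mono hr₂.keeps.dict).mono fun k _ => f5 k).mono hr₄.keeps.dict)
  have z₄ : s₄.arr 4 (pairCode a b) = 0 := by
    refine hzero hr₄.inv (w₃ e11) (w₃ e12) fun hne => ?_
    obtain ⟨u, hu, hul⟩ := hr₄.fresh _ (by rw [f6, z₂]) hne
    exact ⟨u, hu, by omega⟩
  obtain ⟨b5, b6, b7, b7'⟩ := hr₄.keeps.stack (s.reg 7) (by omega)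
  have l4 := hr₄.size_lt
  have t4 := hr₄.time
  have le4 := hr₄.le
  have hG3 : G₃.length ≤ 2 * r - 1 := by
    simp only [List.length_append] at l4
    omega
  have hVG3 : E.callCost * G₃.length ≤ 2 * (E.callCost * r) - E.callCost := by
    refine (Nat.mul_le_mul_left _ hG3).trans ?_
    rw [Nat.mul_sub, Nat.mul_one, Nat.mul_left_comm]
  simp only [List.length_append, Nat.mul_add] at t4 l4
  refine wp_mainLoop_of_body (by rw [hr₄.mode]; omega) (by omega) (by rw [hr₄.mode]; omega)
    fun _ => ?_
  have v₂ := (hr₂.val.append (G' := G₃))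
  have v₄ := hr₄.val
  rw [Nat.add_assoc p k r] at v₄
  refine wp_retProg_right (len := k + r) (p := p) (sp := s.reg 7) (a := a) (b := b) (l := s₂.reg 10)
    (wl := wl) (wr := wr) (hr₄.inv.later (Nat.le_add_right t₄ 8)) (hr₄.sp.trans f7) (by omega) hl2 hq
    (by rw [b7, f8, c7, e9]) (by rw [b7', f9]) (w₃ e11) (w₃ e12) e13 z₄ (by rw [hk]; exact v₂)
    (by rw [hk]; exact v₄) hb (by simp only [List.length_append]; omega) (by omega) ?_
  intro t₅ s₅ g1 g2 g3 g4 g5 g6 g7 g8 g9 g10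
  have hd : ∀ k', s.arr 3 k' ≠ 0 → s₅.arr 3 k' = s.arr 3 k' := by
    intro k' h
    have := (((e4.trans hr₂.keeps (sp' := s₁.reg 7) (by omega)).trans f4 le_rfl).trans hr₄.keeps
      (by omega)).dict k' h
    rw [g7 3 (by simp), this]
  have hk4 := ((e4.trans hr₂.keeps (sp' := s₁.reg 7) (by omega)).trans f4 le_rfl).trans hr₄.keeps
      (by omega)
  refine hQ _ _ _ ⟨g3, ⟨hd, fun k' h => ?_, fun k' h => ?_⟩, g6, g5, by rw [g4]; exact g10,
    ⟨G₁ ++ (G₃ ++ [.pair (s₂.reg 10) (s₄.reg 10)]), by simp⟩, fun k' h0 h => ?_, Or.inr (by simp [g4]; omega), ?_,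
    by omega, ?_⟩
  · rw [g8, hk4.tab k' h]
    rintro rfl
    rw [e5] at e14
    exact h e14
  · rw [g7 5 (by simp), g7 6 (by simp), g7 7 (by simp), g7 7 (by simp)]
    exact hk4.stack k' h
  · by_cases hc : k' = pairCode a b
    · rw [hc, g9]
      exact ⟨_, g10, hlsl.le⟩
    · rw [g8 k' hc] at h ⊢
      by_cases h2 : s₂.arr 4 k' = 0
      · obtain ⟨u, hu, hul⟩ := hr₄.fresh k' (by rw [f6, h2]) h
        exact ⟨u, hu.append, by omega⟩
      · obtain ⟨u, hu, hul⟩ := hr₂.fresh k' (by rw [e5, h0]) h2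
        refine ⟨u, ?_, by omega⟩
        rw [hr₄.keeps.tab k' (by rwa [f6]), f6]
        exact hu.append.append
  · simp only [List.length_append, List.length_singleton]
    omega
  · simp only [List.length_append, List.length_singleton, Nat.mul_add, Nat.mul_one]
    omega

end

/-! ### The whole program -/

/-- Set up the registers. -/
def initProg : Prog :=
  block [
    .assign 37 (.const 5 * .reg 1),
    .assign 5 (.load (.const 5 * (.reg 2 - .reg 0) + .const 4)),
    .assign 3 (.reg 37 + .const 6 * .reg 5 + .const 8),
    .assign 22 (.reg 2),
    .loop (.bin .lt (.reg 0) (.reg 22 + .const 1))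
      (block [.assign 4 (.reg 4 + .const 1),
        .assign 22 (.load (.const 5 * (.reg 22 - .reg 0) + .const 1))]),
    .assign 6 (.const 44),
    .assign 22 (.reg 0 + .reg 5),
    .loop (.bin .lt (.const 1) (.reg 22))
      (block [.assign 22 (.bin .div (.reg 22) (.const 2)), .assign 6 (.reg 6 + .const 4)]),
    .assign 9 (.reg 5)]

/-- The program that computes the straight line program of Bisection. -/
def espToBisection : Prog :=
  block [initProg, mainLoop, .assign 0 (.reg 11), .assign 1 (.reg 37)]

section
variable {σ root : ℕ} {D : List (List ℕ)}

theorem length_flatMap_ruleWords (σ : ℕ) (D D' : List (List ℕ)) :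
    (D'.flatMap (ruleWords σ D)).length = 5 * D'.length := by
  induction D' with
  | nil => rfl
  | cons x l ih =>
    rw [List.flatMap_cons, List.length_append, ih, List.length_cons]
    simp [ruleWords]
    omega

theorem inputState_mem_rule {i k : ℕ} (hi : i < D.length) (hk : k < 5) :
    (inputState σ D root).mem (5 * i + k) = (ruleWords σ D (D.getD i [])).getD k 0 := by
  have key : ∀ (D' : List (List ℕ)) (i : ℕ), i < D'.length →
      (D'.flatMap (ruleWords σ D)).getD (5 * i + k) 0 = (ruleWords σ D (D'.getD i [])).getD k 0 := by
    intro D'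
    induction D' with
    | nil => intro i hi; simp at hi
    | cons x l ih =>
      intro i hi
      rw [List.flatMap_cons]
      have hx : (ruleWords σ D x).length = 5 := rfl
      rcases i with _ | i
      · rw [List.getD_append _ _ _ _ (by omega), Nat.mul_zero, Nat.zero_add, List.getD_cons_zero]
      · rw [List.getD_append_right _ _ _ _ (by omega), List.getD_cons_succ,
          ← ih i (by simpa using hi)]
        congr 1
        omega
  exact key D i hi

theorem inputState_mem_zero {a : ℕ} (ha : 5 * D.length ≤ a) : (inputState σ D root).mem a = 0 :=
  List.getD_eq_default _ _ (by rw [length_flatMap_ruleWords]; exact ha)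

variable {E : Env} {Q : ℕ → State → Prop}

/-- The height is found by following first children from the root down to a letter, and the
logarithm in `M` by repeated halving. `N` is read off as the length recorded with the root. -/
theorem wp_initProg (hX : E.X = 5 * E.D.length + 6 * E.S.length + 8)
    (hM : E.M = 44 + 4 * Nat.log 2 (E.σ + E.S.length))
    (hQ : ∀ t s, t ≤ 100 + 30 * E.h + 20 * E.M → MInv E t s [] → s.reg 7 = 0 → s.reg 8 = 0 →
      s.reg 9 = E.S.length → s.reg 13 = 0 → (∀ k, s.arr 4 k = 0) → Q t s) :
    initProg.wp E.w Q 0 (inputState E.σ E.D E.root) := by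
  have h1 := E.fits
  have hT := E.le_T
  have P := E.parse
  have hh := P.height_pos
  have hle := E.height_le
  have hr0 := P.mem_succ (i := E.h - 1) (X := E.root) (by omega)
    (by rw [Nat.sub_add_cancel hh, P.top]; exact List.mem_singleton_self _)
  have hN : (inputState E.σ E.D E.root).mem (5 * (E.root - E.σ) + 4) = E.S.length := by
    rw [inputState_mem_rule (by omega) (by omega)]
    have := P.length_derive_rule (i := E.h - 1) (X := E.root) (by omega)
      (by rw [Nat.sub_add_cancel hh, P.top]; exact List.mem_singleton_self _)
    have h2 := P.flatMap_str le_rfl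
    rw [P.top, List.flatMap_singleton] at h2
    rw [h2] at this
    exact this
  have i0 : (inputState E.σ E.D E.root).reg 0 = E.σ := rfl
  have i1 : (inputState E.σ E.D E.root).reg 1 = E.D.length := rfl
  have i2 : (inputState E.σ E.D E.root).reg 2 = E.root := rfl
  have ir : ∀ i, 3 ≤ i → (inputState E.σ E.D E.root).reg i = 0 := fun i hi =>
    List.getD_eq_default _ _ hi
  generalize hs0 : inputState E.σ E.D E.root = s₀ at *
  simp only [wp_simps, initProg, reduceIte, Nat.reduceEqDiff, i0, i1, i2, hN]
  refine ⟨by omega, by omega, by omega, ?_⟩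
  refine Prog.wp_loop (fun t s => ∃ i, i ≤ E.h ∧ t ≤ 60 + 30 * i ∧ s.mem = s₀.mem ∧
    s.reg 22 ∈ espLevel E.σ E.D E.S (E.h - i) ∧ s.reg 4 = i ∧ s.reg 37 = 5 * E.D.length ∧
    s.reg 5 = E.S.length ∧ s.reg 3 = E.X ∧
    ∀ j, j ∉ [37, 5, 3, 22, 4] → s.reg j = s₀.reg j) (60 + 30 * E.h) ?_ ?_ ?_
  · rintro t s ⟨i, e1, e2, -⟩
    omega
  · rintro t s ⟨i, e1, e2, e3, e4, e5, e6, e7, e8, e9⟩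
    have g0 := (e9 0 (by simp)).trans i0
    have hlt := P.symbol_lt (by omega) e4
    simp only [wp_simps, reduceIte, Nat.reduceEqDiff, g0, e5]
    refine ⟨by omega, fun hx => ⟨by omega, by omega, ?_⟩, fun hx => ⟨by omega, by omega, ?_⟩⟩
    · have hi : i < E.h := by
        by_contra hc
        rw [show E.h - i = 0 by omega, espLevel_zero] at e4
        have := P.lt _ e4
        omega
      have hmem : s.reg 22 ∈ espLevel E.σ E.D E.S (E.h - (i + 1) + 1) := by
        rwa [show E.h - (i + 1) + 1 = E.h - i by omega]
      have hlr := P.length_rule (by omega) hmem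
      have hv : s.mem (5 * (s.reg 22 - E.σ) + 1) = (rule E.σ E.D (s.reg 22)).getD 0 0 := by
        rw [e3, ← hs0, inputState_mem_rule (by omega) (by omega)]
        rfl
      refine ⟨i + 1, by omega, by omega, e3, ?_, by simp, by simpa using e6, by simpa using e7,
        by simpa using e8, fun j hj => ?_⟩
      · rw [hv]
        refine P.mem_of_mem_rule (by omega) hmem ?_
        rw [List.getD_eq_getElem _ _ (by omega)]
        exact List.getElem_mem _
      · simp at hj
        rw [if_neg (by omega), if_neg (by omega)]
        exact e9 j (by simp; omega)
    -- The descent has reached a letter, and only symbols of level zero are letters.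
    · have hi : i = E.h := by
        by_contra hc
        rw [show E.h - i = E.h - (i + 1) + 1 by omega] at e4
        have := P.mem_succ (by omega) e4
        omega
      subst hi
      simp only [e7]
      refine Prog.wp_loop (fun t s => ∃ i, t ≤ 80 + 30 * E.h + 20 * i ∧ s.mem = s₀.mem ∧
        s.reg 6 = 44 + 4 * i ∧ 1 ≤ s.reg 22 ∧ Nat.log 2 (s.reg 22) + i = Nat.log 2 (E.σ + E.S.length) ∧
        s.reg 22 ≤ E.σ + E.S.length ∧
        s.reg 4 = E.h ∧ s.reg 37 = 5 * E.D.length ∧ s.reg 5 = E.S.length ∧ s.reg 3 = E.X ∧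
        ∀ j, j ∉ [37, 5, 3, 22, 4, 6] → s.reg j = s₀.reg j)
        (80 + 30 * E.h + 20 * Nat.log 2 (E.σ + E.S.length)) ?_ ?_ ?_
      · rintro t s ⟨i, e2, -, -, -, e1, -⟩
        omega
      · rintro t s ⟨i, f1, f2, f3, f4, f5, f6, f7, f8, f9, f10, f11⟩
        simp only [wp_simps, reduceIte, Nat.reduceEqDiff, f3, f9]
        refine ⟨by omega, fun hx => ⟨by omega, by omega, i + 1, by omega, f2, by omega, ?_, ?_,
          ?_, f7, f8, f10, fun j hj => ?_⟩, fun hx => ?_⟩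
        · omega
        · have := Nat.log_div_base 2 (s.reg 22)
          have h2 := Nat.log_pos (b := 2) (by omega) hx
          omega
        · omega
        · simp at hj
          rw [if_neg (by omega), if_neg (by omega)]
          exact f11 j (by simp; omega)
        · obtain hx1 : s.reg 22 = 1 := by omega
          rw [hx1, Nat.log_one_right, Nat.zero_add] at f5
          have ha : ∀ r k, (s.setReg 9 E.S.length).arr r k = 0 := by
            intro r k
            show s.mem _ = 0
            rw [f2, ← hs0]
            exact inputState_mem_zero (by simp [f10]; omega)
          have g : ∀ j, j ∉ [37, 5, 3, 22, 4, 6, 9] →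
              (s.setReg 9 E.S.length).reg j = s₀.reg j := by
            intro j hj
            simp at hj
            rw [State.reg_setReg, if_neg (by omega)]
            exact f11 j (by simp; omega)
          refine hQ _ _ (by omega) ⟨⟨(g 0 (by simp)).trans i0, (g 2 (by simp)).trans i2, f10, f7, f9,
            ?_, fun i hi k hk => ?_⟩, f8, ?_, by simp, by simp, ?_,
            ⟨fun k => by simp [ha], fun k k' _ h => absurd (ha 3 k) h⟩, fun k h => absurd (ha 4 k) h,
            by simp, PartialSLP.nil _⟩ ?_ ?_ (by simp) ?_ (ha 4)
          · simp [f3]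
            omega
          · rw [State.mem_setReg, f2, ← hs0, inputState_mem_rule hi hk]
          · rw [g 11 (by simp), ir 11 (by omega)]
            rfl
          · rw [g 12 (by simp), ir 12 (by omega)]
            omega
          · rw [g 7 (by simp), ir 7 (by omega)]
          · rw [g 8 (by simp), ir 8 (by omega)]
          · rw [g 13 (by simp), ir 13 (by omega)]
      · refine ⟨0, by omega, e3, by simp, by simp; omega, by simp, by simp, by simpa using e5,
          by simpa using e6, by simpa using e7, by simpa using e8, fun j hj => ?_⟩
        simp at hj
        rw [State.reg_setReg, State.reg_setReg, if_neg (by omega), if_neg (by omega)]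
        exact e9 j (by simp; omega)
  · refine ⟨0, by omega, by omega, rfl, ?_, ?_, by simp, by simp, ?_, fun j hj => ?_⟩
    · simp [P.top]
    · simp [ir 4]
    · simp [hX]
    · simp at hj
      simp [hj]

/-- The set-up and the final return are absorbed by two further multiples of `callCost`, beyond the
one for the first visit and three for each variable; as there is at least one variable, the factor
five results. -/
theorem exists_exec_espToBisection (hX : E.X = 5 * E.D.length + 6 * E.S.length + 8)
    (hM : E.M = 44 + 4 * Nat.log 2 (E.σ + E.S.length))
    (hT : 100 + 30 * E.h + 20 * E.M + 6 * (E.callCost * E.S.length) + 40000 * (E.S.length + E.M) +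
      60001 ≤ E.T) :
    ∃ (t : ℕ) (s : State) (G : List SLPExpr),
      Exec E.w espToBisection (inputState E.σ E.D E.root) t s ∧ IsOutput s G ∧
      IsBisectionSLP G E.S ∧ t ≤ 5 * (E.callCost * G.length) := by
  have h1 := E.fits
  have h2 := E.parse.two_le
  have hV : E.callCost = (E.h + 2) * (E.levelCost + 100) + 5000 * E.h + 5000 +
    200 * Nat.log 2 E.S.length + 2000 := rfl
  have hL : E.levelCost = 1600 * E.M + 22000 * E.h + 5000 := rfl
  have hVL : E.levelCost + 100 ≤ (E.h + 2) * (E.levelCost + 100) :=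
    Nat.le_mul_of_pos_left _ (by omega)
  suffices h : espToBisection.wp E.w (fun t s => ∃ G, IsOutput s G ∧ IsBisectionSLP G E.S ∧
      t ≤ 5 * (E.callCost * G.length)) 0 (inputState E.σ E.D E.root) by
    obtain ⟨d, s, h3, G, h4, h5, h6⟩ := Prog.exec_of_wp h
    exact ⟨d, s, G, h3, h4, h5, by omega⟩
  simp only [espToBisection, wp_block_cons]
  refine wp_initProg hX hM fun t s e1 e2 e3 e4 e5 e6 e7 => ?_
  refine wp_mainLoop_call e2 e4 e5 e6 (by omega) (by omega)
    (by rw [Nat.zero_add, slice_self]; exact .self) (by omega) (by simp) (by omega)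
    fun t₁ s₁ G hr => ?_
  have hv := hr.val
  rw [Nat.zero_add, slice_self] at hv
  -- The output format requires the variable for `S` to be the last one. It is, because the program
  -- was empty before the first visit, so the visit added its variable last.
  have hlast : s₁.reg 10 + 1 = G.length := by
    rcases hr.last with rfl | h
    · have := hv.lt_length
      simp at this
    · exact h
  have htime := hr.time
  have hVG : E.callCost ≤ E.callCost * G.length := Nat.le_mul_of_pos_right _ (by omega)
  have h7 : s₁.reg 7 = 0 := hr.sp.trans e3
  simp only [List.length_nil, Nat.mul_zero] at htime
  refine wp_mainLoop_of_body (by rw [hr.mode]; omega) (by omega) (by rw [hr.mode]; omega)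
    fun _ => ?_
  simp only [wp_simps, retProg, h7, not_true, IsEmpty.forall_iff, forall_true_left]
  refine ⟨by omega, by omega, ?_⟩
  refine Prog.wp_loop_exit ⟨trivial, by show 2 < 2 ^ E.w; omega, trivial⟩ ?_ ?_
  · simp
  simp only [wp_simps]
  have hout := hr.inv.out
  refine ⟨G, ⟨?_, fun k hk => ?_⟩, hr.inv.isBisectionSLP ?_, by omega⟩
  · simp [hr.inv.size]
  · simp [hr.inv.base, hout k hk]
  · rw [← hlast]
    exact hv

end

/-! ### Numerical bounds for the time and the word length -/

theorem log_add_le {σ N κ : ℕ} (hN : 2 ≤ N) (hσ : σ ≤ N ^ κ) :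
    Nat.log 2 (σ + N) ≤ 2 * (κ + 1) * Nat.log 2 N := by
  have h1 : N < 2 ^ (Nat.log 2 N + 1) := Nat.lt_pow_succ_log_self (by omega) N
  have hL : 1 ≤ Nat.log 2 N := Nat.log_pos (by omega) hN
  generalize Nat.log 2 N = L at *
  have h2 : σ ≤ 2 ^ ((L + 1) * (κ + 1)) := by
    refine hσ.trans ((Nat.pow_le_pow_left h1.le κ).trans ?_)
    rw [← pow_mul]
    exact Nat.pow_le_pow_right (by omega) (Nat.mul_le_mul_left _ (by omega))
  have h3 : 2 ^ (L + 1) ≤ 2 ^ ((L + 1) * (κ + 1)) :=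
    Nat.pow_le_pow_right (by omega) (Nat.le_mul_of_pos_right _ (by omega))
  have h4 : Nat.log 2 (σ + N) < (L + 1) * (κ + 1) + 1 := by
    refine Nat.log_lt_of_lt_pow (by omega) ?_
    rw [pow_succ]
    omega
  have h5 : (L + 1) * (κ + 1) ≤ 2 * L * (κ + 1) := Nat.mul_le_mul_right _ (by omega)
  have h6 : 2 * L * (κ + 1) = 2 * (κ + 1) * L := by ring
  omega

/-- A bound for the time spent with one interval, for a parse of height `h`. -/
def callBound (L h M : ℕ) : ℕ :=
  (h + 2) * ((1600 * M + 22000 * h + 5000) + 100) + 5000 * h + 5000 + 200 * L + 2000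

/-- The product of the number of levels and the cost of one level is quadratic in `L`, since both
`h` and `M` are linear in it. The other terms are linear. -/
theorem callBound_le {L h M κ : ℕ} (hL : 1 ≤ L) (hh : h ≤ L) (hM : M ≤ (52 + 8 * κ) * L) :
    callBound L h M ≤ 40000 * (κ + 9) * L ^ 2 := by
  have h1 : (h + 2) * ((1600 * M + 22000 * h + 5000) + 100) ≤
      (3 * L) * ((1600 * (52 + 8 * κ) + 27100) * L) := by
    refine Nat.mul_le_mul (by omega) ?_
    nlinarith
  have h2 : L ≤ L ^ 2 := Nat.le_self_pow (by omega) L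
  unfold callBound
  nlinarith [Nat.zero_le (κ * L ^ 2)]

/-- Every term is at most a constant times `N ^ (κ + 3)`, where the constants add up to at most `2 ^
(κ + 23) ≤ N ^ (κ + 23)`. Squaring, and bounding `100` by `N ^ 7`, gives the exponent `7 + 2 * (2 *
κ + 26)`. -/
theorem time_bound {L h M N σ n κ : ℕ} (hL : 1 ≤ L) (hh : h ≤ L) (hM : M ≤ (52 + 8 * κ) * L)
    (hLN : L ≤ N) (hn : n ≤ N) (hN : 2 ≤ N) (hσ : σ ≤ N ^ κ) :
    100 * (100 + 30 * h + 20 * M + 6 * (callBound L h M * N) + 40000 * (N + M) + 60001 +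
      (5 * n + 6 * N + 8 + 10 * (σ + N) + M + 100)) ^ 2 ≤ N ^ (4 * κ + 59) := by
  have hZ1 : N ^ κ ≤ N ^ (κ + 3) := Nat.pow_le_pow_right (by omega) (by omega)
  have hZ3 : N ^ 3 ≤ N ^ (κ + 3) := Nat.pow_le_pow_right (by omega) (by omega)
  have hZN : N ≤ N ^ (κ + 3) := Nat.le_self_pow (by omega) N
  have hV : callBound L h M * N ≤ 40000 * (κ + 9) * N ^ (κ + 3) := by
    calc callBound L h M * N ≤ 40000 * (κ + 9) * N ^ 2 * N := by
          refine Nat.mul_le_mul_right _ ((callBound_le hL hh hM).trans ?_)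
          exact Nat.mul_le_mul_left _ (Nat.pow_le_pow_left hLN 2)
      _ = 40000 * (κ + 9) * N ^ 3 := by ring
      _ ≤ _ := Nat.mul_le_mul_left _ hZ3
  have hM' : M ≤ (52 + 8 * κ) * N ^ (κ + 3) :=
    hM.trans (Nat.mul_le_mul_left _ (hLN.trans hZN))
  have hZ2 : 2 ^ (κ + 23) ≤ N ^ (κ + 23) := Nat.pow_le_pow_left hN _
  have hκ : κ + 1 ≤ 2 ^ κ := Nat.lt_two_pow_self
  have hsum : 100 + 30 * h + 20 * M + 6 * (callBound L h M * N) + 40000 * (N + M) + 60001 +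
      (5 * n + 6 * N + 8 + 10 * (σ + N) + M + 100) ≤ 2 ^ (κ + 23) * N ^ (κ + 3) := by
    generalize N ^ (κ + 3) = Z at *
    have h1 : (600000 * κ + 5000000) * Z ≤ 2 ^ (κ + 23) * Z := by
      refine Nat.mul_le_mul_right _ ?_
      rw [pow_add]
      omega
    refine le_trans ?_ h1
    have h2 : 40000 * (κ + 9) * Z = 40000 * (κ * Z) + 360000 * Z := by ring
    have h3 : (52 + 8 * κ) * Z = 52 * Z + 8 * (κ * Z) := by ring
    have h4 : (600000 * κ + 5000000) * Z = 600000 * (κ * Z) + 5000000 * Z := by ring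
    generalize callBound L h M * N = W at *
    generalize κ * Z = Y at *
    omega
  calc _ ≤ 2 ^ 7 * (2 ^ (κ + 23) * N ^ (κ + 3)) ^ 2 :=
        Nat.mul_le_mul (by norm_num) (Nat.pow_le_pow_left hsum 2)
    _ ≤ N ^ 7 * (N ^ (κ + 23) * N ^ (κ + 3)) ^ 2 :=
        Nat.mul_le_mul (Nat.pow_le_pow_left hN 7)
          (Nat.pow_le_pow_left (Nat.mul_le_mul_right _ hZ2) 2)
    _ = N ^ (4 * κ + 59) := by
        rw [← pow_add, ← pow_mul, ← pow_add]
        congr 1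
        ring

end ESPBisection

theorem theorem27 :
    ∃ P : ESPBisection.Prog, ∀ κ : ℕ, ∃ c C : ℕ,
      ∀ (σ w root : ℕ) (S : List ℕ) (D : List (List ℕ)),
        2 ≤ S.length → (∀ a ∈ S, a < σ) → σ ≤ S.length ^ κ →
        ESPBisection.IsESP σ S D root →
        S.length ^ c ≤ 2 ^ w →
        ∃ (t : ℕ) (s : ESPBisection.State) (G : List ESPBisection.SLPExpr),
          ESPBisection.Exec w P (ESPBisection.inputState σ D root) t s ∧
          ESPBisection.IsOutput s G ∧
          ESPBisection.IsBisectionSLP G S ∧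
          (t : ℝ) ≤ C * G.length * (Real.logb 2 S.length) ^ 2 := by
  -- The word length exponent is that of `time_bound`. The constant `200000 * (κ + 9)` is five times
  -- the one in `callBound_le`, the five being that of `exists_exec_espToBisection`.
  refine ⟨ESPBisection.espToBisection, fun κ => ⟨4 * κ + 59, 200000 * (κ + 9), ?_⟩⟩
  intro σ w root S D hN hlt hσ hD hw
  obtain ⟨hnd, h, htop, hlen, hmem⟩ := hD
  have P : ESPBisection.Parse σ S D root h := ⟨hN, hlt, hnd, htop, hlen, hmem⟩
  have hL : 1 ≤ Nat.log 2 S.length := Nat.log_pos (by omega) hN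
  have hh : h ≤ Nat.log 2 S.length := Nat.le_log_of_pow_le (by omega) P.two_pow_le
  have hLN : Nat.log 2 S.length < S.length := Nat.log_lt_self _ (by omega)
  have hn := P.card_lt
  have hb := ESPBisection.log_add_le hN hσ
  have hlog : ∀ n, ESPBisection.logStar n ≤ Nat.log 2 n + 2 := fun n =>
    ESPBisection.logStar_le_of_lt_two_pow (Nat.lt_pow_succ_log_self (by omega) n)
  have hlm : Nat.log 2 S.length ≤ Nat.log 2 (σ + S.length) := Nat.log_mono_right (by omega)
  have hM : 44 + 4 * Nat.log 2 (σ + S.length) ≤ (52 + 8 * κ) * Nat.log 2 S.length := by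
    nlinarith
  have hl1 := hlog S.length
  have hl2 := hlog (σ + S.length)
  have hT := (ESPBisection.time_bound hL hh hM hLN.le (n := D.length) (by omega) hN hσ).trans hw
  -- The bound `T` is left to unification with `hT`: it is the sum of the time needed and of the
  -- lower bound demanded by `Env.le_T`, so both requirements hold trivially.
  obtain ⟨t, s, G, h1, h2, h3, h4⟩ := ESPBisection.exists_exec_espToBisection
    (E := ⟨σ, S, D, root, h, w, 44 + 4 * Nat.log 2 (σ + S.length),
      5 * D.length + 6 * S.length + 8, _, P, by omega, by omega, by omega, Nat.le_add_left _ _, hT⟩)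
    rfl rfl (Nat.le_add_right _ _)
  refine ⟨t, s, G, h1, h2, h3, ?_⟩
  have h5 : t ≤ 200000 * (κ + 9) * G.length * Nat.log 2 S.length ^ 2 := by
    refine h4.trans ?_
    have := Nat.mul_le_mul_right (5 * G.length) (ESPBisection.callBound_le hL hh hM)
    refine le_trans (le_of_eq ?_) (this.trans (le_of_eq ?_))
    · exact Nat.mul_left_comm _ _ _
    · ring
  have h6 : (Nat.log 2 S.length : ℝ) ≤ Real.logb 2 S.length := by
    have := Real.natLog_le_logb S.length 2
    exact_mod_cast this
  calc (t : ℝ) ≤ ((200000 * (κ + 9) * G.length * Nat.log 2 S.length ^ 2 : ℕ) : ℝ) := by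
        exact_mod_cast h5
    _ = ((200000 * (κ + 9) : ℕ) : ℝ) * G.length * (Nat.log 2 S.length : ℝ) ^ 2 := by push_cast; ring
    _ ≤ _ := by gcongr
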